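/- Let $N\ge 2$ be an integer. Consider the problem $$u''+\frac{N-1}{r}u'+f(u)=0\quad (r>0),\qquad u'(0)=0,\qquad \lim_{r\to\infty}u(r)=0, \tag{P}$$ whose solutions are $C^2$ functions $u$ on $[0,\infty)$ with values in the interval on which $f$ is defined. Write $F(s)=\int_0^s f(t)\,dt$ and $Q(s)=2NF(s)-(N-2)sf(s)$. Let $-\infty\le\gamma_*^-<0<\gamma_*\le\infty$, and assume that $f$ satisfies (A1) or (A2): **(A1)** ($\gamma_*<\infty$) $f$ is continuous on $(\gamma_*^-,\gamma_*]$, locally Lipschitz on $(\gamma_*^-,\gamma_*]\setminus\{0\}$, $f(0)=f(\gamma_*)=0$; and there is $\delta>0$ such that $F(s)<0$ for $0<|s|<\delta$; $\lim_{s\to\gamma_*^-}F(s)=F(\gamma_*)$ and $F(s)<F(\gamma_*)$ for $s\in(\gamma_*^-,\gamma_*)$; $F$ has a local maximum at some $\gamma\in(\delta,\gamma_*)$ with $F(\gamma)>0$; $f$ has finitely many zeros in $(\gamma_*^-,-\delta)\cup(\delta,\gamma_*)$ and changes sign at each of them. **(A2)** ($\gamma_*=\infty$) $f$ is continuous on $(\gamma_*^-,\infty)$,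 locally Lipschitz on $(\gamma_*^-,\infty)\setminus\{0\}$, $f(0)=0$; and there is $\delta>0$ such that $F(s)<0$ for $0<|s|<\delta$; $F(s)<\lim_{t\to\infty}F(t)=\lim_{t\to\gamma_*^-}F(t)\in(-\infty,\infty]$ for all $s$; $F$ has a local maximum at some $\gamma\in(\delta,\infty)$ with $F(\gamma)>0$; $f$ has finitely many zeros in $(\gamma_*^-,-\delta)\cup(\delta,\infty)$ and changes sign at each of them; moreover there are $s_0\in(\gamma_*^-,0)$ with $Q>0$ on $(\gamma_*^-,s_0)$ and $\theta\in(0,1)$ with $$\lim_{s\to\infty}\ \inf_{s_1,s_2\in[\theta s,s]}Q(s_2)\Bigl(\frac{s}{f(s_1)}\Bigr)^{N/2}=\infty .$$ Put $\gamma_0=0$. For $i\ge 0$ let $\gamma_{i+1}$ be the first local maximum point of $F$ in $(\gamma_i,\gamma_*)$ with $F(\gamma_{i+1})>F(\gamma_i)$, and let $\gamma_M$ be the last point so obtained. Likewise, for $i\le 0$ let $\gamma_{i-1}$ be the first local maximum point of $F$ to the left of $\gamma_i$ in $(\gamma_*^-,\gamma_i)$ with $F(\gamma_{i-1})>F(\gamma_i)$,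 and let $\gamma_{\bar M}$ be the last one ($\bar M=0$ if there is none). Let $\beta_1$ be the largest point of $(0,\gamma_1)$ with $F(\beta_1)=0$, let $\beta_*$ be the largest point of $(\gamma_M,\gamma_*)$ with $F(\beta_*)=F(\gamma_M)$, and let $\beta_*^-$ be the smallest point of $(\gamma_*^-,\gamma_{\bar M})$ with $F(\beta_*^-)=F(\gamma_{\bar M})$. Let $\bar\beta\in(\beta_*,\gamma_*)$ be any point with $F(\bar\beta)>F(\beta_*^-)$ and, under (A2), such that in addition $Q(s)>0$ for all $s$ with $F(s)>F(\bar\beta)$. Set $$\bar F=-\min_{[0,\beta_1]}F,\qquad \bar C=2(N-1)\frac{\bar\beta-\beta_1}{F(\bar\beta)-F(\gamma_M)}\Bigl(2\bigl(F(\bar\beta)-\min_{[\beta_1,\beta_*]}F\bigr)\Bigr)^{1/2},$$ $$A_0=\frac{\beta_*-\beta_1}{(F(\bar\beta)-F(\gamma_M))^{1/2}}+\Bigl(\frac{2N(\bar\beta-\beta_*)}{\min_{[\beta_*,\bar\beta]}f}\Bigr)^{1/2}.$$ Under (A1) let $A=A_0$ and $\bar I=F(\gamma_*)$. Under (A2)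 let $A=\max\{1,A_0\}$ and $$\bar I=\Bigl(\frac{\bar C+1}{\bar C}\Bigr)^N\Bigl(2F(\bar\beta)+(\bar\beta-\beta_1)^2+\frac1N\Bigl(\sup_{[\beta_1,\bar\beta]}Q-\min_{[s_0,\bar\beta]}Q\Bigr)\Bigr)+\frac{(N-2)^2\bar\beta^2}{2\bar C^2}.$$ **Theorem.** If $f$ satisfies (A1) or (A2) and $$(\bar C+A)\,\bar I<\frac{2^{1/2}(N-1)}{(\bar I+\bar F)^{1/2}}\int_0^{\beta_1}|F(s)|\,ds,$$ then for every integer $k\ge 0$ there exist at least two solutions $u$ of (P) with $u(0)\in(\beta_*,\gamma_*)$ that have exactly $k$ sign changes in $(0,\infty)$. -/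

import Mathlib

open Set Filter Topology

noncomputable section

namespace BoundState

/-! The nonlinearity is a function `f : ℝ → ℝ` of which only the values on the interval
`(γm, γs]` (or `(γm, ∞)` when `γs = ⊤`) matter. -/

/-- The interval on which the nonlinearity lives: `(γm, γs]` if `γs` is finite, and `(γm, ∞)` if
`γs = ⊤`. -/
def dom (γm γs : EReal) : Set ℝ := {s : ℝ | γm < (s : EReal) ∧ (s : EReal) ≤ γs}

/-- The filter "`s → γm` from the right" on `ℝ`; for `γm = ⊥` it is `s → -∞`. -/
def toLeftEnd (γm : EReal) : Filter ℝ := comap ((↑) : ℝ → EReal) (𝓝[>] γm)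

/-- The primitive `F(s) = ∫_0^s f(t) dt`. -/
def F (f : ℝ → ℝ) (s : ℝ) : ℝ := ∫ t in (0 : ℝ)..s, f t

/-- `Q(s) = 2 N F(s) - (N - 2) s f(s)`. -/
def Q (N : ℕ) (f : ℝ → ℝ) (s : ℝ) : ℝ := 2 * (N : ℝ) * F f s - ((N : ℝ) - 2) * s * f s

/-- `f` has opposite strict signs immediately to the left and immediately to the right of `z`. -/
def ChangesSignAt (f : ℝ → ℝ) (z : ℝ) : Prop :=
  ∃ ε > 0, ∀ s ∈ Ioo (z - ε) z, ∀ t ∈ Ioo z (z + ε), f s * f t < 0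

/-- The points of `(γm, -δ) ∪ (δ, γs)` at which `f` vanishes. -/
def farZeros (f : ℝ → ℝ) (γm γs : EReal) (δ : ℝ) : Set ℝ :=
  {z : ℝ | ((γm < (z : EReal) ∧ z < -δ) ∨ (δ < z ∧ (z : EReal) < γs)) ∧ f z = 0}

/-- The hypotheses in the finite case `γs < ∞`. -/
structure AssumptionA1 (f : ℝ → ℝ) (γm : EReal) (γs δ : ℝ) : Prop where
  left_neg : γm < 0
  right_pos : 0 < γs
  cont : ContinuousOn f (dom γm γs)
  zero_zero : f 0 = 0
  zero_right : f γs = 0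
  lip : LocallyLipschitzOn (dom γm γs \ {0}) f
  delta_pos : 0 < δ
  F_neg : ∀ s ∈ dom γm γs, 0 < |s| → |s| < δ → F f s < 0
  F_lim : Tendsto (F f) (toLeftEnd γm) (𝓝 (F f γs))
  F_lt : ∀ s : ℝ, γm < (s : EReal) → s < γs → F f s < F f γs
  exists_max : ∃ γ : ℝ, δ < γ ∧ γ < γs ∧ IsLocalMax (F f) γ ∧ 0 < F f γ
  zeros_finite : (farZeros f γm γs δ).Finite
  zeros_sign : ∀ z ∈ farZeros f γm γs δ, ChangesSignAt f z

/-- The hypotheses in the infinite case `γs = ∞`. The common limit `L` of `F` at both ends may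
be `+∞`. The field `growth` says that
`inf_{s₁, s₂ ∈ [θ s, s]} Q(s₂) (s / f(s₁))^{N/2} → ∞` as `s → ∞`. -/
structure AssumptionA2 (N : ℕ) (f : ℝ → ℝ) (γm : EReal) (δ s₀ : ℝ) : Prop where
  left_neg : γm < 0
  cont : ContinuousOn f (dom γm ⊤)
  zero_zero : f 0 = 0
  lip : LocallyLipschitzOn (dom γm ⊤ \ {0}) f
  delta_pos : 0 < δ
  F_neg : ∀ s ∈ dom γm ⊤, 0 < |s| → |s| < δ → F f s < 0
  F_lim : ∃ L : EReal, Tendsto (fun s : ℝ => (F f s : EReal)) atTop (𝓝 L) ∧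
    Tendsto (fun s : ℝ => (F f s : EReal)) (toLeftEnd γm) (𝓝 L) ∧
    ∀ s ∈ dom γm ⊤, (F f s : EReal) < L
  exists_max : ∃ γ : ℝ, δ < γ ∧ IsLocalMax (F f) γ ∧ 0 < F f γ
  zeros_finite : (farZeros f γm ⊤ δ).Finite
  zeros_sign : ∀ z ∈ farZeros f γm ⊤ δ, ChangesSignAt f z
  s₀_mem : γm < (s₀ : EReal) ∧ s₀ < 0
  Q_pos : ∀ s : ℝ, γm < (s : EReal) → s < s₀ → 0 < Q N f s
  growth : ∃ θ ∈ Ioo (0 : ℝ) 1, ∀ C : ℝ, ∀ᶠ s : ℝ in atTop,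
    ∀ s₁ ∈ Icc (θ * s) s, ∀ s₂ ∈ Icc (θ * s) s,
      C ≤ Q N f s₂ * (s / f s₁) ^ ((N : ℝ) / 2)

/-! ### The special points of `F` -/

/-- The local maximum points of `F` in `(x, γs)` at which `F` exceeds `F x`. -/
def higherMaxRight (f : ℝ → ℝ) (γs : EReal) (x : ℝ) : Set ℝ :=
  {s : ℝ | x < s ∧ (s : EReal) < γs ∧ IsLocalMax (F f) s ∧ F f x < F f s}

/-- The local maximum points of `F` in `(γm, x)` at which `F` exceeds `F x`. -/
def higherMaxLeft (f : ℝ → ℝ) (γm : EReal) (x : ℝ) : Set ℝ :=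
  {s : ℝ | γm < (s : EReal) ∧ s < x ∧ IsLocalMax (F f) s ∧ F f x < F f s}

/-- `γ_0 = 0`, and `γ_{i+1}` is the first local maximum point of `F` after `γ_i` with
`F(γ_i) < F(γ_{i+1})`. -/
def gammaPos (f : ℝ → ℝ) (γs : EReal) : ℕ → ℝ
  | 0 => 0
  | i + 1 => sInf (higherMaxRight f γs (gammaPos f γs i))

/-- `gammaNeg f γm i` is `γ_{-i}`: `γ_0 = 0`, and `γ_{-(i+1)}` is the first local maximum point
of `F` to the left of `γ_{-i}` with `F(γ_{-i}) < F(γ_{-(i+1)})`. -/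
def gammaNeg (f : ℝ → ℝ) (γm : EReal) : ℕ → ℝ
  | 0 => 0
  | i + 1 => sSup (higherMaxLeft f γm (gammaNeg f γm i))

/-- The index `M` of the last `γ_i` on the right. -/
def lastPos (f : ℝ → ℝ) (γs : EReal) : ℕ :=
  sInf {i : ℕ | higherMaxRight f γs (gammaPos f γs i) = ∅}

/-- The index of the last `γ_{-i}` on the left; it is `0` if there is no negative local
maximum point with `F > 0`. -/
def lastNeg (f : ℝ → ℝ) (γm : EReal) : ℕ :=
  sInf {i : ℕ | higherMaxLeft f γm (gammaNeg f γm i) = ∅}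

/-- `γ_M`. -/
def gammaM (f : ℝ → ℝ) (γs : EReal) : ℝ := gammaPos f γs (lastPos f γs)

/-- The last `γ_i` on the left (`γ_0 = 0` if there is none with `i < 0`). -/
def gammaMbar (f : ℝ → ℝ) (γm : EReal) : ℝ := gammaNeg f γm (lastNeg f γm)

/-- `β_1`, the largest point of `(γ_0, γ_1)` with `F(β_1) = F(γ_0)`. -/
def beta1 (f : ℝ → ℝ) (γs : EReal) : ℝ :=
  sSup {s : ℝ | s ∈ Ioo (gammaPos f γs 0) (gammaPos f γs 1) ∧ F f s = F f (gammaPos f γs 0)}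

/-- `β_*`, the largest point of `(γ_M, γs)` with `F(β_*) = F(γ_M)`. -/
def betaStar (f : ℝ → ℝ) (γs : EReal) : ℝ :=
  sSup {s : ℝ | gammaM f γs < s ∧ (s : EReal) < γs ∧ F f s = F f (gammaM f γs)}

/-- `β_*^-`, the smallest point of `(γm, γ_{M̄})` with `F(β_*^-) = F(γ_{M̄})`. -/
def betaStarNeg (f : ℝ → ℝ) (γm : EReal) : ℝ :=
  sInf {s : ℝ | γm < (s : EReal) ∧ s < gammaMbar f γm ∧ F f s = F f (gammaMbar f γm)}

/-- `b` is an admissible choice of `β̄` in the finite case. -/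
def IsBarBetaA1 (f : ℝ → ℝ) (γm : EReal) (γs b : ℝ) : Prop :=
  betaStar f γs < b ∧ b < γs ∧ F f (betaStarNeg f γm) < F f b

/-- `b` is an admissible choice of `β̄` in the infinite case. -/
def IsBarBetaA2 (N : ℕ) (f : ℝ → ℝ) (γm : EReal) (b : ℝ) : Prop :=
  betaStar f ⊤ < b ∧ F f (betaStarNeg f γm) < F f b ∧
    ∀ s ∈ dom γm ⊤, F f b < F f s → 0 < Q N f s

/-! ### The constants in the explicit inequality -/

/-- `F̄ = - min_{[0, β_1]} F`. -/
def Fbar (f : ℝ → ℝ) (γs : EReal) : ℝ := -sInf (F f '' Icc 0 (beta1 f γs))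

/-- `C̄`. -/
def Cbar (N : ℕ) (f : ℝ → ℝ) (γs : EReal) (b : ℝ) : ℝ :=
  2 * ((N : ℝ) - 1) * ((b - beta1 f γs) / (F f b - F f (gammaM f γs))) *
    √(2 * (F f b - sInf (F f '' Icc (beta1 f γs) (betaStar f γs))))

/-- `A` in the finite case. -/
def constA1 (N : ℕ) (f : ℝ → ℝ) (γs : EReal) (b : ℝ) : ℝ :=
  (betaStar f γs - beta1 f γs) / √(F f b - F f (gammaM f γs)) +
    √(2 * (N : ℝ) * (b - betaStar f γs) / sInf (f '' Icc (betaStar f γs) b))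

/-- `A` in the infinite case. -/
def constA2 (N : ℕ) (f : ℝ → ℝ) (b : ℝ) : ℝ := max 1 (constA1 N f ⊤ b)

/-- `Ī` in the finite case. -/
def IbarA1 (f : ℝ → ℝ) (γs : ℝ) : ℝ := F f γs

/-- `Ī` in the infinite case. -/
def IbarA2 (N : ℕ) (f : ℝ → ℝ) (s₀ b : ℝ) : ℝ :=
  ((Cbar N f ⊤ b + 1) / Cbar N f ⊤ b) ^ N *
      (2 * F f b + (b - beta1 f ⊤) ^ 2 +
        1 / (N : ℝ) * (sSup (Q N f '' Icc (beta1 f ⊤) b) - sInf (Q N f '' Icc s₀ b))) +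
    ((N : ℝ) - 2) ^ 2 * b ^ 2 / (2 * Cbar N f ⊤ b ^ 2)

/-- The inequality `(C̄ + A) Ī < 2^{1/2} (N - 1) (Ī + F̄)^{-1/2} ∫_0^{β_1} |F(s)| ds`, for given
values of `A` and `Ī`. -/
def KeyInequality (N : ℕ) (f : ℝ → ℝ) (γs : EReal) (b A I : ℝ) : Prop :=
  (Cbar N f γs b + A) * I <
    √2 * ((N : ℝ) - 1) / √(I + Fbar f γs) * ∫ s in (0 : ℝ)..(beta1 f γs), |F f s|

/-! ### Solutions and their sign changes -/

/-- `u`, restricted to `[0, ∞)`, is a `C²` solution of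
`u'' + (N-1)/r u' + f(u) = 0` for `r > 0`, `u'(0) = 0`, `u(r) → 0` as `r → ∞`,
with values in the interval where the nonlinearity is defined. -/
structure IsSolution (N : ℕ) (f : ℝ → ℝ) (γm γs : EReal) (u : ℝ → ℝ) : Prop where
  smooth : ContDiffOn ℝ 2 u (Ici 0)
  mem_dom : ∀ r : ℝ, 0 ≤ r → u r ∈ dom γm γs
  ode : ∀ r : ℝ, 0 < r → deriv (deriv u) r + ((N : ℝ) - 1) / r * deriv u r + f (u r) = 0
  deriv_zero : derivWithin u (Ici 0) 0 = 0
  lim : Tendsto u atTop (𝓝 0)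

/-- There are points `0 < r_0 < ... < r_n` at which `u` takes values of alternating strict sign,
that is, `u` changes sign at least `n` times in `(0, ∞)`. -/
def SignChangesAtLeast (u : ℝ → ℝ) (n : ℕ) : Prop :=
  ∃ r : Fin (n + 1) → ℝ, StrictMono r ∧ (∀ i, 0 < r i) ∧
    ∀ i : Fin n, u (r i.castSucc) * u (r i.succ) < 0

/-- `u` changes sign exactly `k` times in `(0, ∞)`. -/
def SignChangesExactly (u : ℝ → ℝ) (k : ℕ) : Prop :=
  SignChangesAtLeast u k ∧ ¬ SignChangesAtLeast u (k + 1)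

/-- `u` is a solution with initial value in `(β_*, γs)` and exactly `k` sign changes. -/
def IsNodalSolution (N : ℕ) (f : ℝ → ℝ) (γm γs : EReal) (k : ℕ) (u : ℝ → ℝ) : Prop :=
  IsSolution N f γm γs u ∧ betaStar f γs < u 0 ∧ (u 0 : EReal) < γs ∧ SignChangesExactly u k

/-- There are two such solutions that differ somewhere on `[0, ∞)`. -/
def AtLeastTwoNodalSolutions (N : ℕ) (f : ℝ → ℝ) (γm γs : EReal) (k : ℕ) : Prop :=
  ∃ u v : ℝ → ℝ, IsNodalSolution N f γm γs k u ∧ IsNodalSolution N f γm γs k v ∧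
    ∃ r : ℝ, 0 ≤ r ∧ u r ≠ v r

end BoundState

end

namespace BoundState

/-! ### Trajectories, energy and reflection -/

/-! The proof is a shooting argument in the initial value. Along a trajectory the energy `E = v²/2 +
F(u)` decreases at the rate `(N-1)v²/r`, so a point where `F` exceeds the current energy is a
barrier. Around zero there are two wells of `F`: the right one ends at `β₁`, where `F` returns to
the value zero and then increases up to some `X`; the left one is its mirror image, with barrier
`-X₂`. A trajectory is `Good` for `k` if it has at most `k` sign changes and, inside the zone `(-X₂,
X)`, its energy falls below every positive number.

Goodness is a closed condition on the initial value (`Family.good_of_frequently`): friction is weak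
at late times, so a trajectory that still has energy late and loses it afterwards in the zone must
oscillate many times (`exists_many_sign_changes`). Goodness is also stable near a good trajectory
that reaches negative energy, or that converges to an interior point of a well. If a good trajectory
tends to zero with fewer than `k` sign changes, its neighbours are trapped near zero and gain at
most one more, so they are good too. Hence at a boundary parameter the trajectory tends to zero with
exactly `k` sign changes, or it converges to the edge `β₁` or its left counterpart
(`Family.boundary`).

The edge limit is impossible when the parameters beyond are not good (`Family.not_edge`). Those
trajectories make an excursion above `β = β₁` and come back with `r E` bounded below. At the time
`S` maximising `r^(N-1)(u - β)` one has `u = β + y`, and two estimates, for `f(β + y)` against `y/S`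
and for `S F(β + y)` from below, combine to `f(β + y) ≤ C F(β + y)`. By continuity every small `y >
0` occurs, and Gronwall's inequality gives `F ≤ 0` to the right of `β`, a contradiction.

The explicit inequality provides a good starting point `α`. Some trajectory enters the well before
time `C̄ + A` with energy at most `Ī`, and comparing `r^(2N-2) E` with a primitive of `F` shows that
it stays positive and does not tend to zero (`Traj.stays_positive`), so it is good for all `k`.
Initial values slightly above `β_*` are not good, since the trajectory remains to the right of
`γ_M`. Initial values near the right end are not good either, since there the energy is still at
least `F(γ_M)` at arbitrarily late times: under (A1) because the trajectory lingers near the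
equilibrium `γ_*`, under (A2) by Pohozaev's functional. On each side of `α` there is thus a boundary
parameter, and the two differ because `α` itself does not give a solution.

As `f` is only continuous at zero, trajectories come from a compactness argument and are continued
by zero after a double zero; uniqueness and continuous dependence are available up to that time
only. -/

/-- Standing regularity assumptions on the nonlinearity on the open interval `J`. -/
structure Nonlin (f : ℝ → ℝ) (J : Set ℝ) : Prop where
  isOpen : IsOpen J
  conn : OrdConnected J
  zero_mem : (0 : ℝ) ∈ J
  cont : ContinuousOn f J
  zero : f 0 = 0
  lip : LocallyLipschitzOn (J \ {0}) f

/-- `(u, v)` solves the first order system equivalent to `u'' + (N-1)/r u' + f(u) = 0`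
for `r > 0`. -/
structure Traj (N : ℕ) (f : ℝ → ℝ) (J : Set ℝ) (u v : ℝ → ℝ) : Prop where
  mem : ∀ r, 0 ≤ r → u r ∈ J
  hu : ∀ r, 0 < r → HasDerivAt u (v r) r
  hv : ∀ r, 0 < r → HasDerivAt v (-(((N : ℝ) - 1) / r * v r) - f (u r)) r
  contu : Continuous u
  contv : Continuous v
  v_zero : v 0 = 0

/-- The energy `v^2 / 2 + F(u)`. -/
noncomputable def energy (f : ℝ → ℝ) (u v : ℝ → ℝ) (r : ℝ) : ℝ := v r ^ 2 / 2 + F f (u r)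

/-- The reflected nonlinearity `s ↦ -f(-s)`. -/
def refl (f : ℝ → ℝ) (s : ℝ) : ℝ := -f (-s)

lemma refl_refl (f : ℝ → ℝ) : refl (refl f) = f := by
  funext s; simp [refl]

lemma F_zero (f : ℝ → ℝ) : F f 0 = 0 := by simp [F]

lemma F_refl (f : ℝ → ℝ) (s : ℝ) : F (refl f) s = F f (-s) := by
  unfold F refl
  rw [intervalIntegral.integral_neg, intervalIntegral.integral_comp_neg (fun t => f t)]
  rw [neg_zero, intervalIntegral.integral_symm, neg_neg]

lemma Nonlin.intervalIntegrable {f : ℝ → ℝ} {J : Set ℝ} (h : Nonlin f J) {a b : ℝ}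
    (ha : a ∈ J) (hb : b ∈ J) : IntervalIntegrable f MeasureTheory.volume a b := by
  apply ContinuousOn.intervalIntegrable
  exact h.cont.mono (h.conn.uIcc_subset ha hb)

lemma Nonlin.hasDerivAt_F {f : ℝ → ℝ} {J : Set ℝ} (h : Nonlin f J) {s : ℝ} (hs : s ∈ J) :
    HasDerivAt (F f) (f s) s := by
  have hc : ContinuousAt f s := h.cont.continuousAt (h.isOpen.mem_nhds hs)
  refine intervalIntegral.integral_hasDerivAt_right (h.intervalIntegrable h.zero_mem hs) ?_ hc
  exact ContinuousOn.stronglyMeasurableAtFilter h.isOpen h.cont s hs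

lemma Nonlin.continuousAt_F {f : ℝ → ℝ} {J : Set ℝ} (h : Nonlin f J) {s : ℝ} (hs : s ∈ J) :
    ContinuousAt (F f) s := (h.hasDerivAt_F hs).continuousAt

lemma Nonlin.continuousOn_F {f : ℝ → ℝ} {J : Set ℝ} (h : Nonlin f J) :
    ContinuousOn (F f) J := fun _ hs => (h.continuousAt_F hs).continuousWithinAt

/-- The reflection `u ↦ -u` exchanges the two sides of zero, so everything proved for the right well
applies to the left one. -/
lemma Nonlin.refl {f : ℝ → ℝ} {J : Set ℝ} (h : Nonlin f J) : Nonlin (refl f) (Neg.neg ⁻¹' J) where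
  isOpen := h.isOpen.preimage continuous_neg
  conn := by
    constructor
    intro x hx y hy z hz
    exact h.conn.out hy hx ⟨by linarith [hz.2], by linarith [hz.1]⟩
  zero_mem := by simpa using h.zero_mem
  cont := (h.cont.comp continuous_neg.continuousOn fun x hx => hx).neg
  zero := by simp [BoundState.refl, h.zero]
  lip := by
    intro x hx
    obtain ⟨K, t, ht, hK⟩ := h.lip (x := -x) ⟨hx.1, by simpa using hx.2⟩
    refine ⟨K, Neg.neg ⁻¹' t, ?_, ?_⟩
    · have hT : Tendsto (fun y : ℝ => -y) (𝓝[Neg.neg ⁻¹' J \ {0}] x) (𝓝[J \ {0}] (-x)) := by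
        apply tendsto_nhdsWithin_of_tendsto_nhds_of_eventually_within
        · exact (continuous_neg.tendsto x).mono_left nhdsWithin_le_nhds
        · filter_upwards [self_mem_nhdsWithin] with y hy
          exact ⟨hy.1, by simpa using hy.2⟩
      exact hT ht
    · apply LipschitzOnWith.of_dist_le_mul
      intro a ha b hb
      have := hK.dist_le_mul _ ha _ hb
      simpa [BoundState.refl] using this

section
variable {N : ℕ} {f : ℝ → ℝ} {J : Set ℝ} {u v : ℝ → ℝ}

lemma Traj.neg (h : Traj N f J u v) : Traj N (refl f) (Neg.neg ⁻¹' J) (-u) (-v) where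
  mem r hr := by simpa using h.mem r hr
  hu r hr := (h.hu r hr).neg
  hv r hr := by
    refine (h.hv r hr).neg.congr_deriv ?_
    simp only [BoundState.refl, Pi.neg_apply, neg_neg]; ring
  contu := h.contu.neg
  contv := h.contv.neg
  v_zero := by simp [h.v_zero]

lemma energy_neg (r : ℝ) : energy (refl f) (-u) (-v) r = energy f u v r := by
  simp [energy, F_refl]

lemma Traj.hasDerivAt_energy (hf : Nonlin f J) (h : Traj N f J u v) {r : ℝ} (hr : 0 < r) :
    HasDerivAt (energy f u v) (-(((N : ℝ) - 1) / r * v r ^ 2)) r := by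
  have h1 := (hf.hasDerivAt_F (h.mem r hr.le)).comp r (h.hu r hr)
  have h2 := (((h.hv r hr).pow 2).div_const 2).add h1
  refine h2.congr_deriv ?_
  push_cast
  ring

lemma Traj.continuousOn_energy (hf : Nonlin f J) (h : Traj N f J u v) :
    ContinuousOn (energy f u v) (Ici 0) := by
  intro r hr
  have h1 : ContinuousAt (fun x => F f (u x)) r :=
    ContinuousAt.comp (hf.continuousAt_F (h.mem r hr)) h.contu.continuousAt
  exact (((h.contv.continuousAt.pow 2).div_const 2).add h1).continuousWithinAt

lemma antitoneOn_Icc_of_deriv {g g' : ℝ → ℝ} {a b : ℝ} (hc : ContinuousOn g (Icc a b))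
    (hd : ∀ x ∈ Ioo a b, HasDerivAt g (g' x) x) (hn : ∀ x ∈ Ioo a b, g' x ≤ 0) :
    AntitoneOn g (Icc a b) := by
  apply antitoneOn_of_deriv_nonpos (convex_Icc a b) hc
  · intro x hx
    rw [interior_Icc] at hx
    exact (hd x hx).differentiableAt.differentiableWithinAt
  · intro x hx
    rw [interior_Icc] at hx
    rw [(hd x hx).deriv]; exact hn x hx

lemma le_of_deriv_nonpos {g g' : ℝ → ℝ} {a b : ℝ} (hab : a ≤ b) (hc : ContinuousOn g (Icc a b))
    (hd : ∀ x ∈ Ioo a b, HasDerivAt g (g' x) x) (hn : ∀ x ∈ Ioo a b, g' x ≤ 0) : g b ≤ g a :=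
  antitoneOn_Icc_of_deriv hc hd hn (left_mem_Icc.2 hab) (right_mem_Icc.2 hab) hab

lemma ge_of_deriv_nonneg {g g' : ℝ → ℝ} {a b : ℝ} (hab : a ≤ b) (hc : ContinuousOn g (Icc a b))
    (hd : ∀ x ∈ Ioo a b, HasDerivAt g (g' x) x) (hn : ∀ x ∈ Ioo a b, 0 ≤ g' x) : g a ≤ g b := by
  have := le_of_deriv_nonpos (g := fun x => -g x) (g' := fun x => -g' x) hab hc.neg
    (fun x hx => (hd x hx).neg) (fun x hx => by linarith [hn x hx])
  linarith

lemma Traj.energy_le (hN : 2 ≤ N) (hf : Nonlin f J) (h : Traj N f J u v) {r s : ℝ} (hr : 0 ≤ r)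
    (hrs : r ≤ s) : energy f u v s ≤ energy f u v r := by
  have hN' : (2 : ℝ) ≤ N := by exact_mod_cast hN
  refine le_of_deriv_nonpos hrs
    ((h.continuousOn_energy hf).mono fun x hx => hr.trans hx.1)
    (fun x hx => h.hasDerivAt_energy hf (hr.trans_lt hx.1)) ?_
  intro x hx
  have hx0 : 0 < x := hr.trans_lt hx.1
  have : 0 ≤ ((N : ℝ) - 1) / x * v x ^ 2 := by
    have : 0 ≤ (N : ℝ) - 1 := by linarith
    positivity
  linarith

lemma F_le_energy (r : ℝ) : F f (u r) ≤ energy f u v r := by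
  unfold energy; nlinarith [sq_nonneg (v r)]

lemma energy_init (h : Traj N f J u v) : energy f u v 0 = F f (u 0) := by
  simp [energy, h.v_zero]

/-- `r^2 E` is nonincreasing while `F(u) ≤ 0`. -/
lemma Traj.sq_mul_energy_le (hN : 2 ≤ N) (hf : Nonlin f J) (h : Traj N f J u v) {r s : ℝ}
    (hr : 0 ≤ r) (hrs : r ≤ s) (hF : ∀ x ∈ Icc r s, F f (u x) ≤ 0) :
    s ^ 2 * energy f u v s ≤ r ^ 2 * energy f u v r := by
  have hN' : (2 : ℝ) ≤ N := by exact_mod_cast hN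
  refine le_of_deriv_nonpos (g := fun x => x ^ 2 * energy f u v x)
    (g' := fun x => x * ((2 - N) * v x ^ 2 + 2 * F f (u x))) hrs
    ((continuous_pow 2).continuousOn.mul
      ((h.continuousOn_energy hf).mono fun x hx => hr.trans hx.1)) ?_ ?_
  · intro x hx
    have hx0 : 0 < x := hr.trans_lt hx.1
    refine (((hasDerivAt_id x).pow 2).mul (h.hasDerivAt_energy hf hx0)).congr_deriv ?_
    simp only [energy, id, Pi.pow_apply]
    field_simp
    ring
  · intro x hx
    have hx0 : 0 < x := hr.trans_lt hx.1
    have h1 := hF x ⟨hx.1.le, hx.2.le⟩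
    have h2 : (2 - (N : ℝ)) * v x ^ 2 ≤ 0 :=
      mul_nonpos_of_nonpos_of_nonneg (by linarith) (sq_nonneg _)
    exact mul_nonpos_of_nonneg_of_nonpos hx0.le (by linarith)

/-- `r^(N-1) v` has derivative `-r^(N-1) f(u)`. -/
lemma Traj.hasDerivAt_pow_mul (hN : 2 ≤ N) (h : Traj N f J u v) {r : ℝ} (hr : 0 < r) :
    HasDerivAt (fun x => x ^ (N - 1) * v x) (-(r ^ (N - 1) * f (u r))) r := by
  obtain ⟨n, rfl⟩ : ∃ n, N = n + 2 := ⟨N - 2, by omega⟩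
  refine ((hasDerivAt_pow (n + 2 - 1) r).mul (h.hv r hr)).congr_deriv ?_
  have : n + 2 - 1 = n + 1 := rfl
  rw [this]
  push_cast
  field_simp
  ring

end

/-- The first time at which a continuous function reaches a lower level. -/
lemma exists_first_hit {u : ℝ → ℝ} (hu : Continuous u) {a r c : ℝ} (har : a ≤ r) (ha : c < u a)
    (hr : u r ≤ c) : ∃ t, a < t ∧ t ≤ r ∧ u t = c ∧ ∀ s, a ≤ s → s < t → c < u s := by
  let S := {t | t ∈ Icc a r ∧ u t ≤ c}
  have hS : IsCompact S := by
    have : S = Icc a r ∩ u ⁻¹' (Iic c) := rfl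
    rw [this]; exact isCompact_Icc.inter_right (isClosed_Iic.preimage hu)
  obtain ⟨t, ht, hmin⟩ := hS.exists_isMinOn ⟨r, ⟨har, le_rfl⟩, hr⟩ continuous_id.continuousOn
  have hlt : ∀ s, a ≤ s → s < t → c < u s := by
    intro s hs hst
    by_contra! hcon
    have := isMinOn_iff.1 hmin s ⟨⟨hs, hst.le.trans ht.1.2⟩, hcon⟩
    simp at this; linarith
  have hat : a < t := by
    rcases ht.1.1.lt_or_eq with h | h
    · exact h
    · rw [← h] at ht; linarith [ht.2]
  refine ⟨t, hat, ht.1.2, le_antisymm ht.2 ?_, hlt⟩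
  by_contra! hcon
  obtain ⟨s, hs, hsc⟩ : ∃ s ∈ Ioo a t, u s = (u t + c) / 2 := by
    apply intermediate_value_Ioo' hat.le hu.continuousOn
    constructor <;> linarith
  linarith [hlt s hs.1.le hs.2]

/-- The last time before `r` at which a continuous function is above a level. -/
lemma exists_last_hit {u : ℝ → ℝ} (hu : Continuous u) {a r c : ℝ} (har : a ≤ r) (ha : c ≤ u a)
    (hr : u r < c) : ∃ t, a ≤ t ∧ t < r ∧ u t = c ∧ ∀ s, t < s → s ≤ r → u s < c := by
  obtain ⟨t, h1, h2, h3, h4⟩ := exists_first_hit (u := fun x => -u (-x))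
    (hu.comp continuous_neg).neg (a := -r) (r := -a) (c := -c) (by linarith)
    (by simpa using hr) (by simpa using ha)
  refine ⟨-t, by linarith, by linarith, by linarith, fun s hs hsr => ?_⟩
  have := h4 (-s) (by linarith) (by linarith)
  simp at this; exact this

end BoundState

namespace BoundState

/-! ### The integral equation: compactness and existence -/

/-- The derivative of the solution, expressed through the solution. -/
noncomputable def velocity (N : ℕ) (g u : ℝ → ℝ) (r : ℝ) : ℝ :=
  -r * ∫ t in (0 : ℝ)..1, t ^ (N - 1) * g (u (r * t))

/-- The substitution `s = r t` has removed the singular factor `r^(1-N)` from the velocity, so `r =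
0` needs no separate treatment. -/
lemma velocity_continuous {N : ℕ} {g u : ℝ → ℝ} (hg : Continuous g) (hu : Continuous u) :
    Continuous (velocity N g u) := by
  unfold velocity
  refine continuous_neg.mul ?_
  apply intervalIntegral.continuous_parametric_intervalIntegral_of_continuous'
  fun_prop

lemma abs_integral_pow_mul_le {N : ℕ} {k : ℝ → ℝ} {B : ℝ}
    (hk : ∀ t ∈ Icc (0 : ℝ) 1, |k t| ≤ B) :
    |∫ t in (0 : ℝ)..1, t ^ (N - 1) * k t| ≤ B := by
  have := intervalIntegral.norm_integral_le_of_norm_le_const (a := 0) (b := 1)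
    (f := fun t => t ^ (N - 1) * k t) (C := B) ?_
  · simpa using this
  · intro t ht
    rw [uIoc_of_le zero_le_one] at ht
    have h1 := hk t ⟨ht.1.le, ht.2⟩
    have h2 : |t ^ (N - 1)| ≤ 1 := by
      rw [abs_of_nonneg (pow_nonneg ht.1.le _)]
      exact pow_le_one₀ ht.1.le ht.2
    rw [Real.norm_eq_abs, abs_mul]
    have := abs_nonneg (t ^ (N - 1))
    nlinarith [abs_nonneg (k t)]

lemma velocity_abs_le {N : ℕ} {g u : ℝ → ℝ} {B : ℝ} (hB : ∀ x, |g x| ≤ B) (r : ℝ) :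
    |velocity N g u r| ≤ |r| * B := by
  unfold velocity
  rw [abs_mul, abs_neg]
  exact mul_le_mul_of_nonneg_left (abs_integral_pow_mul_le fun t _ => hB _) (abs_nonneg _)

lemma velocity_sub_le {N : ℕ} {g u w : ℝ → ℝ} {η r : ℝ} (hg : Continuous g) (hu : Continuous u)
    (hw : Continuous w) (h : ∀ t ∈ Icc (0 : ℝ) 1, |g (u (r * t)) - g (w (r * t))| ≤ η) :
    |velocity N g u r - velocity N g w r| ≤ |r| * η := by
  unfold velocity
  have : (-r * ∫ t in (0 : ℝ)..1, t ^ (N - 1) * g (u (r * t))) -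
      (-r * ∫ t in (0 : ℝ)..1, t ^ (N - 1) * g (w (r * t))) =
      -r * ∫ t in (0 : ℝ)..1, t ^ (N - 1) * (g (u (r * t)) - g (w (r * t))) := by
    rw [← mul_sub, ← intervalIntegral.integral_sub]
    · congr 2; funext t; ring
    · apply Continuous.intervalIntegrable; fun_prop
    · apply Continuous.intervalIntegrable; fun_prop
  rw [this, abs_mul, abs_neg]
  exact mul_le_mul_of_nonneg_left (abs_integral_pow_mul_le h) (abs_nonneg _)

lemma velocity_eq {N : ℕ} {g u : ℝ → ℝ} {r : ℝ} (hr : 0 < r) :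
    velocity N g u r = -(∫ s in (0 : ℝ)..r, s ^ (N - 1) * g (u s)) / r ^ (N - 1) := by
  unfold velocity
  have h1 := intervalIntegral.integral_comp_mul_left (a := 0) (b := 1)
    (fun s => (s ^ (N - 1) * g (u s))) hr.ne'
  have h2 : (∫ t in (0 : ℝ)..1, (r * t) ^ (N - 1) * g (u (r * t))) =
      r ^ (N - 1) * ∫ t in (0 : ℝ)..1, t ^ (N - 1) * g (u (r * t)) := by
    rw [← intervalIntegral.integral_const_mul]
    congr 1; funext t; ring
  rw [h2] at h1
  simp only [mul_zero, mul_one, smul_eq_mul] at h1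
  have hp : r ^ (N - 1) ≠ 0 := pow_ne_zero _ hr.ne'
  rw [eq_div_iff hp]
  have : r * (r ^ (N - 1) * ∫ t in (0 : ℝ)..1, t ^ (N - 1) * g (u (r * t))) =
      ∫ s in (0 : ℝ)..r, s ^ (N - 1) * g (u s) := by
    rw [h1]; field_simp
  linarith

/-- The integrated form of the initial value problem. -/
structure IntSol (N : ℕ) (g : ℝ → ℝ) (α : ℝ) (u : ℝ → ℝ) : Prop where
  cont : Continuous u
  eq : ∀ r, u r = α + ∫ s in (0 : ℝ)..r, velocity N g u s

lemma IntSol.hasDerivAt {N : ℕ} {g u : ℝ → ℝ} {α : ℝ} (hg : Continuous g) (h : IntSol N g α u)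
    (r : ℝ) : HasDerivAt u (velocity N g u r) r := by
  have hc := velocity_continuous (N := N) hg h.cont
  have : HasDerivAt (fun r => α + ∫ s in (0 : ℝ)..r, velocity N g u s) (velocity N g u r) r :=
    (intervalIntegral.integral_hasDerivAt_right (hc.intervalIntegrable _ _)
      (hc.stronglyMeasurableAtFilter _ _) hc.continuousAt).const_add _
  exact this.congr_of_eventuallyEq (Eventually.of_forall h.eq)

lemma velocity_hasDerivAt {N : ℕ} {g u : ℝ → ℝ} {r : ℝ} (hN : 2 ≤ N) (hg : Continuous g)
    (hu : Continuous u) (hr : 0 < r) :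
    HasDerivAt (velocity N g u)
      (-(((N : ℝ) - 1) / r * velocity N g u r) - g (u r)) r := by
  have hc : Continuous fun s => s ^ (N - 1) * g (u s) := by fun_prop
  have h1 : HasDerivAt (fun r => ∫ s in (0 : ℝ)..r, s ^ (N - 1) * g (u s))
      (r ^ (N - 1) * g (u r)) r :=
    intervalIntegral.integral_hasDerivAt_right (hc.intervalIntegrable _ _)
      (hc.stronglyMeasurableAtFilter _ _) hc.continuousAt
  have hp : r ^ (N - 1) ≠ 0 := pow_ne_zero _ hr.ne'
  have h2 := h1.neg.div (hasDerivAt_pow (N - 1) r) hp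
  have h3 : velocity N g u =ᶠ[𝓝 r]
      fun r => -(∫ s in (0 : ℝ)..r, s ^ (N - 1) * g (u s)) / r ^ (N - 1) := by
    filter_upwards [lt_mem_nhds hr] with x hx using velocity_eq hx
  refine (h2.congr_of_eventuallyEq h3).congr_deriv ?_
  rw [velocity_eq hr]
  obtain ⟨n, rfl⟩ : ∃ n, N = n + 2 := ⟨N - 2, by omega⟩
  have : n + 2 - 1 = n + 1 := rfl
  rw [this] at *
  simp only [Nat.add_sub_cancel, Pi.neg_apply]
  push_cast
  field_simp
  ring

/-- A bounded family with a locally uniform Lipschitz bound is locally uniformly precompact. -/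
lemma exists_subseq_tendstoLocallyUniformly (u : ℕ → ℝ → ℝ) {B C : ℝ} (hB : 0 ≤ B)
    (h0 : ∀ n, |u n 0| ≤ C)
    (hl : ∀ n, ∀ R, 0 ≤ R → ∀ x y, |x| ≤ R → |y| ≤ R → |u n x - u n y| ≤ B * R * |x - y|) :
    ∃ φ : ℕ → ℕ, StrictMono φ ∧ ∃ w : ℝ → ℝ, Continuous w ∧
      TendstoLocallyUniformly (fun n => u (φ n)) w atTop := by
  let P : (ℝ → ℝ) → Prop := fun w => |w 0| ≤ C ∧
    ∀ R, 0 ≤ R → ∀ x y, |x| ≤ R → |y| ≤ R → |w x - w y| ≤ B * R * |x - y|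
  have hPeq : ∀ x₀ : ℝ, ∀ ε > 0, ∃ η > 0, ∀ w, P w → ∀ x, |x - x₀| < η → |w x - w x₀| < ε := by
    intro x₀ ε hε
    refine ⟨min 1 (ε / (B * (|x₀| + 1) + 1)), by positivity, fun w hw x hx => ?_⟩
    have hx1 : |x - x₀| < 1 := hx.trans_le (min_le_left _ _)
    have hx2 : |x - x₀| < ε / (B * (|x₀| + 1) + 1) := hx.trans_le (min_le_right _ _)
    have h1 : |x| ≤ |x₀| + 1 := by
      have := abs_sub_abs_le_abs_sub x x₀; linarith
    have h2 := hw.2 (|x₀| + 1) (by positivity) x x₀ h1 (by linarith [abs_nonneg x₀])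
    have hp : 0 < B * (|x₀| + 1) + 1 := by positivity
    rw [lt_div_iff₀ hp] at hx2
    nlinarith [abs_nonneg (x - x₀)]
  have hPc : ∀ w, P w → Continuous w := by
    intro w hw
    rw [Metric.continuous_iff]
    intro x₀ ε hε
    obtain ⟨η, hη, h⟩ := hPeq x₀ ε hε
    exact ⟨η, hη, fun x hx => h w hw x hx⟩
  -- Arzelà–Ascoli: `S` is compact for pointwise convergence, as a closed subset of a product of
  -- intervals, and it is equicontinuous, hence it is compact for locally uniform convergence.
  let S : Set C(ℝ, ℝ) := {w | P w}
  have hS1 : IsCompact (ContinuousMap.toFun '' S) := by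
    have himg : ContinuousMap.toFun '' S = {w | P w} := by
      ext w; constructor
      · rintro ⟨w', hw', rfl⟩; exact hw'
      · intro hw; exact ⟨⟨w, hPc w hw⟩, hw, rfl⟩
    rw [himg]
    have hK : IsCompact (Set.univ.pi fun x : ℝ => Icc (-(C + B * |x| * |x|)) (C + B * |x| * |x|)) :=
      isCompact_univ_pi fun x => isCompact_Icc
    refine hK.of_isClosed_subset ?_ ?_
    · have hset : {w | P w} = {w : ℝ → ℝ | |w 0| ≤ C} ∩
          ⋂ (R : ℝ) (_ : 0 ≤ R) (x : ℝ) (y : ℝ) (_ : |x| ≤ R) (_ : |y| ≤ R),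
            {w : ℝ → ℝ | |w x - w y| ≤ B * R * |x - y|} := by
        ext w; simp [P]
      rw [hset]
      refine IsClosed.inter (isClosed_le (by fun_prop) continuous_const) ?_
      refine isClosed_iInter fun R => isClosed_iInter fun _ => isClosed_iInter fun x =>
        isClosed_iInter fun y => isClosed_iInter fun _ => isClosed_iInter fun _ =>
        isClosed_le (by fun_prop) continuous_const
    · intro w hw x _
      have h1 := hw.2 |x| (abs_nonneg x) x 0 le_rfl (by simp)
      have h2 := hw.1
      rw [sub_zero] at h1
      have h3 : |w x| ≤ C + B * |x| * |x| := by
        have := abs_sub_abs_le_abs_sub (w x) (w 0); linarith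
      exact abs_le.1 h3
  have hS2 : Equicontinuous ((↑) : S → ℝ → ℝ) := by
    intro x₀
    rw [Metric.equicontinuousAt_iff]
    intro ε hε
    obtain ⟨η, hη, h⟩ := hPeq x₀ ε hε
    refine ⟨η, hη, fun x hx w => ?_⟩
    rw [Real.dist_eq, abs_sub_comm]
    exact h _ w.2 x hx
  have hS := ArzelaAscoli.isCompact_of_equicontinuous S hS1 hS2
  have hu : ∀ n, P (u n) := fun n => ⟨h0 n, hl n⟩
  obtain ⟨w, -, φ, hφ, hlim⟩ := hS.tendsto_subseq
    (x := fun n => (⟨u n, hPc _ (hu n)⟩ : C(ℝ, ℝ))) fun n => hu n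
  exact ⟨φ, hφ, w, w.continuous, ContinuousMap.tendsto_iff_tendstoLocallyUniformly.1 hlim⟩

/-- Moves a point towards the origin by `ε`. -/
noncomputable def shrink (ε x : ℝ) : ℝ := x - max (-ε) (min ε x)

lemma shrink_continuous (ε : ℝ) : Continuous (shrink ε) := by unfold shrink; fun_prop

lemma shrink_sub {ε : ℝ} (hε : 0 ≤ ε) (x : ℝ) : |shrink ε x - x| ≤ ε := by
  unfold shrink
  have h1 : -ε ≤ max (-ε) (min ε x) := le_max_left _ _
  have h2 : max (-ε) (min ε x) ≤ ε := max_le (by linarith) (min_le_left _ _)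
  rw [abs_le]; constructor <;> linarith

/-- This is what makes the delayed equation explicit: on `|r| ≤ ρ` its right-hand side only involves
the unknown on `|x| ≤ max (ρ - ε) 0`. -/
lemma abs_shrink_le {ε : ℝ} (hε : 0 ≤ ε) (x : ℝ) : |shrink ε x| ≤ max (|x| - ε) 0 := by
  unfold shrink
  rcases le_total ε x with h | h
  · rw [min_eq_left h, max_eq_right (by linarith), abs_of_nonneg (by linarith)]
    exact le_max_of_le_left (by linarith [le_abs_self x])
  · rw [min_eq_right h]
    rcases le_total (-ε) x with h' | h'
    · rw [max_eq_right h']; simp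
    · rw [max_eq_left h', abs_of_nonpos (by linarith)]
      exact le_max_of_le_left (by linarith [neg_le_abs x])

lemma abs_shrink_le_abs {ε : ℝ} (hε : 0 ≤ ε) (x : ℝ) : |shrink ε x| ≤ |x| :=
  (abs_shrink_le hε x).trans (max_le (by linarith) (abs_nonneg x))

lemma lipschitz_of_eq_integral {N : ℕ} {g u w : ℝ → ℝ} {α B : ℝ} (hg : Continuous g)
    (hB : ∀ x, |g x| ≤ B) (hw : Continuous w)
    (hu : ∀ r, u r = α + ∫ s in (0 : ℝ)..r, velocity N g w s) {R x y : ℝ}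
    (hx : |x| ≤ R) (hy : |y| ≤ R) : |u x - u y| ≤ B * R * |x - y| := by
  have hc := velocity_continuous (N := N) hg hw
  have hB0 : 0 ≤ B := (abs_nonneg _).trans (hB 0)
  rw [hu x, hu y, add_sub_add_left_eq_sub,
    intervalIntegral.integral_interval_sub_left (hc.intervalIntegrable _ _)
      (hc.intervalIntegrable _ _)]
  rw [← Real.norm_eq_abs]
  refine intervalIntegral.norm_integral_le_of_norm_le_const fun s hs => ?_
  rw [Real.norm_eq_abs]
  refine (velocity_abs_le hB s).trans ?_
  rw [mul_comm B R]
  refine mul_le_mul_of_nonneg_right ?_ hB0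
  have := uIoc_subset_uIcc hs
  rw [abs_le] at *
  rcases le_total y x with h | h
  · rw [uIcc_of_le h] at this; constructor <;> linarith [this.1, this.2]
  · rw [uIcc_of_ge h] at this; constructor <;> linarith [this.1, this.2]

/-- Limits of (delayed) solutions are solutions. -/
lemma exists_subseq_intSol {N : ℕ} {g : ℝ → ℝ} {B α : ℝ} (hg : Continuous g)
    (hB : ∀ x, |g x| ≤ B) {a ε : ℕ → ℝ} (ha : Tendsto a atTop (𝓝 α)) (hε0 : ∀ n, 0 ≤ ε n)
    (hε : Tendsto ε atTop (𝓝 0)) {u : ℕ → ℝ → ℝ} (hu : ∀ n, Continuous (u n))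
    (heq : ∀ n r, u n r = a n + ∫ s in (0 : ℝ)..r, velocity N g (u n ∘ shrink (ε n)) s) :
    ∃ φ : ℕ → ℕ, StrictMono φ ∧ ∃ w : ℝ → ℝ, IntSol N g α w ∧
      TendstoLocallyUniformly (fun n => u (φ n)) w atTop := by
  have hB0 : 0 ≤ B := (abs_nonneg _).trans (hB 0)
  have hl : ∀ n, ∀ R, 0 ≤ R → ∀ x y, |x| ≤ R → |y| ≤ R → |u n x - u n y| ≤ B * R * |x - y| :=
    fun n R _ x y hx hy => lipschitz_of_eq_integral hg hB
      ((hu n).comp (shrink_continuous _)) (heq n) hx hy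
  obtain ⟨C, hC⟩ := (Metric.isBounded_range_of_tendsto a ha).exists_norm_le
  have h0 : ∀ n, |u n 0| ≤ C := by
    intro n
    rw [heq n 0]; simpa using hC (a n) (mem_range_self n)
  obtain ⟨φ, hφ, w, hw, hlim⟩ := exists_subseq_tendstoLocallyUniformly u hB0 h0 hl
  refine ⟨φ, hφ, w, ⟨hw, fun r => ?_⟩, hlim⟩
  have hpt : ∀ x, Tendsto (fun n => u (φ n) x) atTop (𝓝 (w x)) := fun x =>
    
    (tendstoLocallyUniformlyOn_univ.2 hlim).tendsto_at (mem_univ x)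
  have hφt := hφ.tendsto_atTop
  -- Evaluating at the delayed argument changes the value by at most the Lipschitz constant times
  -- the delay, which tends to zero.
  have hpt' : ∀ x, Tendsto (fun n => u (φ n) (shrink (ε (φ n)) x)) atTop (𝓝 (w x)) := by
    intro x
    have h1 : Tendsto (fun n => u (φ n) (shrink (ε (φ n)) x) - u (φ n) x) atTop (𝓝 0) := by
      refine squeeze_zero_norm (a := fun n => B * |x| * ε (φ n)) (fun n => ?_) ?_
      · refine (hl (φ n) |x| (abs_nonneg _) _ _ (abs_shrink_le_abs (hε0 _) _) le_rfl).trans ?_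
        exact mul_le_mul_of_nonneg_left (shrink_sub (hε0 _) _) (by positivity)
      · simpa using (hε.comp hφt).const_mul (B * |x|)
    simpa using h1.add (hpt x)
  have hvel : ∀ s, Tendsto (fun n => velocity N g (u (φ n) ∘ shrink (ε (φ n))) s) atTop
      (𝓝 (velocity N g w s)) := by
    intro s
    unfold velocity
    refine Tendsto.const_mul _ ?_
    refine intervalIntegral.tendsto_integral_filter_of_dominated_convergence (fun _ => B) ?_ ?_ ?_ ?_
    · refine Eventually.of_forall fun n => Continuous.aestronglyMeasurable ?_
      have := (hu (φ n)).comp (shrink_continuous (ε (φ n)))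
      exact (continuous_pow _).mul (hg.comp (this.comp (continuous_const.mul continuous_id)))
    · refine Eventually.of_forall fun n => Eventually.of_forall fun t ht => ?_
      rw [uIoc_of_le zero_le_one] at ht
      rw [Real.norm_eq_abs, abs_mul, abs_of_nonneg (pow_nonneg ht.1.le _)]
      have h2 : t ^ (N - 1) ≤ 1 := pow_le_one₀ ht.1.le ht.2
      have h3 := hB ((u (φ n) ∘ shrink (ε (φ n))) (s * t))
      nlinarith [abs_nonneg (g ((u (φ n) ∘ shrink (ε (φ n))) (s * t))), pow_nonneg ht.1.le (N - 1)]
    · simp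
    · refine Eventually.of_forall fun t _ => Tendsto.const_mul _ ?_
      exact (hg.tendsto _).comp (hpt' (s * t))
  refine tendsto_nhds_unique (hpt r) ?_
  have hfun : (fun n => u (φ n) r) = fun n => a (φ n) +
      ∫ s in (0 : ℝ)..r, velocity N g (u (φ n) ∘ shrink (ε (φ n))) s := funext fun n => heq _ _
  rw [hfun]
  refine (ha.comp hφt).add ?_
  refine intervalIntegral.tendsto_integral_filter_of_dominated_convergence
    (fun s => |s| * B) ?_ ?_ ?_ ?_
  · exact Eventually.of_forall fun n =>
      (velocity_continuous hg ((hu _).comp (shrink_continuous _))).aestronglyMeasurable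
  · exact Eventually.of_forall fun n => Eventually.of_forall fun s _ => velocity_abs_le hB s
  · apply Continuous.intervalIntegrable; fun_prop
  · exact Eventually.of_forall fun s _ => hvel s

/-- Picard iterates of the delayed equation. -/
noncomputable def delayIter (N : ℕ) (g : ℝ → ℝ) (α ε : ℝ) : ℕ → ℝ → ℝ
  | 0 => fun _ => α
  | m + 1 => fun r => α + ∫ s in (0 : ℝ)..r, velocity N g (delayIter N g α ε m ∘ shrink ε) s

lemma delayIter_continuous {N : ℕ} {g : ℝ → ℝ} (hg : Continuous g) (α ε : ℝ) (m : ℕ) :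
    Continuous (delayIter N g α ε m) := by
  induction m with
  | zero => exact continuous_const
  | succ m ih =>
    have := velocity_continuous (N := N) hg (ih.comp (shrink_continuous ε))
    refine continuous_const.add ?_
    exact intervalIntegral.continuous_primitive (fun a b => this.intervalIntegrable a b) 0

lemma integral_velocity_congr {N : ℕ} {g u w : ℝ → ℝ} {ε ρ : ℝ} (hε : 0 ≤ ε)
    (h : ∀ x, |x| ≤ max (|ρ| - ε) 0 → u x = w x) :
    ∫ s in (0 : ℝ)..ρ, velocity N g (u ∘ shrink ε) s =
      ∫ s in (0 : ℝ)..ρ, velocity N g (w ∘ shrink ε) s := by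
  refine intervalIntegral.integral_congr fun s hs => ?_
  have hs' : |s| ≤ |ρ| := by
    have := abs_sub_left_of_mem_uIcc hs; simpa using this
  unfold velocity
  congr 1
  refine intervalIntegral.integral_congr fun t ht => ?_
  rw [uIcc_of_le zero_le_one] at ht
  have h1 : |s * t| ≤ |ρ| := by
    rw [abs_mul, abs_of_nonneg ht.1]
    nlinarith [abs_nonneg s, ht.2]
  simp only [Function.comp]
  rw [h]
  refine (abs_shrink_le hε _).trans ?_
  exact max_le_max_right _ (by linarith)

/-- Method of steps: as the integral operator looks back by `ε`, each application settles one more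
layer of width `ε`. At stage zero only the point `r = 0` is settled. -/
lemma delayIter_stable {N : ℕ} {g : ℝ → ℝ} {α ε : ℝ} (hε : 0 < ε) (m : ℕ) :
    ∀ r : ℝ, |r| ≤ m * ε → delayIter N g α ε (m + 1) r = delayIter N g α ε m r := by
  induction m with
  | zero =>
    intro r hr
    have : r = 0 := by simpa using hr
    subst this
    simp [delayIter]
  | succ m ih =>
    intro r hr
    change α + _ = α + _
    congr 1
    refine integral_velocity_congr hε.le fun x hx => ih x (hx.trans (max_le ?_ (by positivity)))
    push_cast at hr; linarith

lemma delayIter_stable' {N : ℕ} {g : ℝ → ℝ} {α ε : ℝ} (hε : 0 < ε) {m n : ℕ} (hmn : m ≤ n)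
    {r : ℝ} (hr : |r| ≤ m * ε) : delayIter N g α ε n r = delayIter N g α ε m r := by
  induction n, hmn using Nat.le_induction with
  | base => rfl
  | succ n hn ih =>
    rw [delayIter_stable hε n r (hr.trans ?_), ih]
    have : (m : ℝ) ≤ n := by exact_mod_cast hn
    nlinarith

lemma exists_delayed {N : ℕ} {g : ℝ → ℝ} (hg : Continuous g) (α : ℝ) {ε : ℝ} (hε : 0 < ε) :
    ∃ u : ℝ → ℝ, Continuous u ∧
      ∀ r, u r = α + ∫ s in (0 : ℝ)..r, velocity N g (u ∘ shrink ε) s := by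
  -- At `r` all iterates of index at least `|r| / ε` agree, so this diagonal choice coincides
  -- locally with one fixed iterate.
  let u : ℝ → ℝ := fun r => delayIter N g α ε ⌈|r| / ε⌉₊ r
  have hu : ∀ m : ℕ, ∀ r : ℝ, |r| ≤ m * ε → u r = delayIter N g α ε m r := by
    intro m r hr
    have h1 : |r| ≤ (⌈|r| / ε⌉₊ : ℝ) * ε := by
      rw [← div_le_iff₀ hε]; exact Nat.le_ceil _
    have h2 : ⌈|r| / ε⌉₊ ≤ m := Nat.ceil_le.2 (by rwa [div_le_iff₀ hε])
    exact (delayIter_stable' hε h2 h1).symm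
  refine ⟨u, ?_, fun r => ?_⟩
  · rw [continuous_iff_continuousAt]
    intro x
    obtain ⟨m, hm⟩ := exists_nat_gt (|x| / ε)
    rw [div_lt_iff₀ hε] at hm
    have : u =ᶠ[𝓝 x] delayIter N g α ε m := by
      filter_upwards [(continuous_abs.tendsto x).eventually_lt_const hm] with y hy
        using hu m y (le_of_lt hy)
    exact (delayIter_continuous hg α ε m).continuousAt.congr this.symm
  · obtain ⟨m, hm⟩ := exists_nat_ge (|r| / ε)
    rw [div_le_iff₀ hε] at hm
    rw [hu (m + 1) r (by push_cast; linarith)]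
    change α + _ = α + _
    congr 1
    refine integral_velocity_congr hε.le fun x hx => (hu m x (hx.trans (max_le ?_ ?_))).symm
    · linarith
    · positivity

/-- Peano's theorem: `g` is merely continuous, so there is no contraction. The delayed equations are
solvable explicitly, and a limit is taken as the delay tends to zero. -/
lemma exists_intSol (N : ℕ) {g : ℝ → ℝ} {B : ℝ} (hg : Continuous g) (hB : ∀ x, |g x| ≤ B)
    (α : ℝ) : ∃ u, IntSol N g α u := by
  choose u hu heq using fun n : ℕ =>
    exists_delayed (N := N) hg α (ε := 1 / ((n : ℝ) + 1)) (by positivity)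
  obtain ⟨-, -, w, hw, -⟩ := exists_subseq_intSol hg hB (a := fun _ => α) (α := α)
    (ε := fun n : ℕ => 1 / ((n : ℝ) + 1)) tendsto_const_nhds (fun n => by positivity)
    tendsto_one_div_add_atTop_nhds_zero_nat hu heq
  exact ⟨w, hw⟩

/-- Compactness of the set of solutions, with convergence of the derivatives. -/
lemma exists_subseq_close {N : ℕ} {g : ℝ → ℝ} {B α : ℝ} (hg : UniformContinuous g)
    (hB : ∀ x, |g x| ≤ B) {a : ℕ → ℝ} (ha : Tendsto a atTop (𝓝 α)) {u : ℕ → ℝ → ℝ}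
    (hu : ∀ n, IntSol N g (a n) (u n)) :
    ∃ φ : ℕ → ℕ, StrictMono φ ∧ ∃ w : ℝ → ℝ, IntSol N g α w ∧
      ∀ R ε : ℝ, 0 < ε → ∀ᶠ n in atTop, ∀ r ∈ Icc 0 R, |u (φ n) r - w r| < ε ∧
        |velocity N g (u (φ n)) r - velocity N g w r| < ε := by
  -- With zero delay the compactness lemma for delayed equations applies to genuine solutions.
  have hsh : shrink 0 = id := by
    funext x; unfold shrink; simp
  obtain ⟨φ, hφ, w, hw, hlim⟩ := exists_subseq_intSol hg.continuous hB ha (ε := fun _ => 0)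
    (fun _ => le_rfl) tendsto_const_nhds (fun n => (hu n).cont)
    (fun n r => by rw [hsh]; exact (hu n).eq r)
  refine ⟨φ, hφ, w, hw, fun R ε hε => ?_⟩
  have hun := (tendstoLocallyUniformly_iff_forall_isCompact.1 hlim) (Icc 0 R) isCompact_Icc
  rw [Metric.tendstoUniformlyOn_iff] at hun
  rw [Metric.uniformContinuous_iff] at hg
  obtain ⟨η, hη, hgη⟩ := hg (ε / (|R| + 1)) (by positivity)
  filter_upwards [hun ε hε, hun η hη] with n h1 h2
  intro r hr
  refine ⟨?_, ?_⟩
  · have := h1 r hr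
    rwa [dist_comm, Real.dist_eq] at this
  · have hgc : Continuous g := Metric.uniformContinuous_iff.2 hg |>.continuous
    have h3 : |velocity N g (u (φ n)) r - velocity N g w r| ≤ |r| * (ε / (|R| + 1)) := by
      refine velocity_sub_le hgc (hu _).cont hw.cont fun t ht => ?_
      have hrt : r * t ∈ Icc 0 R :=
        ⟨mul_nonneg hr.1 ht.1, (mul_le_of_le_one_right hr.1 ht.2).trans hr.2⟩
      have h4 := h2 _ hrt
      rw [dist_comm] at h4
      exact (hgη h4).le
    refine h3.trans_lt ?_
    have hR : |r| ≤ |R| := by rw [abs_of_nonneg hr.1]; exact hr.2.trans (le_abs_self R)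
    rw [← mul_div_assoc, div_lt_iff₀ (by positivity)]
    nlinarith [abs_nonneg r]

end BoundState

namespace BoundState

/-! ### Confinement, uniqueness and continuous dependence -/

/-- Every energy level of a point of `J` is confined to a compact subinterval of `J`. -/
def Confining (f : ℝ → ℝ) (J : Set ℝ) : Prop :=
  ∀ x ∈ J, ∃ p ∈ J, ∃ q ∈ J, p < x ∧ p < 0 ∧ x < q ∧ 0 < q ∧ F f x < F f p ∧ F f x < F f q

/-- The solution with initial value `α`, continued by zero after a double zero. -/
structure Sol (N : ℕ) (f : ℝ → ℝ) (J : Set ℝ) (α : ℝ) (u v : ℝ → ℝ) : Prop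
    extends Traj N f J u v where
  init : u 0 = α
  absorb : ∀ r₀, 0 ≤ r₀ → u r₀ = 0 → v r₀ = 0 → ∀ r, r₀ ≤ r → u r = 0 ∧ v r = 0

/-- Freezing the values of `f` outside `[p, q]` gives a bounded, uniformly continuous nonlinearity
on the whole line. The modification is invisible to trajectories that the energy confines to `(p,
q)`. -/
lemma exists_cut {f : ℝ → ℝ} {J : Set ℝ} (hf : Nonlin f J) {p q : ℝ} (hp : p ∈ J) (hq : q ∈ J)
    (hpq : p ≤ q) : ∃ g : ℝ → ℝ, UniformContinuous g ∧ (∃ B, ∀ x, |g x| ≤ B) ∧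
      ∀ x ∈ Icc p q, g x = f x := by
  have hsub : Icc p q ⊆ J := hf.conn.out hp hq
  have hc : ContinuousOn f (Icc p q) := hf.cont.mono hsub
  refine ⟨IccExtend hpq ((Icc p q).domRestrict f), ?_, ?_, ?_⟩
  · exact (CompactSpace.uniformContinuous_of_continuous hc.domRestrict).comp
      (LipschitzWith.projIcc hpq).uniformContinuous
  · obtain ⟨B, hB⟩ := isCompact_Icc.exists_bound_of_continuousOn hc
    exact ⟨B, fun x => hB _ (projIcc p q hpq x).2⟩
  · intro x hx
    rw [IccExtend_of_mem _ _ hx]; rfl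

section
variable {N : ℕ} {f g : ℝ → ℝ} {J : Set ℝ} {u v u₁ v₁ u₂ v₂ : ℝ → ℝ} {α p q : ℝ}

lemma velocity_zero : velocity N g u 0 = 0 := by simp [velocity]

lemma IntSol.init (h : IntSol N g α u) : u 0 = α := by
  rw [h.eq]; simp

/-- The energy does not increase, while `F(p)` and `F(q)` exceed its initial value. Since `g = f` is
known only on `[p, q]`, the energy balance is used just up to the first exit time. -/
lemma IntSol.mem_Ioo (hN : 2 ≤ N) (hf : Nonlin f J) (hpJ : p ∈ J) (hqJ : q ∈ J) (hp : p < α)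
    (hq : α < q) (hFp : F f α < F f p) (hFq : F f α < F f q) (hg : Continuous g)
    (hgf : ∀ x ∈ Icc p q, g x = f x) (h : IntSol N g α u) : ∀ r, 0 ≤ r → u r ∈ Ioo p q := by
  by_contra! hcon
  obtain ⟨r, hr, hout⟩ := hcon
  have hsub : Icc p q ⊆ J := hf.conn.out hpJ hqJ
  let S := Icc 0 r ∩ u ⁻¹' (Ioo p q)ᶜ
  have hS : IsCompact S :=
    isCompact_Icc.inter_right (isOpen_Ioo.isClosed_compl.preimage h.cont)
  obtain ⟨t, ht, hmin⟩ := hS.exists_isMinOn ⟨r, ⟨hr, le_rfl⟩, hout⟩ continuous_id.continuousOn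
  have hlt : ∀ s, 0 ≤ s → s < t → u s ∈ Ioo p q := by
    intro s hs hst
    by_contra hns
    have := isMinOn_iff.1 hmin s ⟨⟨hs, hst.le.trans ht.1.2⟩, hns⟩
    simp at this; linarith
  have ht0 : 0 < t := by
    rcases ht.1.1.lt_or_eq with h' | h'
    · exact h'
    · exact absurd (by rw [← h', h.init]; exact ⟨hp, hq⟩) ht.2
  have hcl : u t ∈ Icc p q := by
    have hlim : Tendsto u (𝓝[<] t) (𝓝 (u t)) := h.cont.continuousAt.continuousWithinAt
    refine isClosed_Icc.mem_of_tendsto hlim ?_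
    filter_upwards [Ioo_mem_nhdsLT ht0] with s hs
    exact Ioo_subset_Icc_self (hlt s hs.1.le hs.2)
  have hmem : ∀ s ∈ Icc 0 t, u s ∈ Icc p q := by
    intro s hs
    rcases hs.2.lt_or_eq with h' | h'
    · exact Ioo_subset_Icc_self (hlt s hs.1 h')
    · rw [h']; exact hcl
  have hvc := velocity_continuous (N := N) hg h.cont
  have hN' : (2 : ℝ) ≤ N := by exact_mod_cast hN
  have hE : energy f u (velocity N g u) t ≤ energy f u (velocity N g u) 0 := by
    refine le_of_deriv_nonpos (g' := fun r => -(((N : ℝ) - 1) / r * velocity N g u r ^ 2))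
      ht0.le ?_ ?_ ?_
    · intro s hs
      have h1 : ContinuousAt (fun x => F f (u x)) s :=
        ContinuousAt.comp (hf.continuousAt_F (hsub (hmem s hs))) h.cont.continuousAt
      exact (((hvc.continuousAt.pow 2).div_const 2).add h1).continuousWithinAt
    · intro s hs
      have hm := hmem s (Ioo_subset_Icc_self hs)
      have h1 := (hf.hasDerivAt_F (hsub hm)).comp s (h.hasDerivAt hg s)
      have h2 := (((velocity_hasDerivAt hN hg h.cont hs.1).pow 2).div_const 2).add h1
      refine h2.congr_deriv ?_
      rw [hgf _ hm]; push_cast; ring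
    · intro s hs
      have : 0 ≤ ((N : ℝ) - 1) / s * velocity N g u s ^ 2 :=
        mul_nonneg (div_nonneg (by linarith) hs.1.le) (sq_nonneg _)
      linarith
  have h0 : energy f u (velocity N g u) 0 = F f α := by
    simp [energy, velocity_zero, h.init]
  have h1 := F_le_energy (f := f) (u := u) (v := velocity N g u) t
  have h2 : u t = p ∨ u t = q := by
    by_contra! hne
    exact ht.2 ⟨lt_of_le_of_ne hcl.1 hne.1.symm, lt_of_le_of_ne hcl.2 hne.2⟩
  rcases h2 with h2 | h2 <;> rw [h2] at h1 <;> linarith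

lemma IntSol.traj (hN : 2 ≤ N) (hf : Nonlin f J) (hpJ : p ∈ J) (hqJ : q ∈ J) (hp : p < α)
    (hq : α < q) (hFp : F f α < F f p) (hFq : F f α < F f q) (hg : Continuous g)
    (hgf : ∀ x ∈ Icc p q, g x = f x) (h : IntSol N g α u) :
    Traj N f J u (velocity N g u) := by
  have hm := h.mem_Ioo hN hf hpJ hqJ hp hq hFp hFq hg hgf
  have hsub : Icc p q ⊆ J := hf.conn.out hpJ hqJ
  refine ⟨fun r hr => hsub (Ioo_subset_Icc_self (hm r hr)), fun r _ => h.hasDerivAt hg r, ?_,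
    h.cont, velocity_continuous hg h.cont, velocity_zero⟩
  intro r hr
  have := velocity_hasDerivAt hN hg h.cont hr
  rwa [hgf _ (Ioo_subset_Icc_self (hm r hr.le))] at this

lemma Traj.mem_Ioo (hN : 2 ≤ N) (hf : Nonlin f J) (hp : p < u 0)
    (hq : u 0 < q) (hFp : F f (u 0) < F f p) (hFq : F f (u 0) < F f q) (h : Traj N f J u v) :
    ∀ r, 0 ≤ r → u r ∈ Ioo p q := by
  intro r hr
  by_contra hout
  have hE : ∀ t, 0 ≤ t → F f (u t) ≤ F f (u 0) := fun t ht =>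
    (F_le_energy t).trans ((h.energy_le hN hf le_rfl ht).trans (energy_init h).le)
  have hcases : u r ≤ p ∨ q ≤ u r := by
    by_contra! hne; exact hout hne
  rcases hcases with hc | hc
  · obtain ⟨t, ht, -, hut, -⟩ := exists_first_hit h.contu hr hp hc
    have := hE t ht.le
    rw [hut] at this; linarith
  · obtain ⟨t, ht, -, hut, -⟩ := exists_first_hit (u := fun x => -u x) h.contu.neg hr
      (neg_lt_neg hq) (neg_le_neg hc)
    have := hE t ht.le
    rw [show u t = q by linarith] at this; linarith

lemma Traj.velocity_eq (hN : 2 ≤ N) (hg : Continuous g) (h : Traj N f J u v)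
    (hgf : ∀ r, 0 ≤ r → g (u r) = f (u r)) {r : ℝ} (hr : 0 ≤ r) :
    velocity N g (fun x => u |x|) r = v r := by
  rcases hr.eq_or_lt with rfl | hr
  · rw [velocity_zero, h.v_zero]
  rw [BoundState.velocity_eq hr]
  have h1 : ∫ s in (0 : ℝ)..r, -(s ^ (N - 1) * g (u |s|)) =
      r ^ (N - 1) * v r - 0 ^ (N - 1) * v 0 := by
    refine intervalIntegral.integral_eq_sub_of_hasDerivAt_of_le (f := fun x => x ^ (N - 1) * v x)
      hr.le ?_ ?_ ?_
    · exact ((continuous_pow _).mul h.contv).continuousOn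
    · intro s hs
      rw [abs_of_pos hs.1, hgf s hs.1.le]
      exact h.hasDerivAt_pow_mul hN hs.1
    · apply Continuous.intervalIntegrable
      have := h.contu
      fun_prop
  rw [h.v_zero, mul_zero, sub_zero, intervalIntegral.integral_neg] at h1
  rw [h1, mul_comm, mul_div_assoc, div_self (pow_ne_zero _ hr.ne'), mul_one]

lemma velocity_even_neg (w : ℝ → ℝ) (r : ℝ) :
    velocity N g (fun x => w |x|) (-r) = -velocity N g (fun x => w |x|) r := by
  unfold velocity
  simp

/-- The compactness results concern functions on the whole line; the even extension turns a
trajectory on `[0, ∞)` into such a function, its velocity being odd. -/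
lemma Traj.intSol (hN : 2 ≤ N) (hg : Continuous g) (h : Traj N f J u v)
    (hgf : ∀ r, 0 ≤ r → g (u r) = f (u r)) : IntSol N g (u 0) (fun x => u |x|) := by
  have hcu : Continuous fun x => u |x| := h.contu.comp continuous_abs
  have hvc := velocity_continuous (N := N) hg hcu
  have hpos : ∀ r, 0 ≤ r → u r = u 0 + ∫ s in (0 : ℝ)..r, velocity N g (fun x => u |x|) s := by
    intro r hr
    have : ∫ s in (0 : ℝ)..r, velocity N g (fun x => u |x|) s = u r - u 0 := by
      refine intervalIntegral.integral_eq_sub_of_hasDerivAt_of_le hr h.contu.continuousOn ?_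
        (hvc.intervalIntegrable _ _)
      intro s hs
      rw [h.velocity_eq hN hg hgf hs.1.le]
      exact h.hu s hs.1
    linarith
  refine ⟨hcu, fun r => ?_⟩
  rcases le_total 0 r with hr | hr
  · simp only [abs_of_nonneg hr]; exact hpos r hr
  · simp only [abs_of_nonpos hr]
    rw [hpos (-r) (by linarith)]
    congr 1
    have := intervalIntegral.integral_comp_neg (a := 0) (b := r)
      (fun s => velocity N g (fun x => u |x|) s)
    simp only [velocity_even_neg, intervalIntegral.integral_neg, neg_zero] at this
    rw [intervalIntegral.integral_symm, ← this, neg_neg]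

/-- Since `f` need not be Lipschitz at zero, a trajectory can leave a double zero again. Freezing it
at the first double zero selects one continuation; the equation survives because `f 0 = 0`, so that
`v` and `v'` both vanish there. -/
lemma Traj.absorbing (hf : Nonlin f J) (h : Traj N f J u v) (h0 : u 0 ≠ 0) :
    ∃ u' v', Sol N f J (u 0) u' v' := by
  by_cases hz : ∃ r, 0 ≤ r ∧ u r = 0 ∧ v r = 0
  swap
  · push Not at hz
    exact ⟨u, v, h, rfl, fun r hr hu hv => absurd hv (hz r hr hu)⟩
  obtain ⟨r₁, hr₁, hu₁, hv₁⟩ := hz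
  let S := Icc 0 r₁ ∩ {r | u r = 0 ∧ v r = 0}
  have hS : IsCompact S := isCompact_Icc.inter_right
    ((isClosed_eq h.contu continuous_const).inter (isClosed_eq h.contv continuous_const))
  obtain ⟨d, ⟨hdI, hud, hvd⟩, hmin⟩ :=
    hS.exists_isMinOn ⟨r₁, ⟨hr₁, le_rfl⟩, hu₁, hv₁⟩ continuous_id.continuousOn
  have hd0 : 0 < d := by
    rcases hdI.1.lt_or_eq with h' | h'
    · exact h'
    · rw [← h'] at hud; exact absurd hud h0
  have hlt : ∀ r, 0 ≤ r → r < d → ¬(u r = 0 ∧ v r = 0) := by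
    intro r hr hrd hcon
    have := isMinOn_iff.1 hmin r ⟨⟨hr, hrd.le.trans hdI.2⟩, hcon⟩
    simp at this; linarith
  have hder : ∀ (w w' : ℝ → ℝ), w d = 0 → w' d = 0 →
      (∀ r, 0 < r → HasDerivAt w (w' r) r) → ∀ r, 0 < r →
      HasDerivAt (fun r => w (min r d)) (w' (min r d)) r := by
    intro w w' hw hw' hd r hr
    rcases lt_trichotomy r d with hrd | hrd | hrd
    · rw [min_eq_left hrd.le]
      refine (hd r hr).congr_of_eventuallyEq ?_
      filter_upwards [gt_mem_nhds hrd] with x hx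
      rw [min_eq_left (le_of_lt hx)]
    · subst hrd
      rw [min_self, hw']
      have h1 : HasDerivWithinAt (fun x => w (min x r)) 0 (Iic r) r := by
        have := (hd r hr).hasDerivWithinAt (s := Iic r)
        rw [hw'] at this
        exact this.congr (fun x hx => by rw [min_eq_left hx]) (by simp)
      have h2 : HasDerivWithinAt (fun x => w (min x r)) 0 (Ici r) r :=
        (hasDerivWithinAt_const r (Ici r) (0 : ℝ)).congr
          (fun x hx => by rw [min_eq_right hx, hw]) (by simp [hw])
      have := h1.union h2
      rw [Iic_union_Ici] at this
      exact this.hasDerivAt univ_mem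
    · rw [min_eq_right hrd.le, hw']
      refine (hasDerivAt_const r (0 : ℝ)).congr_of_eventuallyEq ?_
      filter_upwards [lt_mem_nhds hrd] with x hx
      rw [min_eq_right (le_of_lt hx), hw]
  refine ⟨fun r => u (min r d), fun r => v (min r d), ⟨?_, ?_, ?_, ?_, ?_, ?_⟩, ?_, ?_⟩
  · intro r hr; exact h.mem _ (le_min hr hd0.le)
  · exact hder u v hud hvd h.hu
  · intro r hr
    have := hder v (fun r => -(((N : ℝ) - 1) / r * v r) - f (u r)) hvd
      (by simp [hud, hvd, hf.zero]) h.hv r hr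
    refine this.congr_deriv ?_
    rcases le_total r d with hrd | hrd
    · rw [min_eq_left hrd]
    · rw [min_eq_right hrd, hvd]; simp
  · exact h.contu.comp (by fun_prop)
  · exact h.contv.comp (by fun_prop)
  · rw [min_eq_left hd0.le, h.v_zero]
  · rw [min_eq_left hd0.le]
  · intro r₀ hr₀ h1 h2 r hr
    have hdr : d ≤ r₀ := by
      by_contra! hcon
      rw [min_eq_left hcon.le] at h1 h2
      exact hlt r₀ hr₀ hcon ⟨h1, h2⟩
    rw [min_eq_right (hdr.trans hr)]; exact ⟨hud, hvd⟩

lemma exists_sol (hN : 2 ≤ N) (hf : Nonlin f J) (hc : Confining f J) (hα : α ∈ J) (h0 : α ≠ 0) :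
    ∃ u v, Sol N f J α u v := by
  obtain ⟨p, hp, q, hq, h1, h2, h3, h4, h5, h6⟩ := hc α hα
  obtain ⟨g, hg, ⟨B, hB⟩, hgf⟩ := exists_cut hf hp hq (by linarith)
  obtain ⟨w, hw⟩ := exists_intSol N hg.continuous hB α
  have ht := hw.traj hN hf hp hq h1 h3 h5 h6 hg.continuous hgf
  obtain ⟨u, v, h⟩ := ht.absorbing hf (by rwa [hw.init])
  rw [hw.init] at h
  exact ⟨u, v, h⟩

lemma nonpos_of_gronwall {G G' : ℝ → ℝ} {a b C : ℝ} (hab : a ≤ b) (hc : ContinuousOn G (Icc a b))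
    (hd : ∀ x ∈ Ioo a b, HasDerivAt G (G' x) x) (hle : ∀ x ∈ Ioo a b, G' x ≤ C * G x)
    (ha : G a ≤ 0) : G b ≤ 0 := by
  have h := le_of_deriv_nonpos (g := fun x => G x * Real.exp (-C * x))
    (g' := fun x => G' x * Real.exp (-C * x) + G x * (Real.exp (-C * x) * -C)) hab
    (hc.mul (by fun_prop)) ?_ ?_
  · have h1 : G a * Real.exp (-C * a) ≤ 0 :=
      mul_nonpos_of_nonpos_of_nonneg ha (Real.exp_pos _).le
    have h2 : G b * Real.exp (-C * b) ≤ 0 := h.trans h1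
    by_contra! hcon
    linarith [mul_pos hcon (Real.exp_pos (-C * b))]
  · intro x hx
    have : HasDerivAt (fun x => Real.exp (-C * x)) (Real.exp (-C * x) * -C) x := by
      have := ((hasDerivAt_id x).const_mul (-C)).exp
      simpa using this
    exact (hd x hx).mul this
  · intro x hx
    have := hle x hx
    have he := Real.exp_pos (-C * x)
    nlinarith

lemma exists_abs_le_near (hf : Nonlin f J) {x : ℝ} (hx : x ∈ J) :
    ∃ η > 0, ∃ B ≥ 0, Icc (x - η) (x + η) ⊆ J ∧
      (∀ s ∈ Icc (x - η) (x + η), |f s| ≤ B) ∧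
      ∀ s ∈ Icc (x - η) (x + η), ∀ t ∈ Icc (x - η) (x + η), |F f s - F f t| ≤ B * |s - t| := by
  obtain ⟨η, hη, hsub⟩ := Metric.isOpen_iff.1 hf.isOpen x hx
  have hI : Icc (x - η / 2) (x + η / 2) ⊆ J := by
    intro s hs
    apply hsub
    rw [Metric.mem_ball, Real.dist_eq, abs_lt]
    constructor <;> linarith [hs.1, hs.2]
  obtain ⟨B, hB⟩ := isCompact_Icc.exists_bound_of_continuousOn (hf.cont.mono hI)
  have hB0 : 0 ≤ B := (norm_nonneg _).trans (hB x ⟨by linarith, by linarith⟩)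
  refine ⟨η / 2, by positivity, B, hB0, hI, hB, fun s hs t ht => ?_⟩
  exact (convex_Icc _ _).norm_image_sub_le_of_norm_hasDerivWithin_le
    (fun z hz => (hf.hasDerivAt_F (hI hz)).hasDerivWithinAt) hB ht hs

lemma exists_Icc_of_eventually {P : ℝ → Prop} {x : ℝ} (h : ∀ᶠ r in 𝓝 x, P r) :
    ∃ ε > 0, ∀ r ∈ Icc x (x + ε), P r := by
  obtain ⟨ε, hε, h⟩ := Metric.eventually_nhds_iff.1 h
  refine ⟨ε / 2, by positivity, fun r hr => h ?_⟩
  rw [Real.dist_eq, abs_lt]; constructor <;> linarith [hr.1, hr.2]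

/-- Gronwall for the squared distance, with `f` Lipschitz near a nonzero value. The friction term
has a favourable sign and is dropped, so the argument includes `x = 0`, where its coefficient is
singular. -/
lemma Traj.eq_right_of_ne_zero (hN : 2 ≤ N) (hf : Nonlin f J) (h₁ : Traj N f J u₁ v₁)
    (h₂ : Traj N f J u₂ v₂) {x : ℝ} (hx : 0 ≤ x) (hu : u₁ x = u₂ x) (hv : v₁ x = v₂ x)
    (hne : u₁ x ≠ 0) : ∃ ε > 0, ∀ r ∈ Icc x (x + ε), u₁ r = u₂ r ∧ v₁ r = v₂ r := by
  have hN' : (2 : ℝ) ≤ N := by exact_mod_cast hN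
  obtain ⟨K, t, ht, hK⟩ := hf.lip (x := u₁ x) ⟨h₁.mem x hx, hne⟩
  have ht' : t ∈ 𝓝 (u₁ x) := by
    rw [IsOpen.nhdsWithin_eq (hf.isOpen.sdiff isClosed_singleton) ⟨h₁.mem x hx, hne⟩] at ht
    exact ht
  have h1 : ∀ᶠ r in 𝓝 x, u₁ r ∈ t := h₁.contu.continuousAt.eventually ht'
  have h2 : ∀ᶠ r in 𝓝 x, u₂ r ∈ t := h₂.contu.continuousAt.eventually (by rwa [← hu])
  obtain ⟨ε, hε, hmem⟩ := exists_Icc_of_eventually (h1.and h2)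
  refine ⟨ε, hε, fun r hr => ?_⟩
  let G : ℝ → ℝ := fun r => (u₁ r - u₂ r) ^ 2 + (v₁ r - v₂ r) ^ 2
  have hG : G r ≤ 0 := by
    refine nonpos_of_gronwall (a := x) (C := 1 + K) hr.1 (G' := fun r =>
      2 * (u₁ r - u₂ r) * (v₁ r - v₂ r) + 2 * (v₁ r - v₂ r) *
        ((-(((N : ℝ) - 1) / r * v₁ r) - f (u₁ r)) - (-(((N : ℝ) - 1) / r * v₂ r) - f (u₂ r))))
      ?_ ?_ ?_ ?_
    · exact (((h₁.contu.sub h₂.contu).pow 2).add ((h₁.contv.sub h₂.contv).pow 2)).continuousOn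
    · intro s hs
      have hs0 : 0 < s := hx.trans_lt hs.1
      refine ((((h₁.hu s hs0).sub (h₂.hu s hs0)).pow 2).add
        (((h₁.hv s hs0).sub (h₂.hv s hs0)).pow 2)).congr_deriv ?_
      simp only [Pi.sub_apply]
      push_cast; ring
    · intro s hs
      have hs0 : 0 < s := hx.trans_lt hs.1
      obtain ⟨hm1, hm2⟩ := hmem s ⟨hs.1.le, hs.2.le.trans hr.2⟩
      have hL := hK.dist_le_mul _ hm1 _ hm2
      rw [Real.dist_eq, Real.dist_eq] at hL
      set d := u₁ s - u₂ s
      set e := v₁ s - v₂ s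
      have hfr : 0 ≤ ((N : ℝ) - 1) / s * e ^ 2 :=
        mul_nonneg (div_nonneg (by linarith) hs0.le) (sq_nonneg _)
      have h3 : -(e * (f (u₁ s) - f (u₂ s))) ≤ K * (|d| * |e|) := by
        refine (neg_le_abs _).trans ?_
        rw [abs_mul]
        nlinarith [abs_nonneg e]
      have h4 : 2 * (|d| * |e|) ≤ d ^ 2 + e ^ 2 := by
        rw [← sq_abs d, ← sq_abs e]; nlinarith [sq_nonneg (|d| - |e|)]
      have h5 : d * e ≤ |d| * |e| := by rw [← abs_mul]; exact le_abs_self _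
      have hK0 : (0 : ℝ) ≤ K := K.2
      have h6 : (2 * d * e + 2 * e * ((-(((N : ℝ) - 1) / s * v₁ s) - f (u₁ s)) -
          (-(((N : ℝ) - 1) / s * v₂ s) - f (u₂ s)))) =
          2 * (d * e) + 2 * -(e * (f (u₁ s) - f (u₂ s))) -
          2 * (((N : ℝ) - 1) / s * e ^ 2) := by
        simp only [e]; ring
      have h7 : (K : ℝ) * (2 * (|d| * |e|)) ≤ K * (d ^ 2 + e ^ 2) :=
        mul_le_mul_of_nonneg_left h4 hK0
      change _ ≤ (1 + (K : ℝ)) * (d ^ 2 + e ^ 2)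
      rw [h6]
      linarith
    · simp [G, hu, hv]
  have h3 : (u₁ r - u₂ r) ^ 2 = 0 := by
    nlinarith [sq_nonneg (u₁ r - u₂ r), sq_nonneg (v₁ r - v₂ r)]
  have h4 : (v₁ r - v₂ r) ^ 2 = 0 := by
    nlinarith [sq_nonneg (u₁ r - u₂ r), sq_nonneg (v₁ r - v₂ r)]
  exact ⟨by simpa [sub_eq_zero] using h3, by simpa [sub_eq_zero] using h4⟩

/-- The differential inequality for the squared distance in the variables `(u, E)`: `d`, `e` and `D`
are the differences of position, energy and potential, and `n` stands for `N - 1`. -/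
lemma chart_estimate {n s x m B v₁ v₂ d e D : ℝ} (hn : 0 ≤ n) (hx : 0 < x) (hxs : x ≤ s)
    (hm : 0 < m) (hB : 0 ≤ B) (hmv : m < |v₁ + v₂|) (hD : |D| ≤ B * |d|)
    (hk : (v₁ - v₂) * (v₁ + v₂) = 2 * (e - D)) :
    2 * d * (v₁ - v₂) + 2 * e * (-(n / s * v₁ ^ 2) - -(n / s * v₂ ^ 2)) ≤
      ((2 / m) * (1 + 2 * B) + 2 * n / x * B) * (d ^ 2 + e ^ 2) := by
  have hw : |v₁ - v₂| ≤ (2 / m) * (|e| + B * |d|) := by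
    have a1 : |v₁ - v₂| * |v₁ + v₂| = 2 * |e - D| := by
      rw [← abs_mul, hk, abs_mul]; norm_num
    have a2 : |e - D| ≤ |e| + |D| := abs_sub _ _
    rw [div_mul_eq_mul_div, le_div_iff₀ hm]
    have : |v₁ - v₂| * m ≤ |v₁ - v₂| * |v₁ + v₂| :=
      mul_le_mul_of_nonneg_left hmv.le (abs_nonneg _)
    linarith
  have h4 : 2 * (|d| * |e|) ≤ d ^ 2 + e ^ 2 := by
    rw [← sq_abs d, ← sq_abs e]; nlinarith [sq_nonneg (|d| - |e|)]
  have h5 : 2 * d * (v₁ - v₂) ≤ (2 / m) * (1 + 2 * B) * (d ^ 2 + e ^ 2) := by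
    have b1 : d * (v₁ - v₂) ≤ |d| * |v₁ - v₂| := by rw [← abs_mul]; exact le_abs_self _
    have b2 : |d| * |v₁ - v₂| ≤ |d| * ((2 / m) * (|e| + B * |d|)) :=
      mul_le_mul_of_nonneg_left hw (abs_nonneg _)
    have b3 : |d| * ((2 / m) * (|e| + B * |d|)) =
        (2 / m) * (|d| * |e|) + (2 / m) * (B * d ^ 2) := by rw [← sq_abs d]; ring
    have b4 : (2 / m) * (2 * (|d| * |e|)) ≤ (2 / m) * (d ^ 2 + e ^ 2) :=
      mul_le_mul_of_nonneg_left h4 (by positivity)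
    have b5 : 0 ≤ (2 / m) * (B * e ^ 2) := by positivity
    have b6 : (2 / m) * (1 + 2 * B) * (d ^ 2 + e ^ 2) = (2 / m) * (d ^ 2 + e ^ 2) +
      2 * ((2 / m) * (B * d ^ 2)) + 2 * ((2 / m) * (B * e ^ 2)) := by ring
    linarith
  have h6 : 2 * e * (-(n / s * v₁ ^ 2) - -(n / s * v₂ ^ 2)) ≤
      2 * n / x * B * (d ^ 2 + e ^ 2) := by
    have c0 : 2 * e * (-(n / s * v₁ ^ 2) - -(n / s * v₂ ^ 2)) =
        4 * (n / s) * (e * D - e ^ 2) := by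
      have : v₁ ^ 2 = v₂ ^ 2 + 2 * (e - D) := by rw [← hk]; ring
      rw [this]; ring
    have c1 : e * D ≤ B * (|d| * |e|) := by
      refine (le_abs_self _).trans ?_
      rw [abs_mul]
      have := mul_le_mul_of_nonneg_left hD (abs_nonneg e)
      linarith
    have c2 : n / s ≤ n / x := div_le_div_of_nonneg_left hn hx hxs
    have c3 : 0 ≤ n / s := div_nonneg hn (hx.le.trans hxs)
    have c4 : 0 ≤ B * (2 * (|d| * |e|)) := by positivity
    have c5 : e * D - e ^ 2 ≤ B * (|d| * |e|) := by linarith [sq_nonneg e]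
    rw [c0]
    calc 4 * (n / s) * (e * D - e ^ 2)
        ≤ 4 * (n / s) * (B * (|d| * |e|)) := mul_le_mul_of_nonneg_left c5 (by positivity)
      _ = 2 * (n / s) * (B * (2 * (|d| * |e|))) := by ring
      _ ≤ 2 * (n / x) * (B * (2 * (|d| * |e|))) :=
          mul_le_mul_of_nonneg_right (by linarith) c4
      _ ≤ 2 * (n / x) * (B * (d ^ 2 + e ^ 2)) := by
          refine mul_le_mul_of_nonneg_left (mul_le_mul_of_nonneg_left h4 hB) ?_
          linarith
      _ = _ := by ring
  have : ((2 / m) * (1 + 2 * B) + 2 * n / x * B) * (d ^ 2 + e ^ 2) =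
      (2 / m) * (1 + 2 * B) * (d ^ 2 + e ^ 2) + 2 * n / x * B * (d ^ 2 + e ^ 2) := by ring
  linarith

/-- At a simple zero of `u` the function `f` may fail to be Lipschitz, but `F` is Lipschitz. Hence
`(u, E)` replaces `(u, v)`; the velocities are recovered from `v₁² - v₂²` because `v₁ + v₂` stays
away from zero. -/
lemma Traj.eq_right_of_vel_ne_zero (hN : 2 ≤ N) (hf : Nonlin f J) (h₁ : Traj N f J u₁ v₁)
    (h₂ : Traj N f J u₂ v₂) {x : ℝ} (hx : 0 < x) (hu : u₁ x = u₂ x) (hv : v₁ x = v₂ x)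
    (hne : v₁ x ≠ 0) : ∃ ε > 0, ∀ r ∈ Icc x (x + ε), u₁ r = u₂ r ∧ v₁ r = v₂ r := by
  have hN' : (2 : ℝ) ≤ N := by exact_mod_cast hN
  obtain ⟨η, hη, B, hB0, hsub, -, hBF⟩ := exists_abs_le_near hf (h₁.mem x hx.le)
  have hI : Icc (u₁ x - η) (u₁ x + η) ∈ 𝓝 (u₁ x) :=
    Icc_mem_nhds (by linarith) (by linarith)
  have e1 : ∀ᶠ r in 𝓝 x, u₁ r ∈ Icc (u₁ x - η) (u₁ x + η) :=
    h₁.contu.continuousAt.eventually hI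
  have e2 : ∀ᶠ r in 𝓝 x, u₂ r ∈ Icc (u₁ x - η) (u₁ x + η) :=
    h₂.contu.continuousAt.eventually (by rwa [← hu])
  have hm : 0 < |v₁ x| := abs_pos.2 hne
  have e3 : ∀ᶠ r in 𝓝 x, |v₁ x| < |v₁ r + v₂ r| := by
    have : Tendsto (fun r => |v₁ r + v₂ r|) (𝓝 x) (𝓝 |v₁ x + v₂ x|) :=
      (h₁.contv.add h₂.contv).abs.tendsto x
    refine this.eventually_const_lt ?_
    rw [← hv, ← two_mul, abs_mul, abs_of_pos (by norm_num : (0 : ℝ) < 2)]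
    linarith
  obtain ⟨ε, hε, hmem⟩ := exists_Icc_of_eventually ((e1.and e2).and e3)
  refine ⟨ε, hε, fun r hr => ?_⟩
  set m := |v₁ x| with hmdef
  set E₁ := energy f u₁ v₁ with hE₁
  set E₂ := energy f u₂ v₂ with hE₂
  have hkey : ∀ s, (v₁ s - v₂ s) * (v₁ s + v₂ s) =
      2 * ((E₁ s - E₂ s) - (F f (u₁ s) - F f (u₂ s))) := by
    intro s; simp only [E₁, E₂, energy]; ring
  let G : ℝ → ℝ := fun r => (u₁ r - u₂ r) ^ 2 + (E₁ r - E₂ r) ^ 2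
  let C : ℝ := (2 / m) * (1 + 2 * B) + 2 * ((N : ℝ) - 1) / x * B
  have hG : G r ≤ 0 := by
    refine nonpos_of_gronwall (a := x) (C := C) hr.1 (G' := fun r =>
      2 * (u₁ r - u₂ r) * (v₁ r - v₂ r) + 2 * (E₁ r - E₂ r) *
        (-(((N : ℝ) - 1) / r * v₁ r ^ 2) - -(((N : ℝ) - 1) / r * v₂ r ^ 2)))
      ?_ ?_ ?_ ?_
    · have c1 := (h₁.continuousOn_energy hf).mono
        (fun y hy => hx.le.trans hy.1 : Icc x r ⊆ Ici 0)
      have c2 := (h₂.continuousOn_energy hf).mono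
        (fun y hy => hx.le.trans hy.1 : Icc x r ⊆ Ici 0)
      exact ((h₁.contu.sub h₂.contu).pow 2).continuousOn.add ((c1.sub c2).pow 2)
    · intro s hs
      have hs0 : 0 < s := hx.trans hs.1
      refine ((((h₁.hu s hs0).sub (h₂.hu s hs0)).pow 2).add
        (((h₁.hasDerivAt_energy hf hs0).sub (h₂.hasDerivAt_energy hf hs0)).pow 2)).congr_deriv ?_
      simp only [Pi.sub_apply, E₁, E₂]
      push_cast; ring
    · intro s hs
      have hs0 : 0 < s := hx.trans hs.1
      obtain ⟨⟨hm1, hm2⟩, hm3⟩ := hmem s ⟨hs.1.le, hs.2.le.trans hr.2⟩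
      have hFd := hBF _ hm1 _ hm2
      exact chart_estimate (by linarith) hx hs.1.le hm hB0 hm3 hFd (hkey s)
    · simp [G, hu, hv, E₁, E₂, energy]
  have hGz : (u₁ r - u₂ r) ^ 2 + (E₁ r - E₂ r) ^ 2 ≤ 0 := hG
  have h3 : (u₁ r - u₂ r) ^ 2 = 0 := by
    nlinarith [sq_nonneg (u₁ r - u₂ r), sq_nonneg (E₁ r - E₂ r)]
  have h4 : (E₁ r - E₂ r) ^ 2 = 0 := by
    nlinarith [sq_nonneg (u₁ r - u₂ r), sq_nonneg (E₁ r - E₂ r)]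
  have h3' : u₁ r = u₂ r := by simpa [sub_eq_zero] using h3
  have h4' : E₁ r - E₂ r = 0 := by simpa using h4
  refine ⟨h3', ?_⟩
  have hk := hkey r
  rw [h4', h3', sub_self, sub_zero, mul_zero] at hk
  have hs := (hmem r hr).2
  have : v₁ r + v₂ r ≠ 0 := by
    intro h0; rw [h0, abs_zero] at hs; linarith
  have := (mul_eq_zero.1 hk).resolve_right this
  linarith

/-- Uniqueness up to the first double zero. -/
lemma Traj.unique (hN : 2 ≤ N) (hf : Nonlin f J) (h₁ : Traj N f J u₁ v₁)
    (h₂ : Traj N f J u₂ v₂) (h0 : u₁ 0 = u₂ 0) (hne : u₁ 0 ≠ 0) {R : ℝ}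
    (hnd : ∀ r ∈ Ico 0 R, ¬(u₁ r = 0 ∧ v₁ r = 0)) :
    ∀ r ∈ Icc 0 R, u₁ r = u₂ r ∧ v₁ r = v₂ r := by
  rcases lt_or_ge R 0 with hR | hR
  · intro r hr; linarith [hr.1, hr.2]
  have hcl : IsClosed ({r | u₁ r = u₂ r ∧ v₁ r = v₂ r} ∩ Icc 0 R) :=
    ((isClosed_eq h₁.contu h₂.contu).inter (isClosed_eq h₁.contv h₂.contv)).inter isClosed_Icc
  refine hcl.Icc_subset_of_forall_exists_gt ⟨h0, by rw [h₁.v_zero, h₂.v_zero]⟩ ?_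
  rintro x ⟨⟨hxu, hxv⟩, hx⟩ y hy
  obtain ⟨ε, hε, heq⟩ : ∃ ε > 0, ∀ r ∈ Icc x (x + ε), u₁ r = u₂ r ∧ v₁ r = v₂ r := by
    by_cases hu : u₁ x = 0
    · have hx0 : 0 < x := by
        rcases hx.1.lt_or_eq with h | h
        · exact h
        · rw [← h] at hu; exact absurd hu hne
      exact h₁.eq_right_of_vel_ne_zero hN hf h₂ hx0 hxu hxv fun hv => hnd x hx ⟨hu, hv⟩
    · exact h₁.eq_right_of_ne_zero hN hf h₂ hx.1 hxu hxv hu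
  refine ⟨min (x + ε) y, heq _ ⟨le_min (by linarith) (le_of_lt hy), min_le_left _ _⟩,
    lt_min (by linarith) hy, min_le_right _ _⟩

/-- Continuous dependence on the initial value, up to the first double zero. -/
lemma Sol.continuous_dependence (hN : 2 ≤ N) (hf : Nonlin f J) (hc : Confining f J)
    {U V : ℝ → ℝ → ℝ} (hS : ∀ a ∈ J, a ≠ 0 → Sol N f J a (U a) (V a)) (hα : α ∈ J) (h0 : α ≠ 0)
    {R : ℝ} (hnd : ∀ r ∈ Ico 0 R, ¬(U α r = 0 ∧ V α r = 0)) {ε : ℝ} (hε : 0 < ε) :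
    ∀ᶠ a in 𝓝 α, ∀ r ∈ Icc 0 R, |U a r - U α r| < ε ∧ |V a r - V α r| < ε := by
  by_contra hcon
  obtain ⟨p, hp, q, hq, h1, h2, h3, h4, h5, h6⟩ := hc α hα
  obtain ⟨g, hg, ⟨B, hB⟩, hgf⟩ := exists_cut hf hp hq (by linarith)
  have hev : ∀ᶠ a in 𝓝 α, a ∈ J ∧ a ≠ 0 ∧ p < a ∧ a < q ∧ F f a < F f p ∧ F f a < F f q := by
    have hFc := hf.continuousAt_F hα
    filter_upwards [hf.isOpen.mem_nhds hα, isOpen_ne.mem_nhds h0, lt_mem_nhds h1, gt_mem_nhds h3,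
      hFc.eventually_lt_const h5, hFc.eventually_lt_const h6] with a b1 b2 b3 b4 b5 b6
    exact ⟨b1, b2, b3, b4, b5, b6⟩
  -- A sequence of bad parameters tending to `α` has a subsequence whose solutions converge, with
  -- their velocities, to a solution `w` starting at `α`. Uniqueness up to `R` identifies `w` with
  -- `U α`, which contradicts badness.
  obtain ⟨a, ha, hbad⟩ := Filter.exists_seq_forall_of_frequently
    ((not_eventually.1 hcon).and_eventually hev)
  have hin : ∀ b, b ∈ J → b ≠ 0 → p < b → b < q → F f b < F f p → F f b < F f q →
      ∀ r, 0 ≤ r → g (U b r) = f (U b r) := by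
    intro b b1 b2 b3 b4 b5 b6 r hr
    have hb := hS b b1 b2
    have hi := hb.init
    exact hgf _ (Ioo_subset_Icc_self
      (hb.toTraj.mem_Ioo hN hf (by rwa [hi]) (by rwa [hi]) (by rwa [hi]) (by rwa [hi]) r hr))
  have hint : ∀ n, IntSol N g (a n) (fun x => U (a n) |x|) := by
    intro n
    obtain ⟨-, b1, b2, b3, b4, b5, b6⟩ := hbad n
    have := (hS (a n) b1 b2).toTraj.intSol hN hg.continuous (hin (a n) b1 b2 b3 b4 b5 b6)
    rwa [(hS (a n) b1 b2).init] at this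
  obtain ⟨φ, hφ, w, hw, hclose⟩ := exists_subseq_close hg hB ha hint
  have htw := hw.traj hN hf hp hq h1 h3 h5 h6 hg.continuous hgf
  have hSα := hS α hα h0
  have huniq := hSα.toTraj.unique hN hf htw (by rw [hSα.init, hw.init]) (by rwa [hSα.init]) hnd
  obtain ⟨n, hn⟩ := (hclose R ε hε).exists
  obtain ⟨hb, b1, b2, b3, b4, b5, b6⟩ := hbad (φ n)
  apply hb
  intro r hr
  have e1 := hn r hr
  have e2 := huniq r hr
  have e3 := (hS _ b1 b2).toTraj.velocity_eq hN hg.continuous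
    (hin _ b1 b2 b3 b4 b5 b6) hr.1
  rw [e3, abs_of_nonneg hr.1] at e1
  rw [e2.1, e2.2]
  exact e1

end

end BoundState

namespace BoundState

/-! ### Sign changes -/

/-- There are `n` sign changes of `u` in `(0, r]`, the last one being completed at `r`. -/
def Alt (u : ℝ → ℝ) : ℕ → ℝ → Prop
  | 0, r => 0 < r
  | n + 1, r => ∃ s, s < r ∧ Alt u n s ∧ u s * u r < 0

lemma Alt.pos {u : ℝ → ℝ} : ∀ {n : ℕ} {r : ℝ}, Alt u n r → 0 < r
  | 0, _, h => h
  | _ + 1, _, ⟨_, hs, h, _⟩ => (Alt.pos h).trans hs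

lemma signChangesAtLeast_iff {u : ℝ → ℝ} {n : ℕ} :
    SignChangesAtLeast u n ↔ ∃ r, Alt u n r := by
  constructor
  · rintro ⟨r, hr, hpos, hs⟩
    have : ∀ i : ℕ, ∀ hi : i < n + 1, Alt u i (r ⟨i, hi⟩) := by
      intro i
      induction i with
      | zero => intro hi; exact hpos _
      | succ i ih =>
        intro hi
        refine ⟨r ⟨i, by omega⟩, hr (by simp [Fin.lt_def]), ih _, ?_⟩
        exact hs ⟨i, by omega⟩
    exact ⟨_, this n (by omega)⟩
  · rintro ⟨r, h⟩
    suffices H : ∀ n r, Alt u n r → ∃ ρ : Fin (n + 1) → ℝ, StrictMono ρ ∧ (∀ i, 0 < ρ i) ∧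
        (∀ i : Fin n, u (ρ i.castSucc) * u (ρ i.succ) < 0) ∧ ρ (Fin.last n) = r by
      obtain ⟨ρ, h1, h2, h3, -⟩ := H n r h
      exact ⟨ρ, h1, h2, h3⟩
    clear h
    intro n
    induction n with
    | zero =>
      intro r h
      refine ⟨fun _ => r, fun a b hab => absurd hab ?_, fun _ => h, fun i => i.elim0, rfl⟩
      rw [Fin.lt_def]; omega
    | succ n ih =>
      rintro r ⟨s, hs, h, hu⟩
      obtain ⟨ρ, h1, h2, h3, h4⟩ := ih s h
      refine ⟨Fin.snoc ρ r, ?_, ?_, ?_, by simp⟩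
      · rw [Fin.strictMono_iff_lt_succ]
        intro i
        refine Fin.lastCases ?_ (fun j => ?_) i
        · simp [h4, hs]
        · rw [← Fin.castSucc_succ, Fin.snoc_castSucc, Fin.snoc_castSucc]
          exact h1 (Fin.castSucc_lt_succ)
      · intro i
        refine Fin.lastCases ?_ (fun j => ?_) i
        · simp [(h.pos).trans hs]
        · simp [h2 j]
      · intro i
        refine Fin.lastCases ?_ (fun j => ?_) i
        · simp [h4, hu]
        · rw [← Fin.castSucc_succ, Fin.snoc_castSucc, Fin.snoc_castSucc]
          exact h3 j

lemma alt_neg {u : ℝ → ℝ} : ∀ {n : ℕ} {r : ℝ}, Alt (-u) n r ↔ Alt u n r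
  | 0, _ => Iff.rfl
  | n + 1, r => by
    simp only [Alt, Pi.neg_apply, neg_mul_neg]
    exact exists_congr fun s => and_congr_right fun _ => and_congr_left fun _ => alt_neg

lemma signChangesAtLeast_neg {u : ℝ → ℝ} {n : ℕ} :
    SignChangesAtLeast (-u) n ↔ SignChangesAtLeast u n := by
  simp only [signChangesAtLeast_iff, alt_neg]

lemma SignChangesAtLeast.of_succ {u : ℝ → ℝ} {n : ℕ} (h : SignChangesAtLeast u (n + 1)) :
    SignChangesAtLeast u n := by
  rw [signChangesAtLeast_iff] at *
  obtain ⟨r, s, -, hs, -⟩ := h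
  exact ⟨s, hs⟩

lemma SignChangesAtLeast.mono {u : ℝ → ℝ} {m n : ℕ} (hmn : m ≤ n)
    (h : SignChangesAtLeast u n) : SignChangesAtLeast u m := by
  induction n, hmn using Nat.le_induction with
  | base => exact h
  | succ n _ ih => exact ih h.of_succ

/-- The number of sign changes is lower semicontinuous under pointwise convergence. -/
lemma Alt.eventually {ι : Type*} {l : Filter ι} {W : ι → ℝ → ℝ} {u : ℝ → ℝ} :
    ∀ {n : ℕ} {r : ℝ}, Alt u n r → (∀ s ∈ Ioc 0 r, Tendsto (fun i => W i s) l (𝓝 (u s))) →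
      ∀ᶠ i in l, Alt (W i) n r
  | 0, _, h, _ => Eventually.of_forall fun _ => h
  | n + 1, r, ⟨s, hs, h, hu⟩, hW => by
    have h1 := Alt.eventually h fun x hx => hW x ⟨hx.1, hx.2.trans hs.le⟩
    have h2 := ((hW s ⟨h.pos, hs.le⟩).mul (hW r ⟨h.pos.trans hs, le_rfl⟩)).eventually_lt_const hu
    filter_upwards [h1, h2] with i h3 h4 using ⟨s, hs, h3, h4⟩

lemma mul_pos_of_same {a b c : ℝ} (h1 : 0 < a * b) (h2 : 0 < b * c) : 0 < a * c := by
  rcases pos_and_pos_or_neg_and_neg_of_mul_pos h1 with ⟨ha, hb⟩ | ⟨ha, hb⟩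
  · exact mul_pos ha (pos_of_mul_pos_right h2 hb.le)
  · exact mul_pos_of_neg_of_neg ha (by by_contra! hc; nlinarith)

lemma mul_neg_of_same {a b c : ℝ} (h1 : 0 < a * b) (h2 : b * c < 0) : a * c < 0 := by
  have := mul_pos_of_same h1 (c := -c) (by linarith)
  linarith

/-- The maximum over `[a, b]` of a function that vanishes at `a` is a critical point or `b`. -/
lemma exists_critical {w w' : ℝ → ℝ} (hw : Continuous w) (hd : ∀ t, 0 < t → HasDerivAt w (w' t) t)
    {a b r : ℝ} (ha : 0 ≤ a) (har : a < r) (hrb : r ≤ b) (hwa : w a = 0) (hr : w r ≠ 0) :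
    ∃ t, a < t ∧ t ≤ b ∧ 0 < w t * w r ∧ (t < b → w' t = 0) := by
  obtain ⟨t, ht, hmax⟩ := isCompact_Icc.exists_isMaxOn ⟨r, har.le, hrb⟩
    (hw.mul continuous_const : Continuous fun t => w t * w r).continuousOn
  have hpos : 0 < w t * w r := lt_of_lt_of_le (mul_self_pos.2 hr) (isMaxOn_iff.1 hmax r ⟨har.le, hrb⟩)
  have hat : a < t := by
    rcases ht.1.lt_or_eq with h | h
    · exact h
    · rw [← h, hwa, zero_mul] at hpos; exact absurd hpos (lt_irrefl _)
  refine ⟨t, hat, ht.2, hpos, fun htb => ?_⟩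
  have hloc : IsLocalMax (fun t => w t * w r) t := hmax.isLocalMax (Icc_mem_nhds hat htb)
  have := hloc.hasDerivAt_eq_zero ((hd t (ha.trans_lt hat)).mul_const (w r))
  exact (mul_eq_zero.1 this).resolve_right hr

lemma exists_zero_between {w : ℝ → ℝ} (hw : Continuous w) {s r : ℝ} (hs : s < r)
    (h : w s * w r < 0) : ∃ z ∈ Ioo s r, w z = 0 := by
  rcases mul_neg_iff.1 h with ⟨h1, h2⟩ | ⟨h1, h2⟩
  · exact intermediate_value_Ioo' hs.le hw.continuousOn ⟨h2, h1⟩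
  · exact intermediate_value_Ioo hs.le hw.continuousOn ⟨h1, h2⟩

/-- Before its next zero, `w` has an extremum of the sign it has at `r`; this is a critical point,
and there `u` has the sign of `w`. Placing the witness before the zero `z` keeps successive
witnesses in order. -/
lemma Alt.transfer_aux {u w w' : ℝ → ℝ} (hu : Continuous u) (hw : Continuous w)
    (hd : ∀ t, 0 < t → HasDerivAt w (w' t) t) {R : ℝ}
    (hcrit : ∀ t, 0 < t → t < R → w' t = 0 → 0 < u t * w t) (h0 : 0 < u 0 * w 0) :
    ∀ (n : ℕ) (r : ℝ), Alt w n r → w r ≠ 0 → ∀ z, r < z → z ≤ R → w z = 0 →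
      ∃ t, t < z ∧ Alt u n t ∧ 0 < u t * w r := by
  intro n
  induction n with
  | zero =>
    intro r hr hwr z hrz hzR hwz
    have hr0 : 0 < r := hr
    by_cases hex : ∃ t, 0 < t ∧ t < z ∧ 0 < u t * w r
    · obtain ⟨t, h1, h2, h3⟩ := hex; exact ⟨t, h2, h1, h3⟩
    exfalso
    push Not at hex
    obtain ⟨t, ht, hmax⟩ := isCompact_Icc.exists_isMaxOn ⟨r, hr0.le, hrz.le⟩
      (hw.mul continuous_const : Continuous fun t => w t * w r).continuousOn
    have hpos : 0 < w t * w r :=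
      lt_of_lt_of_le (mul_self_pos.2 hwr) (isMaxOn_iff.1 hmax r ⟨hr0.le, hrz.le⟩)
    have htz : t < z := by
      rcases ht.2.lt_or_eq with h | h
      · exact h
      · rw [h, hwz, zero_mul] at hpos; exact absurd hpos (lt_irrefl _)
    rcases ht.1.lt_or_eq with h | h
    · have hloc : IsLocalMax (fun t => w t * w r) t := hmax.isLocalMax (Icc_mem_nhds h htz)
      have := hloc.hasDerivAt_eq_zero ((hd t h).mul_const (w r))
      have hc := hcrit t h (htz.trans_le hzR) ((mul_eq_zero.1 this).resolve_right hwr)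
      have := hex t h htz
      linarith [mul_pos_of_same hc hpos]
    -- The maximum may sit at time zero, where no positive critical time is available. Then the
    -- common sign at zero is used, and continuity moves the witness to a positive time.
    · rw [← h] at hpos
      have h1 := mul_pos_of_same h0 hpos
      have h2 : ∀ᶠ t in 𝓝[>] (0 : ℝ), 0 < u t * w r :=
        ((hu.mul continuous_const).tendsto 0 |>.eventually_const_lt h1).filter_mono
          nhdsWithin_le_nhds
      obtain ⟨x, hx1, hx2⟩ := (h2.and (Ioo_mem_nhdsGT (hr0.trans hrz))).exists
      linarith [hex x hx2.1 hx2.2]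
  | succ n ih =>
    rintro r ⟨s, hs, h, hsr⟩ hwr z hrz hzR hwz
    obtain ⟨z', hz', hwz'⟩ := exists_zero_between hw hs hsr
    obtain ⟨t', ht', hA, hsgn⟩ := ih s h (left_ne_zero_of_mul hsr.ne) z' hz'.1
      (hz'.2.le.trans (hrz.le.trans hzR)) hwz'
    have hz'0 : 0 < z' := h.pos.trans hz'.1
    obtain ⟨t, h1, h2, h3, h4⟩ := exists_critical hw hd hz'0.le hz'.2 hrz.le hwz' hwr
    have htz : t < z := by
      rcases h2.lt_or_eq with h | h
      · exact h
      · rw [h, hwz, zero_mul] at h3; exact absurd h3 (lt_irrefl _)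
    have hc := mul_pos_of_same (hcrit t (hz'0.trans h1) (htz.trans_le hzR) (h4 htz)) h3
    refine ⟨t, htz, ⟨t', ht'.trans h1, hA, ?_⟩, hc⟩
    have := mul_neg_of_same hsgn hsr
    have := mul_neg_of_same (by linarith [mul_comm (u t) (w r)] : 0 < u t * w r)
      (by linarith : w r * u t' < 0)
    linarith

/-- Sign changes up to time `R` are transferred between functions with matching signs at
critical points and at `R`. -/
lemma Alt.transfer {u w w' : ℝ → ℝ} (hu : Continuous u) (hw : Continuous w)
    (hd : ∀ t, 0 < t → HasDerivAt w (w' t) t) {R : ℝ}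
    (hcrit : ∀ t, 0 < t → t < R → w' t = 0 → 0 < u t * w t) (h0 : 0 < u 0 * w 0)
    (hR : 0 < u R * w R) {n : ℕ} {r : ℝ} (hr : r ≤ R) (h : Alt w n r) : ∃ t ≤ R, Alt u n t := by
  cases n with
  | zero => exact ⟨r, hr, h⟩
  | succ n =>
    obtain ⟨s, hs, h, hsr⟩ := h
    obtain ⟨z', hz', hwz'⟩ := exists_zero_between hw hs hsr
    obtain ⟨t', ht', hA, hsgn⟩ := Alt.transfer_aux hu hw hd hcrit h0 n s h
      (left_ne_zero_of_mul hsr.ne) z' hz'.1 (hz'.2.le.trans hr) hwz'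
    have hz'0 : 0 < z' := h.pos.trans hz'.1
    obtain ⟨t, h1, h2, h3, h4⟩ := exists_critical hw hd hz'0.le hz'.2 hr hwz'
      (right_ne_zero_of_mul hsr.ne)
    have hc : 0 < u t * w r := by
      rcases h2.lt_or_eq with h | h
      · exact mul_pos_of_same (hcrit t (hz'0.trans h1) h (h4 h)) h3
      · rw [h] at h3 ⊢; exact mul_pos_of_same hR h3
    refine ⟨t, h2, t', ht'.trans h1, hA, ?_⟩
    have h5 := mul_neg_of_same hsgn hsr
    have := mul_neg_of_same hc (by linarith : w r * u t' < 0)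
    linarith

lemma Alt.before {w : ℝ → ℝ} {R : ℝ} (hR : 0 < R) (hs : ∀ r, R ≤ r → 0 < w r * w R) {n : ℕ}
    {r : ℝ} (h : Alt w n r) : ∃ r' ≤ R, Alt w n r' := by
  by_cases hr : r ≤ R
  · exact ⟨r, hr, h⟩
  push Not at hr
  cases n with
  | zero => exact ⟨R, le_rfl, hR⟩
  | succ n =>
    obtain ⟨s, hsr, h, hss⟩ := h
    have h1 := hs r hr.le
    rcases lt_or_ge s R with h2 | h2
    · refine ⟨R, le_rfl, s, h2, h, ?_⟩
      have := mul_neg_of_same (by linarith : 0 < w R * w r) (by linarith : w r * w s < 0)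
      linarith
    · have h3 := mul_pos_of_same (hs s h2) (by linarith : 0 < w R * w r)
      linarith

/-- If at most one sign change takes place after `R`, only one has to be sacrificed in order to find
the others before `R`. -/
lemma Alt.before_of_at_most_one {w : ℝ → ℝ} {R : ℝ} (hR : 0 < R) (hwR : w R ≠ 0)
    (hs : ∀ a b, R ≤ a → a < b → w R * w a < 0 → ¬ w a * w b < 0) {n : ℕ}
    {r : ℝ} (h : Alt w (n + 1) r) : ∃ r' ≤ R, Alt w n r' := by
  obtain ⟨s, hsr, h, hss⟩ := h
  by_cases hsR : s ≤ R
  · exact ⟨s, hsR, h⟩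
  push Not at hsR
  have h1 : 0 < w R * w s := by
    rcases (mul_ne_zero hwR (left_ne_zero_of_mul hss.ne)).lt_or_gt with h | h
    · exact absurd hss (hs s r hsR.le hsr h)
    · exact h
  cases n with
  | zero => exact ⟨R, le_rfl, hR⟩
  | succ n =>
    obtain ⟨s', hs', h', hss'⟩ := h
    have h2 : w R * w s' < 0 := mul_neg_of_same h1 (by linarith)
    rcases lt_or_ge s' R with h3 | h3
    · exact ⟨R, le_rfl, s', h3, h', by linarith⟩
    · exact absurd hss' (hs s' s h3 hs' h2)

/-- Infinitely many simple zeros produce infinitely many sign changes. -/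
lemma exists_alt_of_zeros {u v : ℝ → ℝ} (hd : ∀ t, 0 < t → HasDerivAt u (v t) t)
    (hv : ∀ t, 0 < t → u t = 0 → v t ≠ 0) (hz : ∀ R, ∃ r, R ≤ r ∧ u r = 0) (n : ℕ) :
    ∃ r, Alt u n r ∧ u r ≠ 0 := by
  induction n with
  | zero =>
    by_contra! hcon
    have h1 : ∀ t, 0 < t → u t = 0 := fun t ht => hcon t ht
    have : u =ᶠ[𝓝 1] fun _ => 0 := by
      filter_upwards [lt_mem_nhds (zero_lt_one' ℝ)] with x hx using h1 x hx
    have h2 := (hd 1 one_pos).unique ((hasDerivAt_const 1 (0 : ℝ)).congr_of_eventuallyEq this)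
    exact hv 1 one_pos (h1 1 one_pos) h2
  | succ n ih =>
    obtain ⟨r, h, hr⟩ := ih
    by_contra! hcon
    have hge : ∀ x, r < x → 0 ≤ u r * u x := by
      intro x hx
      by_contra! hneg
      exact right_ne_zero_of_mul hneg.ne (hcon x ⟨r, hx, h, hneg⟩)
    obtain ⟨z, hz1, hz2⟩ := hz (r + 1)
    have hz0 : 0 < z := by linarith [h.pos]
    -- Without a further alternation `u r * u` is nonnegative from `r` on, so a later zero is a
    -- minimum and hence a double zero.
    have hloc : IsLocalMin (fun x => u r * u x) z := by
      have hn : ∀ᶠ x in 𝓝 z, r < x := lt_mem_nhds (by linarith)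
      filter_upwards [hn] with x hx
      rw [hz2, mul_zero]; exact hge x hx
    have := hloc.hasDerivAt_eq_zero ((hd z hz0).const_mul (u r))
    exact hv z hz0 hz2 ((mul_eq_zero.1 this).resolve_left hr)

end BoundState

namespace BoundState

/-! ### Wells of the potential -/

/-- To the right of `0` the potential is nonpositive up to `β` and increasing on `[β, X]`. -/
structure RightWell (f : ℝ → ℝ) (J : Set ℝ) (δ β X : ℝ) : Prop where
  δ_pos : 0 < δ
  δ_le : δ ≤ β
  lt : β < X
  mem : X ∈ J
  neg : ∀ s ∈ Ioo 0 δ, F f s < 0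
  nonpos : ∀ s ∈ Icc 0 β, F f s ≤ 0
  F_eq : F f β = 0
  f_pos : ∀ s ∈ Ioc β X, 0 < f s
  dip : ∀ ℓ, 0 ≤ ℓ → ℓ < β → ∃ s ∈ Ioo ℓ β, F f s < 0

section
variable {N : ℕ} {f : ℝ → ℝ} {J : Set ℝ} {u v : ℝ → ℝ} {δ β X δ₂ β₂ X₂ : ℝ}

lemma RightWell.β_pos (h : RightWell f J δ β X) : 0 < β := h.δ_pos.trans_le h.δ_le

lemma RightWell.X_pos (h : RightWell f J δ β X) : 0 < X := h.β_pos.trans h.lt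

lemma RightWell.sub (hf : Nonlin f J) (h : RightWell f J δ β X) : Icc 0 X ⊆ J :=
  hf.conn.out hf.zero_mem h.mem

lemma RightWell.F_lt (hf : Nonlin f J) (h : RightWell f J δ β X) {s t : ℝ} (hs : β ≤ s)
    (hst : s < t) (ht : t ≤ X) : F f s < F f t := by
  have hsub := h.sub hf
  have hm : StrictMonoOn (F f) (Icc β X) := by
    refine strictMonoOn_of_deriv_pos (convex_Icc _ _)
      (hf.continuousOn_F.mono ((Icc_subset_Icc_left h.β_pos.le).trans hsub)) ?_
    intro x hx
    rw [interior_Icc] at hx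
    rw [(hf.hasDerivAt_F (hsub ⟨h.β_pos.le.trans hx.1.le, hx.2.le⟩)).deriv]
    exact h.f_pos x ⟨hx.1, hx.2.le⟩
  exact hm ⟨hs, hst.le.trans ht⟩ ⟨hs.trans hst.le, ht⟩ hst

lemma RightWell.F_pos (hf : Nonlin f J) (h : RightWell f J δ β X) {s : ℝ} (hs : β < s)
    (hX : s ≤ X) : 0 < F f s := by
  rw [← h.F_eq]; exact h.F_lt hf le_rfl hs hX

/-- The point `b` separates two regimes: below `b` the potential is so small that a trajectory of
larger energy has definite speed, and above `b` the restoring force is bounded below. -/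
lemma RightWell.split (hf : Nonlin f J) (h : RightWell f J δ β X) {e : ℝ} (he : 0 < e) :
    ∃ b ∈ Ioo β X, ∃ f₀ > 0, (∀ s ∈ Icc 0 b, F f s ≤ e) ∧ ∀ s ∈ Icc b X, f₀ ≤ f s := by
  have hsub := h.sub hf
  have hc := hf.continuousAt_F (hsub ⟨h.β_pos.le, h.lt.le⟩)
  have h1 : ∀ᶠ s in 𝓝[>] β, F f s < e :=
    (hc.eventually_lt_const (by rwa [h.F_eq])).filter_mono nhdsWithin_le_nhds
  obtain ⟨b, hb1, hb2⟩ := (h1.and (Ioo_mem_nhdsGT h.lt)).exists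
  have hcont : ContinuousOn f (Icc b X) :=
    hf.cont.mono ((Icc_subset_Icc_left (h.β_pos.le.trans hb2.1.le)).trans hsub)
  obtain ⟨m, hm, hmin⟩ := isCompact_Icc.exists_isMinOn (nonempty_Icc.2 hb2.2.le) hcont
  refine ⟨b, hb2, f m, h.f_pos m ⟨hb2.1.trans_le hm.1, hm.2⟩, fun s hs => ?_,
    fun s hs => isMinOn_iff.1 hmin s hs⟩
  rcases le_or_gt s β with hsb | hsb
  · exact (h.nonpos s ⟨hs.1, hsb⟩).trans he.le
  · rcases hs.2.lt_or_eq with h2 | h2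
    · exact ((h.F_lt hf hsb.le h2 hb2.2.le).trans hb1).le
    · rw [h2]; exact hb1.le

/-! ### Single trajectories -/

/-- The energy is then constant on the interval, so its dissipation `(N-1)v²/r` vanishes. -/
lemma Traj.v_zero_of_energy_le (hN : 2 ≤ N) (hf : Nonlin f J) (h : Traj N f J u v) {a b : ℝ}
    (ha : 0 ≤ a) (hab : a < b) (hE : energy f u v a ≤ energy f u v b) :
    ∀ y ∈ Icc a b, v y = 0 := by
  have hN' : (2 : ℝ) ≤ N := by exact_mod_cast hN
  have hconst : ∀ y ∈ Icc a b, energy f u v y = energy f u v a := fun y hy =>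
    le_antisymm (h.energy_le hN hf ha hy.1)
      (hE.trans (h.energy_le hN hf (ha.trans hy.1) hy.2))
  have hin : ∀ y ∈ Ioo a b, v y = 0 := by
    intro y hy
    have hy0 : 0 < y := ha.trans_lt hy.1
    have h1 : energy f u v =ᶠ[𝓝 y] fun _ => energy f u v a := by
      filter_upwards [Ioo_mem_nhds hy.1 hy.2] with x hx using hconst x (Ioo_subset_Icc_self hx)
    have h2 := (h.hasDerivAt_energy hf hy0).unique
      ((hasDerivAt_const y (energy f u v a)).congr_of_eventuallyEq h1)
    have h3 : ((N : ℝ) - 1) / y ≠ 0 := (div_pos (by linarith) hy0).ne'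
    rcases mul_eq_zero.1 (neg_eq_zero.1 h2) with h4 | h4
    · exact absurd h4 h3
    · simpa using h4
  intro y hy
  have hcl : closure (Ioo a b) ⊆ {y | v y = 0} :=
    (isClosed_eq h.contv continuous_const).closure_subset_iff.2 hin
  rw [closure_Ioo hab.ne] at hcl
  exact hcl hy

lemma Traj.ne_of_energy_lt (hN : 2 ≤ N) (hf : Nonlin f J) (h : Traj N f J u v) {a r c : ℝ}
    (ha : 0 ≤ a) (har : a ≤ r) (hE : energy f u v a < F f c) : u r ≠ c := by
  intro hu
  have := (F_le_energy (f := f) (u := u) (v := v) r).trans (h.energy_le hN hf ha har)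
  rw [hu] at this; linarith

/-- Points of energy larger than that of the trajectory act as barriers. -/
lemma Traj.lt_iff_of_energy_lt (hN : 2 ≤ N) (hf : Nonlin f J) (h : Traj N f J u v) {a r c : ℝ}
    (ha : 0 ≤ a) (har : a ≤ r) (hE : energy f u v a < F f c) : u a < c ↔ u r < c := by
  have hne : ∀ s ∈ Icc a r, u s ≠ c := fun s hs => h.ne_of_energy_lt hN hf ha hs.1 hE
  constructor
  · intro hu
    by_contra! hcon
    obtain ⟨s, hs, hsc⟩ := intermediate_value_Icc har h.contu.continuousOn ⟨hu.le, hcon⟩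
    exact hne s hs hsc
  · intro hu
    by_contra! hcon
    obtain ⟨s, hs, hsc⟩ := intermediate_value_Icc' har h.contu.continuousOn ⟨hu.le, hcon⟩
    exact hne s hs hsc

lemma Traj.mem_zone_iff (hN : 2 ≤ N) (hf : Nonlin f J) (h : Traj N f J u v) {a r c d : ℝ}
    (ha : 0 ≤ a) (har : a ≤ r) (hE : energy f u v a < F f c) (hE' : energy f u v a < F f d) :
    u a ∈ Ioo d c ↔ u r ∈ Ioo d c := by
  have h1 := h.lt_iff_of_energy_lt hN hf ha har hE
  have h2 := h.lt_iff_of_energy_lt hN hf ha har hE'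
  have h3 := h.ne_of_energy_lt hN hf ha le_rfl hE'
  have h4 := h.ne_of_energy_lt hN hf ha har hE'
  constructor
  · rintro ⟨h5, h6⟩
    refine ⟨lt_of_le_of_ne ?_ h4.symm, h1.1 h6⟩
    by_contra! hcon; exact absurd (h2.2 hcon) (by linarith)
  · rintro ⟨h5, h6⟩
    refine ⟨lt_of_le_of_ne ?_ h3.symm, h1.2 h6⟩
    by_contra! hcon; exact absurd (h2.1 hcon) (by linarith)

/-- In a region of nonpositive potential a descending trajectory keeps descending as long as its
energy is nonnegative. -/
lemma Traj.descending (hN : 2 ≤ N) (hf : Nonlin f J) (h : Traj N f J u v) {A β R r : ℝ}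
    (hR : 0 ≤ R) (hF : ∀ s ∈ Icc A β, F f s ≤ 0) (huR : u R ≤ β) (hvR : v R ≤ 0)
    (hu : ∀ s ∈ Icc R r, A ≤ u s) (hE : ∀ s ∈ Icc R r, 0 ≤ energy f u v s) :
    ∀ s ∈ Icc R r, v s ≤ 0 := by
  intro s hs
  by_contra! hvs
  let S := {y | y ∈ Icc R s ∧ 0 < v y}
  have hSne : S.Nonempty := ⟨s, ⟨hs.1, le_rfl⟩, hvs⟩
  have hSb : BddBelow S := ⟨R, fun y hy => hy.1.1⟩
  set t := sInf S with ht
  have hRt : R ≤ t := le_csInf hSne fun y hy => hy.1.1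
  have hts : t ≤ s := csInf_le hSb ⟨⟨hs.1, le_rfl⟩, hvs⟩
  have hlt : ∀ y, R ≤ y → y < t → v y ≤ 0 := by
    intro y hy hyt
    by_contra! hcon
    exact absurd (csInf_le hSb (⟨⟨hy, hyt.le.trans hts⟩, hcon⟩ : y ∈ S)) (by linarith)
  have hvt0 : 0 ≤ v t := by
    have : t ∈ closure S := csInf_mem_closure hSne hSb
    have h2 : closure S ⊆ {y | 0 ≤ v y} :=
      (isClosed_le continuous_const h.contv).closure_subset_iff.2 fun y hy => hy.2.le
    exact h2 this
  have hut : u t ≤ u R := le_of_deriv_nonpos hRt h.contu.continuousOn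
    (fun x hx => h.hu x (hR.trans_lt hx.1)) (fun x hx => hlt x hx.1.le hx.2)
  have hvt : v t = 0 := by
    refine le_antisymm ?_ hvt0
    rcases hRt.lt_or_eq with h1 | h1
    · have hlim : Tendsto v (𝓝[<] t) (𝓝 (v t)) := h.contv.continuousAt.continuousWithinAt
      refine le_of_tendsto hlim ?_
      filter_upwards [Ioo_mem_nhdsLT h1] with y hy using hlt y hy.1.le hy.2
    · rw [← h1]; exact hvR
  -- At the first possible reversal, `v = 0` and `F(u) ≤ 0`, so the energy is nonpositive. Being
  -- nonnegative later, it is constant, and `v` vanishes up to time `s`.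
  have hEt : energy f u v t ≤ 0 := by
    have := hF (u t) ⟨hu t ⟨hRt, hts.trans hs.2⟩, hut.trans huR⟩
    simp [energy, hvt, this]
  have hts' : t < s := by
    rcases hts.lt_or_eq with h1 | h1
    · exact h1
    · rw [h1] at hvt; linarith
  have := h.v_zero_of_energy_le hN hf (hR.trans hRt) hts' (hEt.trans (hE s hs)) s
    ⟨hts, le_rfl⟩
  linarith

/-- Energy needed for crossing a region of negative potential. -/
lemma Traj.crossing (hN : 2 ≤ N) (hf : Nonlin f J) (h : Traj N f J u v) {p p' c₀ R r : ℝ}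
    (hp : p < p') (hc : 0 < c₀) (hR : 0 < R) (hRr : R ≤ r)
    (hF : ∀ s ∈ Icc R r, F f (u s) ≤ 0) (hE : 0 ≤ energy f u v r)
    (hw : ∀ s ∈ Icc p p', F f s ≤ -c₀) (huR : p' ≤ u R) (hur : u r ≤ p) :
    √(2 * c₀) * (p' - p) ≤ energy f u v R * (R + (p' - p) / √(2 * c₀)) := by
  have hN' : (2 : ℝ) ≤ N := by exact_mod_cast hN
  -- Where `F ≤ -c₀`, nonnegative energy forces the speed to be at least `√(2 c₀)`.
  set k := √(2 * c₀) with hk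
  have hk0 : 0 < k := Real.sqrt_pos.2 (by linarith)
  have hk2 : k ^ 2 = 2 * c₀ := Real.sq_sqrt (by linarith)
  obtain ⟨b, hRb, hbr, hub, hb⟩ := exists_first_hit h.contu hRr (hp.trans_le huR) hur
  obtain ⟨a, hRa, hab, hua, ha⟩ := exists_last_hit h.contu hRb.le huR
    (by rw [hub]; exact hp : u b < p')
  have ha0 : 0 < a := hR.trans_le hRa
  have hEn : ∀ s, s ≤ r → 0 ≤ s → 0 ≤ energy f u v s := fun s hs hs0 =>
    hE.trans (h.energy_le hN hf hs0 hs)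
  have hmem : ∀ s ∈ Icc a b, u s ∈ Icc p p' := by
    intro s hs
    constructor
    · rcases hs.2.lt_or_eq with h1 | h1
      · exact (hb s (hRa.trans hs.1) h1).le
      · rw [h1, hub]
    · rcases hs.1.lt_or_eq with h1 | h1
      · exact (ha s h1 hs.2).le
      · rw [← h1, hua]
  have hvk : ∀ s ∈ Icc a b, k ^ 2 ≤ v s ^ 2 := by
    intro s hs
    have h1 := hw _ (hmem s hs)
    have h2 := hEn s (hs.2.trans hbr) (ha0.le.trans hs.1)
    simp only [energy] at h2
    rw [hk2]; linarith
  have hneg : ∀ s ∈ Icc a b, v s ≤ -k := by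
    intro s hs
    by_contra! hcon
    have hvs : k ≤ v s := by
      have h1 := sq_le_sq.1 (hvk s hs)
      rw [abs_of_pos hk0] at h1
      rcases le_abs.1 h1 with h2 | h2
      · exact h2
      · linarith
    obtain ⟨z, hz, hvz⟩ := exists_hasDerivAt_eq_slope u v hab h.contu.continuousOn
      fun x hx => h.hu x (ha0.trans hx.1)
    have hvz0 : v z < 0 := by
      rw [hvz, hub, hua]; exact div_neg_of_neg_of_pos (by linarith) (by linarith)
    have hzI := Ioo_subset_Icc_self hz
    obtain ⟨y, hy, hvy⟩ : ∃ y ∈ Icc a b, v y = 0 := by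
      rcases le_total s z with h1 | h1
      · obtain ⟨y, hy, hy0⟩ := intermediate_value_Icc' h1 h.contv.continuousOn
          (⟨hvz0.le, hk0.le.trans hvs⟩ : (0 : ℝ) ∈ Icc (v z) (v s))
        exact ⟨y, ⟨hs.1.trans hy.1, hy.2.trans hzI.2⟩, hy0⟩
      · obtain ⟨y, hy, hy0⟩ := intermediate_value_Icc h1 h.contv.continuousOn
          (⟨hvz0.le, hk0.le.trans hvs⟩ : (0 : ℝ) ∈ Icc (v z) (v s))
        exact ⟨y, ⟨hzI.1.trans hy.1, hy.2.trans hs.2⟩, hy0⟩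
    have := hvk y hy
    rw [hvy] at this
    have := pow_pos hk0 2
    linarith
  have htime : k * (b - a) ≤ p' - p := by
    have := le_of_deriv_nonpos (g := fun x => u x + k * x) (g' := fun x => v x + k) hab.le
      (h.contu.add (continuous_const.mul continuous_id)).continuousOn ?_ ?_
    · simp only [hub, hua] at this; linarith
    · intro x hx
      exact ((h.hu x (ha0.trans hx.1)).add ((hasDerivAt_id x).const_mul k)).congr_deriv (by simp)
    · intro x hx; linarith [hneg x (Ioo_subset_Icc_self hx)]
  -- For `N ≥ 2` the loss rate `(N-1)v²/x` dominates `(k/b)|v|`, so crossing the strip costs at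
  -- least `k/b` times its width.
  have hloss : energy f u v b - k / b * p ≤ energy f u v a - k / b * p' := by
    have := le_of_deriv_nonpos (g := fun x => energy f u v x - k / b * u x)
      (g' := fun x => -(((N : ℝ) - 1) / x * v x ^ 2) - k / b * v x) hab.le
      (((h.continuousOn_energy hf).mono fun x hx => ha0.le.trans hx.1).sub
        (continuous_const.mul h.contu).continuousOn) ?_ ?_
    · simpa only [hub, hua] using this
    · intro x hx
      exact (h.hasDerivAt_energy hf (ha0.trans hx.1)).sub ((h.hu x (ha0.trans hx.1)).const_mul _)
    · intro x hx
      have hx0 := ha0.trans hx.1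
      have h1 := hneg x (Ioo_subset_Icc_self hx)
      have h2 : 1 / b ≤ ((N : ℝ) - 1) / x :=
        div_le_div₀ (by linarith) (by linarith) hx0 hx.2.le
      have hb0 : 0 < 1 / b := by have := ha0.trans hab; positivity
      have h3 : k * (-v x) ≤ v x ^ 2 := by nlinarith
      have h4 : 1 / b * (k * -v x) ≤ ((N : ℝ) - 1) / x * v x ^ 2 :=
        mul_le_mul h2 h3 (by nlinarith) (hb0.le.trans h2)
      have h5 : 1 / b * (k * -v x) = -(k / b * v x) := by ring
      linarith
  have hb0 : 0 < b := ha0.trans hab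
  have hEb := hEn b hbr hb0.le
  have h1 : k * (p' - p) ≤ b * energy f u v a := by
    have : k / b * (p' - p) ≤ energy f u v a := by linarith
    rw [div_mul_eq_mul_div, div_le_iff₀ hb0] at this
    linarith
  -- The strip may be entered long after `R`; monotonicity of `r²E` turns the energy needed at the
  -- entry time `a` into a condition at `R`.
  have h2 := h.sq_mul_energy_le hN hf hR.le hRa fun x hx =>
    hF x ⟨hx.1, hx.2.trans (hab.le.trans hbr)⟩
  have hER := hEn R hRr hR.le
  have hEa := hEn a (hab.le.trans hbr) ha0.le
  set T := (p' - p) / k with hT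
  have hT0 : 0 < T := div_pos (by linarith) hk0
  have hbT : b ≤ a + T := by
    have : b - a ≤ T := by rw [hT, le_div_iff₀ hk0]; linarith
    linarith
  have h3 : a ^ 2 * (b * energy f u v a) ≤ a ^ 2 * (energy f u v R * (R + T)) := by
    calc a ^ 2 * (b * energy f u v a) = b * (a ^ 2 * energy f u v a) := by ring
      _ ≤ (a + T) * (R ^ 2 * energy f u v R) :=
        mul_le_mul hbT h2 (by positivity) (by positivity)
      _ = energy f u v R * ((a + T) * R ^ 2) := by ring
      _ ≤ energy f u v R * ((R + T) * a ^ 2) := by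
        refine mul_le_mul_of_nonneg_left ?_ hER
        have : R ^ 2 ≤ a ^ 2 := by gcongr
        nlinarith [mul_pos ha0 hR]
      _ = _ := by ring
  exact h1.trans (le_of_mul_le_mul_left h3 (by positivity))

/-- A trajectory moving through the well with enough energy changes sign within bounded time. -/
lemma Traj.exists_neg_of_nonneg (hN : 2 ≤ N) (h : Traj N f J u v) {b k f₀ V r T : ℝ}
    (hb : 0 < b) (hk : 0 < k) (hf₀ : 0 < f₀) (hV : 0 ≤ V) (hr : 0 < r)
    (hrV : ((N : ℝ) - 1) * V / r ≤ f₀ / 2)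
    (hT : 2 * ((b + 1) / k) + 2 * (2 * (V + 1) / f₀) ≤ T)
    (hv : ∀ s ∈ Icc r (r + T), |v s| ≤ V)
    (hlow : ∀ s ∈ Icc r (r + T), 0 ≤ u s → u s ≤ b → k ≤ |v s|)
    (hhigh : ∀ s ∈ Icc r (r + T), b ≤ u s → f₀ ≤ f (u s)) (hur : 0 ≤ u r) :
    ∃ s, r < s ∧ s ≤ r + T ∧ u s < 0 := by
  have hN' : (2 : ℝ) ≤ N := by exact_mod_cast hN
  by_contra! hcon
  have hnn : ∀ s ∈ Icc r (r + T), 0 ≤ u s := by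
    intro s hs
    rcases hs.1.lt_or_eq with h1 | h1
    · exact hcon s h1 hs.2
    · rwa [← h1]
  -- `T₁` suffices to cross `[0, b]` at speed `k`; during `T₂` a deceleration of at least `f₀/2`
  -- changes the velocity by more than `V`. The trajectory may have to rise to `b` and turn (`T₁ +
  -- T₂`), fall back to `b` (`T₂`) and cross zero (`T₁`).
  set T₁ := (b + 1) / k with hT₁
  set T₂ := 2 * (V + 1) / f₀ with hT₂
  have hT₁0 : 0 < T₁ := by positivity
  have hT₂0 : 0 < T₂ := by positivity
  have hkT : k * T₁ = b + 1 := by rw [hT₁]; field_simp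
  have hfT : f₀ / 2 * T₂ = V + 1 := by rw [hT₂]; field_simp
  have hacc : ∀ s ∈ Icc r (r + T), b ≤ u s → -(((N : ℝ) - 1) / s * v s) - f (u s) ≤ -(f₀ / 2) := by
    intro s hs hbs
    have h1 := hhigh s hs hbs
    have hs0 : 0 < s := hr.trans_le hs.1
    have h2 : -(((N : ℝ) - 1) / s * v s) ≤ ((N : ℝ) - 1) * V / r := by
      have h3 : -v s ≤ V := (neg_le_abs _).trans (hv s hs)
      have h4 : ((N : ℝ) - 1) / s ≤ ((N : ℝ) - 1) / r :=
        div_le_div_of_nonneg_left (by linarith) hr hs.1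
      have h5 : 0 ≤ ((N : ℝ) - 1) / s := div_nonneg (by linarith) hs0.le
      calc -(((N : ℝ) - 1) / s * v s) = ((N : ℝ) - 1) / s * (-v s) := by ring
        _ ≤ ((N : ℝ) - 1) / s * V := mul_le_mul_of_nonneg_left h3 h5
        _ ≤ ((N : ℝ) - 1) / r * V := mul_le_mul_of_nonneg_right h4 hV
        _ = _ := by ring
    linarith
  have hslow : ∀ x y, r ≤ x → x ≤ y → y ≤ r + T → (∀ s ∈ Ioo x y, b ≤ u s) →
      v y + f₀ / 2 * y ≤ v x + f₀ / 2 * x := by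
    intro x y hx hxy hy hb'
    refine le_of_deriv_nonpos (g := fun s => v s + f₀ / 2 * s)
      (g' := fun s => (-(((N : ℝ) - 1) / s * v s) - f (u s)) + f₀ / 2) hxy
      (h.contv.add (continuous_const.mul continuous_id)).continuousOn ?_ ?_
    · intro s hs
      exact ((h.hv s (hr.trans_le (hx.trans hs.1.le))).add
        ((hasDerivAt_id s).const_mul (f₀ / 2))).congr_deriv (by simp)
    · intro s hs
      linarith [hacc s ⟨hx.trans hs.1.le, hs.2.le.trans hy⟩ (hb' s hs)]
  -- the trajectory starts descending
  obtain ⟨t₁, ht₁r, ht₁, hvt₁⟩ : ∃ t, r ≤ t ∧ t ≤ r + (T₁ + T₂) ∧ v t ≤ 0 := by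
    by_contra! hpos
    have hmono : ∀ x y, r ≤ x → x ≤ y → y ≤ r + (T₁ + T₂) → u x ≤ u y := by
      intro x y hx hxy hy
      exact ge_of_deriv_nonneg hxy h.contu.continuousOn
        (fun s hs => h.hu s (hr.trans_le (hx.trans hs.1.le)))
        (fun s hs => (hpos s (hx.trans hs.1.le) (hs.2.le.trans hy)).le)
    have hub : b < u (r + T₁) := by
      by_contra! hle
      have := ge_of_deriv_nonneg (g := fun s => u s - k * s) (g' := fun s => v s - k)
        (by linarith : r ≤ r + T₁)
        (h.contu.sub (continuous_const.mul continuous_id)).continuousOn ?_ ?_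
      · nlinarith
      · intro s hs
        exact ((h.hu s (hr.trans hs.1)).sub ((hasDerivAt_id s).const_mul k)).congr_deriv (by simp)
      · intro s hs
        have hsI : s ∈ Icc r (r + T) := ⟨hs.1.le, by linarith [hs.2]⟩
        have h1 := hlow s hsI (hnn s hsI) ((hmono s _ hs.1.le hs.2.le (by linarith)).trans hle)
        rw [abs_of_pos (hpos s hs.1.le (by linarith [hs.2]))] at h1
        linarith
    have h1 := hslow (r + T₁) (r + (T₁ + T₂)) (by linarith) (by linarith) (by linarith)
      fun s hs => hub.le.trans (hmono _ s (by linarith) hs.1.le hs.2.le)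
    have h2 := (le_abs_self _).trans (hv (r + T₁) ⟨by linarith, by linarith⟩)
    have h3 := hpos (r + (T₁ + T₂)) (by linarith) le_rfl
    linarith
  -- it enters the region below `b`
  obtain ⟨t₂, ht₂t, ht₂, hut₂, hvt₂⟩ : ∃ t, t₁ ≤ t ∧ t ≤ t₁ + T₂ ∧ u t ≤ b ∧ v t ≤ 0 := by
    by_cases hu1 : u t₁ ≤ b
    · exact ⟨t₁, le_rfl, by linarith, hu1, hvt₁⟩
    push Not at hu1
    have hex : ∃ t ∈ Icc t₁ (t₁ + T₂), u t ≤ b := by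
      by_contra! hall
      have h1 := hslow t₁ (t₁ + T₂) ht₁r (by linarith) (by linarith)
        fun s hs => (hall s (Ioo_subset_Icc_self hs)).le
      have h2 := (neg_le_abs _).trans (hv (t₁ + T₂) ⟨by linarith, by linarith⟩)
      linarith
    obtain ⟨t, ht, hut⟩ := hex
    obtain ⟨z, hz1, hz2, hz3, hz4⟩ := exists_first_hit h.contu ht.1 hu1 hut
    refine ⟨z, hz1.le, hz2.trans ht.2, hz3.le, ?_⟩
    have h1 := hslow t₁ z ht₁r hz1.le (by linarith [ht.2]) fun s hs => (hz4 s hs.1.le hs.2).le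
    nlinarith
  -- it crosses zero
  have ht₂r : r ≤ t₂ := ht₁r.trans ht₂t
  have hend : t₂ + T₁ ≤ r + T := by linarith
  have hvneg : ∀ s ∈ Icc t₂ (t₂ + T₁), v s < 0 := by
    by_contra! hex
    obtain ⟨s, hs, hvs⟩ := hex
    have hI₂ : t₂ ∈ Icc r (r + T) := ⟨ht₂r, by linarith⟩
    have hv2 : v t₂ < 0 := by
      have := hlow t₂ hI₂ (hnn t₂ hI₂) hut₂
      rw [abs_of_nonpos hvt₂] at this; linarith
    obtain ⟨z, hz1, hz2, hz3, hz4⟩ := exists_first_hit (u := fun x => -v x) (c := 0) h.contv.neg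
      hs.1 (by linarith) (by linarith)
    have hzI : z ∈ Icc r (r + T) := ⟨ht₂r.trans hz1.le, (hz2.trans hs.2).trans hend⟩
    have huz : u z ≤ u t₂ := le_of_deriv_nonpos hz1.le h.contu.continuousOn
      (fun x hx => h.hu x (hr.trans_le (ht₂r.trans hx.1.le)))
      (fun x hx => by linarith [hz4 x hx.1.le hx.2])
    have := hlow z hzI (hnn z hzI) (huz.trans hut₂)
    rw [show v z = 0 by linarith, abs_zero] at this
    linarith
  have hanti : ∀ s ∈ Icc t₂ (t₂ + T₁), u s ≤ b := by
    intro s hs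
    refine le_trans ?_ hut₂
    exact le_of_deriv_nonpos hs.1 h.contu.continuousOn
      (fun x hx => h.hu x (hr.trans_le (ht₂r.trans hx.1.le)))
      (fun x hx => (hvneg x ⟨hx.1.le, hx.2.le.trans hs.2⟩).le)
  have := le_of_deriv_nonpos (g := fun s => u s + k * s) (g' := fun s => v s + k)
    (by linarith : t₂ ≤ t₂ + T₁)
    (h.contu.add (continuous_const.mul continuous_id)).continuousOn ?_ ?_
  · have h1 := hnn (t₂ + T₁) ⟨by linarith, hend⟩
    nlinarith
  · intro s hs
    exact ((h.hu s (hr.trans_le (ht₂r.trans hs.1.le))).add ((hasDerivAt_id s).const_mul k)).congr_deriv (by simp)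
  · intro s hs
    have hsI : s ∈ Icc r (r + T) := ⟨ht₂r.trans hs.1.le, hs.2.le.trans hend⟩
    have h1 := hlow s hsI (hnn s hsI) (hanti s (Ioo_subset_Icc_self hs))
    rw [abs_of_neg (hvneg s (Ioo_subset_Icc_self hs))] at h1
    linarith

lemma exists_alt_of_flips {u : ℝ → ℝ} {a b T : ℝ} (ha : 0 < a) (hT : 0 < T)
    (hpos : ∀ r, a ≤ r → r + T ≤ b → 0 ≤ u r → ∃ s, r < s ∧ s ≤ r + T ∧ u s < 0)
    (hneg : ∀ r, a ≤ r → r + T ≤ b → u r ≤ 0 → ∃ s, r < s ∧ s ≤ r + T ∧ 0 < u s) (n : ℕ)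
    (hn : a + (n + 1) * T ≤ b) :
    ∃ r, a ≤ r ∧ r ≤ a + (n + 1) * T ∧ Alt u n r ∧ u r ≠ 0 := by
  induction n with
  | zero =>
    rcases le_total 0 (u a) with h | h
    · obtain ⟨s, h1, h2, h3⟩ := hpos a le_rfl (by simpa using hn) h
      exact ⟨s, h1.le, by simpa using h2, ha.trans h1, h3.ne⟩
    · obtain ⟨s, h1, h2, h3⟩ := hneg a le_rfl (by simpa using hn) h
      exact ⟨s, h1.le, by simpa using h2, ha.trans h1, h3.ne'⟩
  | succ n ih =>
    push_cast at hn
    obtain ⟨r, h1, h2, h3, h4⟩ := ih (by nlinarith)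
    have h5 : r + T ≤ b := by nlinarith
    push_cast
    rcases h4.lt_or_gt with h | h
    · obtain ⟨s, g1, g2, g3⟩ := hneg r h1 h5 h.le
      exact ⟨s, h1.trans g1.le, by linarith, ⟨r, g1, h3, mul_neg_of_neg_of_pos h g3⟩, g3.ne'⟩
    · obtain ⟨s, g1, g2, g3⟩ := hpos r h1 h5 h.le
      exact ⟨s, h1.trans g1.le, by linarith, ⟨r, g1, h3, mul_neg_of_pos_of_neg h g3⟩, g3.ne⟩

/-- If a trajectory has energy at least `e₂` at a late time and later falls to energy `e₁` in the
central zone, then it has many sign changes. -/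
lemma exists_many_sign_changes (hN : 2 ≤ N) (hf : Nonlin f J) (hr : RightWell f J δ β X)
    (hl : RightWell (refl f) (Neg.neg ⁻¹' J) δ₂ β₂ X₂) {e₁ e₂ : ℝ} (he₁ : 0 < e₁) (he : e₁ < e₂)
    (heX : e₂ < F f X) (heX₂ : e₂ < F f (-X₂)) (n : ℕ) :
    ∃ R₀ > 0, ∀ u v : ℝ → ℝ, Traj N f J u v → ∀ ρ, R₀ ≤ ρ → e₂ ≤ energy f u v ρ →
      ∀ σ, 0 ≤ σ → energy f u v σ ≤ e₁ → u σ ∈ Ioo (-X₂) X → SignChangesAtLeast u n := by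
  have hN' : (2 : ℝ) ≤ N := by exact_mod_cast hN
  obtain ⟨b, hb, f₀, hf₀, hFb, hfb⟩ := hr.split hf (half_pos he₁)
  obtain ⟨b₂, hb₂, f₂, hf₂, hFb₂, hfb₂⟩ := hl.split hf.refl (half_pos he₁)
  have hsub : Icc (-X₂) X ⊆ J := hf.conn.out (by simpa using hl.mem) hr.mem
  obtain ⟨B, hB⟩ := isCompact_Icc.exists_bound_of_continuousOn (hf.continuousOn_F.mono hsub)
  have hB0 : 0 ≤ B := (norm_nonneg _).trans
    (hB 0 ⟨by linarith [hl.X_pos], hr.X_pos.le⟩)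
  set V := √(2 * (e₂ + B)) with hV
  have hV0 : 0 < V := Real.sqrt_pos.2 (by linarith)
  have hV2 : V ^ 2 = 2 * (e₂ + B) := Real.sq_sqrt (by linarith)
  set k := √e₁ with hk
  have hk0 : 0 < k := Real.sqrt_pos.2 he₁
  have hk2 : k ^ 2 = e₁ := Real.sq_sqrt he₁.le
  have hb0 : 0 < b := hr.β_pos.trans hb.1
  have hb₂0 : 0 < b₂ := hl.β_pos.trans hb₂.1
  set T := (2 * ((b + 1) / k) + 2 * (2 * (V + 1) / f₀)) +
    (2 * ((b₂ + 1) / k) + 2 * (2 * (V + 1) / f₂)) with hT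
  have hTa : 0 < 2 * ((b + 1) / k) + 2 * (2 * (V + 1) / f₀) := by positivity
  have hTb : 0 < 2 * ((b₂ + 1) / k) + 2 * (2 * (V + 1) / f₂) := by positivity
  have hT0 : 0 < T := by linarith
  set c := ((N : ℝ) - 1) * V with hc
  have hc0 : 0 < c := mul_pos (by linarith) hV0
  -- After `R₀` friction is at most half of the restoring force on either side (first two summands).
  -- As the energy decays at rate at most `(N-1)V²/r = cV/r`, the third summand makes its drop from
  -- `e₂` to `e₁` last at least `(n+1)T`.
  set R₀ := 2 * c / f₀ + 2 * c / f₂ + c * V * ((n + 1) * T) / (e₂ - e₁) with hR₀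
  have he21 : 0 < e₂ - e₁ := by linarith
  have hR1 : 0 < 2 * c / f₀ := by positivity
  have hR2 : 0 < 2 * c / f₂ := by positivity
  have hR3 : 0 < c * V * ((n + 1) * T) / (e₂ - e₁) := by positivity
  refine ⟨R₀, by linarith, fun u v h ρ hρ hEρ σ hσ0 hEσ hσ => ?_⟩
  have hρ0 : 0 < ρ := by linarith
  have hρσ : ρ < σ := by
    by_contra! hcon
    have := h.energy_le hN hf hσ0 hcon
    linarith
  have hEc : ∀ x y, 0 ≤ x → ContinuousOn (energy f u v) (Icc x y) := fun x y hx =>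
    (h.continuousOn_energy hf).mono fun z hz => hx.trans hz.1
  obtain ⟨ra, hra, hEa⟩ := intermediate_value_Icc' hρσ.le (hEc ρ σ hρ0.le)
    (⟨by linarith, hEρ⟩ : e₂ ∈ Icc (energy f u v σ) (energy f u v ρ))
  have hra0 : 0 < ra := hρ0.trans_le hra.1
  obtain ⟨rb, hrb, hEb⟩ := intermediate_value_Icc' hra.2 (hEc ra σ hra0.le)
    (⟨hEσ, by linarith⟩ : e₁ ∈ Icc (energy f u v σ) (energy f u v ra))
  have hE : ∀ s ∈ Icc ra rb, energy f u v s ∈ Icc e₁ e₂ := fun s hs =>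
    ⟨hEb ▸ h.energy_le hN hf (hra0.le.trans hs.1) hs.2, hEa ▸ h.energy_le hN hf hra0.le hs.1⟩
  -- The barriers also work backwards in time: from `ra` on the energy is below `F(X)` and `F(-X₂)`,
  -- so being in the zone at `σ` means having been there since `ra`.
  have hz : ∀ s ∈ Icc ra rb, u s ∈ Ioo (-X₂) X := by
    intro s hs
    have hs2 := (hE s hs).2
    exact (h.mem_zone_iff hN hf (hra0.le.trans hs.1) (hs.2.trans hrb.2) (by linarith)
      (by linarith)).2 hσ
  have hv : ∀ s ∈ Icc ra rb, |v s| ≤ V := by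
    intro s hs
    have h1 := (hE s hs).2
    have h2 := (abs_le.1 (hB _ (Ioo_subset_Icc_self (hz s hs)))).1
    apply abs_le_of_sq_le_sq _ hV0.le
    rw [hV2]; simp only [energy] at h1; linarith
  have hlow : ∀ s ∈ Icc ra rb, F f (u s) ≤ e₁ / 2 → k ≤ |v s| := by
    intro s hs hF
    have h1 := (hE s hs).1
    rw [← abs_of_pos hk0]
    apply sq_le_sq.1
    rw [hk2]; simp only [energy] at h1; linarith
  have hdur : (n + 1) * T ≤ rb - ra := by
    have := ge_of_deriv_nonneg (g := fun s => energy f u v s + c * V / ra * s)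
      (g' := fun s => -(((N : ℝ) - 1) / s * v s ^ 2) + c * V / ra) hrb.1
      ((hEc ra rb hra0.le).add (continuous_const.mul continuous_id).continuousOn) ?_ ?_
    · simp only [hEa, hEb] at this
      have h1 : e₂ - e₁ ≤ c * V / ra * (rb - ra) := by linarith
      rw [div_mul_eq_mul_div, le_div_iff₀ hra0] at h1
      have h2 : c * V * ((n + 1) * T) / (e₂ - e₁) ≤ ra := by linarith [hra.1]
      rw [div_le_iff₀ he21] at h2
      have h3 : c * V * ((n + 1) * T) ≤ c * V * (rb - ra) := by linarith
      exact le_of_mul_le_mul_left h3 (by positivity)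
    · intro s hs
      exact ((h.hasDerivAt_energy hf (hra0.trans hs.1)).add
        ((hasDerivAt_id s).const_mul (c * V / ra))).congr_deriv (by simp)
    · intro s hs
      have hs0 := hra0.trans hs.1
      have h1 : v s ^ 2 ≤ V ^ 2 := sq_le_sq' (abs_le.1 (hv s (Ioo_subset_Icc_self hs))).1
        (abs_le.1 (hv s (Ioo_subset_Icc_self hs))).2
      have h2 : ((N : ℝ) - 1) / s ≤ ((N : ℝ) - 1) / ra :=
        div_le_div_of_nonneg_left (by linarith) hra0 hs.1.le
      have h3 : ((N : ℝ) - 1) / s * v s ^ 2 ≤ ((N : ℝ) - 1) / ra * V ^ 2 :=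
        mul_le_mul h2 h1 (sq_nonneg _) (div_nonneg (by linarith) hra0.le)
      have h4 : ((N : ℝ) - 1) / ra * V ^ 2 = c * V / ra := by rw [hc]; ring
      linarith
  have hraR : R₀ ≤ ra := hρ.trans hra.1
  have hfric : ∀ g₀ r, 0 < g₀ → 2 * c / g₀ ≤ ra → ra ≤ r → c / r ≤ g₀ / 2 := by
    intro g₀ r hg₀ h1 h2
    rw [div_le_iff₀ (hra0.trans_le h2)]
    rw [div_le_iff₀ hg₀] at h1
    nlinarith
  have hpos : ∀ r, ra ≤ r → r + T ≤ rb → 0 ≤ u r → ∃ s, r < s ∧ s ≤ r + T ∧ u s < 0 := by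
    intro r hr1 hr2 hur
    have hI : ∀ s ∈ Icc r (r + T), s ∈ Icc ra rb := fun s hs => ⟨hr1.trans hs.1, hs.2.trans hr2⟩
    exact h.exists_neg_of_nonneg hN hb0 hk0 hf₀ hV0.le (hra0.trans_le hr1)
      (hfric f₀ r hf₀ (by linarith) hr1) (by linarith) (fun s hs => hv s (hI s hs))
      (fun s hs h1 h2 => hlow s (hI s hs) (hFb _ ⟨h1, h2⟩))
      (fun s hs h1 => hfb _ ⟨h1, (hz s (hI s hs)).2.le⟩) hur
  have hneg : ∀ r, ra ≤ r → r + T ≤ rb → u r ≤ 0 → ∃ s, r < s ∧ s ≤ r + T ∧ 0 < u s := by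
    intro r hr1 hr2 hur
    have hI : ∀ s ∈ Icc r (r + T), s ∈ Icc ra rb := fun s hs => ⟨hr1.trans hs.1, hs.2.trans hr2⟩
    obtain ⟨s, h1, h2, h3⟩ := h.neg.exists_neg_of_nonneg (T := T) hN hb₂0 hk0 hf₂ hV0.le
      (hra0.trans_le hr1)
      (hfric f₂ r hf₂ (by linarith) hr1) (by linarith)
      (fun s hs => by simpa using hv s (hI s hs))
      (fun s hs h1 h2 => by
        have := hFb₂ _ ⟨h1, h2⟩
        rw [F_refl] at this
        simpa using hlow s (hI s hs) (by simpa using this))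
      (fun s hs h1 => hfb₂ _ ⟨h1, by
        have := (hz s (hI s hs)).1.le
        simp only [Pi.neg_apply]; linarith⟩) (by simpa using hur)
    exact ⟨s, h1, h2, by simpa using h3⟩
  obtain ⟨r, -, -, hA, -⟩ := exists_alt_of_flips hra0 hT0 hpos hneg n (by linarith)
  exact signChangesAtLeast_iff.2 ⟨r, hA⟩

end

end BoundState

namespace BoundState

/-! ### Long-time behaviour of a single trajectory -/

section
variable {N : ℕ} {f : ℝ → ℝ} {J : Set ℝ} {u v : ℝ → ℝ} {δ β X δ₂ β₂ X₂ : ℝ}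

/-- While `F(u) ≤ 0` the quantity `r²E` does not increase, so `E` is at most a constant times `r⁻²`.
-/
lemma Traj.exists_energy_lt_of_nonpos (hN : 2 ≤ N) (hf : Nonlin f J) (h : Traj N f J u v) {R e : ℝ}
    (hR : 0 ≤ R) (hF : ∀ r, R ≤ r → F f (u r) ≤ 0) (he : 0 < e) :
    ∃ r, R ≤ r ∧ energy f u v r < e := by
  set K := R ^ 2 * energy f u v R
  have hK : 0 ≤ |K| / e := by positivity
  refine ⟨R + |K| / e + 1, by linarith, ?_⟩
  set x := R + |K| / e + 1 with hx
  by_contra! hcon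
  have h1 := h.sq_mul_energy_le hN hf hR (by linarith : R ≤ x) fun y hy => hF y hy.1
  have h2 : |K| < x * e := by
    have : |K| / e < x := by linarith
    rwa [div_lt_iff₀ he] at this
  have h3 : x * e ≤ x ^ 2 * energy f u v x := by
    have : x * e ≤ x ^ 2 * e := by
      apply mul_le_mul_of_nonneg_right _ he.le
      nlinarith
    exact this.trans (mul_le_mul_of_nonneg_left hcon (sq_nonneg x))
  linarith [le_abs_self K]

lemma Traj.eq_of_v_zero (h : Traj N f J u v) {a b : ℝ} (ha : 0 ≤ a) (hab : a ≤ b)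
    (hv : ∀ y ∈ Icc a b, v y = 0) : u b = u a :=
  le_antisymm
    (le_of_deriv_nonpos hab h.contu.continuousOn (fun x hx => h.hu x (ha.trans_lt hx.1))
      fun x hx => (hv x (Ioo_subset_Icc_self hx)).le)
    (ge_of_deriv_nonneg hab h.contu.continuousOn (fun x hx => h.hu x (ha.trans_lt hx.1))
      fun x hx => (hv x (Ioo_subset_Icc_self hx)).ge)

/-- At a zero of `u` the energy is nonnegative, so reaching one from energy `≤ 0` would make the
energy constant and the trajectory stationary. -/
lemma Traj.ne_zero_of_energy_nonpos (hN : 2 ≤ N) (hf : Nonlin f J) (h : Traj N f J u v) {t : ℝ}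
    (ht : 0 ≤ t) (hE : energy f u v t ≤ 0) (hu : u t ≠ 0) : ∀ r, t ≤ r → u r ≠ 0 := by
  intro r hr h0
  have h1 : 0 ≤ energy f u v r := by
    have := F_le_energy (f := f) (u := u) (v := v) r
    rwa [h0, F_zero] at this
  rcases hr.lt_or_eq with h2 | h2
  · have h3 := h.v_zero_of_energy_le hN hf ht h2 (hE.trans h1)
    exact hu ((h.eq_of_v_zero ht hr h3).symm.trans h0)
  · exact hu (h2 ▸ h0)

lemma pos_of_ne_zero {u : ℝ → ℝ} (hu : Continuous u) {t : ℝ} (h0 : ∀ r, t ≤ r → u r ≠ 0)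
    (ht : 0 < u t) : ∀ r, t ≤ r → 0 < u r := by
  intro r hr
  by_contra! hcon
  obtain ⟨s, hs, hs0⟩ := intermediate_value_Icc' hr hu.continuousOn ⟨hcon, ht.le⟩
  exact h0 s hs.1 hs0

lemma Traj.pos_of_energy_nonpos (hN : 2 ≤ N) (hf : Nonlin f J) (h : Traj N f J u v) {t : ℝ}
    (ht : 0 ≤ t) (hE : energy f u v t ≤ 0) (hu : 0 < u t) : ∀ r, t ≤ r → 0 < u r :=
  pos_of_ne_zero h.contu (h.ne_zero_of_energy_nonpos hN hf ht hE hu.ne') hu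

/-- A trajectory does not become an equilibrium of zero energy in finite time. -/
lemma Traj.energy_pos (hN : 2 ≤ N) (hf : Nonlin f J) (h : Traj N f J u v)
    (h0 : 0 < energy f u v 0) (hnn : ∀ r, 0 ≤ r → 0 ≤ energy f u v r)
    (hnd : ∀ r, 0 ≤ r → ¬(u r = 0 ∧ v r = 0)) : ∀ r, 0 ≤ r → 0 < energy f u v r := by
  have hN' : (2 : ℝ) ≤ N := by exact_mod_cast hN
  intro r hr
  by_contra! hcon
  have hcE : Continuous fun x => energy f u v (max 0 x) :=
    (h.continuousOn_energy hf).comp_continuous (continuous_const.max continuous_id)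
      fun x => mem_Ici.2 (le_max_left _ _)
  obtain ⟨t, ht0, -, hEt, hlt⟩ := exists_first_hit hcE hr (c := 0) (by simpa using h0)
    (by simpa [max_eq_right hr] using hcon)
  rw [max_eq_right ht0.le] at hEt
  have hlt' : ∀ s, 0 ≤ s → s < t → 0 < energy f u v s := fun s hs hst => by
    simpa [max_eq_right hs] using hlt s hs hst
  have hv0 := h.v_zero_of_energy_le hN hf ht0.le (by linarith : t < t + 1)
    (hEt.le.trans (hnn _ (by linarith)))
  set ℓ := u t with hℓ
  have hvt : v t = 0 := hv0 t ⟨le_rfl, by linarith⟩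
  have hℓ0 : ℓ ≠ 0 := fun hu => hnd t ht0.le ⟨hu, hvt⟩
  have hfℓ : f ℓ = 0 := by
    have h1 : v =ᶠ[𝓝 (t + 1 / 2)] fun _ => 0 := by
      filter_upwards [Ioo_mem_nhds (by linarith : t < t + 1 / 2)
        (by linarith : t + 1 / 2 < t + 1)] with x hx using hv0 x (Ioo_subset_Icc_self hx)
    have h2 := (h.hv (t + 1 / 2) (by linarith)).unique
      ((hasDerivAt_const _ (0 : ℝ)).congr_of_eventuallyEq h1)
    rw [hv0 (t + 1 / 2) ⟨by linarith, by linarith⟩,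
      h.eq_of_v_zero ht0.le (by linarith : t ≤ t + 1 / 2)
        fun y hy => hv0 y ⟨hy.1, by linarith [hy.2]⟩] at h2
    linarith
  obtain ⟨K, z, hz, hK⟩ := hf.lip (x := ℓ) ⟨h.mem t ht0.le, hℓ0⟩
  have hz' : z ∈ 𝓝 ℓ := by
    rwa [IsOpen.nhdsWithin_eq (hf.isOpen.sdiff isClosed_singleton) ⟨h.mem t ht0.le, hℓ0⟩] at hz
  obtain ⟨ε, hε, hmem⟩ := Metric.eventually_nhds_iff.1
    ((h.contu.continuousAt.eventually hz').and (lt_mem_nhds (by linarith : t / 2 < t)))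
  have hm : ∀ x ∈ Icc (t - ε / 2) t, u x ∈ z ∧ t / 2 < x := fun x hx => hmem (by
    rw [Real.dist_eq, abs_lt]; constructor <;> linarith [hx.1, hx.2])
  have hlow := (hm (t - ε / 2) ⟨le_rfl, by linarith⟩).2
  -- Gronwall is run backwards from the equilibrium `(ℓ, 0)`. Friction then has the unfavourable
  -- sign, but on the interval considered, which lies in `(t/2, t]`, its coefficient is at most
  -- `2(N-1)/t`.
  set C : ℝ := 1 + K + 4 * (N - 1) / t with hC
  have hG := nonpos_of_gronwall (a := -t) (b := -(t - ε / 2)) (C := C)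
    (G := fun x => (u (-x) - ℓ) ^ 2 + v (-x) ^ 2)
    (G' := fun x => 2 * (u (-x) - ℓ) * (-v (-x)) +
      2 * v (-x) * (-(-(((N : ℝ) - 1) / (-x) * v (-x)) - f (u (-x))))) (by linarith) ?_ ?_ ?_ ?_
  · simp only [neg_neg] at hG
    have h1 : v (t - ε / 2) = 0 := by nlinarith [sq_nonneg (u (t - ε / 2) - ℓ)]
    have h2 : u (t - ε / 2) = ℓ := by nlinarith [sq_nonneg (v (t - ε / 2))]
    have h3 := hlt' (t - ε / 2) (by linarith) (by linarith)
    simp only [energy, h1, h2] at h3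
    simp only [energy, hvt] at hEt
    rw [hEt] at h3
    exact lt_irrefl _ h3
  · have := h.contu; have := h.contv
    exact Continuous.continuousOn (by fun_prop)
  · intro x hx
    have hx0 : 0 < -x := by linarith [hx.2]
    have h1 := (h.hu (-x) hx0).comp x (hasDerivAt_neg x)
    have h2 := (h.hv (-x) hx0).comp x (hasDerivAt_neg x)
    refine (((h1.sub_const ℓ).pow 2).add (h2.pow 2)).congr_deriv ?_
    simp only [Function.comp]
    ring
  · intro x hx
    have hxI : -x ∈ Icc (t - ε / 2) t := ⟨by linarith [hx.2], by linarith [hx.1]⟩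
    obtain ⟨h1, h2⟩ := hm _ hxI
    have hx0 : 0 < -x := by linarith
    have h3 : |f (u (-x))| ≤ K * |u (-x) - ℓ| := by
      have := hK.dist_le_mul _ h1 _ (mem_of_mem_nhds hz')
      rwa [hfℓ, Real.dist_eq, Real.dist_eq, sub_zero] at this
    have h4 : ((N : ℝ) - 1) / (-x) ≤ 2 * (N - 1) / t := by
      rw [div_le_div_iff₀ hx0 ht0]; nlinarith
    have h5 : v (-x) * f (u (-x)) ≤ K * (|v (-x)| * |u (-x) - ℓ|) := by
      calc _ ≤ |v (-x) * f (u (-x))| := le_abs_self _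
        _ = |v (-x)| * |f (u (-x))| := abs_mul _ _
        _ ≤ |v (-x)| * (K * |u (-x) - ℓ|) := mul_le_mul_of_nonneg_left h3 (abs_nonneg _)
        _ = _ := by ring
    have h6 : -((u (-x) - ℓ) * v (-x)) ≤ |v (-x)| * |u (-x) - ℓ| := by
      rw [← abs_mul, mul_comm]; exact neg_le_abs _
    have h7 : 2 * (|v (-x)| * |u (-x) - ℓ|) ≤ (u (-x) - ℓ) ^ 2 + v (-x) ^ 2 := by
      rw [← sq_abs (u (-x) - ℓ), ← sq_abs (v (-x))]
      nlinarith [sq_nonneg (|v (-x)| - |u (-x) - ℓ|)]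
    have h8 : ((N : ℝ) - 1) / (-x) * v (-x) ^ 2 ≤ 2 * (N - 1) / t * v (-x) ^ 2 :=
      mul_le_mul_of_nonneg_right h4 (sq_nonneg _)
    have h9 : (0 : ℝ) ≤ 2 * (N - 1) / t := div_nonneg (by linarith) ht0.le
    have h10 := mul_le_mul_of_nonneg_left h7 K.2
    have h11 : 2 * (N - 1) / t * v (-x) ^ 2 ≤
        2 * (N - 1) / t * ((u (-x) - ℓ) ^ 2 + v (-x) ^ 2) :=
      mul_le_mul_of_nonneg_left (by nlinarith [sq_nonneg (u (-x) - ℓ)]) h9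
    have h12 : C = 1 + K + 2 * (2 * (N - 1) / t) := by rw [hC]; ring
    rw [h12]
    simp only [NNReal.val_eq_coe] at h10
    nlinarith
  · simp [← hℓ, hvt]

/-- A trajectory that stays nonnegative loses its energy. -/
lemma Traj.exists_energy_lt_of_nonneg (hN : 2 ≤ N) (hf : Nonlin f J) (hr : RightWell f J δ β X)
    (h : Traj N f J u v) {R e : ℝ} (hR : 0 < R) (hu : ∀ r, R ≤ r → 0 ≤ u r)
    (hX : ∀ r, R ≤ r → u r ≤ X) (he : 0 < e) : ∃ r, R ≤ r ∧ energy f u v r < e := by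
  have hN' : (2 : ℝ) ≤ N := by exact_mod_cast hN
  by_contra! hcon
  obtain ⟨b, hb, f₀, hf₀, hFb, hfb⟩ := hr.split hf (half_pos he)
  obtain ⟨B, hB⟩ := isCompact_Icc.exists_bound_of_continuousOn
    (hf.continuousOn_F.mono (hr.sub hf))
  have hB0 : 0 ≤ B := (norm_nonneg _).trans (hB 0 ⟨le_rfl, hr.X_pos.le⟩)
  have hER := hcon R le_rfl
  set V := √(2 * (energy f u v R + B)) with hV
  have hV0 : 0 < V := Real.sqrt_pos.2 (by linarith)
  have hV2 : V ^ 2 = 2 * (energy f u v R + B) := Real.sq_sqrt (by linarith)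
  set k := √e with hk
  have hk0 : 0 < k := Real.sqrt_pos.2 he
  have hk2 : k ^ 2 = e := Real.sq_sqrt he.le
  have hc0 : 0 < ((N : ℝ) - 1) * V := mul_pos (by linarith) hV0
  set ρ := R + 2 * (((N : ℝ) - 1) * V) / f₀ with hρ
  have hρ1 : 0 < 2 * (((N : ℝ) - 1) * V) / f₀ := by positivity
  obtain ⟨s, hs, -, hus⟩ := h.exists_neg_of_nonneg hN (hr.β_pos.trans hb.1) hk0 hf₀ hV0.le
    (by linarith : 0 < ρ) (by
      have h1 : 2 * (((N : ℝ) - 1) * V) / f₀ ≤ ρ := by linarith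
      rw [div_le_iff₀ (by linarith)]
      rw [div_le_iff₀ hf₀] at h1
      nlinarith) le_rfl (fun s hs => by
      have hRs : R ≤ s := by linarith [hs.1]
      have h1 := h.energy_le hN hf hR.le hRs
      have h2 := (abs_le.1 (hB _ ⟨hu s hRs, hX s hRs⟩)).1
      apply abs_le_of_sq_le_sq _ hV0.le
      rw [hV2]
      have h3 : energy f u v s = v s ^ 2 / 2 + F f (u s) := rfl
      linarith) (fun s hs h1 h2 => by
      have h3 := hcon s (by linarith [hs.1])
      have h4 := hFb _ ⟨h1, h2⟩
      rw [← abs_of_pos hk0]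
      apply sq_le_sq.1
      rw [hk2]; simp only [energy] at h3; linarith)
    (fun s hs h1 => hfb _ ⟨h1, hX s (by linarith [hs.1])⟩) (hu ρ (by linarith))
  linarith [hu s (by linarith)]

/-- A trajectory with little energy does not leave a well. -/
lemma Traj.trapped (hN : 2 ≤ N) (hf : Nonlin f J) (h : Traj N f J u v) {p q w c₀ R : ℝ}
    (hw : 0 < w) (hc : 0 < c₀) (hR : 0 < R) (hF : ∀ s ∈ Icc p q, F f s ≤ 0)
    (hp : ∀ s ∈ Icc p (p + w), F f s ≤ -c₀) (hq : ∀ s ∈ Icc (q - w) q, F f s ≤ -c₀)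
    (hu : u R ∈ Icc (p + w) (q - w))
    (hE : energy f u v R * (R + w / √(2 * c₀)) < √(2 * c₀) * w) :
    (∀ r, R ≤ r → u r ∈ Icc p q) ∨
      ∃ t, R ≤ t ∧ energy f u v t < 0 ∧ ∀ r ∈ Icc R t, u r ∈ Icc p q := by
  by_contra! hcon
  obtain ⟨⟨r, hRr, hr⟩, hneg⟩ := hcon
  have hcd : Continuous fun x => min (u x - p) (q - u x) :=
    (h.contu.sub continuous_const).min (continuous_const.sub h.contu)
  obtain ⟨t, hRt, -, ht0, hlt⟩ := exists_first_hit hcd hRr (c := 0)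
    (lt_min (by linarith [hu.1]) (by linarith [hu.2])) (by
      by_contra! h1
      have := lt_min_iff.1 h1
      exact hr ⟨by linarith [this.1], by linarith [this.2]⟩)
  have hin : ∀ s ∈ Icc R t, u s ∈ Icc p q := by
    intro s hs
    have h1 : 0 ≤ min (u s - p) (q - u s) := by
      rcases hs.2.lt_or_eq with h2 | h2
      · exact (hlt s hs.1 h2).le
      · rw [h2]; exact ht0.ge
    have := le_min_iff.1 h1
    exact ⟨by linarith [this.1], by linarith [this.2]⟩
  have hEt : 0 ≤ energy f u v t := by
    by_contra! h1
    obtain ⟨s, hs, hs'⟩ := hneg t hRt.le h1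
    exact hs' (hin s hs)
  have hF' : ∀ s ∈ Icc R t, F f (u s) ≤ 0 := fun s hs => hF _ (hin s hs)
  rcases min_choice (u t - p) (q - u t) with h1 | h1
  · have := h.crossing hN hf (p := p) (p' := p + w) (by linarith) hc hR hRt.le hF' hEt hp hu.1
      (by linarith)
    rw [add_sub_cancel_left] at this
    linarith
  · have := h.neg.crossing hN hf.refl (p := -q) (p' := -(q - w)) (by linarith) hc hR hRt.le
      (fun s hs => by simpa [F_refl] using hF' s hs) (by rwa [energy_neg])
      (fun s hs => by
        rw [F_refl]; exact hq _ ⟨by linarith [hs.2], by linarith [hs.1]⟩)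
      (by simp only [Pi.neg_apply]; linarith [hu.2]) (by simp only [Pi.neg_apply]; linarith)
    rw [energy_neg, show -(q - w) - -q = w by ring] at this
    linarith

/-- A trajectory entering the right well slowly stays positive and loses its energy. -/
lemma Traj.slow_descent (hN : 2 ≤ N) (hf : Nonlin f J) (hr : RightWell f J δ β X)
    (h : Traj N f J u v) {p w c₀ ρ : ℝ} (hp : 0 < p) (hw : 0 < w) (hc : 0 < c₀)
    (hpw : p + w ≤ β) (hwell : ∀ s ∈ Icc p (p + w), F f s ≤ -c₀) (hρ : 0 < ρ) (huρ : u ρ = β)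
    (hvρ : v ρ ≤ 0) (hE : energy f u v ρ * (ρ + w / √(2 * c₀)) < √(2 * c₀) * w) :
    (∀ r, ρ ≤ r → 0 < u r) ∧ ∀ e > 0, ∃ r, ρ ≤ r ∧ energy f u v r < e := by
  have hF : ∀ s ∈ Icc p β, F f s ≤ 0 := fun s hs => hr.nonpos s ⟨hp.le.trans hs.1, hs.2⟩
  have hdesc : ∀ b, ρ ≤ b → (∀ s ∈ Icc ρ b, p ≤ u s) → 0 ≤ energy f u v b →
      ∀ s ∈ Icc ρ b, u s ∈ Icc p β := by
    intro b hb hpu hEb s hs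
    refine ⟨hpu s hs, ?_⟩
    have hv := h.descending hN hf hρ.le hF huρ.le hvρ hpu fun x hx =>
      hEb.trans (h.energy_le hN hf (hρ.le.trans hx.1) hx.2)
    rw [← huρ]
    exact le_of_deriv_nonpos hs.1 h.contu.continuousOn (fun x hx => h.hu x (hρ.trans hx.1))
      fun x hx => hv x ⟨hx.1.le, hx.2.le.trans hs.2⟩
  -- The trajectory cannot afford to cross the strip with nonnegative energy. Either it reaches `p`
  -- with negative energy, after which it cannot vanish, or it never gets down to `p`.
  by_cases hhit : ∃ r, ρ ≤ r ∧ u r ≤ p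
  · obtain ⟨r, hρr, hur⟩ := hhit
    obtain ⟨b, hρb, -, hub, hlt⟩ := exists_first_hit h.contu hρr (by rw [huρ]; linarith) hur
    have hpu : ∀ s ∈ Icc ρ b, p ≤ u s := by
      intro s hs
      rcases hs.2.lt_or_eq with h2 | h2
      · exact (hlt s hs.1 h2).le
      · rw [h2, hub]
    have hEb : energy f u v b < 0 := by
      by_contra! hEb
      have := h.crossing hN hf (p := p) (p' := p + w) (by linarith) hc hρ hρb.le
        (fun s hs => hF _ (hdesc b hρb.le hpu hEb s hs)) hEb hwell (by rwa [huρ]) hub.le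
      rw [add_sub_cancel_left] at this
      linarith
    have hpos := h.pos_of_energy_nonpos hN hf (hρ.trans hρb).le hEb.le (by rwa [hub])
    refine ⟨fun s hs => ?_, fun e he => ⟨b, hρb.le, hEb.trans he⟩⟩
    rcases le_total s b with h2 | h2
    · exact hp.trans_le (hpu s ⟨hs, h2⟩)
    · exact hpos s h2
  · push Not at hhit
    refine ⟨fun s hs => hp.trans (hhit s hs), fun e he => ?_⟩
    by_cases hneg : ∃ r, ρ ≤ r ∧ energy f u v r < 0
    · obtain ⟨r, h1, h2⟩ := hneg
      exact ⟨r, h1, h2.trans he⟩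
    · push Not at hneg
      exact h.exists_energy_lt_of_nonpos hN hf hρ.le (fun r hr' =>
        hF _ (hdesc r hr' (fun s hs => (hhit s hs.1).le) (hneg r hr') r ⟨hr', le_rfl⟩)) he

lemma tendsto_of_v_nonpos {R A : ℝ} (h : Traj N f J u v) (hR : 0 ≤ R)
    (hv : ∀ r, R ≤ r → v r ≤ 0) (hA : ∀ r, R ≤ r → A ≤ u r) :
    ∃ ℓ, Tendsto u atTop (𝓝 ℓ) ∧ A ≤ ℓ ∧ ∀ r, R ≤ r → ℓ ≤ u r := by
  have hanti : Antitone fun r => u (max R r) := by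
    intro x y hxy
    exact le_of_deriv_nonpos (max_le_max_left R hxy) h.contu.continuousOn
      (fun z hz => h.hu z (hR.trans_lt ((le_max_left R x).trans_lt hz.1)))
      fun z hz => hv z ((le_max_left R x).trans hz.1.le)
  have hbdd : BddBelow (range fun r => u (max R r)) :=
    ⟨A, by rintro _ ⟨r, rfl⟩; exact hA _ (le_max_left _ _)⟩
  have ht := tendsto_atTop_ciInf hanti hbdd
  refine ⟨_, ht.congr' ?_, le_ciInf fun r => hA _ (le_max_left _ _), fun r hr => ?_⟩
  · filter_upwards [eventually_ge_atTop R] with r hr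
    simp only [max_eq_right hr]
  · have := ciInf_le hbdd r
    simpa only [max_eq_right hr] using this

/-- The possible limits of a positive trajectory whose energy decreases to zero. -/
lemma Traj.tendsto_of_energy_tendsto_zero (hN : 2 ≤ N) (hf : Nonlin f J) (hr : RightWell f J δ β X)
    (h : Traj N f J u v) {R : ℝ} (hR : 0 < R) (hu : ∀ r, R ≤ r → 0 < u r ∧ u r < X)
    (hE : ∀ r, R ≤ r → 0 < energy f u v r)
    (hE0 : ∀ e > 0, ∃ r, 0 ≤ r ∧ energy f u v r < e) :
    ∃ ℓ ∈ Icc 0 β, Tendsto u atTop (𝓝 ℓ) ∧ ∃ R', R ≤ R' ∧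
      ((ℓ < β ∧ ∀ r, R' ≤ r → u r ≤ β) ∨
      (ℓ = β ∧ ((∀ r, R' ≤ r → β < u r) ∨ ∀ r, R' ≤ r → u r < β ∧ 0 < v r))) := by
  have hF : ∀ s ∈ Icc 0 β, F f s ≤ 0 := hr.nonpos
  by_cases hd : ∃ r, R ≤ r ∧ u r ≤ β ∧ v r ≤ 0
  · obtain ⟨R', hRR', huR', hvR'⟩ := hd
    have hR' := hR.trans_le hRR'
    have hv : ∀ r, R' ≤ r → v r ≤ 0 := fun r hr' =>
      h.descending hN hf hR'.le hF huR' hvR' (fun s hs => (hu s (hRR'.trans hs.1)).1.le)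
        (fun s hs => (hE s (hRR'.trans hs.1)).le) r ⟨hr', le_rfl⟩
    obtain ⟨ℓ, hℓ, h0, hle⟩ := tendsto_of_v_nonpos h hR'.le hv
      fun r hr' => (hu r (hRR'.trans hr')).1.le
    have hub : ∀ r, R' ≤ r → u r ≤ β := fun r hr' =>
      (le_of_deriv_nonpos hr' h.contu.continuousOn (fun x hx => h.hu x (hR'.trans hx.1))
        fun x hx => hv x hx.1.le).trans huR'
    have hℓβ : ℓ < β := by
      refine lt_of_le_of_ne ((hle R' le_rfl).trans huR') fun heq => ?_
      have hc : ∀ r, R' ≤ r → u r = β := fun r hr' =>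
        le_antisymm (hub r hr') (heq ▸ hle r hr')
      have h1 : u =ᶠ[𝓝 (R' + 1)] fun _ => β := by
        filter_upwards [lt_mem_nhds (by linarith : R' < R' + 1)] with x hx using hc x hx.le
      have h2 := (h.hu (R' + 1) (by linarith)).unique
        ((hasDerivAt_const _ β).congr_of_eventuallyEq h1)
      have h3 := hE (R' + 1) (by linarith)
      simp [energy, h2, hc (R' + 1) (by linarith), hr.F_eq] at h3
    exact ⟨ℓ, ⟨h0, hℓβ.le⟩, hℓ, R', hRR', Or.inl ⟨hℓβ, hub⟩⟩
  push Not at hd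
  by_cases hab : ∃ r, R ≤ r ∧ β < u r
  · obtain ⟨R', hRR', huR'⟩ := hab
    -- In this case `v > 0` whenever `u ≤ β`, so the level `β` cannot be crossed downwards.
    have hgt : ∀ r, R' ≤ r → β < u r := by
      intro r hr'
      by_contra! hcon
      obtain ⟨t, hRt, -, hut, hlt⟩ := exists_first_hit h.contu hr' huR' hcon
      have ht0 : 0 < t := hR.trans (hRR'.trans_lt hRt)
      have hvt := hd t (hRR'.trans hRt.le) hut.le
      obtain ⟨ε, hε, hε'⟩ := Metric.eventually_nhds_iff.1
        (h.contv.continuousAt.eventually (lt_mem_nhds hvt))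
      set x := max R' (t - ε / 2) with hx
      have hxt : x < t := max_lt hRt (by linarith)
      have := ge_of_deriv_nonneg hxt.le h.contu.continuousOn
        (fun z hz => h.hu z (hR.trans_le (hRR'.trans ((le_max_left _ _).trans hz.1.le))))
        (fun z hz => (hε' (by
          rw [Real.dist_eq, abs_lt]
          constructor <;> linarith [hz.1, hz.2, le_max_right R' (t - ε / 2)])).le)
      linarith [hlt x (le_max_left _ _) hxt]
    refine ⟨β, ⟨hr.β_pos.le, le_rfl⟩, ?_, R', hRR', Or.inr ⟨rfl, Or.inl hgt⟩⟩
    rw [Metric.tendsto_atTop]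
    intro ε hε
    have hb : β < min X (β + ε) := lt_min hr.lt (by linarith)
    obtain ⟨r, hr0, hEr⟩ := hE0 _ (hr.F_pos hf hb (min_le_left _ _))
    refine ⟨max r R', fun s hs => ?_⟩
    have hs1 := (le_max_right _ _).trans hs
    have hs2 := hgt s hs1
    have hs3 : u s < min X (β + ε) := by
      by_contra! hcon
      have h1 : F f (min X (β + ε)) ≤ F f (u s) := by
        rcases hcon.lt_or_eq with h2 | h2
        · exact (hr.F_lt hf hb.le h2 (hu s (hRR'.trans hs1)).2.le).le
        · rw [h2]
      have h2 := (F_le_energy (f := f) (u := u) (v := v) s).trans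
        (h.energy_le hN hf hr0 ((le_max_left _ _).trans hs))
      linarith
    rw [Real.dist_eq, abs_lt]
    constructor <;> linarith [hs3.trans_le (min_le_right _ _)]
  push Not at hab
  obtain ⟨ℓ, hℓ, h0, hle⟩ := tendsto_of_v_nonpos h.neg hR.le (A := -β)
    (fun r hr' => by simpa using (hd r hr' (hab r hr')).le) (fun r hr' => by simpa using hab r hr')
  have hℓ' : Tendsto u atTop (𝓝 (-ℓ)) := by simpa using hℓ.neg
  have hle' : ∀ r, R ≤ r → u r ≤ -ℓ := fun r hr' => by
    have := hle r hr'; simp only [Pi.neg_apply] at this; linarith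
  have hℓ0 : 0 ≤ -ℓ := (hu R le_rfl).1.le.trans (hle' R le_rfl)
  have hlt : ∀ r, R ≤ r → u r < -ℓ := by
    intro r hr'
    refine lt_of_lt_of_le ?_ (hle' (r + 1) (by linarith))
    have hm : StrictMonoOn u (Ici R) := strictMonoOn_of_deriv_pos (convex_Ici R)
      h.contu.continuousOn fun x hx => by
        rw [interior_Ici] at hx
        rw [(h.hu x (hR.trans hx)).deriv]
        exact hd x hx.le (hab x hx.le)
    exact hm hr' (by simp only [mem_Ici]; linarith) (by linarith)
  refine ⟨-ℓ, ⟨hℓ0, by linarith⟩, hℓ', R, le_rfl, ?_⟩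
  rcases (by linarith : -ℓ ≤ β).lt_or_eq with h1 | h1
  · exact Or.inl ⟨h1, hab⟩
  · exact Or.inr ⟨h1, Or.inr fun r hr' => ⟨h1 ▸ hlt r hr', hd r hr' (hab r hr')⟩⟩

/-! ### Good trajectories -/

/-- The trajectory has at most `k` sign changes and loses all its energy (down to zero or beyond)
in the central zone. -/
def Good (f : ℝ → ℝ) (X X₂ : ℝ) (k : ℕ) (u v : ℝ → ℝ) : Prop :=
  ¬ SignChangesAtLeast u (k + 1) ∧
    ∀ e > 0, ∃ r, 0 ≤ r ∧ energy f u v r < e ∧ u r ∈ Ioo (-X₂) X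

lemma good_neg {k : ℕ} : Good (refl f) X₂ X k (-u) (-v) ↔ Good f X X₂ k u v := by
  unfold Good
  rw [signChangesAtLeast_neg]
  refine and_congr_right fun _ => forall_congr' fun e => forall_congr' fun _ =>
    exists_congr fun r => and_congr_right fun _ => ?_
  rw [energy_neg]
  simp only [Pi.neg_apply, mem_Ioo]
  exact and_congr_right fun _ => ⟨fun h => ⟨by linarith, by linarith⟩,
    fun h => ⟨by linarith, by linarith⟩⟩

lemma Traj.good_of_energy_lt (hN : 2 ≤ N) (hf : Nonlin f J) (h : Traj N f J u v) {k : ℕ} {a : ℝ}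
    (hk : ¬ SignChangesAtLeast u (k + 1)) (ha : 0 ≤ a) (hz : u a ∈ Ioo (-X₂) X)
    (h1 : energy f u v a < F f X) (h2 : energy f u v a < F f (-X₂))
    (hE : ∀ e > 0, ∃ r, a ≤ r ∧ energy f u v r < e) : Good f X X₂ k u v := by
  refine ⟨hk, fun e he => ?_⟩
  obtain ⟨r, har, hEr⟩ := hE e he
  exact ⟨r, ha.trans har, hEr, (h.mem_zone_iff hN hf ha har h1 h2).1 hz⟩

end

end BoundState

namespace BoundState

/-! ### One-parameter families of trajectories -/

/-- A one-parameter family of trajectories of positive initial energy, depending continuously on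
the parameter in `[0, 1]` up to the first double zero. -/
structure Family (N : ℕ) (f : ℝ → ℝ) (J : Set ℝ) (U V : ℝ → ℝ → ℝ) : Prop where
  traj : ∀ s ∈ Icc (0 : ℝ) 1, Traj N f J (U s) (V s)
  absorb : ∀ s ∈ Icc (0 : ℝ) 1, ∀ r₀, 0 ≤ r₀ → U s r₀ = 0 → V s r₀ = 0 →
    ∀ r, r₀ ≤ r → U s r = 0 ∧ V s r = 0
  pos : ∀ s ∈ Icc (0 : ℝ) 1, 0 < F f (U s 0)
  cont : ∀ c ∈ Icc (0 : ℝ) 1, ∀ R, (∀ r ∈ Ico 0 R, ¬(U c r = 0 ∧ V c r = 0)) → ∀ ε > 0,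
    ∀ᶠ s in 𝓝[Icc 0 1] c, ∀ r ∈ Icc 0 R, |U s r - U c r| < ε ∧ |V s r - V c r| < ε

section
variable {N : ℕ} {f : ℝ → ℝ} {J : Set ℝ} {U V : ℝ → ℝ → ℝ} {δ β X δ₂ β₂ X₂ : ℝ} {k : ℕ} {c : ℝ}

lemma Family.neg (h : Family N f J U V) :
    Family N (refl f) (Neg.neg ⁻¹' J) (fun s => -U s) (fun s => -V s) where
  traj s hs := (h.traj s hs).neg
  absorb s hs r₀ hr hu hv r hr' := by
    simpa using h.absorb s hs r₀ hr (by simpa using hu) (by simpa using hv) r hr'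
  pos s hs := by simpa [F_refl] using h.pos s hs
  cont c hc R hnd ε hε := by
    filter_upwards [h.cont c hc R (fun r hr => by simpa using hnd r hr) ε hε] with s hs r hr
    simpa [neg_add_eq_sub, abs_sub_comm] using hs r hr

lemma Family.tendsto (h : Family N f J U V) (hc : c ∈ Icc (0 : ℝ) 1) {R : ℝ} (hR : 0 ≤ R)
    (hnd : ∀ r ∈ Ico 0 R, ¬(U c r = 0 ∧ V c r = 0)) :
    Tendsto (fun s => U s R) (𝓝[Icc 0 1] c) (𝓝 (U c R)) ∧
      Tendsto (fun s => V s R) (𝓝[Icc 0 1] c) (𝓝 (V c R)) := by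
  constructor <;>
  · rw [Metric.tendsto_nhds]
    intro ε hε
    filter_upwards [h.cont c hc R hnd ε hε] with s hs
    have := hs R ⟨hR, le_rfl⟩
    simp only [Real.dist_eq, this.1, this.2]

lemma Family.tendsto_energy (hf : Nonlin f J) (h : Family N f J U V) (hc : c ∈ Icc (0 : ℝ) 1)
    {R : ℝ} (hR : 0 ≤ R) (hnd : ∀ r ∈ Ico 0 R, ¬(U c r = 0 ∧ V c r = 0)) :
    Tendsto (fun s => energy f (U s) (V s) R) (𝓝[Icc 0 1] c) (𝓝 (energy f (U c) (V c) R)) := by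
  obtain ⟨h1, h2⟩ := h.tendsto hc hR hnd
  exact ((h2.pow 2).div_const 2).add
    ((hf.continuousAt_F ((h.traj c hc).mem R hR)).tendsto.comp h1)

lemma Family.no_double_zero (h : Family N f J U V) (hc : c ∈ Icc (0 : ℝ) 1) {R : ℝ}
    (hU : ¬(U c R = 0 ∧ V c R = 0)) : ∀ r ∈ Icc 0 R, ¬(U c r = 0 ∧ V c r = 0) :=
  fun r hr h0 => hU (h.absorb c hc r hr.1 h0.1 h0.2 R hr.2)

/-- Near the parameter `c` no sign changes before time `R` appear. -/
lemma Family.transfer (h : Family N f J U V) (hc : c ∈ Icc (0 : ℝ) 1) {R : ℝ} (hR : 0 ≤ R)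
    (hU : U c R ≠ 0) : ∀ᶠ s in 𝓝[Icc 0 1] c, 0 < U c R * U s R ∧
      ∀ n x, x ≤ R → Alt (U s) n x → ∃ y ≤ R, Alt (U c) n y := by
  have hnd := h.no_double_zero hc (R := R) fun h => hU h.1
  have hT := h.traj c hc
  obtain ⟨z, hz, hmin⟩ := isCompact_Icc.exists_isMinOn (nonempty_Icc.2 hR)
    (hT.contu.abs.max hT.contv.abs).continuousOn
  -- Without double zeros, position and velocity are never both small on `[0, R]`. At a critical
  -- point of a nearby `U s` the velocity `V c` is small, so `U c` is large and has the same sign as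
  -- `U s`.
  set m := max |U c z| |V c z| with hm
  have hm0 : 0 < m := by
    by_contra! hle
    have h1 := (le_max_left _ _).trans hle
    have h2 := (le_max_right _ _).trans hle
    exact hnd z hz ⟨abs_nonpos_iff.1 h1, abs_nonpos_iff.1 h2⟩
  have hU0 : 0 < |U c R| := abs_pos.2 hU
  have key : ∀ x y ε : ℝ, |y - x| < ε → ε ≤ |x| → 0 < x * y := by
    intro x y ε h1 h2
    rcases le_total 0 x with hx | hx
    · rw [abs_of_nonneg hx] at h2
      have := (abs_lt.1 (h1.trans_le h2)).1
      exact mul_pos (lt_of_le_of_ne hx (by rintro rfl; linarith [abs_nonneg (y - 0)]))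
        (by linarith)
    · rw [abs_of_nonpos hx] at h2
      have := (abs_lt.1 (h1.trans_le h2)).2
      exact mul_pos_of_neg_of_neg
        (lt_of_le_of_ne hx (by rintro rfl; linarith [abs_nonneg (y - 0)])) (by linarith)
  filter_upwards [h.cont c hc R (fun r hr => hnd r (Ico_subset_Icc_self hr)) (min m |U c R|)
    (lt_min hm0 hU0), eventually_mem_nhdsWithin] with s hs hsP
  have hcrit : ∀ t ∈ Icc 0 R, V s t = 0 → 0 < U c t * U s t := by
    intro t ht hV
    obtain ⟨h1, h2⟩ := hs t ht
    have h3 : m ≤ max |U c t| |V c t| := isMinOn_iff.1 hmin t ht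
    rw [hV, zero_sub, abs_neg] at h2
    have h4 : m ≤ |U c t| := by
      rcases le_max_iff.1 h3 with h5 | h5
      · exact h5
      · linarith [h2.trans_le (min_le_left _ _)]
    exact key _ _ _ (h1.trans_le (min_le_left _ _)) h4
  have hRR := key _ _ _ ((hs R ⟨hR, le_rfl⟩).1.trans_le (min_le_right _ _)) le_rfl
  have hTs := h.traj s hsP
  exact ⟨hRR, fun n x hx hA => Alt.transfer hT.contu hTs.contu hTs.hu
    (fun t ht0 htR hV => hcrit t ⟨ht0.le, htR.le⟩ hV) (hcrit 0 ⟨le_rfl, hR⟩ hTs.v_zero) hRR hx hA⟩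

/-- Goodness is a closed condition. -/
lemma Family.good_of_frequently (hN : 2 ≤ N) (hf : Nonlin f J) (hr : RightWell f J δ β X)
    (hl : RightWell (refl f) (Neg.neg ⁻¹' J) δ₂ β₂ X₂) (h : Family N f J U V)
    (hc : c ∈ Icc (0 : ℝ) 1) (hfreq : ∃ᶠ s in 𝓝[Icc 0 1] c, Good f X X₂ k (U s) (V s)) :
    Good f X X₂ k (U c) (V c) := by
  have hT := h.traj c hc
  refine ⟨fun hk => ?_, ?_⟩
  · obtain ⟨r, hA⟩ := signChangesAtLeast_iff.1 hk
    have hUr : U c r ≠ 0 := by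
      obtain ⟨s, -, -, hs⟩ := hA
      exact right_ne_zero_of_mul hs.ne
    have hnd := h.no_double_zero hc (R := r) fun h => hUr h.1
    have := Alt.eventually hA (W := U) (l := 𝓝[Icc 0 1] c) fun x hx =>
      (h.tendsto hc hx.1.le fun y hy => hnd y ⟨hy.1, hy.2.le.trans hx.2⟩).1
    obtain ⟨s, hs1, hs2⟩ := (hfreq.and_eventually this).exists
    exact hs1.1 (signChangesAtLeast_iff.2 ⟨r, hs2⟩)
  · by_contra! hcon
    obtain ⟨e₀, he₀, hcon⟩ := hcon
    have hFX : 0 < F f X := hr.F_pos hf hr.lt le_rfl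
    have hFX₂ : 0 < F f (-X₂) := by
      have := hl.F_pos hf.refl hl.lt le_rfl; rwa [F_refl] at this
    set e := min e₀ (min (F f X) (F f (-X₂))) with he
    have he0 : 0 < e := lt_min he₀ (lt_min hFX hFX₂)
    have heX : e ≤ F f X := (min_le_right _ _).trans (min_le_left _ _)
    have heX₂ : e ≤ F f (-X₂) := (min_le_right _ _).trans (min_le_right _ _)
    have hnd : ∀ r, 0 ≤ r → ¬(U c r = 0 ∧ V c r = 0) := fun r hr0 h0 =>
      hcon r hr0 (by simp [energy, h0, F_zero, he₀]) (by
        rw [h0.1]; exact ⟨by linarith [hl.X_pos], hr.X_pos⟩)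
    have hE : ∀ R, 0 ≤ R → Tendsto (fun s => energy f (U s) (V s) R) (𝓝[Icc 0 1] c)
        (𝓝 (energy f (U c) (V c) R)) := fun R hR =>
      h.tendsto_energy hf hc hR fun r hr' => hnd r hr'.1
    -- If the limit trajectory has energy below `e` at some time, it is outside the zone there by
    -- `hcon`, and so are its neighbours. The barriers keep them outside whenever their energy is
    -- below `e`, against goodness.
    by_cases hlow : ∃ r, 0 ≤ r ∧ energy f (U c) (V c) r < e
    · obtain ⟨r, hr0, hEr⟩ := hlow
      have hout := hcon r hr0 (hEr.trans_le (min_le_left _ _))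
      have hX : U c r ≠ X := hT.ne_of_energy_lt hN hf hr0 le_rfl (hEr.trans_le heX)
      have hX₂ : U c r ≠ -X₂ := hT.ne_of_energy_lt hN hf hr0 le_rfl (hEr.trans_le heX₂)
      have hev : ∀ᶠ x in 𝓝 (U c r), x ∉ Ioo (-X₂) X := by
        rcases hX.lt_or_gt with h1 | h1
        · have h2 : U c r < -X₂ := by
            rcases hX₂.lt_or_gt with h2 | h2
            · exact h2
            · exact absurd ⟨h2, h1⟩ hout
          filter_upwards [gt_mem_nhds h2] with x hx hx'
          linarith [hx'.1]
        · filter_upwards [lt_mem_nhds h1] with x hx hx'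
          linarith [hx'.2]
      have hev' := (h.tendsto hc hr0 fun y hy => hnd y hy.1).1.eventually hev
      obtain ⟨s, ⟨hs1, hs2⟩, hs3, hsP⟩ := ((hfreq.and_eventually hev').and_eventually
        (((hE r hr0).eventually_lt_const hEr).and eventually_mem_nhdsWithin)).exists
      obtain ⟨x, hx0, hEx, hux⟩ := hs1.2 e he0
      have hTs := h.traj s hsP
      rcases le_total r x with h1 | h1
      · exact hs2 ((hTs.mem_zone_iff hN hf hr0 h1 (hs3.trans_le heX) (hs3.trans_le heX₂)).2 hux)
      · exact hs2 ((hTs.mem_zone_iff hN hf hx0 h1 (hEx.trans_le heX) (hEx.trans_le heX₂)).1 hux)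
    -- If its energy never falls below `e`, good neighbours still have energy `e/2` at the late time
    -- `R₀` but lose it afterwards, which costs more than `k` sign changes.
    · push Not at hlow
      obtain ⟨R₀, hR₀, hmany⟩ := exists_many_sign_changes hN hf hr hl (e₁ := e / 4) (e₂ := e / 2)
        (by linarith) (by linarith) (by linarith) (by linarith) (k + 1)
      obtain ⟨s, hs1, hs2, hsP⟩ := (hfreq.and_eventually (((hE R₀ hR₀.le).eventually_const_lt
        (by linarith [hlow R₀ hR₀.le] : e / 2 < _)).and eventually_mem_nhdsWithin)).exists
      obtain ⟨x, hx0, hEx, hux⟩ := hs1.2 (e / 4) (by linarith)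
      exact hs1.1 (hmany _ _ (h.traj s hsP) R₀ le_rfl hs2.le x hx0 hEx.le hux)

/-- Negative energy at time `r` is an open condition and excludes zeros after `r`. All sign changes
of a neighbour thus happen before `r`, where they are transferred to `U c`. -/
lemma Family.eventually_good_of_energy_neg (hN : 2 ≤ N) (hf : Nonlin f J)
    (hr : RightWell f J δ β X) (hl : RightWell (refl f) (Neg.neg ⁻¹' J) δ₂ β₂ X₂)
    (h : Family N f J U V) (hc : c ∈ Icc (0 : ℝ) 1) (hG : Good f X X₂ k (U c) (V c)) {r : ℝ}
    (hr0 : 0 ≤ r) (hE : energy f (U c) (V c) r < 0) :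
    ∀ᶠ s in 𝓝[Icc 0 1] c, Good f X X₂ k (U s) (V s) := by
  have hT := h.traj c hc
  have hFX : 0 < F f X := hr.F_pos hf hr.lt le_rfl
  have hFX₂ : 0 < F f (-X₂) := by
    have := hl.F_pos hf.refl hl.lt le_rfl; rwa [F_refl] at this
  have hU : U c r ≠ 0 := by
    intro h0
    have := F_le_energy (f := f) (u := U c) (v := V c) r
    rw [h0, F_zero] at this; linarith
  have hnd := h.no_double_zero hc (R := r) fun h => hU h.1
  have hz : U c r ∈ Ioo (-X₂) X := by
    obtain ⟨x, hx0, hEx, hux⟩ := hG.2 _ (lt_min hFX hFX₂)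
    rcases le_total r x with h1 | h1
    · exact (hT.mem_zone_iff hN hf hr0 h1 (hE.trans hFX) (hE.trans hFX₂)).2 hux
    · exact (hT.mem_zone_iff hN hf hx0 h1 (hEx.trans_le (min_le_left _ _))
        (hEx.trans_le (min_le_right _ _))).1 hux
  have hnd' : ∀ y ∈ Ico 0 r, ¬(U c y = 0 ∧ V c y = 0) := fun y hy =>
    hnd y (Ico_subset_Icc_self hy)
  filter_upwards [h.transfer hc hr0 hU, (h.tendsto_energy hf hc hr0 hnd').eventually_lt_const hE,
    (h.tendsto hc hr0 hnd').1.eventually (isOpen_Ioo.mem_nhds hz), eventually_mem_nhdsWithin]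
    with s h1 h2 h3 hsP
  have hTs := h.traj s hsP
  refine hTs.good_of_energy_lt hN hf ?_ hr0 h3 (h2.trans hFX) (h2.trans hFX₂)
    fun e he => ⟨r, le_rfl, h2.trans he⟩
  intro hk
  obtain ⟨x, hA⟩ := signChangesAtLeast_iff.1 hk
  have hUs : U s r ≠ 0 := right_ne_zero_of_mul h1.1.ne'
  have hne := hTs.ne_zero_of_energy_nonpos hN hf hr0 h2.le hUs
  have hr1 : 0 < r := by
    rcases hr0.lt_or_eq with h4 | h4
    · exact h4
    · have := h.pos s hsP
      rw [← h4, energy_init hTs] at h2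
      linarith
  have hsame : ∀ y, r ≤ y → 0 < U s y * U s r := by
    intro y hy
    rcases hUs.lt_or_gt with h4 | h4
    · have := pos_of_ne_zero (u := -U s) hTs.contu.neg (t := r)
        (fun z hz => by simpa using hne z hz) (by simpa using h4) y hy
      exact mul_pos_of_neg_of_neg (by simpa using this) h4
    · exact mul_pos (pos_of_ne_zero hTs.contu hne h4 y hy) h4
  obtain ⟨x', hx', hA'⟩ := Alt.before hr1 hsame hA
  obtain ⟨y, -, hAy⟩ := h1.2 _ _ hx' hA'
  exact hG.1 (signChangesAtLeast_iff.2 ⟨y, hAy⟩)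

/-- Since `F < 0` at both ends of `[p, q]`, there are strips with `F ≤ -c₀` next to them; these act
as moats which are expensive to cross. -/
lemma exists_trap (hf : Nonlin f J) {p q ℓ : ℝ} (hp : p ∈ J) (hq : q ∈ J) (hpℓ : p < ℓ)
    (hℓq : ℓ < q) (hFp : F f p < 0) (hFq : F f q < 0) :
    ∃ w > 0, ∃ c₀ > 0, p + w < ℓ ∧ ℓ < q - w ∧ (∀ s ∈ Icc p (p + w), F f s ≤ -c₀) ∧
      ∀ s ∈ Icc (q - w) q, F f s ≤ -c₀ := by
  set c₀ := min (-F f p) (-F f q) / 2 with hc₀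
  have h0 : 0 < min (-F f p) (-F f q) := lt_min (by linarith) (by linarith)
  have h1 : F f p < -c₀ := by have := min_le_left (-F f p) (-F f q); linarith
  have h2 : F f q < -c₀ := by have := min_le_right (-F f p) (-F f q); linarith
  obtain ⟨a, ha, ha'⟩ := Metric.eventually_nhds_iff.1
    ((hf.continuousAt_F hp).eventually_lt_const h1)
  obtain ⟨b, hb, hb'⟩ := Metric.eventually_nhds_iff.1
    ((hf.continuousAt_F hq).eventually_lt_const h2)
  set w := min (min (a / 2) (b / 2)) (min ((ℓ - p) / 2) ((q - ℓ) / 2)) with hw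
  have w1 : w ≤ a / 2 := (min_le_left _ _).trans (min_le_left _ _)
  have w2 : w ≤ b / 2 := (min_le_left _ _).trans (min_le_right _ _)
  have w3 : w ≤ (ℓ - p) / 2 := (min_le_right _ _).trans (min_le_left _ _)
  have w4 : w ≤ (q - ℓ) / 2 := (min_le_right _ _).trans (min_le_right _ _)
  refine ⟨w, lt_min (lt_min (by linarith) (by linarith)) (lt_min (by linarith) (by linarith)), c₀,
    by linarith, by linarith, by linarith, fun s hs => (ha' ?_).le, fun s hs => (hb' ?_).le⟩ <;>
  · rw [Real.dist_eq, abs_lt]; constructor <;> linarith [hs.1, hs.2]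

/-- If a trajectory of the family comes close to the interior of a well with little energy, then
nearby trajectories are trapped in the well. -/
lemma Family.trap (hN : 2 ≤ N) (hf : Nonlin f J) (hr : RightWell f J δ β X)
    (hl : RightWell (refl f) (Neg.neg ⁻¹' J) δ₂ β₂ X₂) (h : Family N f J U V)
    (hc : c ∈ Icc (0 : ℝ) 1) {p q ℓ : ℝ} (hpX : -X₂ < p) (hpℓ : p < ℓ) (hℓq : ℓ < q) (hqX : q < X)
    (hF : ∀ s ∈ Icc p q, F f s ≤ 0) (hFp : F f p < 0) (hFq : F f q < 0) :
    ∃ ε > 0, ∀ R, 0 < R → |U c R - ℓ| < ε → 0 ≤ energy f (U c) (V c) R →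
      energy f (U c) (V c) R * (R + 1) < ε → (∀ r ∈ Ico 0 R, ¬(U c r = 0 ∧ V c r = 0)) →
      ∀ᶠ s in 𝓝[Icc 0 1] c, ((∀ r, R ≤ r → U s r ∈ Icc p q) ∨
        ∃ t, R ≤ t ∧ energy f (U s) (V s) t < 0 ∧ ∀ r ∈ Icc R t, U s r ∈ Icc p q) ∧
        (¬ SignChangesAtLeast (U s) (k + 1) → Good f X X₂ k (U s) (V s)) := by
  have hFX : 0 < F f X := hr.F_pos hf hr.lt le_rfl
  have hFX₂ : 0 < F f (-X₂) := by
    have := hl.F_pos hf.refl hl.lt le_rfl; rwa [F_refl] at this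
  have hsub : Icc (-X₂) X ⊆ J := hf.conn.out (by simpa using hl.mem) hr.mem
  obtain ⟨w, hw, c₀, hc₀, hpw, hqw, hp, hq⟩ := exists_trap hf
    (hsub ⟨hpX.le, by linarith⟩) (hsub ⟨by linarith, hqX.le⟩) hpℓ hℓq hFp hFq
  set κ := √(2 * c₀) with hκ
  have hκ0 : 0 < κ := Real.sqrt_pos.2 (by linarith)
  set T := w / κ with hT
  have hT0 : 0 < T := by positivity
  -- The first two terms place `U c R` between the strips, the next two activate the outer barriers,
  -- and the last is below the cost of crossing a strip, since `R + T ≤ (R + 1)(1 + T)`.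
  set ε := min (min (ℓ - (p + w)) (q - w - ℓ)) (min (min (F f X) (F f (-X₂))) (κ * w / (1 + T)))
    with hε
  refine ⟨ε, lt_min (lt_min (by linarith) (by linarith))
    (lt_min (lt_min hFX hFX₂) (by positivity)), fun R hR hU hE0 hE hnd => ?_⟩
  have hE1 : energy f (U c) (V c) R ≤ energy f (U c) (V c) R * (R + 1) := by nlinarith
  have hE2 : energy f (U c) (V c) R * (R + T) < κ * w := by
    have h1 : energy f (U c) (V c) R * (R + 1) < κ * w / (1 + T) :=
      hE.trans_le ((min_le_right _ _).trans (min_le_right _ _))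
    rw [lt_div_iff₀ (by linarith)] at h1
    have : energy f (U c) (V c) R * (R + T) ≤ energy f (U c) (V c) R * ((R + 1) * (1 + T)) :=
      mul_le_mul_of_nonneg_left (by nlinarith) hE0
    linarith
  have hEX : energy f (U c) (V c) R < F f X := hE1.trans_lt (hE.trans_le
    ((min_le_right _ _).trans ((min_le_left _ _).trans (min_le_left _ _))))
  have hEX₂ : energy f (U c) (V c) R < F f (-X₂) := hE1.trans_lt (hE.trans_le
    ((min_le_right _ _).trans ((min_le_left _ _).trans (min_le_right _ _))))
  have hUR : U c R ∈ Ioo (p + w) (q - w) := by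
    have h1 := abs_lt.1 hU
    have h2 : ε ≤ ℓ - (p + w) := (min_le_left _ _).trans (min_le_left _ _)
    have h3 : ε ≤ q - w - ℓ := (min_le_left _ _).trans (min_le_right _ _)
    exact ⟨by linarith, by linarith⟩
  have hET := h.tendsto_energy hf hc hR.le hnd
  filter_upwards [hET.eventually_lt_const hEX, hET.eventually_lt_const hEX₂,
    (hET.mul_const (R + T)).eventually_lt_const hE2,
    (h.tendsto hc hR.le hnd).1.eventually (isOpen_Ioo.mem_nhds hUR), eventually_mem_nhdsWithin]
    with s h1 h2 h3 h4 hsP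
  have hTs := h.traj s hsP
  have htrap := hTs.trapped hN hf hw hc₀ hR hF hp hq (Ioo_subset_Icc_self h4) h3
  refine ⟨htrap, fun hk => hTs.good_of_energy_lt hN hf hk hR.le
    ⟨by linarith [h4.1], by linarith [h4.2]⟩ h1 h2 fun e he => ?_⟩
  rcases htrap with h5 | ⟨t, ht, hEt, -⟩
  · exact hTs.exists_energy_lt_of_nonpos hN hf hR.le (fun r hr' => hF _ (h5 r hr')) he
  · exact ⟨t, ht, hEt.trans he⟩

/-- The field `dip` gives a point `q` beyond `ℓ` with `F < 0`, and small positive points serve as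
`p`. Neighbours are trapped in an interval of positive numbers and cannot change sign any more. -/
lemma Family.eventually_good_of_interior_limit (hN : 2 ≤ N) (hf : Nonlin f J)
    (hr : RightWell f J δ β X) (hl : RightWell (refl f) (Neg.neg ⁻¹' J) δ₂ β₂ X₂)
    (h : Family N f J U V) (hc : c ∈ Icc (0 : ℝ) 1) (hG : Good f X X₂ k (U c) (V c)) {ℓ : ℝ}
    (hℓ0 : 0 < ℓ) (hℓβ : ℓ < β)
    (happ : ∀ ε > 0, ∃ R, 0 < R ∧ |U c R - ℓ| < ε ∧ 0 ≤ energy f (U c) (V c) R ∧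
      energy f (U c) (V c) R * (R + 1) < ε) :
    ∀ᶠ s in 𝓝[Icc 0 1] c, Good f X X₂ k (U s) (V s) := by
  obtain ⟨q, hq, hFq⟩ := hr.dip ℓ hℓ0.le hℓβ
  set p := min δ ℓ / 2 with hp
  have hp0 : 0 < min δ ℓ := lt_min hr.δ_pos hℓ0
  have hp1 := min_le_left δ ℓ
  have hp2 := min_le_right δ ℓ
  obtain ⟨ε, hε, htrap⟩ := h.trap (k := k) hN hf hr hl hc (p := p) (q := q) (ℓ := ℓ)
    (by linarith [hl.X_pos]) (by linarith) hq.1 (hq.2.trans hr.lt)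
    (fun s hs => hr.nonpos s ⟨by linarith [hs.1], hs.2.trans hq.2.le⟩)
    (hr.neg p ⟨by linarith, by linarith⟩) hFq
  obtain ⟨R, hR, hU, hE0, hE⟩ := happ (min ε ℓ) (lt_min hε hℓ0)
  have hU0 : 0 < U c R := by
    have := (abs_lt.1 (hU.trans_le (min_le_right _ _))).1; linarith
  have hnd := h.no_double_zero hc (R := R) fun h => hU0.ne' h.1
  filter_upwards [htrap R hR (hU.trans_le (min_le_left _ _)) hE0 (hE.trans_le (min_le_left _ _))
    fun r hr' => hnd r (Ico_subset_Icc_self hr'), h.transfer hc hR.le hU0.ne',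
    eventually_mem_nhdsWithin] with s h1 h2 hsP
  refine h1.2 fun hk => ?_
  have hTs := h.traj s hsP
  have hpos : ∀ r, R ≤ r → 0 < U s r := by
    rcases h1.1 with h3 | ⟨t, ht, hEt, h3⟩
    · exact fun r hr' => lt_of_lt_of_le (by linarith) (h3 r hr').1
    · intro r hr'
      rcases le_total r t with h4 | h4
      · exact lt_of_lt_of_le (by linarith) (h3 r ⟨hr', h4⟩).1
      · exact hTs.pos_of_energy_nonpos hN hf (hR.le.trans ht) hEt.le
          (lt_of_lt_of_le (by linarith) (h3 t ⟨ht, le_rfl⟩).1) r h4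
  obtain ⟨x, hA⟩ := signChangesAtLeast_iff.1 hk
  obtain ⟨x', hx', hA'⟩ := Alt.before hR (fun r hr' => mul_pos (hpos r hr') (hpos R le_rfl)) hA
  obtain ⟨y, -, hAy⟩ := h2.2 _ _ hx' hA'
  exact hG.1 (signChangesAtLeast_iff.2 ⟨y, hAy⟩)

/-- In a region of nonpositive potential a trajectory of nonnegative energy has at most one zero. -/
lemma Traj.at_most_one_sign_change {u v : ℝ → ℝ} (hN : 2 ≤ N) (hf : Nonlin f J)
    (h : Traj N f J u v) {R t a b : ℝ} (hR : 0 < R) (hF : ∀ r ∈ Icc R t, F f (u r) ≤ 0)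
    (hRa : R ≤ a) (hab : a < b) (hbt : b ≤ t) (h1 : u R * u a < 0) (h2 : u a * u b < 0) :
    False := by
  have hRa' : R < a := by
    rcases hRa.lt_or_eq with h3 | h3
    · exact h3
    · rw [h3] at h1; nlinarith [mul_self_nonneg (u a)]
  obtain ⟨z₁, hz₁, hu₁⟩ := exists_zero_between h.contu hRa' h1
  obtain ⟨z₂, hz₂, hu₂⟩ := exists_zero_between h.contu hab h2
  have hua : u a ≠ 0 := right_ne_zero_of_mul h1.ne
  have hz₁0 : 0 < z₁ := hR.trans hz₁.1
  obtain ⟨m, hz₁m, hmz₂, hum, hvm⟩ := exists_critical h.contu h.hu hz₁0.le hz₁.2 hz₂.1.le hu₁ hua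
  have hum0 : u m ≠ 0 := left_ne_zero_of_mul hum.ne'
  have hmz₂' : m < z₂ := by
    rcases hmz₂.lt_or_eq with h3 | h3
    · exact h3
    · exact absurd (h3 ▸ hu₂) hum0
  have hm0 := hz₁0.trans hz₁m
  have hEm : energy f u v m ≤ 0 := by
    have := hF m ⟨(hz₁.1.trans hz₁m).le, (hmz₂'.trans (hz₂.2.trans_le hbt)).le⟩
    simp [energy, hvm hmz₂', this]
  exact h.ne_zero_of_energy_nonpos hN hf hm0.le hEm hum0 z₂ hmz₂'.le hu₂

/-- Neighbours are trapped in an interval around zero on which `F ≤ 0`, where a further pair of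
zeros would enclose a turning point of nonpositive energy. So they gain at most one sign change, and
`U c` has fewer than `k`. -/
lemma Family.eventually_good_of_zero_limit (hN : 2 ≤ N) (hf : Nonlin f J)
    (hr : RightWell f J δ β X) (hl : RightWell (refl f) (Neg.neg ⁻¹' J) δ₂ β₂ X₂)
    (h : Family N f J U V) (hc : c ∈ Icc (0 : ℝ) 1) (hk : ¬ SignChangesAtLeast (U c) k)
    (happ : ∀ ε > 0, ∃ R, 0 < R ∧ U c R ≠ 0 ∧ |U c R| < ε ∧ 0 ≤ energy f (U c) (V c) R ∧
      energy f (U c) (V c) R * (R + 1) < ε) :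
    ∀ᶠ s in 𝓝[Icc 0 1] c, Good f X X₂ k (U s) (V s) := by
  have hF : ∀ s ∈ Icc (-(δ₂ / 2)) (δ / 2), F f s ≤ 0 := by
    intro s hs
    rcases le_total 0 s with h1 | h1
    · exact hr.nonpos s ⟨h1, by linarith [hs.2, hr.δ_le, hr.δ_pos]⟩
    · have := hl.nonpos (-s) ⟨by linarith, by linarith [hs.1, hl.δ_le, hl.δ_pos]⟩
      rwa [F_refl, neg_neg] at this
  obtain ⟨ε, hε, htrap⟩ := h.trap (k := k) hN hf hr hl hc (p := -(δ₂ / 2)) (q := δ / 2) (ℓ := 0)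
    (by linarith [hl.δ_pos, hl.δ_le, hl.lt]) (by linarith [hl.δ_pos]) (by linarith [hr.δ_pos])
    (by linarith [hr.δ_pos, hr.δ_le, hr.lt]) hF
    (by
      have := hl.neg (δ₂ / 2) ⟨by linarith [hl.δ_pos], by linarith [hl.δ_pos]⟩
      rwa [F_refl] at this)
    (hr.neg _ ⟨by linarith [hr.δ_pos], by linarith [hr.δ_pos]⟩)
  obtain ⟨R, hR, hU0, hU, hE0, hE⟩ := happ ε hε
  have hnd := h.no_double_zero hc (R := R) fun h => hU0 h.1
  filter_upwards [htrap R hR (by rwa [sub_zero]) hE0 hE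
    fun r hr' => hnd r (Ico_subset_Icc_self hr'), h.transfer hc hR.le hU0,
    eventually_mem_nhdsWithin] with s h1 h2 hsP
  refine h1.2 fun hk' => ?_
  have hTs := h.traj s hsP
  obtain ⟨x, hA⟩ := signChangesAtLeast_iff.1 hk'
  have hUs : U s R ≠ 0 := right_ne_zero_of_mul h2.1.ne'
  -- If the trap ends because the energy becomes negative at `t`, there is no zero after `t`, so a
  -- later sign can be read off at `t`, where `F(u) ≤ 0` still holds.
  obtain ⟨x', hx', hA'⟩ := Alt.before_of_at_most_one hR hUs (fun a b hRa hab g1 g2 => by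
    rcases h1.1 with h3 | ⟨t, ht, hEt, h3⟩
    · exact hTs.at_most_one_sign_change hN hf hR (t := b) (fun r hr' => hF _ (h3 r hr'.1)) hRa hab
        le_rfl g1 g2
    · have ht0 : 0 ≤ t := hR.le.trans ht
      have hut : U s t ≠ 0 := by
        intro h0
        have := F_le_energy (f := f) (u := U s) (v := V s) t
        rw [h0, F_zero] at this; linarith
      have hne := hTs.ne_zero_of_energy_nonpos hN hf ht0 hEt.le hut
      have hzt : ∀ x y, x < y → U s x * U s y < 0 → x < t := by
        intro x y hxy hneg
        obtain ⟨z, hz, hz0⟩ := exists_zero_between hTs.contu hxy hneg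
        by_contra! hcon
        exact hne z (hcon.trans hz.1.le) hz0
      have hat := hzt a b hab g2
      rcases le_total b t with h4 | h4
      · exact hTs.at_most_one_sign_change hN hf hR (fun r hr' => hF _ (h3 r hr')) hRa hab h4 g1 g2
      · refine hTs.at_most_one_sign_change hN hf hR (fun r hr' => hF _ (h3 r hr')) hRa hat le_rfl g1
          ?_
        have h5 : 0 < U s b * U s t := by
          rcases hut.lt_or_gt with h6 | h6
          · have := pos_of_ne_zero (u := -U s) hTs.contu.neg (t := t)
              (fun z hz => by simpa using hne z hz) (by simpa using h6) b h4
            exact mul_pos_of_neg_of_neg (by simpa using this) h6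
          · exact mul_pos (pos_of_ne_zero hTs.contu hne h6 b h4) h6
        rw [mul_comm] at g2 h5 ⊢
        exact mul_neg_of_same h5 g2) hA
  obtain ⟨y, -, hAy⟩ := h2.2 _ _ hx' hA'
  exact hk (signChangesAtLeast_iff.2 ⟨y, hAy⟩)

/-- The exceptional behaviour: convergence to the zero `β` of the potential. -/
structure Edge (f : ℝ → ℝ) (β : ℝ) (u v : ℝ → ℝ) : Prop where
  energy_pos : ∀ r, 0 ≤ r → 0 < energy f u v r
  energy_lim : ∀ e > 0, ∃ r, 0 ≤ r ∧ energy f u v r < e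
  lim : Tendsto u atTop (𝓝 β)
  side : ∃ R > 0, (∀ r, R ≤ r → β < u r) ∨ ∀ r, R ≤ r → u r < β ∧ 0 < v r

/-- Since `r²E` is bounded, even `E (r + 1)` tends to zero. This is the smallness required for
trapping, as the crossing cost is inversely proportional to the elapsed time. -/
lemma Traj.approach {u v : ℝ → ℝ} (hN : 2 ≤ N) (hf : Nonlin f J) (h : Traj N f J u v) {ℓ R : ℝ}
    (hR : 0 < R) (hu : ∀ r, R ≤ r → F f (u r) ≤ 0) (hlim : Tendsto u atTop (𝓝 ℓ))
    (hE : ∀ r, R ≤ r → 0 < energy f u v r) {ε : ℝ} (hε : 0 < ε) :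
    ∀ᶠ r in atTop, R ≤ r ∧ 0 < r ∧ |u r - ℓ| < ε ∧ 0 ≤ energy f u v r ∧
      energy f u v r * (r + 1) < ε := by
  set K := R ^ 2 * energy f u v R with hK
  have hK0 : 0 < K := mul_pos (by positivity) (hE R le_rfl)
  filter_upwards [eventually_ge_atTop R, eventually_gt_atTop 1, eventually_gt_atTop (2 * K / ε),
    (Metric.tendsto_nhds.1 hlim ε hε)] with r h1 h2 h3 h4
  refine ⟨h1, by linarith, h4, (hE r h1).le, ?_⟩
  have h5 := h.sq_mul_energy_le hN hf hR.le h1 fun x hx => hu x hx.1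
  rw [div_lt_iff₀ hε] at h3
  have h6 : energy f u v r * (r + 1) * r ≤ 2 * K := by
    have : energy f u v r * (r + 1) * r ≤ 2 * (r ^ 2 * energy f u v r) := by
      have := (hE r h1).le
      nlinarith [mul_nonneg this (by nlinarith : (0 : ℝ) ≤ r ^ 2 - r)]
    linarith
  by_contra! hcon
  nlinarith

/-- Among the possible limits of a positive trajectory, an interior point of the well, or zero with
fewer than `k` sign changes, would make all nearby parameters good. Only zero with `k` sign changes
and the edge remain. -/
lemma Family.boundary_of_pos (hN : 2 ≤ N) (hf : Nonlin f J)
    (hr : RightWell f J δ β X) (hl : RightWell (refl f) (Neg.neg ⁻¹' J) δ₂ β₂ X₂)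
    (h : Family N f J U V) (hc : c ∈ Icc (0 : ℝ) 1) (hG : Good f X X₂ k (U c) (V c))
    (hnot : ¬ ∀ᶠ s in 𝓝[Icc 0 1] c, Good f X X₂ k (U s) (V s))
    (hE : ∀ r, 0 ≤ r → 0 < energy f (U c) (V c) r) {R : ℝ} (hR : 0 < R)
    (hU : ∀ r, R ≤ r → 0 < U c r ∧ U c r < X) :
    (SignChangesAtLeast (U c) k ∧ Tendsto (U c) atTop (𝓝 0)) ∨ Edge f β (U c) (V c) := by
  have hT := h.traj c hc
  have hE0 : ∀ e > 0, ∃ r, 0 ≤ r ∧ energy f (U c) (V c) r < e := fun e he => by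
    obtain ⟨r, h1, h2, -⟩ := hG.2 e he
    exact ⟨r, h1, h2⟩
  obtain ⟨ℓ, hℓ, hlim, R', hRR', hcase⟩ := hT.tendsto_of_energy_tendsto_zero hN hf hr hR hU
    (fun r hr' => hE r (hR.le.trans hr')) hE0
  have hR' := hR.trans_le hRR'
  rcases hcase with ⟨hℓβ, hub⟩ | ⟨hℓβ, hside⟩
  · have happ := fun (ε : ℝ) (hε : 0 < ε) => (hT.approach hN hf hR' (fun r hr' =>
      hr.nonpos _ ⟨(hU r (hRR'.trans hr')).1.le, hub r hr'⟩) hlim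
      (fun r hr' => hE r (hR'.le.trans hr')) hε).exists
    rcases hℓ.1.lt_or_eq with h0 | h0
    · refine absurd (h.eventually_good_of_interior_limit hN hf hr hl hc hG h0 hℓβ
        fun ε hε => ?_) hnot
      obtain ⟨r, -, h1⟩ := happ ε hε
      exact ⟨r, h1⟩
    · rw [← h0] at hlim
      refine Or.inl ⟨?_, hlim⟩
      by_contra hk
      refine hnot (h.eventually_good_of_zero_limit hN hf hr hl hc hk fun ε hε => ?_)
      obtain ⟨r, h1, h2, h3, h4⟩ := happ ε hε
      rw [← h0, sub_zero] at h3
      exact ⟨r, h2, (hU r (hRR'.trans h1)).1.ne', h3, h4⟩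
  · exact Or.inr ⟨hE, hE0, hℓβ ▸ hlim, R', hR', hside⟩

/-- At a boundary point of the set of good parameters the trajectory is a solution with exactly
`k` sign changes, unless it shows the exceptional behaviour. -/
lemma Family.boundary (hN : 2 ≤ N) (hf : Nonlin f J)
    (hr : RightWell f J δ β X) (hl : RightWell (refl f) (Neg.neg ⁻¹' J) δ₂ β₂ X₂)
    (h : Family N f J U V) (hc : c ∈ Icc (0 : ℝ) 1) (hG : Good f X X₂ k (U c) (V c))
    (hnot : ¬ ∀ᶠ s in 𝓝[Icc 0 1] c, Good f X X₂ k (U s) (V s)) :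
    (SignChangesExactly (U c) k ∧ Tendsto (U c) atTop (𝓝 0)) ∨ Edge f β (U c) (V c) ∨
      Edge (refl f) β₂ (-U c) (-V c) := by
  have hT := h.traj c hc
  have hFX : 0 < F f X := hr.F_pos hf hr.lt le_rfl
  have hFX₂ : 0 < F f (-X₂) := by
    have := hl.F_pos hf.refl hl.lt le_rfl; rwa [F_refl] at this
  have hE : ∀ r, 0 ≤ r → 0 ≤ energy f (U c) (V c) r := by
    intro r hr0
    by_contra! hneg
    exact hnot (h.eventually_good_of_energy_neg hN hf hr hl hc hG hr0 hneg)
  by_cases hd : ∃ d, 0 ≤ d ∧ U c d = 0 ∧ V c d = 0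
  · obtain ⟨d₁, hd₁, hd₁'⟩ := hd
    obtain ⟨d, ⟨hdI, hdz⟩, hmin⟩ := (isCompact_Icc (a := (0 : ℝ)) (b := d₁) |>.inter_right
      ((isClosed_eq hT.contu continuous_const).inter
        (isClosed_eq hT.contv continuous_const))).exists_isMinOn
      ⟨d₁, ⟨hd₁, le_rfl⟩, hd₁'⟩ continuous_id.continuousOn
    have hlt : ∀ x, 0 ≤ x → x < d → ¬(U c x = 0 ∧ V c x = 0) := by
      intro x hx hxd hx0
      have := isMinOn_iff.1 hmin x ⟨⟨hx, hxd.le.trans hdI.2⟩, hx0⟩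
      simp only [id] at this; linarith
    have hd0 : 0 < d := by
      rcases hdI.1.lt_or_eq with h1 | h1
      · exact h1
      · have := h.pos c hc
        have h2 : U c d = 0 := hdz.1
        rw [← h1] at h2
        rw [h2, F_zero] at this
        exact absurd this (lt_irrefl _)
    have hlim : Tendsto (U c) atTop (𝓝 0) := by
      refine tendsto_const_nhds.congr' ?_
      filter_upwards [eventually_ge_atTop d] with r hr'
      exact (h.absorb c hc d hd0.le hdz.1 hdz.2 r hr').1.symm
    refine Or.inl ⟨⟨?_, hG.1⟩, hlim⟩
    by_contra hk
    refine hnot (h.eventually_good_of_zero_limit hN hf hr hl hc hk fun ε hε => ?_)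
    have hcE : ContinuousAt (fun r => energy f (U c) (V c) r * (r + 1)) d :=
      ((hT.continuousOn_energy hf).continuousAt (Ici_mem_nhds hd0)).mul
        (continuous_id.add continuous_const).continuousAt
    have hUd : U c d = 0 := hdz.1
    have hVd : V c d = 0 := hdz.2
    have h1 : ∀ᶠ r in 𝓝 d, |U c r| < ε :=
      hT.contu.abs.continuousAt.eventually_lt_const (by simpa [hUd] using hε)
    have h2 : ∀ᶠ r in 𝓝 d, energy f (U c) (V c) r * (r + 1) < ε :=
      hcE.eventually_lt_const (by simp [energy, hUd, hVd, F_zero, hε])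
    obtain ⟨η, hη, hη'⟩ := Metric.eventually_nhds_iff.1 (h1.and (h2.and (lt_mem_nhds hd0)))
    -- Just before the first double zero `d` the trajectory is small, has little energy and is not
    -- identically zero, so such a time can play the role of a late time in a convergence to zero.
    obtain ⟨x, hx, hx0⟩ : ∃ x ∈ Ioo (d - η) d, U c x ≠ 0 := by
      by_contra! hz
      have hη2 : d - η / 2 ∈ Ioo (d - η) d := ⟨by linarith, by linarith⟩
      have h3 : U c =ᶠ[𝓝 (d - η / 2)] fun _ => 0 := by
        filter_upwards [isOpen_Ioo.mem_nhds hη2] with y hy using hz y hy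
      have h4 : 0 < d - η / 2 := (hη' (by rw [Real.dist_eq, abs_lt]; constructor <;> linarith)).2.2
      have h5 := (hT.hu _ h4).unique ((hasDerivAt_const _ (0 : ℝ)).congr_of_eventuallyEq h3)
      exact hlt _ h4.le (by linarith) ⟨hz _ hη2, h5⟩
    obtain ⟨g1, g2, g3⟩ := hη' (y := x)
      (by rw [Real.dist_eq, abs_lt]; constructor <;> linarith [hx.1, hx.2])
    exact ⟨x, g3, hx0, g1, hE x g3.le, g2⟩
  push Not at hd
  have hEpos := hT.energy_pos hN hf (by rw [energy_init hT]; exact h.pos c hc) hE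
    fun r hr0 h0 => hd r hr0 h0.1 h0.2
  -- Zeros at arbitrarily late times, all of them simple, would produce more than `k` sign changes.
  obtain ⟨R₁, hR₁⟩ : ∃ R, ∀ r, R ≤ r → U c r ≠ 0 := by
    by_contra! hz
    obtain ⟨r, hA, -⟩ := exists_alt_of_zeros hT.hu (fun t ht h0 => hd t ht.le h0) hz (k + 1)
    exact hG.1 (signChangesAtLeast_iff.2 ⟨r, hA⟩)
  obtain ⟨R₂, hR₂, hER₂, hz₂⟩ := hG.2 _ (lt_min hFX hFX₂)
  have hzone : ∀ r, R₂ ≤ r → U c r ∈ Ioo (-X₂) X := fun r hr' =>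
    (hT.mem_zone_iff hN hf hR₂ hr' (hER₂.trans_le (min_le_left _ _))
      (hER₂.trans_le (min_le_right _ _))).1 hz₂
  set R := max R₁ R₂ + 1 with hR
  have hRR₁ : R₁ ≤ R := by linarith [le_max_left R₁ R₂]
  have hRR₂ : R₂ ≤ R := by linarith [le_max_right R₁ R₂]
  have hR0 : 0 < R := by linarith [le_max_right R₁ R₂]
  rcases (hR₁ R hRR₁).lt_or_gt with hs | hs
  · have hneg := pos_of_ne_zero (u := -U c) hT.contu.neg (t := R)
      (fun z hz => by simpa using hR₁ z (hRR₁.trans hz)) (by simpa using hs)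
    have hf2 : refl (refl f) = f := refl_refl f
    have hJ2 : Neg.neg ⁻¹' (Neg.neg ⁻¹' J) = J := by ext x; simp
    rcases h.neg.boundary_of_pos (k := k) (X₂ := X) hN hf.refl hl (by rwa [hf2, hJ2]) hc
      (good_neg.2 hG)
      (by simpa only [good_neg] using hnot)
      (fun r hr0 => by rw [energy_neg]; exact hEpos r hr0) hR0
      (fun r hr' => ⟨hneg r hr', by
        have := (hzone r (hRR₂.trans hr')).1
        simp only [Pi.neg_apply]; linarith⟩) with ⟨h1, h2⟩ | h1
    · exact Or.inl ⟨⟨signChangesAtLeast_neg.1 h1, hG.1⟩, by simpa using h2.neg⟩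
    · exact Or.inr (Or.inr h1)
  · have hpos := pos_of_ne_zero hT.contu (t := R) (fun z hz => hR₁ z (hRR₁.trans hz)) hs
    rcases h.boundary_of_pos hN hf hr hl hc hG hnot hEpos hR0
      (fun r hr' => ⟨hpos r hr', (hzone r (hRR₂.trans hr')).2⟩) with ⟨h1, h2⟩ | h1
    · exact Or.inl ⟨⟨h1, hG.1⟩, h2⟩
    · exact Or.inr (Or.inl h1)

end

end BoundState

namespace BoundState

/-! ### Exclusion of the exceptional behaviour -/

section
variable {N : ℕ} {f : ℝ → ℝ} {J : Set ℝ} {u v : ℝ → ℝ} {δ β X δ₂ β₂ X₂ : ℝ}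

lemma RightWell.f_nonneg (hf : Nonlin f J) (h : RightWell f J δ β X) {s : ℝ} (hs : s ∈ Icc β X) :
    0 ≤ f s := by
  rcases hs.1.lt_or_eq with h1 | h1
  · exact (h.f_pos s ⟨h1, hs.2⟩).le
  · have hβ : β ∈ J := h.sub hf ⟨h.β_pos.le, h.lt.le⟩
    have hc : ContinuousAt f β := hf.cont.continuousAt (hf.isOpen.mem_nhds hβ)
    rw [← h1]
    refine ge_of_tendsto (hc.tendsto.mono_left (nhdsWithin_le_nhds (s := Ioi β))) ?_
    filter_upwards [Ioc_mem_nhdsGT h.lt] with x hx using (h.f_pos x hx).le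

/-- Up to the factor `r^(3-N)` this quantity is the derivative of `r^(N-2)(u - β)`. It decreases
where `f(u) ≥ 0`, and the case `N = 2` needs no separate formula. -/
lemma Traj.hasDerivAt_kappa (h : Traj N f J u v) {r : ℝ} (hr : 0 < r) (β : ℝ) :
    HasDerivAt (fun x => x * v x + ((N : ℝ) - 2) * (u x - β)) (-(r * f (u r))) r := by
  refine (((hasDerivAt_id r).mul (h.hv r hr)).add
    (((h.hu r hr).sub_const β).const_mul ((N : ℝ) - 2))).congr_deriv ?_
  simp only [id]
  field_simp
  ring

lemma Traj.kappa_le (hf : Nonlin f J) (hr : RightWell f J δ β X) (h : Traj N f J u v) {a b : ℝ}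
    (ha : 0 < a) (hab : a ≤ b) (hm : ∀ r ∈ Icc a b, u r ∈ Icc β X) :
    b * v b + ((N : ℝ) - 2) * (u b - β) ≤ a * v a + ((N : ℝ) - 2) * (u a - β) := by
  refine le_of_deriv_nonpos (g := fun x => x * v x + ((N : ℝ) - 2) * (u x - β)) hab ?_
    (fun x hx => h.hasDerivAt_kappa (ha.trans hx.1) β) fun x hx => ?_
  · have := h.contu; have := h.contv
    exact Continuous.continuousOn (by fun_prop)
  · have := hr.f_nonneg hf (hm x (Ioo_subset_Icc_self hx))
    have := mul_nonneg (ha.trans hx.1).le this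
    linarith

/-- The quantity `r v + (N-2)(u-β)` remains at most `-y`, and its second summand is nonnegative, so
`r v ≤ -y` persists and `u` falls at least like `-y log r`. -/
lemma Traj.log_decay (hN : 2 ≤ N) (hf : Nonlin f J) (hr : RightWell f J δ β X)
    (h : Traj N f J u v) {a b y : ℝ} (ha : 0 < a) (hab : a ≤ b)
    (hm : ∀ r ∈ Icc a b, u r ∈ Icc β X) (hκ : a * v a + ((N : ℝ) - 2) * (u a - β) ≤ -y) :
    u b + y * Real.log b ≤ u a + y * Real.log a := by
  have hN' : (2 : ℝ) ≤ N := by exact_mod_cast hN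
  refine le_of_deriv_nonpos (g := fun x => u x + y * Real.log x)
    (g' := fun x => v x + y * x⁻¹) hab ?_ (fun x hx => ?_) fun x hx => ?_
  · refine h.contu.continuousOn.add (continuousOn_const.mul (Real.continuousOn_log.mono ?_))
    intro x hx
    exact (ha.trans_le hx.1).ne'
  · exact (h.hu x (ha.trans hx.1)).add ((Real.hasDerivAt_log (ha.trans hx.1).ne').const_mul y)
  · have hx0 := ha.trans hx.1
    have h1 := h.kappa_le hf hr ha hx.1.le fun r hr' => hm r ⟨hr'.1, hr'.2.trans hx.2.le⟩
    have h2 : 0 ≤ ((N : ℝ) - 2) * (u x - β) :=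
      mul_nonneg (by linarith) (by linarith [(hm x (Ioo_subset_Icc_self hx)).1])
    have h3 : x * (v x + y * x⁻¹) ≤ 0 := by
      have : x * (v x + y * x⁻¹) = x * v x + y := by field_simp
      linarith
    by_contra! hcon
    nlinarith

/-- Bounds before the time `S` at which `r^(N-1) (u - β)` is maximal. -/
lemma Traj.bounds_before_turning (hN : 2 ≤ N) (hf : Nonlin f J) (hr : RightWell f J δ β X)
    (h : Traj N f J u v) {t₀ S y : ℝ} (ht₀ : 0 < t₀) (hS : 8 * t₀ ≤ S)
    (hm : ∀ r ∈ Icc t₀ S, u r ∈ Icc β X)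
    (hφ : ∀ r ∈ Icc t₀ S, 0 ≤ r * v r + ((N : ℝ) - 1) * (u r - β))
    (hφS : S * v S + ((N : ℝ) - 1) * (u S - β) = 0) (hy : u S = β + y) (hy0 : 0 < y) :
    (∀ r ∈ Icc (S / 8) S, u r - β ≤ 8 ^ (N - 1) * y ∧ -(8 ^ N * N * (y / S)) ≤ v r) ∧
      ∀ r ∈ Icc (S / 4) S, v r ≤ 8 ^ N * N * (y / S) := by
  have hN' : (2 : ℝ) ≤ N := by exact_mod_cast hN
  obtain ⟨n, rfl⟩ : ∃ n, N = n + 2 := ⟨N - 2, by omega⟩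
  have hS0 : 0 < S := by linarith
  rw [show n + 2 - 1 = n + 1 from rfl]
  set C₁ : ℝ := 8 ^ (n + 2) * ((n + 2 : ℕ) : ℝ) with hC₁
  set M : ℝ := 8 ^ (n + 1) with hM
  have hM1 : 1 ≤ M := one_le_pow₀ (by norm_num)
  have hC₁M : C₁ = 8 * M * ((n + 2 : ℕ) : ℝ) := by rw [hC₁, hM, pow_succ]; ring
  have hC1M : 8 * M ≤ C₁ := by rw [hC₁M]; nlinarith
  have hcM : M * (((n + 2 : ℕ) : ℝ) - 1) ≤ C₁ := by rw [hC₁M]; nlinarith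
  have hC1 : 1 ≤ C₁ := by linarith
  have hcont : Continuous u := h.contu
  have hcontv : Continuous v := h.contv
  have hpow : ∀ r, S / 8 ≤ r → S ^ (n + 1) ≤ M * r ^ (n + 1) := by
    intro r hr'
    rw [hM, ← mul_pow]
    exact pow_le_pow_left₀ hS0.le (by linarith) _
  -- bound for `w = u - β`
  have hw : ∀ r ∈ Icc (S / 8) S, u r - β ≤ M * y := by
    intro r hr'
    have hr0 : 0 < r := by linarith [hr'.1]
    -- `hφ` says that `r^(N-1)(u - β)` is nondecreasing up to `S`, so `u - β` at `r ≥ S/8` is at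
    -- most `8^(N-1)` times its value `y` at `S`.
    have hmono := ge_of_deriv_nonneg (g := fun x => x ^ (n + 1) * (u x - β))
      (g' := fun x => x ^ n * (x * v x + (((n + 2 : ℕ) : ℝ) - 1) * (u x - β))) hr'.2
      (Continuous.continuousOn (by fun_prop))
      (fun x hx => by
        refine ((hasDerivAt_pow (n + 1) x).mul
          ((h.hu x (hr0.trans hx.1)).sub_const β)).congr_deriv ?_
        push_cast
        ring)
      (fun x hx => mul_nonneg (pow_nonneg (hr0.trans hx.1).le _)
        (hφ x ⟨by linarith [hr'.1, hx.1], hx.2.le⟩))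
    simp only [hy, add_sub_cancel_left] at hmono
    have h1 := hpow r hr'.1
    have h2 : r ^ (n + 1) * (u r - β) ≤ r ^ (n + 1) * (M * y) := by
      calc _ ≤ S ^ (n + 1) * y := hmono
        _ ≤ M * r ^ (n + 1) * y := mul_le_mul_of_nonneg_right h1 hy0.le
        _ = _ := by ring
    exact le_of_mul_le_mul_left h2 (pow_pos hr0 _)
  have hvm : ∀ a b, t₀ ≤ a → a ≤ b → b ≤ S → b ^ (n + 1) * v b ≤ a ^ (n + 1) * v a := by
    intro a b ha hab hb
    have := le_of_deriv_nonpos (g := fun x => x ^ (n + 2 - 1) * v x) hab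
      (Continuous.continuousOn (by fun_prop))
      (fun x hx => h.hasDerivAt_pow_mul hN (ht₀.trans_le (ha.trans hx.1.le)))
      (fun x hx => by
        have hx0 := ht₀.trans_le (ha.trans hx.1.le)
        have := mul_nonneg (pow_nonneg hx0.le (n + 2 - 1))
          (hr.f_nonneg hf (hm x ⟨ha.trans hx.1.le, hx.2.le.trans hb⟩))
        linarith)
    exact this
  have hvS : v S = -((((n + 2 : ℕ) : ℝ) - 1) * (y / S)) := by
    rw [hy, add_sub_cancel_left] at hφS
    field_simp
    linarith
  have hyS : 0 < y / S := div_pos hy0 hS0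
  -- bounds for `v`
  have hvlow : ∀ r ∈ Icc (S / 8) S, -(C₁ * (y / S)) ≤ v r := by
    intro r hr'
    have hr0 : 0 < r := by linarith [hr'.1]
    have h1 := hvm r S (by linarith [hr'.1]) hr'.2 le_rfl
    have h2 := hpow r hr'.1
    rw [hvS] at h1
    have h3 : r ^ (n + 1) * (-(M * ((((n + 2 : ℕ) : ℝ) - 1) * (y / S)))) ≤ r ^ (n + 1) * v r := by
      have h4 : 0 ≤ (((n + 2 : ℕ) : ℝ) - 1) * (y / S) := mul_nonneg (by linarith) hyS.le
      nlinarith [mul_le_mul_of_nonneg_right h2 h4]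
    have h5 := le_of_mul_le_mul_left h3 (pow_pos hr0 _)
    nlinarith [mul_le_mul_of_nonneg_right hcM hyS.le]
  -- Since `r^(N-1) v` is nonincreasing, a positive velocity at `r` is a lower bound for the
  -- velocity on `[S/8, r]`. The rise of `u` there is at least `S/8` times it and at most a multiple
  -- of `y`.
  have hvup : ∀ r ∈ Icc (S / 4) S, v r ≤ C₁ * (y / S) := by
    intro r hr'
    rcases le_or_gt (v r) 0 with h0 | h0
    · exact h0.trans (by positivity)
    have hr0 : 0 < r := by linarith [hr'.1]
    have h1 := ge_of_deriv_nonneg (g := fun x => u x - v r * x) (g' := fun x => v x - v r)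
      (by linarith [hr'.1] : S / 8 ≤ r) (Continuous.continuousOn (by fun_prop))
      (fun x hx => ((h.hu x (by linarith [hx.1])).sub
        ((hasDerivAt_id x).const_mul (v r))).congr_deriv (by simp))
      (fun x hx => by
        have hx0 : 0 < x := by linarith [hx.1]
        have h2 := hvm x r (by linarith [hx.1]) hx.2.le hr'.2
        have h3 : x ^ (n + 1) ≤ r ^ (n + 1) := pow_le_pow_left₀ hx0.le hx.2.le _
        have h4 : x ^ (n + 1) * v r ≤ x ^ (n + 1) * v x :=
          (mul_le_mul_of_nonneg_right h3 h0.le).trans h2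
        linarith [le_of_mul_le_mul_left h4 (pow_pos hx0 _)])
    have h2 := hw r ⟨by linarith [hr'.1], hr'.2⟩
    have h3 := (hm (S / 8) ⟨by linarith, by linarith⟩).1
    have h4 : S / 8 * v r ≤ M * y := by nlinarith [hr'.1]
    have h5 : v r ≤ 8 * M * (y / S) := by
      rw [← mul_div_assoc, le_div_iff₀ hS0]; linarith
    exact h5.trans (mul_le_mul_of_nonneg_right hC1M hyS.le)
  exact ⟨fun r hr' => ⟨hw r hr', hvlow r hr'⟩, hvup⟩

/-- Closing arithmetic: if the minimum is `1` the claim follows from `S ≥ 1`, otherwise by taking a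
square root. -/
lemma mul_le_of_sq_mul_min_le {S H K C y : ℝ} (hS : 1 ≤ S) (hH : 0 < H) (hK : 1 ≤ K) (hC : 1 ≤ C)
    (hy : 0 < y) (h : S ^ 2 * H * min 1 (H / (K * C * y)) ≤ 24 * C * y) :
    H * S ≤ 24 * K * C * y := by
  have hCy : 0 < C * y := by positivity
  rcases min_choice 1 (H / (K * C * y)) with hc | hc
  · rw [hc] at h
    have h1 : H * S ≤ S ^ 2 * H * 1 := by
      have : 0 ≤ H * S * (S - 1) := mul_nonneg (by positivity) (by linarith)
      linarith
    have h2 : 0 ≤ (K - 1) * (C * y) := mul_nonneg (by linarith) hCy.le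
    linarith
  · rw [hc] at h
    have h1 : (H * S) ^ 2 ≤ 24 * K * (C * y) ^ 2 := by
      have g1 : S ^ 2 * H * (H / (K * C * y)) = (H * S) ^ 2 / (K * C * y) := by ring
      rw [g1, div_le_iff₀ (by positivity)] at h
      linarith
    have h2 : 24 * K * (C * y) ^ 2 ≤ (24 * K * C * y) ^ 2 := by
      have g1 : (24 * K * C * y) ^ 2 = (24 * K) * (24 * K * (C * y) ^ 2) := by ring
      rw [g1]
      exact le_mul_of_one_le_left (by positivity) (by linarith)
    exact (abs_le_of_sq_le_sq' (h1.trans h2) (by positivity)).2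

/-- An estimate for the nonlinearity at the point where `r^(N-1) (u - β)` is maximal. -/
lemma Traj.f_le_at_turning (hN : 2 ≤ N) (hf : Nonlin f J) (hr : RightWell f J δ β X)
    (h : Traj N f J u v) {t₀ S K ρ y : ℝ} (ht₀ : 0 < t₀) (hS : 8 * t₀ ≤ S) (hS1 : 1 ≤ S)
    (hm : ∀ r ∈ Icc t₀ S, u r ∈ Icc β X)
    (hφ : ∀ r ∈ Icc t₀ S, 0 ≤ r * v r + ((N : ℝ) - 1) * (u r - β))
    (hφS : S * v S + ((N : ℝ) - 1) * (u S - β) = 0) (hy : u S = β + y) (hy0 : 0 < y)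
    (hK : 1 ≤ K) (hyρ : 8 ^ (N - 1) * y ≤ ρ)
    (hlip : ∀ x ∈ Icc β (β + ρ), ∀ z ∈ Icc β (β + ρ), |f x - f z| ≤ K * |x - z|) :
    f (β + y) ≤ 24 * K * (8 ^ N * N) * (y / S) := by
  have hN' : (2 : ℝ) ≤ N := by exact_mod_cast hN
  have hS0 : 0 < S := by linarith
  obtain ⟨hb, hvup⟩ := h.bounds_before_turning hN hf hr ht₀ hS hm hφ hφS hy hy0
  set C₁ : ℝ := 8 ^ N * N with hC₁
  set M : ℝ := 8 ^ (N - 1) with hM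
  have hM1 : 1 ≤ M := one_le_pow₀ (by norm_num)
  have hC₁M : C₁ = 8 * M * N := by
    rw [hC₁, hM, ← pow_succ', show N - 1 + 1 = N by omega]
  have hNM : 2 ≤ N * M := by nlinarith
  have hC1 : 1 ≤ C₁ := by rw [hC₁M]; linarith
  have hw : ∀ r ∈ Icc (S / 8) S, u r - β ≤ M * y := fun r hr' => (hb r hr').1
  have hvlow : ∀ r ∈ Icc (S / 8) S, -(C₁ * (y / S)) ≤ v r := fun r hr' => (hb r hr').2
  have hcont : Continuous u := h.contu
  have hcontv : Continuous v := h.contv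
  have hyS : 0 < y / S := div_pos hy0 hS0
  set H := f (β + y) with hH
  have hX : β + y ≤ X := hy ▸ (hm S ⟨by linarith, le_rfl⟩).2
  have hH0 : 0 < H := hr.f_pos _ ⟨by linarith, hX⟩
  -- On the window `[S - τ, S]` with `τ = S m / 2` the position changes so little that `f(u) ≥ H/2`.
  -- Integrating `(r v + (N-2)(u-β))' = -r f(u)` over the window, with both end values of order `y`,
  -- bounds `S² H m` by a multiple of `y`.
  set m := min 1 (H / (K * C₁ * y)) with hmdef
  have hm0 : 0 < m := lt_min one_pos (by positivity)
  have hm1 : m ≤ 1 := min_le_left _ _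
  have hmH : K * C₁ * y * m ≤ H := by
    have := min_le_right 1 (H / (K * C₁ * y))
    rw [← hmdef, le_div_iff₀ (by positivity)] at this
    linarith
  set τ := S / 2 * m with hτ
  have hτ0 : 0 < τ := by positivity
  have hτS : τ ≤ S / 2 := by nlinarith
  have hf_low : ∀ r ∈ Icc (S - τ) S, H / 2 ≤ f (u r) := by
    intro r hr'
    have hr8 : r ∈ Icc (S / 8) S := ⟨by linarith [hr'.1], hr'.2⟩
    have h1 : |u r - u S| ≤ C₁ * (y / S) * τ := by
      have g1 := ge_of_deriv_nonneg (g := fun x => u x + C₁ * (y / S) * x)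
        (g' := fun x => v x + C₁ * (y / S)) hr'.2 (Continuous.continuousOn (by fun_prop))
        (fun x hx => ((h.hu x (by linarith [hx.1, hr8.1])).add
          ((hasDerivAt_id x).const_mul (C₁ * (y / S)))).congr_deriv (by simp))
        (fun x hx => by linarith [hvlow x ⟨hr8.1.trans hx.1.le, hx.2.le⟩])
      have g2 := le_of_deriv_nonpos (g := fun x => u x - C₁ * (y / S) * x)
        (g' := fun x => v x - C₁ * (y / S)) hr'.2 (Continuous.continuousOn (by fun_prop))
        (fun x hx => ((h.hu x (by linarith [hx.1, hr8.1])).sub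
          ((hasDerivAt_id x).const_mul (C₁ * (y / S)))).congr_deriv (by simp))
        (fun x hx => by linarith [hvup x ⟨by linarith [hx.1, hr'.1], hx.2.le⟩])
      have g3 : C₁ * (y / S) * (S - r) ≤ C₁ * (y / S) * τ :=
        mul_le_mul_of_nonneg_left (by linarith [hr'.1]) (by positivity)
      rw [abs_le]; constructor <;> linarith
    have h2 := hlip (u r) ⟨(hm r ⟨by linarith [hr8.1], hr'.2⟩).1, by linarith [hw r hr8]⟩ (β + y)
      ⟨by linarith, by nlinarith⟩
    rw [← hy] at h2
    have h3 : K * |u r - u S| ≤ K * (C₁ * (y / S) * τ) :=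
      mul_le_mul_of_nonneg_left h1 (by linarith)
    have h4 : K * (C₁ * (y / S) * τ) = K * C₁ * y * m / 2 := by
      rw [hτ]; field_simp
    have h5 := (abs_le.1 (h2.trans h3)).1
    rw [hy] at h5
    linarith
  have hκ := le_of_deriv_nonpos
    (g := fun x => (x * v x + ((N : ℝ) - 2) * (u x - β)) + S * H / 4 * x)
    (g' := fun x => -(x * f (u x)) + S * H / 4) (by linarith : S - τ ≤ S)
    (Continuous.continuousOn (by fun_prop))
    (fun x hx => ((h.hasDerivAt_kappa (by linarith [hx.1] : 0 < x) β).add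
      ((hasDerivAt_id x).const_mul (S * H / 4))).congr_deriv (by simp))
    (fun x hx => by
      have h1 := hf_low x (Ioo_subset_Icc_self hx)
      have h2 : S / 2 * (H / 2) ≤ x * f (u x) :=
        mul_le_mul (by linarith [hx.1]) h1 (by linarith) (by linarith [hx.1])
      linarith)
  have hκS : S * v S + ((N : ℝ) - 2) * (u S - β) = -y := by
    have : u S - β = y := by rw [hy]; ring
    rw [this] at hφS ⊢
    linarith
  have hκτ : (S - τ) * v (S - τ) + ((N : ℝ) - 2) * (u (S - τ) - β) ≤ 2 * C₁ * y := by
    have h1 := hvup (S - τ) ⟨by linarith, by linarith⟩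
    have h2 := hw (S - τ) ⟨by linarith, by linarith⟩
    have h3 : (S - τ) * v (S - τ) ≤ C₁ * y := by
      have g1 : (S - τ) * v (S - τ) ≤ (S - τ) * (C₁ * (y / S)) :=
        mul_le_mul_of_nonneg_left h1 (by linarith)
      have g2 : (S - τ) * (C₁ * (y / S)) ≤ S * (C₁ * (y / S)) :=
        mul_le_mul_of_nonneg_right (by linarith) (by positivity)
      have g3 : S * (C₁ * (y / S)) = C₁ * y := by field_simp
      linarith
    have h4 : ((N : ℝ) - 2) * (u (S - τ) - β) ≤ C₁ * y := by
      have g1 : ((N : ℝ) - 2) * (u (S - τ) - β) ≤ ((N : ℝ) - 2) * (M * y) :=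
        mul_le_mul_of_nonneg_left h2 (by linarith)
      have g2 : ((N : ℝ) - 2) * M ≤ C₁ := by rw [hC₁M]; linarith
      nlinarith [mul_le_mul_of_nonneg_right g2 hy0.le]
    linarith
  have hmain : S ^ 2 * H * m ≤ 24 * C₁ * y := by
    have h1 : y ≤ C₁ * y := le_mul_of_one_le_left hy0.le hC1
    have h2 : S * H / 4 * τ ≤ 3 * C₁ * y := by linarith
    rw [hτ] at h2
    linarith
  rw [← mul_div_assoc, le_div_iff₀ hS0]
  exact mul_le_of_sq_mul_min_le hS1 hH0 hK hC1 hy0 (hmdef ▸ hmain)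

lemma nonpos_of_le_left {w : ℝ → ℝ} {w' a b : ℝ} (hab : a < b) (hd : HasDerivAt w w' b)
    (h : ∀ r ∈ Ioo a b, w b ≤ w r) : w' ≤ 0 := by
  refine le_of_tendsto ((hasDerivAt_iff_tendsto_slope.1 hd).mono_left (nhdsLT_le_nhdsNE b)) ?_
  filter_upwards [Ioo_mem_nhdsLT hab] with r hr
  rw [slope_def_field]
  exact div_nonpos_of_nonneg_of_nonpos (by linarith [h r hr]) (by linarith [hr.2])

/-- An excursion of a trajectory above the level `β` during `[t₀, r₂]`. -/
structure Excursion (N : ℕ) (f : ℝ → ℝ) (β X : ℝ) (u v : ℝ → ℝ) (R κ t₀ r₂ : ℝ) : Prop where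
  le : R ≤ t₀
  lt : t₀ < r₂
  before : ∀ r ∈ Ico R t₀, u r < β
  mem : ∀ r ∈ Icc t₀ r₂, u r ∈ Icc β X
  above : ∀ r ∈ Ioo t₀ r₂, β < u r
  phi_pos : 0 < t₀ * v t₀ + ((N : ℝ) - 1) * (u t₀ - β)
  end_eq : u r₂ = β
  energy_end : κ ≤ r₂ * energy f u v r₂
  small : t₀ = R ∨ t₀ * energy f u v t₀ ≤ κ / 48

/-- The times after `R` at which `u ≥ β` and `r^(N-1) (u - β)` is nonincreasing. -/
def turning (N : ℕ) (β : ℝ) (u v : ℝ → ℝ) (R : ℝ) : Set ℝ :=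
  {r | R ≤ r ∧ β ≤ u r ∧ r * v r + ((N : ℝ) - 1) * (u r - β) ≤ 0}

/-- At `t₀` the quantity `φ = r v + (N-1)(u-β)` is positive. At `r₂` one has `u = β` with positive
energy, hence `v < 0` and `φ < 0`. So the first turning time lies strictly between, and `φ` vanishes
there. -/
lemma Excursion.turning_time (hr : RightWell f J δ β X)
    (h : Traj N f J u v) {R κ t₀ r₂ S : ℝ} (hR : 0 < R) (hκ : 0 < κ)
    (hx : Excursion N f β X u v R κ t₀ r₂) (hS : S = sInf (turning N β u v R)) :
    t₀ < S ∧ S < r₂ ∧ S * v S + ((N : ℝ) - 1) * (u S - β) = 0 ∧ β < u S ∧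
      (∀ r ∈ Ico t₀ S, 0 < r * v r + ((N : ℝ) - 1) * (u r - β)) ∧
      ∀ r ∈ Ico R S, u r < β ∨ 0 < r * v r + ((N : ℝ) - 1) * (u r - β) := by
  have hcu := h.contu
  have hcv := h.contv
  have hcφ : Continuous fun r => r * v r + ((N : ℝ) - 1) * (u r - β) := by fun_prop
  set Ω := turning N β u v R with hΩ
  have hcl : IsClosed Ω := by
    have : Ω = Ici R ∩ ({r | β ≤ u r} ∩ {r | r * v r + ((N : ℝ) - 1) * (u r - β) ≤ 0}) := rfl
    rw [this]
    exact isClosed_Ici.inter ((isClosed_le continuous_const hcu).inter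
      (isClosed_le hcφ continuous_const))
  have hbdd : BddBelow Ω := ⟨R, fun r hr => hr.1⟩
  have ht₀0 : 0 < t₀ := hR.trans_le hx.le
  have hr₂0 : 0 < r₂ := ht₀0.trans hx.lt
  have hE₂ : 0 < energy f u v r₂ := by
    by_contra! hcon
    nlinarith [hx.energy_end]
  have hv₂ : v r₂ < 0 := by
    have h1 : v r₂ ≠ 0 := by
      intro h0
      simp [energy, h0, hx.end_eq, hr.F_eq] at hE₂
    exact lt_of_le_of_ne (nonpos_of_le_left hx.lt (h.hu r₂ hr₂0) fun r hr' => by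
      rw [hx.end_eq]; exact (hx.above r hr').le) h1
  have hr₂ : r₂ ∈ Ω := ⟨hx.le.trans hx.lt.le, hx.end_eq.ge, by
    rw [hx.end_eq, sub_self, mul_zero, add_zero]; nlinarith⟩
  have hSm : S ∈ Ω := hS ▸ hcl.csInf_mem ⟨r₂, hr₂⟩ hbdd
  have hlt : ∀ r ∈ Ico R S, u r < β ∨ 0 < r * v r + ((N : ℝ) - 1) * (u r - β) := by
    intro r hr'
    by_contra! hcon
    have := csInf_le hbdd (⟨hr'.1, hcon.1, hcon.2⟩ : r ∈ Ω)
    rw [← hS] at this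
    linarith [hr'.2]
  have ht₀S : t₀ < S := by
    by_contra! hcon
    rcases hcon.lt_or_eq with h1 | h1
    · linarith [hx.before S ⟨hSm.1, h1⟩, hSm.2.1]
    · have := hSm.2.2
      rw [h1] at this
      linarith [hx.phi_pos]
  have hSr : S ≤ r₂ := hS ▸ csInf_le hbdd hr₂
  have hpos : ∀ r ∈ Ico t₀ S, 0 < r * v r + ((N : ℝ) - 1) * (u r - β) := by
    intro r hr'
    rcases hlt r ⟨hx.le.trans hr'.1, hr'.2⟩ with h1 | h1
    · linarith [(hx.mem r ⟨hr'.1, hr'.2.le.trans hSr⟩).1]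
    · exact h1
  have hφS : S * v S + ((N : ℝ) - 1) * (u S - β) = 0 := by
    refine le_antisymm hSm.2.2 ?_
    refine ge_of_tendsto (hcφ.continuousAt.tendsto.mono_left
      (nhdsWithin_le_nhds (s := Iio S))) ?_
    filter_upwards [Ico_mem_nhdsLT ht₀S] with x hx using (hpos x hx).le
  have hSr' : S < r₂ := by
    refine lt_of_le_of_ne hSr fun h1 => ?_
    rw [h1, hx.end_eq, sub_self, mul_zero, add_zero] at hφS
    rcases mul_eq_zero.1 hφS with h2 | h2 <;> linarith
  exact ⟨ht₀S, hSr', hφS, hx.above S ⟨ht₀S, hSr'⟩, hpos, hlt⟩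

/-- The energy left at the end of the excursion forces `S F(β + y) ≥ κ/6`, while the estimate at the
turning time bounds `f(β + y)` by a multiple of `y/S`. With `y ≤ 1`, eliminating `S` compares `f`
with `F` at the same point. -/
lemma Excursion.f_le (hN : 2 ≤ N) (hf : Nonlin f J) (hr : RightWell f J δ β X)
    (h : Traj N f J u v) {R κ t₀ r₂ K ρ y : ℝ} (hR : 1 ≤ R) (hκ : 0 < κ)
    (hx : Excursion N f β X u v R κ t₀ r₂) (hy : u (sInf (turning N β u v R)) = β + y)
    (hK : 1 ≤ K) (hyρ : 8 ^ (N - 1) * y ≤ ρ) (hy1 : y ≤ 1)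
    (hyκ : 3 * ((N : ℝ) - 1) ^ 2 * y ≤ κ) (hyR : 48 * R * F f (β + y) ≤ κ)
    (hlip : ∀ x ∈ Icc β (β + ρ), ∀ z ∈ Icc β (β + ρ), |f x - f z| ≤ K * |x - z|) :
    f (β + y) ≤ 24 * K * (8 ^ N * N) * (6 / κ) * F f (β + y) := by
  have hN' : (2 : ℝ) ≤ N := by exact_mod_cast hN
  have hR0 : 0 < R := by linarith
  obtain ⟨S, hS⟩ : ∃ S, S = sInf (turning N β u v R) := ⟨_, rfl⟩
  rw [← hS] at hy
  obtain ⟨h1, h2, h3, h4, h5, -⟩ := hx.turning_time hr h hR0 hκ hS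
  have hS1 : 1 ≤ S := by linarith [hx.le]
  have hS0 : 0 < S := by linarith
  have ht₀0 : 0 < t₀ := hR0.trans_le hx.le
  have hy0 : 0 < y := by linarith
  have hyX : β + y ≤ X := hy ▸ (hx.mem S ⟨h1.le, h2.le⟩).2
  have hFy : 0 < F f (β + y) := hr.F_pos hf (by linarith) hyX
  have hvS : S * v S = -(((N : ℝ) - 1) * y) := by
    rw [hy, add_sub_cancel_left] at h3; linarith
  -- By logarithmic decay at rate `y`, the height `y` is lost before time has grown by the factor `e
  -- < 3`.
  have hr₂ : r₂ ≤ 3 * S := by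
    have hlog := h.log_decay hN hf hr (y := y) hS0 h2.le
      (fun r hr' => hx.mem r ⟨h1.le.trans hr'.1, hr'.2⟩) (by
        rw [hvS, hy, add_sub_cancel_left]; linarith)
    rw [hx.end_eq, hy] at hlog
    have h6 : Real.log (r₂ / S) ≤ 1 := by
      rw [Real.log_div (by linarith) hS0.ne']
      by_contra! hcon
      nlinarith
    rw [Real.log_le_iff_le_exp (div_pos (by linarith) hS0), div_le_iff₀ hS0] at h6
    nlinarith [Real.exp_one_lt_d9]
  have hES : energy f u v S = (S * v S) ^ 2 / (2 * S ^ 2) + F f (β + y) := by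
    simp only [energy, hy]; field_simp
  have hSF : κ / 6 ≤ S * F f (β + y) := by
    have g1 := h.energy_le hN hf hS0.le h2.le
    have g2 := hx.energy_end
    have g3 : r₂ * energy f u v r₂ ≤ 3 * S * energy f u v S := by
      have : 0 ≤ energy f u v r₂ := by
        have := F_le_energy (f := f) (u := u) (v := v) r₂
        rwa [hx.end_eq, hr.F_eq] at this
      exact mul_le_mul hr₂ g1 this (by linarith)
    have g4 : 3 * S * energy f u v S = 3 * (S * v S) ^ 2 / (2 * S) + 3 * (S * F f (β + y)) := by
      rw [hES]; field_simp
    have g5 : 3 * (S * v S) ^ 2 / (2 * S) ≤ κ / 2 := by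
      rw [hvS, div_le_iff₀ (by linarith)]
      have : 3 * (-(((N : ℝ) - 1) * y)) ^ 2 = 3 * ((N : ℝ) - 1) ^ 2 * y * y := by ring
      rw [this]
      have : 3 * ((N : ℝ) - 1) ^ 2 * y * y ≤ κ * 1 :=
        mul_le_mul hyκ hy1 hy0.le hκ.le
      nlinarith
    linarith
  -- The excursion starts either at the fixed time `R`, with `F(β + y)` small against `κ/R`, or with
  -- `t₀ E(t₀) ≤ κ/48`. In both cases `S F(β + y) ≥ κ/6` forces `S` to be late.
  have hS8 : 8 * t₀ ≤ S := by
    rcases hx.small with g | g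
    · rw [g]
      by_contra! hcon
      nlinarith
    · have g1 : F f (β + y) ≤ energy f u v t₀ := by
        have g2 := F_le_energy (f := f) (u := u) (v := v) S
        rw [hy] at g2
        exact g2.trans (h.energy_le hN hf ht₀0.le h1.le)
      by_contra! hcon
      have g3 : S * F f (β + y) ≤ S * energy f u v t₀ := mul_le_mul_of_nonneg_left g1 hS0.le
      have g4 : S * energy f u v t₀ < 8 * t₀ * energy f u v t₀ :=
        mul_lt_mul_of_pos_right hcon (hFy.trans_le g1)
      linarith
  have hmain := h.f_le_at_turning hN hf hr ht₀0 hS8 hS1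
    (fun r hr' => hx.mem r ⟨hr'.1, hr'.2.trans h2.le⟩) (fun r hr' => by
      rcases hr'.2.lt_or_eq with g | g
      · exact (h5 r ⟨hr'.1, g⟩).le
      · rw [g, h3]) h3 hy hy0 hK hyρ hlip
  refine hmain.trans ?_
  rw [mul_assoc (24 * K * (8 ^ N * (N : ℝ))) (6 / κ)]
  refine mul_le_mul_of_nonneg_left ?_ (by positivity)
  rw [div_mul_eq_mul_div, div_le_div_iff₀ hS0 hκ]
  nlinarith

end

end BoundState

/-! ### Excursions of nearby trajectories and the contradiction at the edge. -/

namespace BoundState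

section
variable {N : ℕ} {f : ℝ → ℝ} {J : Set ℝ} {u v : ℝ → ℝ} {U V : ℝ → ℝ → ℝ}
  {δ β X δ₂ β₂ X₂ : ℝ} {k : ℕ} {c : ℝ}

/-- A trajectory that never returns to `β`, or returns too slowly to cross the well, stays positive
and loses its energy, which `hnot` excludes. So it returns with `r E` bounded below. -/
lemma Traj.exists_excursion (hN : 2 ≤ N) (hf : Nonlin f J) (hr : RightWell f J δ β X)
    (h : Traj N f J u v) {p w c₀ R t₀ ε κ : ℝ} (hp : 0 < p) (hw : 0 < w) (hc : 0 < c₀)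
    (hpw : p + w ≤ β) (hwell : ∀ s ∈ Icc p (p + w), F f s ≤ -c₀) (hR : 0 < R) (hRt : R ≤ t₀)
    (hT : w / √(2 * c₀) ≤ R) (hκ : 2 * κ ≤ √(2 * c₀) * w) (hbefore : ∀ r ∈ Ico R t₀, u r < β)
    (hut₀ : β ≤ u t₀) (hut₀X : u t₀ < X) (hEX : energy f u v t₀ < F f X) (hε : 0 < ε)
    (habove : ∀ r ∈ Ioc t₀ (t₀ + ε), β < u r)
    (hφ : 0 < t₀ * v t₀ + ((N : ℝ) - 1) * (u t₀ - β))
    (hsmall : t₀ = R ∨ t₀ * energy f u v t₀ ≤ κ / 48)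
    (hnot : ¬ ((∀ r, t₀ ≤ r → 0 < u r) ∧ ∀ e > 0, ∃ r, t₀ ≤ r ∧ energy f u v r < e)) :
    ∃ r₂, Excursion N f β X u v R κ t₀ r₂ := by
  have ht₀ : 0 < t₀ := hR.trans_le hRt
  have hX : ∀ r, t₀ ≤ r → u r < X := fun r hr' =>
    (h.lt_iff_of_energy_lt hN hf ht₀.le hr' hEX).1 hut₀X
  by_cases hret : ∃ r, t₀ < r ∧ u r ≤ β
  swap
  · push Not at hret
    have hge : ∀ r, t₀ ≤ r → β ≤ u r := by
      intro r hr'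
      rcases hr'.lt_or_eq with h1 | h1
      · exact (hret r h1).le
      · rwa [← h1]
    exact absurd ⟨fun r hr' => hr.β_pos.trans_le (hge r hr'), fun e he =>
      h.exists_energy_lt_of_nonneg hN hf hr ht₀ (fun r hr' => hr.β_pos.le.trans (hge r hr'))
        (fun r hr' => (hX r hr').le) he⟩ hnot
  obtain ⟨r, htr, hur⟩ := hret
  have hεr : t₀ + ε ≤ r := by
    by_contra! hcon
    linarith [habove r ⟨htr, hcon.le⟩]
  obtain ⟨r₂, hr₂, -, hur₂, hlt⟩ := exists_first_hit h.contu hεr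
    (habove (t₀ + ε) ⟨by linarith, le_rfl⟩) hur
  have habove' : ∀ s ∈ Ioo t₀ r₂, β < u s := by
    intro s hs
    rcases le_total s (t₀ + ε) with h1 | h1
    · exact habove s ⟨hs.1, h1⟩
    · exact hlt s h1 hs.2
  have htr₂ : t₀ < r₂ := by linarith
  have hr₂0 : 0 < r₂ := ht₀.trans htr₂
  have hmem : ∀ s ∈ Icc t₀ r₂, β ≤ u s := by
    intro s hs
    rcases hs.1.lt_or_eq with h1 | h1
    · rcases hs.2.lt_or_eq with h2 | h2
      · exact (habove' s ⟨h1, h2⟩).le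
      · rw [h2, hur₂]
    · rwa [← h1]
  have hv₂ : v r₂ ≤ 0 := nonpos_of_le_left htr₂ (h.hu r₂ hr₂0) fun s hs => by
    rw [hur₂]; exact (habove' s hs).le
  have hE₂ : 0 ≤ energy f u v r₂ := by
    have := F_le_energy (f := f) (u := u) (v := v) r₂
    rwa [hur₂, hr.F_eq] at this
  have hE : √(2 * c₀) * w ≤ energy f u v r₂ * (r₂ + w / √(2 * c₀)) := by
    by_contra! hcon
    obtain ⟨h1, h2⟩ := h.slow_descent hN hf hr hp hw hc hpw hwell hr₂0 hur₂ hv₂ hcon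
    refine hnot ⟨fun s hs => ?_, fun e he => ?_⟩
    · rcases le_total s r₂ with h3 | h3
      · exact hr.β_pos.trans_le (hmem s ⟨hs, h3⟩)
      · exact h1 s h3
    · obtain ⟨s, hs, hs'⟩ := h2 e he
      exact ⟨s, htr₂.le.trans hs, hs'⟩
  refine ⟨r₂, hRt, htr₂, hbefore, fun s hs => ⟨hmem s hs, (hX s hs.1).le⟩, habove', hφ, hur₂, ?_,
    hsmall⟩
  have : energy f u v r₂ * (w / √(2 * c₀)) ≤ energy f u v r₂ * r₂ :=
    mul_le_mul_of_nonneg_left (by linarith) hE₂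
  linarith

/-- Starting between the strip and `β` with too little energy to cross the strip, the trajectory can
only climb to `β`, or remain positive and lose its energy. -/
lemma Traj.ascent (hN : 2 ≤ N) (hf : Nonlin f J) (hr : RightWell f J δ β X)
    (h : Traj N f J u v) {p w c₀ R : ℝ} (hp : 0 < p) (hw : 0 < w) (hc : 0 < c₀)
    (hwell : ∀ s ∈ Icc p (p + w), F f s ≤ -c₀) (hR : 0 < R) (huR : p + w ≤ u R) (huRβ : u R < β)
    (hE : energy f u v R * (R + w / √(2 * c₀)) < √(2 * c₀) * w) :
    ((∀ r, R ≤ r → 0 < u r) ∧ ∀ e > 0, ∃ r, R ≤ r ∧ energy f u v r < e) ∨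
      ∃ t₀, R < t₀ ∧ u t₀ = β ∧ ∀ r ∈ Ico R t₀, p < u r ∧ u r < β := by
  have hF : ∀ s ∈ Icc p β, F f s ≤ 0 := fun s hs => hr.nonpos s ⟨hp.le.trans hs.1, hs.2⟩
  have hleft : ∀ b, R ≤ b → (∀ r ∈ Icc R b, u r ≤ β) → u b ≤ p →
      (∀ r, R ≤ r → 0 < u r) ∧ ∀ e > 0, ∃ r, R ≤ r ∧ energy f u v r < e := by
    intro b' hb' hβ hub'
    obtain ⟨b, hRb, hbb', hub, hlt⟩ := exists_first_hit h.contu hb' (by linarith : p < u R) hub'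
    have hpu : ∀ s ∈ Icc R b, p ≤ u s := by
      intro s hs
      rcases hs.2.lt_or_eq with h2 | h2
      · exact (hlt s hs.1 h2).le
      · rw [h2, hub]
    have hEb : energy f u v b < 0 := by
      by_contra! hEb
      have := h.crossing hN hf (p := p) (p' := p + w) (by linarith) hc hR hRb.le
        (fun s hs => hF _ ⟨hpu s hs, hβ s ⟨hs.1, hs.2.trans hbb'⟩⟩) hEb hwell huR hub.le
      rw [add_sub_cancel_left] at this
      linarith
    have hpos := h.pos_of_energy_nonpos hN hf (hR.trans hRb).le hEb.le (by rwa [hub])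
    refine ⟨fun s hs => ?_, fun e he => ⟨b, hRb.le, hEb.trans he⟩⟩
    rcases le_total s b with h2 | h2
    · exact hp.trans_le (hpu s ⟨hs, h2⟩)
    · exact hpos s h2
  by_cases hβ : ∃ r, R ≤ r ∧ β ≤ u r
  · obtain ⟨r, hRr, hur⟩ := hβ
    obtain ⟨t₀, hRt, -, hut, hlt⟩ := exists_first_hit (u := fun x => -u x) h.contu.neg hRr
      (neg_lt_neg huRβ) (neg_le_neg hur)
    have hlt' : ∀ s, R ≤ s → s < t₀ → u s < β := fun s hs hst => by linarith [hlt s hs hst]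
    by_cases hb : ∃ b ∈ Ico R t₀, u b ≤ p
    · obtain ⟨b, hb, hub⟩ := hb
      exact Or.inl (hleft b hb.1 (fun s hs => (hlt' s hs.1 (hs.2.trans_lt hb.2)).le) hub)
    · push Not at hb
      exact Or.inr ⟨t₀, hRt, by linarith, fun s hs => ⟨hb s hs, hlt' s hs.1 hs.2⟩⟩
  · push Not at hβ
    by_cases hb : ∃ b, R ≤ b ∧ u b ≤ p
    · obtain ⟨b, hb, hub⟩ := hb
      exact Or.inl (hleft b hb (fun s hs => (hβ s hs.1).le) hub)
    · push Not at hb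
      exact Or.inl ⟨fun s hs => hp.trans (hb s hs), fun e he =>
        h.exists_energy_lt_of_nonpos hN hf hR.le
          (fun s hs => hF _ ⟨(hb s hs).le, (hβ s hs).le⟩) he⟩

/-- Staying positive after `R` adds no sign changes, and those before `R` are transferred to `U c`.
This makes failure of goodness a usable hypothesis on neighbours. -/
lemma Family.eventually_good_of_pos (hN : 2 ≤ N) (hf : Nonlin f J)
    (hl : RightWell (refl f) (Neg.neg ⁻¹' J) δ₂ β₂ X₂)
    (h : Family N f J U V) (hc : c ∈ Icc (0 : ℝ) 1) (hG : Good f X X₂ k (U c) (V c)) {R : ℝ}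
    (hR : 0 < R) (hU : 0 < U c R) (hUX : U c R < X) (hEX : energy f (U c) (V c) R < F f X)
    (hEX₂ : energy f (U c) (V c) R < F f (-X₂)) :
    ∀ᶠ s in 𝓝[Icc 0 1] c, (∀ r, R ≤ r → 0 < U s r) →
      (∀ e > 0, ∃ r, R ≤ r ∧ energy f (U s) (V s) r < e) → Good f X X₂ k (U s) (V s) := by
  have hnd := h.no_double_zero hc (R := R) fun h => hU.ne' h.1
  have hnd' : ∀ y ∈ Ico 0 R, ¬(U c y = 0 ∧ V c y = 0) := fun y hy =>
    hnd y (Ico_subset_Icc_self hy)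
  have hE := h.tendsto_energy hf hc hR.le hnd'
  filter_upwards [h.transfer hc hR.le hU.ne', hE.eventually_lt_const hEX,
    hE.eventually_lt_const hEX₂, (h.tendsto hc hR.le hnd').1.eventually_lt_const hUX,
    eventually_mem_nhdsWithin] with s h1 h2 h3 h4 hsP hpos hloses
  have hTs := h.traj s hsP
  refine hTs.good_of_energy_lt hN hf ?_ hR.le
    ⟨by linarith [hpos R le_rfl, hl.X_pos], h4⟩ h2 h3 hloses
  intro hk
  obtain ⟨x, hA⟩ := signChangesAtLeast_iff.1 hk
  obtain ⟨x', hx', hA'⟩ := Alt.before hR (fun y hy => mul_pos (hpos y hy) (hpos R le_rfl)) hA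
  obtain ⟨y, -, hAy⟩ := h1.2 _ _ hx' hA'
  exact hG.1 (signChangesAtLeast_iff.2 ⟨y, hAy⟩)

lemma Family.eventually_turning_free (h : Family N f J U V) (hN : 2 ≤ N)
    (hc : c ∈ Icc (0 : ℝ) 1) {R T : ℝ} (hR : 0 ≤ R)
    (hnd : ∀ r ∈ Ico 0 T, ¬(U c r = 0 ∧ V c r = 0))
    (hfree : ∀ r ∈ Icc R T, U c r < β ∨ 0 < r * V c r + ((N : ℝ) - 1) * (U c r - β)) :
    ∀ᶠ s in 𝓝[Icc 0 1] c, ∀ r ∈ Icc R T,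
      U s r < β ∨ 0 < r * V s r + ((N : ℝ) - 1) * (U s r - β) := by
  have hN' : (2 : ℝ) ≤ N := by exact_mod_cast hN
  rcases lt_or_ge T R with hTR | hTR
  · exact Eventually.of_forall fun s r hr => by linarith [hr.1, hr.2]
  have hT := h.traj c hc
  have hcu := hT.contu
  have hcv := hT.contv
  obtain ⟨z, hz, hmin⟩ := isCompact_Icc.exists_isMinOn (nonempty_Icc.2 hTR)
    (Continuous.continuousOn (by fun_prop :
      Continuous fun r => max (β - U c r) (r * V c r + ((N : ℝ) - 1) * (U c r - β))))
  set m := max (β - U c z) (z * V c z + ((N : ℝ) - 1) * (U c z - β)) with hm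
  have hm0 : 0 < m := by
    rcases hfree z hz with h1 | h1
    · exact lt_max_of_lt_left (by linarith)
    · exact lt_max_of_lt_right h1
  have hTN : 0 < T + N := by linarith
  set ε := m / (T + N) with hε
  have hε0 : 0 < ε := by positivity
  have hεm : ε * (T + N) = m := by rw [hε]; field_simp
  filter_upwards [h.cont c hc T hnd ε hε0] with s hs r hr
  have hr0 : 0 ≤ r := hR.trans hr.1
  obtain ⟨h1, h2⟩ := hs r ⟨hr0, hr.2⟩
  rw [abs_lt] at h1 h2
  have h3 : m ≤ max (β - U c r) (r * V c r + ((N : ℝ) - 1) * (U c r - β)) :=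
    isMinOn_iff.1 hmin r hr
  rcases le_max_iff.1 h3 with h4 | h4
  · left
    nlinarith
  · right
    have h5 : r * V c r - r * V s r ≤ T * ε := by
      calc r * V c r - r * V s r = r * (V c r - V s r) := by ring
        _ ≤ r * ε := mul_le_mul_of_nonneg_left (by linarith) hr0
        _ ≤ T * ε := mul_le_mul_of_nonneg_right hr.2 hε0.le
    nlinarith

/-- At the first turning time `r v + (N-1)(u-β)` crosses zero transversally, with derivative `-S
f(u) + v < 0`. Hence this time, and the height reached there, depend continuously on the parameter.
-/
lemma Family.continuousWithinAt_turning (hN : 2 ≤ N) (hf : Nonlin f J) (hr : RightWell f J δ β X)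
    (h : Family N f J U V) (hc : c ∈ Icc (0 : ℝ) 1) {R κ t₀ r₂ : ℝ} (hR : 0 < R) (hκ : 0 < κ)
    (hx : Excursion N f β X (U c) (V c) R κ t₀ r₂) :
    ContinuousWithinAt (fun s => U s (sInf (turning N β (U s) (V s) R))) (Icc 0 1) c := by
  have hN' : (2 : ℝ) ≤ N := by exact_mod_cast hN
  have hT := h.traj c hc
  obtain ⟨S, hS⟩ : ∃ S, S = sInf (turning N β (U c) (V c) R) := ⟨_, rfl⟩
  obtain ⟨h1, h2, h3, h4, -, h6⟩ := hx.turning_time hr hT hR hκ hS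
  have hRS : R < S := hx.le.trans_lt h1
  have hS0 : 0 < S := hR.trans hRS
  rw [ContinuousWithinAt, Metric.tendsto_nhds]
  intro ε hε
  rw [← hS]
  obtain ⟨η, hη, hη'⟩ := Metric.eventually_nhds_iff.1
    (Metric.tendsto_nhds.1 (hT.contu.tendsto S) (ε / 2) (half_pos hε))
  have hd : HasDerivAt (fun x => x * V c x + ((N : ℝ) - 1) * (U c x - β))
      (-(S * f (U c S)) + V c S) S := by
    refine ((hT.hasDerivAt_kappa hS0 β).add ((hT.hu S hS0).sub_const β)).congr_of_eventuallyEq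
      (Eventually.of_forall fun x => ?_)
    simp only [Pi.add_apply]
    ring
  have hd0 : -(S * f (U c S)) + V c S < 0 := by
    have g1 := hr.f_nonneg hf (hx.mem S ⟨h1.le, h2.le⟩)
    have g2 := mul_nonneg hS0.le g1
    have g3 : V c S < 0 := by
      by_contra! hcon
      nlinarith [mul_nonneg hS0.le hcon]
    linarith
  have hev : ∀ᶠ x in 𝓝[>] S, x * V c x + ((N : ℝ) - 1) * (U c x - β) < 0 := by
    have := ((hasDerivAt_iff_tendsto_slope.1 hd).mono_left
      (nhdsGT_le_nhdsNE S)).eventually_lt_const hd0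
    filter_upwards [this, self_mem_nhdsWithin] with x hx hxS
    rw [slope_def_field, h3, sub_zero, div_neg_iff] at hx
    rcases hx with g | g
    · linarith [mem_Ioi.1 hxS, g.2]
    · exact g.1
  have hev' : ∀ᶠ x in 𝓝[>] S, β < U c x :=
    (hT.contu.continuousAt.eventually (lt_mem_nhds h4)).filter_mono nhdsWithin_le_nhds
  obtain ⟨x, ⟨hφx, hux⟩, hxS⟩ := ((hev.and hev').and
    (Ioo_mem_nhdsGT (by linarith : S < S + η))).exists
  have hx0 : 0 < x := hS0.trans hxS.1
  have hnd := h.no_double_zero hc (R := x) fun h0 => by linarith [h0.1, hr.β_pos]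
  have hnd' : ∀ y ∈ Ico 0 x, ¬(U c y = 0 ∧ V c y = 0) := fun y hy =>
    hnd y (Ico_subset_Icc_self hy)
  obtain ⟨t1, t2⟩ := h.tendsto hc hx0.le hnd'
  have tφ := ((t2.const_mul x).add ((t1.sub_const β).const_mul ((N : ℝ) - 1))).eventually_lt_const
    hφx
  filter_upwards [h.cont c hc x hnd' (ε / 2) (half_pos hε),
    h.eventually_turning_free hN hc (T := S - η / 2) hR.le
      (fun y hy => hnd' y ⟨hy.1, by linarith [hy.2, hxS.1]⟩)
      (fun y hy => h6 y ⟨hy.1, by linarith [hy.2]⟩), tφ, t1.eventually_const_lt hux]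
    with s g1 g2 g3 g4
  have hmem : x ∈ turning N β (U s) (V s) R := ⟨(hRS.trans hxS.1).le, g4.le, g3.le⟩
  set S' := sInf (turning N β (U s) (V s) R) with hS'
  have hS'x : S' ≤ x := csInf_le ⟨R, fun y hy => hy.1⟩ hmem
  have hS'l : S - η / 2 ≤ S' := by
    refine le_csInf ⟨x, hmem⟩ fun y hy => ?_
    by_contra! hcon
    rcases g2 y ⟨hy.1, hcon.le⟩ with g | g
    · linarith [hy.2.1]
    · linarith [hy.2.2]
  have hS'R : R ≤ S' := le_csInf ⟨x, hmem⟩ fun y hy => hy.1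
  have e1 := (g1 S' ⟨hR.le.trans hS'R, hS'x⟩).1
  have e2 := hη' (y := S') (by
    rw [Real.dist_eq, abs_lt]; constructor <;> linarith [hxS.2])
  rw [Real.dist_eq] at e2 ⊢
  calc |U s S' - U c S| ≤ |U s S' - U c S'| + |U c S' - U c S| := abs_sub_le _ _ _
    _ < ε := by linarith

lemma exists_right_of_eventually {P : ℝ → Prop} (hc : c ∈ Ico (0 : ℝ) 1)
    (h : ∀ᶠ s in 𝓝[Icc 0 1] c, P s) : ∃ d ∈ Ioc c 1, ∀ s ∈ Ioc c d, P s := by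
  obtain ⟨ε, hε, hsub⟩ := Metric.mem_nhdsWithin_iff.1 h
  refine ⟨min 1 (c + ε / 2), ⟨lt_min hc.2 (by linarith), min_le_left _ _⟩, fun s hs => hsub ⟨?_, ?_⟩⟩
  · have := hs.2.trans (min_le_right _ _)
    rw [Metric.mem_ball, Real.dist_eq, abs_lt]
    constructor <;> linarith [hs.1]
  · exact ⟨hc.1.trans hs.1.le, hs.2.trans (min_le_left _ _)⟩

/-- Near a parameter with exceptional behaviour, trajectories that are not good make an excursion
above `β`. -/
lemma Family.eventually_excursion (hN : 2 ≤ N) (hf : Nonlin f J) (hr : RightWell f J δ β X)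
    (hl : RightWell (refl f) (Neg.neg ⁻¹' J) δ₂ β₂ X₂) (h : Family N f J U V)
    (hc : c ∈ Icc (0 : ℝ) 1) (hG : Good f X X₂ k (U c) (V c)) (hE : Edge f β (U c) (V c)) :
    ∃ R κ, 1 ≤ R ∧ 0 < κ ∧
      (∀ r, R ≤ r → U c r < β ∨ 0 < r * V c r + ((N : ℝ) - 1) * (U c r - β)) ∧
      ∀ᶠ s in 𝓝[Icc 0 1] c, ¬ Good f X X₂ k (U s) (V s) →
        ∃ t₀ r₂, Excursion N f β X (U s) (V s) R κ t₀ r₂ := by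
  have hN' : (2 : ℝ) ≤ N := by exact_mod_cast hN
  have hT := h.traj c hc
  have hFX : 0 < F f X := hr.F_pos hf hr.lt le_rfl
  have hFX₂ : 0 < F f (-X₂) := by
    have := hl.F_pos hf.refl hl.lt le_rfl; rwa [F_refl] at this
  have hδ := hr.δ_pos
  have hsub := hr.sub hf
  have hδβ := hr.δ_le
  have hβX := hr.lt
  set p := δ / 3 with hpdef
  obtain ⟨w, hw, c₀, hc₀, hpw', -, hwell, -⟩ := exists_trap hf (p := p) (q := 2 * δ / 3)
    (ℓ := δ / 2) (hsub ⟨by linarith, by linarith⟩) (hsub ⟨by linarith, by linarith⟩) (by linarith)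
    (by linarith) (hr.neg _ ⟨by linarith, by linarith⟩) (hr.neg _ ⟨by linarith, by linarith⟩)
  have hp : 0 < p := by linarith
  have hpw : p + w ≤ β := by linarith
  have hs0 : 0 < √(2 * c₀) := Real.sqrt_pos.2 (by linarith)
  set T := w / √(2 * c₀) with hTdef
  have hT0 : 0 < T := by positivity
  set κ := √(2 * c₀) * w / 2 with hκ
  have hκ0 : 0 < κ := by positivity
  obtain ⟨R₁, hR₁, hER₁⟩ := hE.energy_lim _ (lt_min hFX hFX₂)
  have hER : ∀ r, R₁ ≤ r → energy f (U c) (V c) r < min (F f X) (F f (-X₂)) := fun r hr' =>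
    (hT.energy_le hN hf hR₁ hr').trans_lt hER₁
  obtain ⟨R₀, hR₀, hside⟩ := hE.side
  rcases hside with hab | hbe
  · have hX : ∀ᶠ r in atTop, U c r < X := hE.lim.eventually_lt_const hr.lt
    obtain ⟨R₂, hR₂⟩ := eventually_atTop.1 hX
    set R := max (max R₀ R₁) (max R₂ (max 1 T)) with hR
    have hRR₀ : R₀ ≤ R := (le_max_left _ _).trans (le_max_left _ _)
    have hRR₁ : R₁ ≤ R := (le_max_right _ _).trans (le_max_left _ _)
    have hRR₂ : R₂ ≤ R := (le_max_left _ _).trans (le_max_right _ _)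
    have hR1 : 1 ≤ R := (le_max_left _ _).trans ((le_max_right _ _).trans (le_max_right _ _))
    have hRT : T ≤ R := (le_max_right _ _).trans ((le_max_right _ _).trans (le_max_right _ _))
    have hR0 : 0 < R := by linarith
    -- Otherwise logarithmic decay brings `U c` down to `β` by time `r e`, although it stays above
    -- `β`.
    have hφ : ∀ r, R ≤ r → 0 < r * V c r + ((N : ℝ) - 1) * (U c r - β) := by
      intro r hr'
      have hr0 : 0 < r := by linarith
      have hur := hab r (hRR₀.trans hr')
      by_contra! hcon
      set y := U c r - β with hy
      have hy0 : 0 < y := by linarith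
      set b := r * Real.exp 1 with hb
      have hrb : r ≤ b := by
        have := Real.add_one_le_exp (1 : ℝ)
        nlinarith
      have hlog := hT.log_decay hN hf hr (y := y) hr0 hrb (fun x hx =>
        ⟨(hab x (hRR₀.trans (hr'.trans hx.1))).le, (hR₂ x (hRR₂.trans (hr'.trans hx.1))).le⟩)
        (by linarith)
      rw [hb, Real.log_mul hr0.ne' (Real.exp_pos 1).ne', Real.log_exp] at hlog
      have := hab (r * Real.exp 1) (hRR₀.trans (hr'.trans hrb))
      linarith
    refine ⟨R, κ, hR1, hκ0, fun r hr' => Or.inr (hφ r hr'), ?_⟩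
    have huR := hab R hRR₀
    have huR0 : 0 < U c R := hr.β_pos.trans huR
    have hnd := h.no_double_zero hc (R := R) fun h => huR0.ne' h.1
    have hnd' : ∀ y ∈ Ico 0 R, ¬(U c y = 0 ∧ V c y = 0) := fun y hy =>
      hnd y (Ico_subset_Icc_self hy)
    obtain ⟨t1, t2⟩ := h.tendsto hc hR0.le hnd'
    have hEX := (hER R hRR₁).trans_le (min_le_left _ _)
    have hEX₂ := (hER R hRR₁).trans_le (min_le_right _ _)
    have tφ := ((t2.const_mul R).add
      ((t1.sub_const β).const_mul ((N : ℝ) - 1))).eventually_const_lt (hφ R le_rfl)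
    filter_upwards [h.eventually_good_of_pos hN hf hl hc hG hR0 huR0 (hR₂ R hRR₂) hEX hEX₂, tφ,
      t1.eventually_const_lt huR, t1.eventually_lt_const (hR₂ R hRR₂),
      (h.tendsto_energy hf hc hR0.le hnd').eventually_lt_const hEX, eventually_mem_nhdsWithin]
      with s g1 g2 g3 g4 g5 hsP hbad
    have hTs := h.traj s hsP
    obtain ⟨ε, hε, hε'⟩ := exists_Icc_of_eventually
      (hTs.contu.continuousAt.eventually (lt_mem_nhds g3))
    exact ⟨R, hTs.exists_excursion hN hf hr hp hw hc₀ hpw hwell hR0 le_rfl hRT (by linarith)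
      (fun r hr' => by linarith [hr'.1, hr'.2]) g3.le g4 g5 hε
      (fun r hr' => hε' r (Ioc_subset_Icc_self hr')) g2 (Or.inl rfl)
      fun hg => hbad (g1 hg.1 hg.2)⟩
  · have hpu : ∀ᶠ r in atTop, p + w < U c r := hE.lim.eventually_const_lt (by linarith)
    obtain ⟨R₃, hR₃⟩ := eventually_atTop.1 hpu
    set R₄ := max R₀ R₃ with hR₄
    have happ := hT.approach hN hf (ℓ := β) (R := R₄) (hR₀.trans_le (le_max_left _ _))
      (fun r hr' => hr.nonpos _ ⟨by linarith [hR₃ r ((le_max_right _ _).trans hr')],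
        (hbe r ((le_max_left _ _).trans hr')).1.le⟩) hE.lim
      (fun r hr' => hE.energy_pos r (hR₀.le.trans ((le_max_left _ _).trans hr')))
      (ε := min (κ / 48) (√(2 * c₀) * w / (1 + T))) (lt_min (by positivity) (by positivity))
    obtain ⟨R, ⟨hRR₄, hR0, -, hE0, hEε⟩, hRR₁, hR1, hRT⟩ := (happ.and ((eventually_ge_atTop R₁).and
      ((eventually_ge_atTop 1).and (eventually_ge_atTop T)))).exists
    have hRR₀ : R₀ ≤ R := (le_max_left _ _).trans hRR₄
    have hRR₃ : R₃ ≤ R := (le_max_right _ _).trans hRR₄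
    refine ⟨R, κ, hR1, hκ0, fun r hr' => Or.inl (hbe r (hRR₀.trans hr')).1, ?_⟩
    have huR := (hbe R hRR₀).1
    have huRp := hR₃ R hRR₃
    have huR0 : 0 < U c R := by linarith
    have hnd := h.no_double_zero hc (R := R) fun h => huR0.ne' h.1
    have hnd' : ∀ y ∈ Ico 0 R, ¬(U c y = 0 ∧ V c y = 0) := fun y hy =>
      hnd y (Ico_subset_Icc_self hy)
    obtain ⟨t1, t2⟩ := h.tendsto hc hR0.le hnd'
    have hEX := (hER R hRR₁).trans_le (min_le_left _ _)
    have hEX₂ := (hER R hRR₁).trans_le (min_le_right _ _)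
    have tE := h.tendsto_energy hf hc hR0.le hnd'
    have hE1 : energy f (U c) (V c) R * (R + T) < √(2 * c₀) * w := by
      have h1 := hEε.trans_le (min_le_right _ _)
      rw [lt_div_iff₀ (by linarith)] at h1
      have : energy f (U c) (V c) R * (R + T) ≤ energy f (U c) (V c) R * ((R + 1) * (1 + T)) :=
        mul_le_mul_of_nonneg_left (by nlinarith) hE0
      linarith
    have hE2 : energy f (U c) (V c) R * R < κ / 48 := by
      have h1 := hEε.trans_le (min_le_left _ _)
      nlinarith
    filter_upwards [h.eventually_good_of_pos hN hf hl hc hG hR0 huR0 (huR.trans hr.lt) hEX hEX₂,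
      t1.eventually_const_lt huRp, t1.eventually_lt_const huR, tE.eventually_lt_const hEX,
      (tE.mul_const (R + T)).eventually_lt_const hE1, (tE.mul_const R).eventually_lt_const hE2,
      eventually_mem_nhdsWithin] with s g1 g2 g3 g4 g5 g6 hsP hbad
    have hTs := h.traj s hsP
    rcases hTs.ascent hN hf hr hp hw hc₀ hwell hR0 g2.le g3 g5 with hg | ⟨t₀, hRt, hut₀, hlt⟩
    · exact absurd (g1 hg.1 hg.2) hbad
    have ht₀ : 0 < t₀ := hR0.trans hRt
    have hposR : ∀ r, R ≤ r → r ≤ t₀ → 0 < U s r := by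
      intro r h1 h2
      rcases h2.lt_or_eq with h3 | h3
      · exact hp.trans (hlt r ⟨h1, h3⟩).1
      · rw [h3, hut₀]; exact hr.β_pos
    have hnot : ¬ ((∀ r, t₀ ≤ r → 0 < U s r) ∧
        ∀ e > 0, ∃ r, t₀ ≤ r ∧ energy f (U s) (V s) r < e) := by
      rintro ⟨h1, h2⟩
      refine hbad (g1 (fun r hr' => ?_) fun e he => ?_)
      · rcases le_total r t₀ with h3 | h3
        · exact hposR r hr' h3
        · exact h1 r h3
      · obtain ⟨r, h3, h4⟩ := h2 e he
        exact ⟨r, hRt.le.trans h3, h4⟩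
    -- Arriving at `β` with zero velocity means zero energy, after which the trajectory stays
    -- positive; the parameter would be good.
    have hv0 : 0 < V s t₀ := by
      have h1 : -V s t₀ ≤ 0 := nonpos_of_le_left (w := fun x => -U s x) hRt (hTs.hu t₀ ht₀).neg
        fun r hr' => by linarith [(hlt r (Ioo_subset_Ico_self hr')).2]
      refine lt_of_le_of_ne (by linarith) fun h2 => hnot ?_
      have h3 : energy f (U s) (V s) t₀ = 0 := by simp [energy, ← h2, hut₀, hr.F_eq]
      exact ⟨hTs.pos_of_energy_nonpos hN hf ht₀.le h3.le (by rw [hut₀]; exact hr.β_pos),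
        fun e he => ⟨t₀, le_rfl, by rwa [h3]⟩⟩
    obtain ⟨ε, hε, hε'⟩ := exists_Icc_of_eventually
      (hTs.contv.continuousAt.eventually (lt_mem_nhds hv0))
    have habove : ∀ r ∈ Ioc t₀ (t₀ + ε), β < U s r := by
      have hm : StrictMonoOn (U s) (Icc t₀ (t₀ + ε)) := strictMonoOn_of_deriv_pos
        (convex_Icc _ _) hTs.contu.continuousOn fun x hx => by
          rw [interior_Icc] at hx
          rw [(hTs.hu x (ht₀.trans hx.1)).deriv]
          exact hε' x (Ioo_subset_Icc_self hx)
      intro r hr'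
      rw [← hut₀]
      exact hm ⟨le_rfl, by linarith⟩ (Ioc_subset_Icc_self hr') hr'.1
    -- Below `β` the quantity `r²E` does not increase, so the smallness of `R E(R)` carries over to
    -- the possibly much later time `t₀`.
    have hsmall : t₀ * energy f (U s) (V s) t₀ ≤ κ / 48 := by
      have h1 := hTs.sq_mul_energy_le hN hf hR0.le hRt.le fun x hx => by
        rcases hx.2.lt_or_eq with h2 | h2
        · exact hr.nonpos _ ⟨(hposR x hx.1 hx.2).le, (hlt x ⟨hx.1, h2⟩).2.le⟩
        · rw [h2, hut₀, hr.F_eq]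
      by_contra! hcon
      have h2 := mul_lt_mul_of_pos_left hcon ht₀
      have h3 := mul_lt_mul_of_pos_left g6 hR0
      have h4 := mul_le_mul_of_nonneg_right hRt.le (by positivity : 0 ≤ κ / 48)
      linarith
    obtain ⟨r₂, hx⟩ := hTs.exists_excursion (κ := κ) hN hf hr hp hw hc₀ hpw hwell hR0 hRt.le hRT
      (by linarith) (fun r hr' => (hlt r hr').2) hut₀.ge (by rw [hut₀]; exact hr.lt)
      ((hTs.energy_le hN hf hR0.le hRt.le).trans_lt g4) hε habove
      (by rw [hut₀, sub_self, mul_zero, add_zero]; exact mul_pos ht₀ hv0) (Or.inr hsmall) hnot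
    exact ⟨t₀, r₂, hx⟩

/-- The exceptional behaviour does not occur at a right boundary point of the set of good
parameters. -/
lemma Family.not_edge (hN : 2 ≤ N) (hf : Nonlin f J) (hr : RightWell f J δ β X)
    (hl : RightWell (refl f) (Neg.neg ⁻¹' J) δ₂ β₂ X₂) (h : Family N f J U V)
    (hc : c ∈ Ico (0 : ℝ) 1) (hG : Good f X X₂ k (U c) (V c))
    (hbad : ∀ s ∈ Ioc c 1, ¬ Good f X X₂ k (U s) (V s)) : ¬ Edge f β (U c) (V c) := by
  intro hE
  have hN' : (2 : ℝ) ≤ N := by exact_mod_cast hN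
  have hcP : c ∈ Icc (0 : ℝ) 1 := Ico_subset_Icc_self hc
  have hT := h.traj c hcP
  have hβ0 := hr.β_pos
  have hsub := hr.sub hf
  have hβX := hr.lt
  obtain ⟨R, κ, hR1, hκ, hfree, hev⟩ := h.eventually_excursion hN hf hr hl hcP hG hE
  have hR0 : 0 < R := by linarith
  obtain ⟨d, hd, hexc⟩ := exists_right_of_eventually hc hev
  have hexc' : ∀ s ∈ Ioc c d, ∃ t₀ r₂, Excursion N f β X (U s) (V s) R κ t₀ r₂ := fun s hs =>
    hexc s hs (hbad s ⟨hs.1, hs.2.trans hd.2⟩)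
  have hP : ∀ s ∈ Ioc c d, s ∈ Icc (0 : ℝ) 1 := fun s hs =>
    ⟨hc.1.trans hs.1.le, hs.2.trans hd.2⟩
  -- `Y s` is the height at the first turning time. It is continuous, stays above `β` and comes
  -- arbitrarily close to `β`, so it takes all values slightly above `β`.
  let Y : ℝ → ℝ := fun s => U s (sInf (turning N β (U s) (V s) R))
  have hYcont : ContinuousOn Y (Ioc c d) := by
    intro s hs
    obtain ⟨t₀, r₂, hx⟩ := hexc' s hs
    exact (h.continuousWithinAt_turning hN hf hr (hP s hs) hR0 hκ hx).mono hP
  have hY : ∀ s ∈ Ioc c d, β < Y s ∧ Y s ≤ X := by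
    intro s hs
    obtain ⟨t₀, r₂, hx⟩ := hexc' s hs
    obtain ⟨g1, g2, -, g4, -⟩ := hx.turning_time hr (h.traj s (hP s hs)) hR0 hκ rfl
    exact ⟨g4, (hx.mem _ ⟨g1.le, g2.le⟩).2⟩
  have hnd : ∀ r, 0 ≤ r → ¬(U c r = 0 ∧ V c r = 0) := by
    intro r hr0 h0
    have := hE.energy_pos r hr0
    simp [energy, h0, F_zero] at this
  -- Near `c` the energy is below `F(y)` at a late time `R'`, and no turning takes place before
  -- `R'`. Hence the potential at the turning time is below `F(y)`.
  have hYsmall : ∀ y, β < y → y ≤ X → ∃ s ∈ Ioc c d, Y s < y := by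
    intro y hy hyX
    obtain ⟨R', hR', hER'⟩ := hE.energy_lim _ (hr.F_pos hf hy hyX)
    obtain ⟨d', hd', hprop⟩ := exists_right_of_eventually hc
      (((h.tendsto_energy hf hcP hR' fun r hr' => hnd r hr'.1).eventually_lt_const hER').and
        (h.eventually_turning_free hN hcP (T := R') hR0.le (fun r hr' => hnd r hr'.1)
          fun r hr' => hfree r hr'.1))
    set s := min d d' with hs
    have hsI : s ∈ Ioc c d := ⟨lt_min hd.1 hd'.1, min_le_left _ _⟩
    obtain ⟨g1, g2⟩ := hprop s ⟨lt_min hd.1 hd'.1, min_le_right _ _⟩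
    refine ⟨s, hsI, ?_⟩
    obtain ⟨t₀, r₂, hx⟩ := hexc' s hsI
    obtain ⟨e1, e2, e3, e4, -⟩ := hx.turning_time hr (h.traj s (hP s hsI)) hR0 hκ rfl
    set S := sInf (turning N β (U s) (V s) R) with hS
    have hRS : R' ≤ S := by
      by_contra! hcon
      rcases g2 S ⟨hx.le.trans e1.le, hcon.le⟩ with g | g
      · linarith
      · linarith
    have h1 : F f (U s S) < F f y := (F_le_energy (v := V s) S).trans_lt
      (((h.traj s (hP s hsI)).energy_le hN hf hR' hRS).trans_lt g1)
    by_contra! hcon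
    rcases hcon.lt_or_eq with h2 | h2
    · linarith [hr.F_lt hf hy.le h2 (hY s hsI).2]
    · rw [h2] at h1
      exact lt_irrefl _ h1
  have hβJ : β ∈ J := hsub ⟨hβ0.le, hβX.le⟩
  obtain ⟨K, z, hz, hK⟩ := hf.lip (x := β) ⟨hβJ, hβ0.ne'⟩
  have hz' : z ∈ 𝓝 β := by
    rwa [IsOpen.nhdsWithin_eq (hf.isOpen.sdiff isClosed_singleton) ⟨hβJ, hβ0.ne'⟩] at hz
  obtain ⟨ρ, hρ, hρz⟩ := exists_Icc_of_eventually hz'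
  have hlip : ∀ x ∈ Icc β (β + ρ), ∀ y ∈ Icc β (β + ρ),
      |f x - f y| ≤ max 1 (K : ℝ) * |x - y| := by
    intro x hx y hy
    have := hK.dist_le_mul _ (hρz x hx) _ (hρz y hy)
    rw [Real.dist_eq, Real.dist_eq] at this
    exact this.trans (mul_le_mul_of_nonneg_right (le_max_right _ _) (abs_nonneg _))
  have hdd : d ∈ Ioc c d := ⟨hd.1, le_rfl⟩
  have hcF : ContinuousAt (fun y => 48 * R * F f (β + y)) 0 := by
    refine ContinuousAt.mul continuousAt_const (ContinuousAt.comp (g := F f) ?_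
      (continuous_const.add continuous_id).continuousAt)
    simpa using hf.continuousAt_F hβJ
  have c1 : ∀ᶠ y in 𝓝 (0 : ℝ), β + y < Y d :=
    (show ContinuousAt (fun y => β + y) 0 by fun_prop).tendsto.eventually_lt_const (by linarith [(hY d hdd).1])
  have c2 : ∀ᶠ y in 𝓝 (0 : ℝ), y < 1 :=
    gt_mem_nhds one_pos
  have c3 : ∀ᶠ y in 𝓝 (0 : ℝ), 8 ^ (N - 1) * y < ρ :=
    (show ContinuousAt (fun y : ℝ => 8 ^ (N - 1) * y) 0 by fun_prop).tendsto.eventually_lt_const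
      (by simpa using hρ)
  have c4 : ∀ᶠ y in 𝓝 (0 : ℝ), 3 * ((N : ℝ) - 1) ^ 2 * y < κ :=
    (show ContinuousAt (fun y : ℝ => 3 * ((N : ℝ) - 1) ^ 2 * y) 0 by
      fun_prop).tendsto.eventually_lt_const (by simpa using hκ)
  have c5 : ∀ᶠ y in 𝓝 (0 : ℝ), 48 * R * F f (β + y) < κ :=
    hcF.tendsto.eventually_lt_const (by simpa [hr.F_eq] using hκ)
  obtain ⟨y₁, hy₁, hprop⟩ := exists_Icc_of_eventually (c1.and (c2.and (c3.and (c4.and c5))))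
  rw [zero_add] at hprop
  set C := 24 * max 1 (K : ℝ) * (8 ^ N * N) * (6 / κ) with hC
  have hkey : ∀ y ∈ Ioc 0 y₁, f (β + y) ≤ C * F f (β + y) := by
    intro y hy
    obtain ⟨p1, p2, p3, p4, p5⟩ := hprop y (Ioc_subset_Icc_self hy)
    obtain ⟨s', hs', hYs'⟩ := hYsmall (β + y) (by linarith [hy.1]) (by linarith [(hY d hdd).2])
    obtain ⟨s, hs, hYs⟩ := intermediate_value_Icc hs'.2
      (hYcont.mono fun x hx => ⟨hs'.1.trans_le hx.1, hx.2⟩)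
      (⟨hYs'.le, p1.le⟩ : β + y ∈ Icc (Y s') (Y d))
    have hsI : s ∈ Ioc c d := ⟨hs'.1.trans_le hs.1, hs.2⟩
    obtain ⟨t₀, r₂, hx⟩ := hexc' s hsI
    exact hx.f_le hN hf hr (h.traj s (hP s hsI)) hR1 hκ hYs (le_max_left _ _) p3.le p2.le p4.le
      p5.le hlip
  have hy₁X : β + y₁ ≤ X := by
    have := (hprop y₁ ⟨hy₁.le, le_rfl⟩).1
    linarith [(hY d hdd).2]
  have hJ : ∀ x ∈ Icc 0 y₁, β + x ∈ J := fun x hx =>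
    hsub ⟨by linarith [hx.1], by linarith [hx.2]⟩
  -- The differential inequality `F' ≤ C F` with `F(β) = 0` gives `F ≤ 0` beyond `β`, where in fact
  -- `F > 0`.
  have := nonpos_of_gronwall (G := fun x => F f (β + x)) (G' := fun x => f (β + x)) (C := C)
    hy₁.le (fun x hx => (ContinuousAt.comp (hf.continuousAt_F (hJ x hx))
      (by fun_prop)).continuousWithinAt)
    (fun x hx => by
      exact ((hf.hasDerivAt_F (hJ x (Ioo_subset_Icc_self hx))).comp x
        ((hasDerivAt_id x).const_add β)).congr_deriv (by simp))
    (fun x hx => hkey x (Ioo_subset_Ioc_self hx)) (by simp [hr.F_eq])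
  linarith [hr.F_pos hf (by linarith : β < β + y₁) hy₁X]

/-- A family leading from a good trajectory to one that is not good contains a solution with
exactly `k` sign changes. -/
lemma Family.exists_nodal (hN : 2 ≤ N) (hf : Nonlin f J) (hr : RightWell f J δ β X)
    (hl : RightWell (refl f) (Neg.neg ⁻¹' J) δ₂ β₂ X₂) (h : Family N f J U V)
    (h0 : Good f X X₂ k (U 0) (V 0)) (h1 : ¬ Good f X X₂ k (U 1) (V 1)) :
    ∃ c ∈ Icc (0 : ℝ) 1, SignChangesExactly (U c) k ∧ Tendsto (U c) atTop (𝓝 0) := by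
  set A := {s | s ∈ Icc (0 : ℝ) 1 ∧ Good f X X₂ k (U s) (V s)} with hA
  have hA0 : (0 : ℝ) ∈ A := ⟨⟨le_rfl, zero_le_one⟩, h0⟩
  have hAb : BddAbove A := ⟨1, fun s hs => hs.1.2⟩
  -- The last good parameter is taken, so that all parameters beyond it are bad, as the exclusion of
  -- the edge requires.
  set c := sSup A with hcdef
  have hcP : c ∈ Icc (0 : ℝ) 1 := ⟨le_csSup hAb hA0, csSup_le ⟨0, hA0⟩ fun s hs => hs.1.2⟩
  have hG : Good f X X₂ k (U c) (V c) := by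
    refine h.good_of_frequently hN hf hr hl hcP ?_
    have hcl : c ∈ closure A := csSup_mem_closure ⟨0, hA0⟩ hAb
    rw [mem_closure_iff_frequently] at hcl
    rw [nhdsWithin, frequently_inf_principal]
    exact hcl.mono fun s hs => hs
  have hc1 : c < 1 := lt_of_le_of_ne hcP.2 fun h2 => h1 (h2 ▸ hG)
  have hbad : ∀ s ∈ Ioc c 1, ¬ Good f X X₂ k (U s) (V s) := fun s hs hg =>
    absurd (le_csSup hAb (⟨⟨hcP.1.trans hs.1.le, hs.2⟩, hg⟩ : s ∈ A)) (by linarith [hs.1])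
  have hcI : c ∈ Ico (0 : ℝ) 1 := ⟨hcP.1, hc1⟩
  have hnot : ¬ ∀ᶠ s in 𝓝[Icc 0 1] c, Good f X X₂ k (U s) (V s) := by
    intro hev
    obtain ⟨d, hd, hprop⟩ := exists_right_of_eventually hcI hev
    exact hbad d hd (hprop d ⟨hd.1, le_rfl⟩)
  have hf2 : refl (refl f) = f := refl_refl f
  have hJ2 : Neg.neg ⁻¹' (Neg.neg ⁻¹' J) = J := by ext x; simp
  rcases h.boundary hN hf hr hl hcP hG hnot with h2 | h2 | h2
  · exact ⟨c, hcP, h2⟩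
  · exact absurd h2 (h.not_edge hN hf hr hl hcI hG hbad)
  · exact absurd h2 (h.neg.not_edge (X₂ := X) hN hf.refl hl (by rwa [hf2, hJ2]) hcI
      (good_neg.2 hG) fun s hs => by rw [good_neg]; exact hbad s hs)

end

end BoundState

namespace BoundState

/-! ### The special points -/

/-- The open interval `(γm, γs)`. -/
def Jset (γm γs : EReal) : Set ℝ := {s : ℝ | γm < (s : EReal) ∧ (s : EReal) < γs}

/-- The common part of the two sets of assumptions. -/
structure Setting (f : ℝ → ℝ) (γm γs : EReal) (δ : ℝ) : Prop where
  nonlin : Nonlin f (Jset γm γs)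
  confining : Confining f (Jset γm γs)
  delta_pos : 0 < δ
  F_neg : ∀ s ∈ Jset γm γs, 0 < |s| → |s| < δ → F f s < 0
  exists_max : ∃ γ : ℝ, δ < γ ∧ (γ : EReal) < γs ∧ IsLocalMax (F f) γ ∧ 0 < F f γ
  zeros_finite : (farZeros f γm γs δ).Finite
  zeros_sign : ∀ z ∈ farZeros f γm γs δ, ChangesSignAt f z

lemma isOpen_Jset (γm γs : EReal) : IsOpen (Jset γm γs) :=
  (isOpen_Ioo (a := γm) (b := γs)).preimage continuous_coe_real_ereal

lemma ordConnected_Jset (γm γs : EReal) : OrdConnected (Jset γm γs) :=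
  ⟨fun _ hx _ hy _ hz => ⟨hx.1.trans_le (EReal.coe_le_coe_iff.2 hz.1),
    (EReal.coe_le_coe_iff.2 hz.2).trans_lt hy.2⟩⟩

section
variable {f : ℝ → ℝ} {J : Set ℝ} {γm γs : EReal} {δ : ℝ}

/-- If `f` has only finitely many zeros to the right of `b`, then it has a constant sign on a right
neighbourhood of `b`. -/
lemma exists_sign_right (hf : Nonlin f J) {b q : ℝ} (hb : b ∈ J) (hbq : b < q) (hq : q ∈ J)
    (hfin : {z | b < z ∧ z < q ∧ f z = 0}.Finite) :
    ∃ x ∈ Ioo b q, (∀ s ∈ Ioc b x, 0 < f s) ∨ ∀ s ∈ Ioc b x, f s < 0 := by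
  have hsub : Icc b q ⊆ J := hf.conn.out hb hq
  obtain ⟨x, hx, hne⟩ : ∃ x ∈ Ioo b q, ∀ s ∈ Ioc b x, f s ≠ 0 := by
    have hev : ∀ᶠ x in 𝓝[>] b, x ∈ Ioo b q ∧ ∀ s ∈ Ioc b x, f s ≠ 0 := by
      have h1 : ∀ᶠ x in 𝓝[>] b, ∀ z ∈ {z | b < z ∧ z < q ∧ f z = 0}, x < z := by
        rw [eventually_all_finite hfin]
        intro z hz
        exact (gt_mem_nhds hz.1).filter_mono nhdsWithin_le_nhds
      filter_upwards [h1, Ioo_mem_nhdsGT hbq] with x h1 h2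
      refine ⟨h2, fun s hs h0 => ?_⟩
      have := h1 s ⟨hs.1, hs.2.trans_lt h2.2, h0⟩
      linarith [hs.2]
    exact hev.exists
  refine ⟨x, hx, ?_⟩
  have hc : ContinuousOn f (Ioc b x) := hf.cont.mono fun s hs =>
    hsub ⟨hs.1.le, hs.2.trans hx.2.le⟩
  have hxx : x ∈ Ioc b x := ⟨hx.1, le_rfl⟩
  have himg : OrdConnected (f '' Ioc b x) := (isPreconnected_Ioc.image f hc).ordConnected
  rcases (hne x hxx).lt_or_gt with h0 | h0
  · right
    intro s hs
    by_contra! hcon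
    obtain ⟨t, ht, ht0⟩ := himg.out (mem_image_of_mem f hxx) (mem_image_of_mem f hs) ⟨h0.le, hcon⟩
    exact hne t ht ht0
  · left
    intro s hs
    by_contra! hcon
    obtain ⟨t, ht, ht0⟩ := himg.out (mem_image_of_mem f hs) (mem_image_of_mem f hxx) ⟨hcon, h0.le⟩
    exact hne t ht ht0

/-- The edge `β` is the infimum of the positive points where `F > 0`. Finiteness of the zeros of `f`
gives `f` a fixed sign just beyond `β`, and this sign must be positive because points with `F > 0`
accumulate there. -/
lemma exists_rightWell (hf : Nonlin f J) (hδ : 0 < δ) (hneg : ∀ s ∈ Ioo 0 δ, s ∈ J → F f s < 0)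
    {q : ℝ} (hq : q ∈ J) (hq0 : 0 < q) (hFq : 0 < F f q)
    (hfin : {z | z ∈ J ∧ δ < z ∧ f z = 0}.Finite) :
    ∃ β X, RightWell f J δ β X ∧ X < q := by
  have hsub : Icc 0 q ⊆ J := hf.conn.out hf.zero_mem hq
  set S := {s | 0 < s ∧ s ≤ q ∧ 0 < F f s} with hS
  have hqS : q ∈ S := ⟨hq0, le_rfl, hFq⟩
  have hbdd : BddBelow S := ⟨0, fun s hs => hs.1.le⟩
  set β := sInf S with hβ
  have hδβ : δ ≤ β := by
    refine le_csInf ⟨q, hqS⟩ fun s hs => ?_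
    by_contra! hcon
    linarith [hneg s ⟨hs.1, hcon⟩ (hsub ⟨hs.1.le, hs.2.1⟩), hs.2.2]
  have hβq : β ≤ q := csInf_le hbdd hqS
  have hβ0 : 0 < β := hδ.trans_le hδβ
  have hβJ : β ∈ J := hsub ⟨hβ0.le, hβq⟩
  have hcβ := hf.continuousAt_F hβJ
  have hbelow : ∀ s, 0 ≤ s → s < β → F f s ≤ 0 := by
    intro s hs hsβ
    rcases hs.lt_or_eq with h1 | h1
    · by_contra! hcon
      exact absurd (csInf_le hbdd (⟨h1, hsβ.le.trans hβq, hcon⟩ : s ∈ S)) (by linarith)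
    · rw [← h1, F_zero]
  have hFβ : F f β = 0 := by
    refine le_antisymm ?_ ?_
    · refine le_of_tendsto (hcβ.tendsto.mono_left (nhdsWithin_le_nhds (s := Iio β))) ?_
      filter_upwards [Ioo_mem_nhdsLT hβ0] with x hx using hbelow x hx.1.le hx.2
    · have hcl : β ∈ closure S := csInf_mem_closure ⟨q, hqS⟩ hbdd
      rw [mem_closure_iff_frequently] at hcl
      by_contra! hcon
      obtain ⟨x, hx, hx'⟩ := (hcl.and_eventually (hcβ.eventually_lt_const hcon)).exists
      linarith [hx.2.2]
  have hβq' : β < q := lt_of_le_of_ne hβq fun h => by rw [← h, hFβ] at hFq; exact lt_irrefl _ hFq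
  obtain ⟨X, hX, hsign⟩ := exists_sign_right hf hβJ hβq' hq (hfin.subset fun z hz =>
    ⟨hsub ⟨by linarith [hz.1], hz.2.1.le⟩, by linarith [hz.1], hz.2.2⟩)
  have hXJ : X ∈ J := hsub ⟨by linarith [hX.1], hX.2.le⟩
  have hderiv : ∀ s ∈ Ioo β X, HasDerivAt (F f) (f s) s := fun s hs =>
    hf.hasDerivAt_F (hsub ⟨by linarith [hs.1], by linarith [hs.2, hX.2]⟩)
  have hcont : ∀ s, s ≤ X → ContinuousOn (F f) (Icc β s) := fun s hs =>
    hf.continuousOn_F.mono fun z hz => hsub ⟨by linarith [hz.1], by linarith [hz.2, hX.2]⟩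
  have hpos : ∀ s ∈ Ioc β X, 0 < f s := by
    rcases hsign with h | h
    · exact h
    · exfalso
      have hcl : β ∈ closure S := csInf_mem_closure ⟨q, hqS⟩ hbdd
      rw [mem_closure_iff_frequently] at hcl
      obtain ⟨x, hx, hxX⟩ := (hcl.and_eventually (gt_mem_nhds hX.1)).exists
      have hβx : β ≤ x := csInf_le hbdd hx
      have := le_of_deriv_nonpos hβx (hcont x hxX.le)
        (fun s hs => hderiv s ⟨hs.1, hs.2.trans hxX⟩)
        (fun s hs => (h s ⟨hs.1, hs.2.le.trans hxX.le⟩).le)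
      rw [hFβ] at this
      linarith [hx.2.2]
  refine ⟨β, X, ⟨hδ, hδβ, hX.1, hXJ, fun s hs => hneg s hs (hsub ⟨hs.1.le, by linarith [hs.2]⟩),
    fun s hs => ?_, hFβ, hpos, ?_⟩, hX.2⟩
  · rcases hs.2.lt_or_eq with h | h
    · exact hbelow s hs.1 h
    · rw [h, hFβ]
  · intro ℓ hℓ0 hℓβ
    rcases hδβ.lt_or_eq with h | h
    -- Otherwise `F` vanishes on an interval to the right of `δ`, which would consist of zeros of
    -- `f`.
    · by_contra! hcon
      have hzero : ∀ s ∈ Ioo (max ℓ δ) β, F f s = 0 := fun s hs =>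
        le_antisymm (hbelow s (hℓ0.trans ((le_max_left _ _).trans hs.1.le)) hs.2)
          (hcon s ⟨(le_max_left _ _).trans_lt hs.1, hs.2⟩)
      have hlt : max ℓ δ < β := max_lt hℓβ h
      refine (Ioo_infinite hlt) (hfin.subset fun s hs => ?_)
      have hsJ : s ∈ J := hsub ⟨hℓ0.trans ((le_max_left _ _).trans hs.1.le), by linarith [hs.2]⟩
      refine ⟨hsJ, (le_max_right _ _).trans_lt hs.1, ?_⟩
      have h1 : F f =ᶠ[𝓝 s] fun _ => 0 := by
        filter_upwards [Ioo_mem_nhds hs.1 hs.2] with x hx using hzero x hx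
      exact (hf.hasDerivAt_F hsJ).unique ((hasDerivAt_const s (0 : ℝ)).congr_of_eventuallyEq h1)
    · set s := max ℓ (δ / 2) with hs
      have h1 : s < β := max_lt hℓβ (by linarith)
      have h2 : 0 < s := lt_of_lt_of_le (by linarith) (le_max_right ℓ (δ / 2))
      exact ⟨(s + β) / 2, ⟨by linarith [le_max_left ℓ (δ / 2)], by linarith⟩,
        hneg _ ⟨by linarith, by linarith⟩ (hsub ⟨by linarith, by linarith⟩)⟩

lemma Setting.J_of_le (h : Setting f γm γs δ) {s t : ℝ} (hs : 0 ≤ s) (hst : s ≤ t)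
    (ht : (t : EReal) < γs) : s ∈ Jset γm γs :=
  ⟨h.nonlin.zero_mem.1.trans_le (EReal.coe_le_coe_iff.2 hs),
    (EReal.coe_le_coe_iff.2 hst).trans_lt ht⟩

lemma Setting.nonpos_delta (h : Setting f γm γs δ) {s : ℝ} (hs0 : 0 ≤ s) (hs : s ≤ δ) :
    F f s ≤ 0 := by
  obtain ⟨γ, hγ, hγs, -, -⟩ := h.exists_max
  rcases hs0.eq_or_lt with rfl | h0
  · rw [F_zero]
  · rcases hs.lt_or_eq with h1 | h1
    · exact (h.F_neg s (h.J_of_le hs0 (hs.trans hγ.le) hγs) (by rwa [abs_of_pos h0])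
        (by rwa [abs_of_pos h0])).le
    · have hc := h.nonlin.continuousAt_F (h.J_of_le hs0 (hs.trans hγ.le) hγs)
      refine le_of_tendsto (hc.tendsto.mono_left (nhdsWithin_le_nhds (s := Iio s))) ?_
      filter_upwards [Ioo_mem_nhdsLT h0] with x hx
      exact (h.F_neg x (h.J_of_le hx.1.le (by linarith [hx.2]) hγs) (by rw [abs_of_pos hx.1]; exact hx.1)
        (by rw [abs_of_pos hx.1, ← h1]; exact hx.2)).le

/-- Candidates for the next `γ_i` are zeros of `f` beyond `δ`, hence finite in number. This is why
the infimum defining `γ_(i+1)` is attained. -/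
lemma Setting.higherMax_sub (h : Setting f γm γs δ) {x : ℝ} (hx : 0 ≤ x) (hFx : 0 ≤ F f x) :
    higherMaxRight f γs x ⊆ farZeros f γm γs δ ∩ Ioi δ := by
  intro s hs
  have hs0 : 0 < s := hx.trans_lt hs.1
  have hδs : δ < s := by
    by_contra! hcon
    linarith [h.nonpos_delta hs0.le hcon, hs.2.2.2]
  exact ⟨⟨Or.inr ⟨hδs, hs.2.1⟩, hs.2.2.1.hasDerivAt_eq_zero
    (h.nonlin.hasDerivAt_F (h.J_of_le hs0.le le_rfl hs.2.1))⟩, hδs⟩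

lemma Setting.sInf_mem (h : Setting f γm γs δ) {x : ℝ} (hx : 0 ≤ x) (hFx : 0 ≤ F f x)
    (hne : (higherMaxRight f γs x).Nonempty) :
    sInf (higherMaxRight f γs x) ∈ higherMaxRight f γs x :=
  hne.csInf_mem ((h.zeros_finite.inter_of_left _).subset (h.higherMax_sub hx hFx))

/-- The first higher local maximum is a maximum to its left. -/
lemma Setting.gamma_succ (h : Setting f γm γs δ) {x : ℝ} (hx : 0 ≤ x) (hFx : 0 ≤ F f x)
    (hmax : ∀ s ∈ Icc 0 x, F f s ≤ F f x) (hne : (higherMaxRight f γs x).Nonempty) :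
    ∀ s ∈ Icc 0 (sInf (higherMaxRight f γs x)), F f s ≤ F f (sInf (higherMaxRight f γs x)) := by
  have hm := h.sInf_mem hx hFx hne
  set y := sInf (higherMaxRight f γs x) with hy
  have hy0 : 0 ≤ y := hx.trans hm.1.le
  obtain ⟨z, hz, hzmax⟩ := isCompact_Icc.exists_isMaxOn (nonempty_Icc.2 hy0)
    (h.nonlin.continuousOn_F.mono fun s hs => h.J_of_le hs.1 hs.2 hm.2.1)
  intro s hs
  refine (isMaxOn_iff.1 hzmax s hs).trans ?_
  by_contra! hcon
  have hxz : x < z := by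
    by_contra! h1
    linarith [hmax z ⟨hz.1, h1⟩, hm.2.2.2]
  have hzy : z < y := lt_of_le_of_ne hz.2 fun h1 => by rw [h1] at hcon; exact lt_irrefl _ hcon
  have hzm : z ∈ higherMaxRight f γs x := by
    refine ⟨hxz, (EReal.coe_le_coe_iff.2 hz.2).trans_lt hm.2.1, ?_, hm.2.2.2.trans hcon⟩
    filter_upwards [Ioo_mem_nhds (hx.trans_lt hxz) hzy] with t ht
    exact isMaxOn_iff.1 hzmax t (Ioo_subset_Icc_self ht)
  have : y ≤ z := csInf_le ⟨x, fun t ht => ht.1.le⟩ hzm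
  linarith

lemma Setting.higherMax_zero (h : Setting f γm γs δ) : (higherMaxRight f γs 0).Nonempty := by
  obtain ⟨γ, hγ, hγs, hm, hF⟩ := h.exists_max
  exact ⟨γ, h.delta_pos.trans hγ, hγs, hm, by rwa [F_zero]⟩

lemma Setting.gammaPos_props (h : Setting f γm γs δ) : ∀ i,
    (∀ j < i, (higherMaxRight f γs (gammaPos f γs j)).Nonempty) →
    0 ≤ gammaPos f γs i ∧ 0 ≤ F f (gammaPos f γs i) ∧
      ∀ s ∈ Icc 0 (gammaPos f γs i), F f s ≤ F f (gammaPos f γs i)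
  | 0, _ => ⟨le_rfl, by simp [gammaPos, F_zero], fun s hs => by
      have h1 : s ≤ 0 := hs.2
      have : s = 0 := le_antisymm h1 hs.1
      simp [gammaPos, this]⟩
  | i + 1, hi => by
    obtain ⟨h1, h2, h3⟩ := h.gammaPos_props i fun j hj => hi j (by omega)
    have hne := hi i (by omega)
    have hm := h.sInf_mem h1 h2 hne
    exact ⟨h1.trans hm.1.le, h2.trans hm.2.2.2.le, h.gamma_succ h1 h2 h3 hne⟩

/-- The recursion stops, since otherwise the strictly increasing `γ_i` would be infinitely many
zeros of `f`. Thus the index set in `lastPos` is nonempty and its infimum is not a default value. -/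
lemma Setting.lastPos_mem (h : Setting f γm γs δ) :
    higherMaxRight f γs (gammaM f γs) = ∅ := by
  have hne : {i : ℕ | higherMaxRight f γs (gammaPos f γs i) = ∅}.Nonempty := by
    by_contra hcon
    have hall : ∀ i, (higherMaxRight f γs (gammaPos f γs i)).Nonempty := by
      intro i
      rw [nonempty_iff_ne_empty]
      intro h0
      exact hcon ⟨i, h0⟩
    have hp := fun i => h.gammaPos_props i fun j _ => hall j
    have hmem := fun i => h.sInf_mem (hp i).1 (hp i).2.1 (hall i)
    have hmono : StrictMono fun i => gammaPos f γs (i + 1) :=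
      strictMono_nat_of_lt_succ fun i => (hmem (i + 1)).1
    refine (infinite_range_of_injective hmono.injective) (h.zeros_finite.subset ?_)
    rintro _ ⟨i, rfl⟩
    exact (h.higherMax_sub (hp i).1 (hp i).2.1 (hmem i)).1
  exact Nat.sInf_mem hne

lemma higherMaxRight_nonempty {j : ℕ} (hj : j < lastPos f γs) :
    (higherMaxRight f γs (gammaPos f γs j)).Nonempty := by
  rw [nonempty_iff_ne_empty]
  exact fun h0 => Nat.notMem_of_lt_sInf hj h0

lemma Setting.gammaM_props (h : Setting f γm γs δ) :
    gammaM f γs ∈ farZeros f γm γs δ ∧ δ < gammaM f γs ∧ IsLocalMax (F f) (gammaM f γs) ∧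
      0 < F f (gammaM f γs) ∧ gammaPos f γs 1 ≤ gammaM f γs ∧
      ∀ s ∈ Icc 0 (gammaM f γs), F f s ≤ F f (gammaM f γs) := by
  have hM : 0 < lastPos f γs := by
    by_contra! hcon
    have h0 : lastPos f γs = 0 := by omega
    have := h.lastPos_mem
    rw [gammaM, h0] at this
    exact h.higherMax_zero.ne_empty this
  obtain ⟨m, hm⟩ : ∃ m, lastPos f γs = m + 1 := ⟨lastPos f γs - 1, by omega⟩
  have hp := fun i (hi : i ≤ m + 1) => h.gammaPos_props i fun j hj => higherMaxRight_nonempty (by omega)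
  have hmem := fun i (hi : i ≤ m) =>
    h.sInf_mem (hp i (by omega)).1 (hp i (by omega)).2.1 (higherMaxRight_nonempty (by omega))
  have hmono : ∀ i, i ≤ m → gammaPos f γs 1 ≤ gammaPos f γs (i + 1) := by
    intro i
    induction i with
    | zero => exact fun _ => le_rfl
    | succ i ih => exact fun hi => (ih (by omega)).trans (hmem (i + 1) hi).1.le
  have h1 := hmem m le_rfl
  have h2 := h.higherMax_sub (hp m (by omega)).1 (hp m (by omega)).2.1 h1
  rw [gammaM, hm]
  exact ⟨h2.1, h2.2, h1.2.2.1, (hp m (by omega)).2.1.trans_lt h1.2.2.2, hmono m le_rfl,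
    (hp (m + 1) le_rfl).2.2⟩

/-- Beyond `γ_M` there is no local maximum above the level `F(γ_M)`, so once above this level `F`
cannot decrease again. -/
lemma Setting.F_le_of_gammaM_lt (h : Setting f γm γs δ) {a x s : ℝ} (ha : gammaM f γs ≤ a)
    (hFa : F f a ≤ F f (gammaM f γs)) (hax : a ≤ x) (hxs : x ≤ s) (hs : (s : EReal) < γs)
    (hx : F f (gammaM f γs) < F f x) : F f x ≤ F f s := by
  by_contra! hcon
  have ha0 : 0 ≤ a := (h.delta_pos.trans h.gammaM_props.2.1).le.trans ha
  obtain ⟨z, hz, hzmax⟩ := isCompact_Icc.exists_isMaxOn (nonempty_Icc.2 (hax.trans hxs))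
    (h.nonlin.continuousOn_F.mono fun t ht => h.J_of_le (ha0.trans ht.1) ht.2 hs)
  have hxz := isMaxOn_iff.1 hzmax x ⟨hax, hxs⟩
  have haz : a < z := lt_of_le_of_ne hz.1 fun h1 => by rw [← h1] at hxz; linarith
  have hzs : z < s := lt_of_le_of_ne hz.2 fun h1 => by rw [h1] at hxz; linarith
  have : z ∈ higherMaxRight f γs (gammaM f γs) := by
    refine ⟨ha.trans_lt haz, (EReal.coe_le_coe_iff.2 hz.2).trans_lt hs, ?_, hx.trans_le hxz⟩
    filter_upwards [Ioo_mem_nhds haz hzs] with t ht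
    exact isMaxOn_iff.1 hzmax t (Ioo_subset_Icc_self ht)
  rw [h.lastPos_mem] at this
  exact this

/-- The sign change upgrades a possibly non-strict local maximum to one with `F` strictly smaller on
the right, which separates `β_*` from `γ_M`. -/
lemma ChangesSignAt.right_neg_of_isLocalMax (hf : Nonlin f J) {z : ℝ} (hz : z ∈ J)
    (hs : ChangesSignAt f z) (hm : IsLocalMax (F f) z) :
    ∃ ε > 0, ∀ s ∈ Ioo z (z + ε), F f s < F f z := by
  obtain ⟨ε, hε, hs⟩ := hs
  obtain ⟨η, hη, hη'⟩ := Metric.eventually_nhds_iff.1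
    (hm.and (hf.isOpen.mem_nhds hz))
  set r := min ε η with hr
  have hr0 : 0 < r := lt_min hε hη
  have hJ : ∀ s, |s - z| < r → F f s ≤ F f z ∧ s ∈ J := fun s hs' =>
    hη' (hs'.trans_le (min_le_right _ _))
  have hneg : ∀ s ∈ Ioo z (z + r), f s < 0 := by
    intro s hs'
    by_contra! hcon
    have hpos : ∀ t ∈ Ioo (z - r) z, f t < 0 := by
      intro t ht
      have := hs t ⟨by linarith [ht.1, min_le_left ε η], ht.2⟩ s
        ⟨hs'.1, by linarith [hs'.2, min_le_left ε η]⟩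
      by_contra! h0
      nlinarith [mul_nonneg h0 hcon]
    have hanti : StrictAntiOn (F f) (Icc (z - r / 2) z) := by
      refine strictAntiOn_of_deriv_neg (convex_Icc _ _) (hf.continuousOn_F.mono fun t ht => ?_)
        fun t ht => ?_
      · exact (hJ t (by rw [abs_lt]; constructor <;> linarith [ht.1, ht.2])).2
      · rw [interior_Icc] at ht
        rw [(hf.hasDerivAt_F (hJ t (by rw [abs_lt]; constructor <;> linarith [ht.1, ht.2])).2).deriv]
        exact hpos t ⟨by linarith [ht.1], ht.2⟩
    have := hanti (left_mem_Icc.2 (by linarith)) (right_mem_Icc.2 (by linarith))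
      (by linarith : z - r / 2 < z)
    linarith [(hJ (z - r / 2) (by rw [abs_lt]; constructor <;> linarith)).1]
  refine ⟨r, hr0, fun s hs' => ?_⟩
  have hanti : StrictAntiOn (F f) (Icc z s) := by
    refine strictAntiOn_of_deriv_neg (convex_Icc _ _) (hf.continuousOn_F.mono fun t ht => ?_)
      fun t ht => ?_
    · exact (hJ t (by rw [abs_lt]; constructor <;> linarith [ht.1, ht.2, hs'.2])).2
    · rw [interior_Icc] at ht
      rw [(hf.hasDerivAt_F (hJ t (by
        rw [abs_lt]; constructor <;> linarith [ht.1, ht.2, hs'.2])).2).deriv]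
      exact hneg t ⟨ht.1, ht.2.trans hs'.2⟩
  exact hanti (left_mem_Icc.2 hs'.1.le) (right_mem_Icc.2 hs'.1.le) hs'.1

/-- `F` dips below `F(γ_M)` right after `γ_M` and, by confinement, exceeds it farther out without
coming back. So the level is attained a last time, and from there on `F` is nondecreasing. -/
lemma Setting.betaStar_props (h : Setting f γm γs δ) :
    gammaM f γs < betaStar f γs ∧ (betaStar f γs : EReal) < γs ∧
      F f (betaStar f γs) = F f (gammaM f γs) ∧
      (∀ s ∈ Icc 0 (betaStar f γs), F f s ≤ F f (gammaM f γs)) ∧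
      ∀ s, betaStar f γs ≤ s → (s : EReal) < γs → 0 < f s := by
  obtain ⟨hz, hδM, hloc, hFM, -, hmaxM⟩ := h.gammaM_props
  set m := gammaM f γs with hm
  have hm0 : 0 < m := h.delta_pos.trans hδM
  have hms : (m : EReal) < γs := by
    rcases hz.1 with h1 | h1
    · linarith [h1.2, h.delta_pos]
    · exact h1.2
  have hmJ := h.J_of_le hm0.le le_rfl hms
  obtain ⟨ε, hε, hlow⟩ := (h.zeros_sign m hz).right_neg_of_isLocalMax h.nonlin hmJ hloc
  obtain ⟨-, -, q, hq, -, -, hmq, -, -, hFq⟩ := h.confining m hmJ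
  set B := {s : ℝ | m < s ∧ (s : EReal) < γs ∧ F f s = F f m} with hB
  have hBq : ∀ s ∈ B, s ≤ q := by
    intro s hs
    by_contra! hcon
    have := h.F_le_of_gammaM_lt le_rfl le_rfl hmq.le hcon.le hs.2.1 hFq
    rw [hs.2.2] at this; linarith
  have hBl : ∀ s ∈ B, m + ε ≤ s := by
    intro s hs
    by_contra! hcon
    linarith [hlow s ⟨hs.1, hcon⟩, hs.2.2]
  have hbdd : BddAbove B := ⟨q, hBq⟩
  have hivt : ∀ x, m < x → x < q → F f x < F f m → ∃ s ∈ Ioo x q, s ∈ B := by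
    intro x hx hxq hFx
    obtain ⟨s, hs, hFs⟩ := intermediate_value_Ioo hxq.le (h.nonlin.continuousOn_F.mono fun t ht =>
      h.J_of_le (hm0.le.trans (hx.le.trans ht.1)) ht.2 hq.2) ⟨hFx, hFq⟩
    exact ⟨s, hs, hx.trans hs.1, (EReal.coe_lt_coe_iff.2 hs.2).trans hq.2, hFs⟩
  have hne : B.Nonempty := by
    set x := min (m + ε / 2) ((m + q) / 2) with hx
    have h1 : m < x := lt_min (by linarith) (by linarith)
    have h2 := min_le_left (m + ε / 2) ((m + q) / 2)
    have h3 := min_le_right (m + ε / 2) ((m + q) / 2)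
    obtain ⟨s, -, hs⟩ := hivt x h1 (by linarith) (hlow x ⟨h1, by linarith⟩)
    exact ⟨s, hs⟩
  have hbdef : betaStar f γs = sSup B := rfl
  set b := sSup B with hb
  rw [hbdef]
  have hmb : m < b := by
    obtain ⟨s, hs⟩ := hne
    linarith [hBl s hs, le_csSup hbdd hs]
  have hbq : b ≤ q := csSup_le hne hBq
  have hbs : (b : EReal) < γs := (EReal.coe_le_coe_iff.2 hbq).trans_lt hq.2
  have hbJ := h.J_of_le (hm0.le.trans hmb.le) le_rfl hbs
  have hFb : F f b = F f m := by
    have hcl : b ∈ closure B := csSup_mem_closure hne hbdd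
    by_contra hcon
    rw [mem_closure_iff_frequently] at hcl
    obtain ⟨x, hx, hx'⟩ := (hcl.and_eventually
      ((h.nonlin.continuousAt_F hbJ).eventually_ne hcon)).exists
    exact hx' hx.2.2
  have hbq' : b < q := lt_of_le_of_ne hbq fun h1 => by rw [← h1] at hFq; linarith
  have hle : ∀ s ∈ Icc 0 b, F f s ≤ F f m := by
    intro s hs
    rcases le_total s m with h1 | h1
    · exact hmaxM s ⟨hs.1, h1⟩
    · by_contra! hcon
      have := h.F_le_of_gammaM_lt le_rfl le_rfl h1 hs.2 hbs hcon
      linarith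
  have hgt : ∀ s : ℝ, b < s → (s : EReal) < γs → F f m < F f s := by
    intro s hbs' hs
    by_contra! hcon
    rcases hcon.lt_or_eq with h1 | h1
    · rcases lt_or_ge s q with h2 | h2
      · obtain ⟨t, ht, htB⟩ := hivt s (hmb.trans hbs') h2 h1
        linarith [le_csSup hbdd htB, ht.1]
      · have := h.F_le_of_gammaM_lt le_rfl le_rfl hmq.le h2 hs hFq
        linarith
    · linarith [le_csSup hbdd (⟨hmb.trans hbs', hs, h1⟩ : s ∈ B)]
  have hmono : ∀ x s : ℝ, b ≤ x → x ≤ s → (s : EReal) < γs → F f x ≤ F f s := by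
    intro x s hbx hxs hs
    rcases hbx.eq_or_lt with rfl | h1
    · rcases hxs.eq_or_lt with rfl | h2
      · exact le_rfl
      · rw [hFb]; exact (hgt s h2 hs).le
    · exact h.F_le_of_gammaM_lt hmb.le hFb.le h1.le hxs hs
        (hgt x h1 ((EReal.coe_le_coe_iff.2 hxs).trans_lt hs))
  have hopen : ∀ s : ℝ, (s : EReal) < γs → ∀ᶠ x in 𝓝 s, ((x : ℝ) : EReal) < γs := fun s hs =>
    (isOpen_Iio.preimage continuous_coe_real_ereal).mem_nhds hs
  have hnonneg : ∀ s : ℝ, b ≤ s → (s : EReal) < γs → 0 ≤ f s := by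
    intro s hbs' hs
    have hd := h.nonlin.hasDerivAt_F (h.J_of_le (hm0.le.trans (hmb.le.trans hbs')) le_rfl hs)
    refine ge_of_tendsto ((hasDerivAt_iff_tendsto_slope.1 hd).mono_left (nhdsGT_le_nhdsNE s)) ?_
    filter_upwards [self_mem_nhdsWithin, (hopen s hs).filter_mono nhdsWithin_le_nhds] with x hx hxs
    rw [slope_def_field]
    exact div_nonneg (by linarith [hmono s x hbs' (le_of_lt hx) hxs]) (by linarith [mem_Ioi.1 hx])
  -- A zero of `f` at or beyond `β_*` would be a sign change. As `f ≥ 0` to its right, `f < 0` to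
  -- its left, so `F` would come down to it from a level above `F(γ_M)`, which is impossible.
  refine ⟨hmb, hbs, hFb, hle, fun s hbs' hs => lt_of_le_of_ne (hnonneg s hbs' hs) fun h0 => ?_⟩
  have hδs : δ < s := hδM.trans (hmb.trans_le hbs')
  obtain ⟨η, hη, hsign⟩ := h.zeros_sign s ⟨Or.inr ⟨hδs, hs⟩, h0.symm⟩
  obtain ⟨x, hx, hxs⟩ : ∃ x ∈ Ioo s (s + η), ((x : ℝ) : EReal) < γs :=
    ((Filter.Eventually.and (Ioo_mem_nhdsGT (by linarith : s < s + η))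
      ((hopen s hs).filter_mono nhdsWithin_le_nhds))).exists
  have hfx : 0 ≤ f x := hnonneg x (hbs'.trans hx.1.le) hxs
  have hleft : ∀ t ∈ Ioo (s - η) s, f t < 0 := by
    intro t ht
    have := hsign t ht x hx
    by_contra! hcon
    nlinarith [mul_nonneg hcon hfx]
  set t := max (s - η / 2) ((m + s) / 2) with ht
  have hts : t < s := max_lt (by linarith) (by linarith)
  have ht1 := le_max_left (s - η / 2) ((m + s) / 2)
  have ht2 := le_max_right (s - η / 2) ((m + s) / 2)
  have hFts : F f s < F f t := by
    have hanti : StrictAntiOn (F f) (Icc t s) := by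
      refine strictAntiOn_of_deriv_neg (convex_Icc _ _) (h.nonlin.continuousOn_F.mono fun y hy =>
        h.J_of_le (by linarith [hy.1]) hy.2 hs) fun y hy => ?_
      rw [interior_Icc] at hy
      rw [(h.nonlin.hasDerivAt_F (h.J_of_le (by linarith [hy.1]) hy.2.le hs)).deriv]
      exact hleft y ⟨by linarith [hy.1], hy.2⟩
    exact hanti (left_mem_Icc.2 hts.le) (right_mem_Icc.2 hts.le) hts
  have hFms : F f m ≤ F f s := by
    rcases hbs'.eq_or_lt with h1 | h1
    · rw [← h1, hFb]
    · exact (hgt s h1 hs).le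
  have := h.F_le_of_gammaM_lt (a := m) le_rfl le_rfl (by linarith) hts.le hs (by linarith)
  linarith

/-- `β_1` is the right end of a well of `F`. -/
lemma Setting.exists_rightWell_beta1 (h : Setting f γm γs δ) :
    ∃ X, RightWell f (Jset γm γs) δ (beta1 f γs) X ∧ X < gammaPos f γs 1 ∧
      gammaPos f γs 1 ≤ gammaM f γs := by
  have h1 : gammaPos f γs 1 ∈ higherMaxRight f γs 0 :=
    h.sInf_mem le_rfl (by rw [F_zero]) h.higherMax_zero
  set g := gammaPos f γs 1 with hg
  have hg0 : 0 < g := h1.1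
  have hgJ := h.J_of_le hg0.le le_rfl h1.2.1
  have hFg : 0 < F f g := by have := h1.2.2.2; rwa [F_zero] at this
  obtain ⟨β, X, hw, hXg⟩ := exists_rightWell h.nonlin h.delta_pos
    (fun s hs hsJ => h.F_neg s hsJ (by rw [abs_of_pos hs.1]; exact hs.1)
      (by rw [abs_of_pos hs.1]; exact hs.2)) hgJ hg0 hFg
    (h.zeros_finite.subset fun z hz => ⟨Or.inr ⟨hz.2.1, hz.1.2⟩, hz.2.2⟩)
  have hβ : beta1 f γs = β := by
    have hset : beta1 f γs = sSup {s : ℝ | s ∈ Ioo 0 g ∧ F f s = 0} := by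
      simp only [beta1, gammaPos, F_zero, hg]
    rw [hset]
    have hβm : β ∈ {s : ℝ | s ∈ Ioo 0 g ∧ F f s = 0} :=
      ⟨⟨hw.β_pos, hw.lt.trans hXg⟩, hw.F_eq⟩
    refine (IsGreatest.csSup_eq ⟨hβm, fun s hs => ?_⟩)
    by_contra! hcon
    -- the maximum over `[0, s]` would be a local maximum before the first one
    set x := min X ((β + s) / 2) with hx
    have hβx : β < x := lt_min hw.lt (by linarith)
    have hxs : x < s := (min_le_right _ _).trans_lt (by linarith)
    have hFx := hw.F_pos h.nonlin hβx (min_le_left _ _)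
    have hs0 : 0 ≤ s := hs.1.1.le
    obtain ⟨z, hz, hzmax⟩ := isCompact_Icc.exists_isMaxOn (nonempty_Icc.2 hs0)
      (h.nonlin.continuousOn_F.mono fun t ht => h.J_of_le ht.1 (ht.2.trans hs.1.2.le) h1.2.1)
    have hxz := isMaxOn_iff.1 hzmax x ⟨by linarith [hw.β_pos], hxs.le⟩
    have hz0 : 0 < z := lt_of_le_of_ne hz.1 fun h2 => by
      rw [← h2, F_zero] at hxz; linarith
    have hzs : z < s := lt_of_le_of_ne hz.2 fun h2 => by
      rw [h2, hs.2] at hxz; linarith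
    have hzm : z ∈ higherMaxRight f γs 0 := by
      refine ⟨hz0, (EReal.coe_le_coe_iff.2 (hz.2.trans hs.1.2.le)).trans_lt h1.2.1, ?_, by
        rw [F_zero]; linarith⟩
      filter_upwards [Ioo_mem_nhds hz0 hzs] with t ht
      exact isMaxOn_iff.1 hzmax t (Ioo_subset_Icc_self ht)
    have : g ≤ z := csInf_le ⟨0, fun t ht => ht.1.le⟩ hzm
    linarith [hs.1.2]
  rw [hβ]
  exact ⟨X, hw, hXg, h.gammaM_props.2.2.2.2.1⟩

lemma Setting.exists_leftWell (h : Setting f γm γs δ) :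
    ∃ β₂ X₂, RightWell (refl f) (Neg.neg ⁻¹' Jset γm γs) δ β₂ X₂ := by
  obtain ⟨p, hp, -, -, -, hp0, -, -, hFp, -⟩ := h.confining 0 h.nonlin.zero_mem
  rw [F_zero] at hFp
  obtain ⟨β₂, X₂, hw, -⟩ := exists_rightWell (q := -p) h.nonlin.refl h.delta_pos
    (fun s hs hsJ => by
      rw [F_refl]
      exact h.F_neg (-s) hsJ (by rw [abs_neg, abs_of_pos hs.1]; exact hs.1)
        (by rw [abs_neg, abs_of_pos hs.1]; exact hs.2)) (by simpa using hp) (by linarith)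
    (by rw [F_refl, neg_neg]; exact hFp)
    ((h.zeros_finite.preimage neg_injective.injOn).subset fun z hz => by
      refine ⟨Or.inl ⟨hz.1.1, ?_⟩, ?_⟩
      · linarith [hz.2.1]
      · have := hz.2.2
        simp only [BoundState.refl] at this
        linarith)
  exact ⟨β₂, X₂, hw⟩

end

end BoundState

namespace BoundState

/-! ### The assumptions as instances of the common setting -/

section
variable {N : ℕ} {f : ℝ → ℝ} {J : Set ℝ} {γm γs : EReal} {δ : ℝ} {u v : ℝ → ℝ}

lemma Jset_subset_dom : Jset γm γs ⊆ dom γm γs := fun _ hs => ⟨hs.1, hs.2.le⟩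

lemma nonlin_of_dom (h0 : γm < 0) (h1 : 0 < γs) (hc : ContinuousOn f (dom γm γs)) (hz : f 0 = 0)
    (hl : LocallyLipschitzOn (dom γm γs \ {0}) f) : Nonlin f (Jset γm γs) where
  isOpen := isOpen_Jset γm γs
  conn := ordConnected_Jset γm γs
  zero_mem := ⟨h0, h1⟩
  cont := hc.mono Jset_subset_dom
  zero := hz
  lip := hl.mono (sdiff_subset_sdiff_left Jset_subset_dom)

lemma exists_left_of_eventually {P : ℝ → Prop} (hP : ∀ᶠ p in toLeftEnd γm, P p) {x : ℝ}
    (hx : γm < (x : EReal)) : ∃ p : ℝ, γm < (p : EReal) ∧ p < x ∧ P p := by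
  obtain ⟨t, ht, htP⟩ := mem_comap.1 hP
  obtain ⟨y, hy, hyt⟩ := (mem_nhdsGT_iff_exists_Ioo_subset' hx).1 ht
  obtain ⟨p, hp1, hp2⟩ := EReal.lt_iff_exists_real_btwn.1 (lt_min hx hy)
  exact ⟨p, hp1, EReal.coe_lt_coe_iff.1 (hp2.trans_le (min_le_left _ _)),
    htP (hyt ⟨hp1, hp2.trans_le (min_le_right _ _)⟩)⟩

/-- The endpoint `γ_*` lies outside the open interval on which `Nonlin` speaks, so continuity of `F`
up to it is obtained separately. -/
lemma AssumptionA1.continuousOn_F {γs : ℝ} (h : AssumptionA1 f γm γs δ) :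
    ContinuousOn (F f) (Icc 0 γs) := by
  rw [← uIcc_of_le h.right_pos.le]
  refine intervalIntegral.continuousOn_primitive_interval
    (ContinuousOn.integrableOn_compact isCompact_uIcc (h.cont.mono fun s hs => ?_))
  rw [uIcc_of_le h.right_pos.le] at hs
  exact ⟨h.left_neg.trans_le (EReal.coe_le_coe_iff.2 hs.1), EReal.coe_le_coe_iff.2 hs.2⟩

lemma AssumptionA1.tendsto_F {γs : ℝ} (h : AssumptionA1 f γm γs δ) :
    Tendsto (F f) (𝓝[<] γs) (𝓝 (F f γs)) :=
  ((h.continuousOn_F γs ⟨h.right_pos.le, le_rfl⟩).mono_left (by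
    rw [← nhdsWithin_Ioo_eq_nhdsLT h.right_pos]
    exact nhdsWithin_mono _ Ioo_subset_Icc_self))

/-- Confinement holds because `F` approaches at both ends a value that it does not attain inside, so
every energy level is exceeded on either side. -/
lemma AssumptionA1.setting {γs : ℝ} (h : AssumptionA1 f γm γs δ) : Setting f γm γs δ where
  nonlin := nonlin_of_dom h.left_neg (EReal.coe_lt_coe_iff.2 h.right_pos) h.cont h.zero_zero h.lip
  confining x hx := by
    have hxs : x < γs := EReal.coe_lt_coe_iff.1 hx.2
    have hlt := h.F_lt x hx.1 hxs
    have hm : γm < ((min x 0 : ℝ) : EReal) := by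
      rcases min_choice x 0 with h1 | h1 <;> rw [h1]
      · exact hx.1
      · exact h.left_neg
    obtain ⟨p, hp, hpx, hFp⟩ :=
      exists_left_of_eventually (h.F_lim.eventually (lt_mem_nhds hlt)) hm
    have hpx' := hpx.trans_le (min_le_left x 0)
    have hp0 := hpx.trans_le (min_le_right x 0)
    obtain ⟨q, hFq, hq⟩ := ((h.tendsto_F.eventually (lt_mem_nhds hlt)).and
      (Ioo_mem_nhdsLT (max_lt hxs h.right_pos))).exists
    have hq1 := (le_max_left x 0).trans_lt hq.1
    exact ⟨p, ⟨hp, EReal.coe_lt_coe_iff.2 (hpx'.trans hxs)⟩, q,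
      ⟨hx.1.trans (EReal.coe_lt_coe_iff.2 hq1), EReal.coe_lt_coe_iff.2 hq.2⟩,
      hpx', hp0, hq1, (le_max_right x 0).trans_lt hq.1, hFp, hFq⟩
  delta_pos := h.delta_pos
  F_neg s hs := h.F_neg s (Jset_subset_dom hs)
  exists_max := by
    obtain ⟨γ, h1, h2, h3⟩ := h.exists_max
    exact ⟨γ, h1, EReal.coe_lt_coe_iff.2 h2, h3⟩
  zeros_finite := h.zeros_finite
  zeros_sign := h.zeros_sign

lemma AssumptionA2.setting {s₀ : ℝ} (h : AssumptionA2 N f γm δ s₀) : Setting f γm ⊤ δ where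
  nonlin := nonlin_of_dom h.left_neg EReal.zero_lt_top h.cont h.zero_zero h.lip
  confining x hx := by
    obtain ⟨L, hL1, hL2, hL⟩ := h.F_lim
    have hlt := hL x (Jset_subset_dom hx)
    have hm : γm < ((min x 0 : ℝ) : EReal) := by
      rcases min_choice x 0 with h1 | h1 <;> rw [h1]
      · exact hx.1
      · exact h.left_neg
    obtain ⟨p, hp, hpx, hFp⟩ := exists_left_of_eventually (hL2.eventually (lt_mem_nhds hlt)) hm
    obtain ⟨q, hFq, hq⟩ := ((hL1.eventually (lt_mem_nhds hlt)).and
      (eventually_gt_atTop (max x 0))).exists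
    have hq1 := (le_max_left x 0).trans_lt hq
    exact ⟨p, ⟨hp, EReal.coe_lt_top p⟩, q,
      ⟨hx.1.trans (EReal.coe_lt_coe_iff.2 hq1), EReal.coe_lt_top q⟩,
      hpx.trans_le (min_le_left x 0), hpx.trans_le (min_le_right x 0), hq1,
      (le_max_right x 0).trans_lt hq, EReal.coe_lt_coe_iff.1 hFp, EReal.coe_lt_coe_iff.1 hFq⟩
  delta_pos := h.delta_pos
  F_neg s hs := h.F_neg s (Jset_subset_dom hs)
  exists_max := by
    obtain ⟨γ, h1, h3⟩ := h.exists_max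
    exact ⟨γ, h1, EReal.coe_lt_top γ, h3⟩
  zeros_finite := h.zeros_finite
  zeros_sign := h.zeros_sign

/-! ### Trajectories as solutions of the boundary value problem -/

/-- L'Hôpital for `r^(N-1) v / r^N`. The limit is the value of `u''` at the origin and removes the
apparent singularity there. -/
lemma Traj.tendsto_div (hN : 2 ≤ N) (hf : Nonlin f J) (h : Traj N f J u v) :
    Tendsto (fun r => v r / r) (𝓝[>] 0) (𝓝 (-(f (u 0) / N))) := by
  have hN0 : (N : ℝ) ≠ 0 := by positivity
  have hfu : ContinuousAt (fun r => f (u r)) 0 :=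
    ContinuousAt.comp (hf.cont.continuousAt (hf.isOpen.mem_nhds (h.mem 0 le_rfl)))
      h.contu.continuousAt
  have hN1 : N - 1 ≠ 0 := by omega
  have key : Tendsto (fun r => (r ^ (N - 1) * v r) / r ^ N) (𝓝[>] 0) (𝓝 (-(f (u 0) / N))) := by
    refine HasDerivAt.lhopital_zero_nhdsGT (f' := fun r => -(r ^ (N - 1) * f (u r)))
      (g' := fun r => (N : ℝ) * r ^ (N - 1)) ?_ ?_ ?_ ?_ ?_ ?_
    · filter_upwards [self_mem_nhdsWithin] with r hr using h.hasDerivAt_pow_mul hN hr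
    · filter_upwards [self_mem_nhdsWithin] with r hr using hasDerivAt_pow N r
    · filter_upwards [self_mem_nhdsWithin] with r hr
      have : 0 < r := hr
      positivity
    · have hc : Continuous fun r => r ^ (N - 1) * v r := (continuous_pow _).mul h.contv
      have := hc.tendsto 0
      rw [zero_pow hN1, zero_mul] at this
      exact this.mono_left nhdsWithin_le_nhds
    · have := (continuous_pow (M := ℝ) N).tendsto 0
      rw [zero_pow (by omega)] at this
      exact this.mono_left nhdsWithin_le_nhds
    · refine Tendsto.congr' ?_ ((hfu.tendsto.mono_left nhdsWithin_le_nhds).div_const (N : ℝ)).neg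
      filter_upwards [self_mem_nhdsWithin] with r hr
      have : r ^ (N - 1) ≠ 0 := pow_ne_zero _ (ne_of_gt hr)
      field_simp
  refine key.congr' ?_
  filter_upwards [self_mem_nhdsWithin] with r hr
  have hr0 : r ≠ 0 := ne_of_gt hr
  have : r ^ (N - 1) ≠ 0 := pow_ne_zero _ hr0
  have h2 : r ^ N = r ^ (N - 1) * r := by rw [← pow_succ]; congr 1; omega
  rw [h2]
  field_simp

lemma Traj.hasDerivWithinAt_u (h : Traj N f J u v) {r : ℝ} (hr : 0 ≤ r) :
    HasDerivWithinAt u (v r) (Ici 0) r := by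
  rcases hr.eq_or_lt with rfl | h0
  · refine hasDerivWithinAt_Ici_of_tendsto_deriv (s := Ioi 0)
      (fun x hx => (h.hu x hx).differentiableAt.differentiableWithinAt)
      h.contu.continuousWithinAt self_mem_nhdsWithin ?_
    refine ((h.contv.tendsto 0).mono_left nhdsWithin_le_nhds).congr' ?_
    filter_upwards [self_mem_nhdsWithin] with x hx using (h.hu x hx).deriv.symm
  · exact (h.hu r h0).hasDerivWithinAt

/-- The continuous extension of `u''` to `[0, ∞)`. -/
noncomputable def secondDeriv (N : ℕ) (f u v : ℝ → ℝ) (r : ℝ) : ℝ :=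
  if r = 0 then -(f (u 0) / N) else -(((N : ℝ) - 1) / r * v r) - f (u r)

lemma Traj.hasDerivWithinAt_v (hN : 2 ≤ N) (hf : Nonlin f J) (h : Traj N f J u v) {r : ℝ}
    (hr : 0 ≤ r) : HasDerivWithinAt v (secondDeriv N f u v r) (Ici 0) r := by
  rcases hr.eq_or_lt with rfl | h0
  · rw [hasDerivWithinAt_iff_tendsto_slope, Ici_sdiff_left]
    simp only [secondDeriv, if_true]
    refine (h.tendsto_div hN hf).congr fun r => ?_
    rw [slope_def_field, h.v_zero, sub_zero, sub_zero]
  · rw [secondDeriv, if_neg h0.ne']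
    exact (h.hv r h0).hasDerivWithinAt

lemma Traj.continuousOn_secondDeriv (hN : 2 ≤ N) (hf : Nonlin f J) (h : Traj N f J u v) :
    ContinuousOn (secondDeriv N f u v) (Ici 0) := by
  intro r hr
  have hfu : ContinuousAt (fun r => f (u r)) r :=
    ContinuousAt.comp (hf.cont.continuousAt (hf.isOpen.mem_nhds (h.mem r hr)))
      h.contu.continuousAt
  rcases (mem_Ici.1 hr).eq_or_lt with rfl | h0
  · rw [← continuousWithinAt_sdiff_self, Ici_sdiff_left, ContinuousWithinAt]
    have h1 := (((h.tendsto_div hN hf).const_mul ((N : ℝ) - 1)).neg).sub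
      (hfu.tendsto.mono_left nhdsWithin_le_nhds)
    have hN0 : (N : ℝ) ≠ 0 := by positivity
    have h2 : -(((N : ℝ) - 1) * -(f (u 0) / N)) - f (u 0) = secondDeriv N f u v 0 := by
      simp only [secondDeriv, if_true]
      field_simp
      ring
    rw [h2] at h1
    refine h1.congr' ?_
    filter_upwards [self_mem_nhdsWithin] with x hx
    rw [secondDeriv, if_neg (ne_of_gt hx)]
    ring
  · have h1 : ContinuousAt (fun x => -(((N : ℝ) - 1) / x * v x) - f (u x)) r :=
      (((continuousAt_const.div continuousAt_id h0.ne').mul h.contv.continuousAt).neg).sub hfu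
    refine (h1.congr ?_).continuousWithinAt
    filter_upwards [isOpen_ne.mem_nhds h0.ne'] with x hx
    rw [secondDeriv, if_neg hx]

lemma Traj.isSolution (hN : 2 ≤ N) (hf : Nonlin f (Jset γm γs)) (h : Traj N f (Jset γm γs) u v)
    (hlim : Tendsto u atTop (𝓝 0)) : IsSolution N f γm γs u where
  smooth := by
    have hU : UniqueDiffOn ℝ (Ici (0 : ℝ)) := uniqueDiffOn_Ici 0
    have hv1 : ContDiffOn ℝ 1 v (Ici 0) := by
      rw [show (1 : WithTop ℕ∞) = 0 + 1 from (zero_add 1).symm,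
        contDiffOn_succ_iff_derivWithin hU]
      refine ⟨fun r hr => (h.hasDerivWithinAt_v hN hf hr).differentiableWithinAt, by simp, ?_⟩
      rw [contDiffOn_zero]
      exact (h.continuousOn_secondDeriv hN hf).congr fun r hr =>
        (h.hasDerivWithinAt_v hN hf hr).derivWithin (hU r hr)
    rw [show (2 : WithTop ℕ∞) = 1 + 1 from one_add_one_eq_two.symm,
      contDiffOn_succ_iff_derivWithin hU]
    refine ⟨fun r hr => (h.hasDerivWithinAt_u hr).differentiableWithinAt, by simp, ?_⟩
    exact hv1.congr fun r hr => (h.hasDerivWithinAt_u hr).derivWithin (hU r hr)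
  mem_dom r hr := Jset_subset_dom (h.mem r hr)
  ode r hr := by
    have h1 : deriv u =ᶠ[𝓝 r] v := by
      filter_upwards [Ioi_mem_nhds hr] with x hx using (h.hu x hx).deriv
    rw [h1.deriv_eq, (h.hv r hr).deriv, h1.eq_of_nhds]
    ring
  deriv_zero := by
    rw [(h.hasDerivWithinAt_u le_rfl).derivWithin (uniqueDiffOn_Ici 0 0 self_mem_Ici), h.v_zero]
  lim := hlim

end

/-! ### Shooting from the right of `β_*` -/

section
variable {N : ℕ} {f : ℝ → ℝ} {J : Set ℝ} {γm γs : EReal} {δ X δ₂ β₂ X₂ α a b : ℝ}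
  {U V : ℝ → ℝ → ℝ} {k : ℕ}

lemma Setting.betaStar_pos (h : Setting f γm γs δ) : 0 < betaStar f γs :=
  (h.delta_pos.trans h.gammaM_props.2.1).trans h.betaStar_props.1

lemma Setting.mem_of_betaStar_le (h : Setting f γm γs δ) (ha : betaStar f γs ≤ a)
    (has : (a : EReal) < γs) : a ∈ Jset γm γs :=
  h.J_of_le (h.betaStar_pos.le.trans ha) le_rfl has

lemma Setting.F_lt_F (h : Setting f γm γs δ) (ha : betaStar f γs ≤ a) (hab : a < b)
    (hb : (b : EReal) < γs) : F f a < F f b := by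
  have hsub : ∀ s ∈ Icc a b, betaStar f γs ≤ s ∧ (s : EReal) < γs := fun s hs =>
    ⟨ha.trans hs.1, (EReal.coe_le_coe_iff.2 hs.2).trans_lt hb⟩
  have hmem : ∀ s ∈ Icc a b, s ∈ Jset γm γs := fun s hs =>
    h.mem_of_betaStar_le (hsub s hs).1 (hsub s hs).2
  refine strictMonoOn_of_deriv_pos (convex_Icc a b) (h.nonlin.continuousOn_F.mono hmem)
    (fun s hs => ?_) (left_mem_Icc.2 hab.le) (right_mem_Icc.2 hab.le) hab
  rw [interior_Icc] at hs
  have hs' := Ioo_subset_Icc_self hs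
  rw [(h.nonlin.hasDerivAt_F (hmem s hs')).deriv]
  exact h.betaStar_props.2.2.2.2 s (hsub s hs').1 (hsub s hs').2

lemma Sol.tendsto (hN : 2 ≤ N) (hf : Nonlin f J) (hc : Confining f J)
    (hS : ∀ a ∈ J, a ≠ 0 → Sol N f J a (U a) (V a)) (hα : α ∈ J) (h0 : α ≠ 0) {R : ℝ} (hR : 0 ≤ R)
    (hnd : ∀ r ∈ Ico 0 R, ¬(U α r = 0 ∧ V α r = 0)) :
    Tendsto (fun a => U a R) (𝓝 α) (𝓝 (U α R)) ∧
      Tendsto (fun a => V a R) (𝓝 α) (𝓝 (V α R)) := by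
  constructor <;>
  · rw [Metric.tendsto_nhds]
    intro ε hε
    filter_upwards [Sol.continuous_dependence hN hf hc hS hα h0 hnd hε] with a ha
    rw [Real.dist_eq]
    first
      | exact (ha R ⟨hR, le_rfl⟩).1
      | exact (ha R ⟨hR, le_rfl⟩).2

lemma Sol.tendsto_energy (hN : 2 ≤ N) (hf : Nonlin f J) (hc : Confining f J)
    (hS : ∀ a ∈ J, a ≠ 0 → Sol N f J a (U a) (V a)) (hα : α ∈ J) (h0 : α ≠ 0) {R : ℝ} (hR : 0 ≤ R)
    (hnd : ∀ r ∈ Ico 0 R, ¬(U α r = 0 ∧ V α r = 0)) :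
    Tendsto (fun a => energy f (U a) (V a) R) (𝓝 α) (𝓝 (energy f (U α) (V α) R)) := by
  obtain ⟨h1, h2⟩ := Sol.tendsto hN hf hc hS hα h0 hR hnd
  exact ((h2.pow 2).div_const 2).add
    ((hf.continuousAt_F ((hS α hα h0).mem R hR)).tendsto.comp h1)

/-- The segment of initial values may run in either direction, so a good value can be joined to bad
ones on both of its sides. -/
lemma Setting.family (h : Setting f γm γs δ) (hN : 2 ≤ N)
    (hS : ∀ a ∈ Jset γm γs, a ≠ 0 → Sol N f (Jset γm γs) a (U a) (V a))
    (ha : betaStar f γs < a) (has : (a : EReal) < γs) (hb : betaStar f γs < b)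
    (hbs : (b : EReal) < γs) :
    Family N f (Jset γm γs) (fun s => U (a + s * (b - a))) (fun s => V (a + s * (b - a))) := by
  have hm : ∀ s ∈ Icc (0 : ℝ) 1, min a b ≤ a + s * (b - a) ∧ a + s * (b - a) ≤ max a b := by
    intro s hs
    have h1 : a + s * (b - a) = (1 - s) * a + s * b := by ring
    have h2 : 0 ≤ 1 - s := by linarith [hs.2]
    have := mul_le_mul_of_nonneg_left (min_le_left a b) h2
    have := mul_le_mul_of_nonneg_left (min_le_right a b) hs.1
    have := mul_le_mul_of_nonneg_left (le_max_left a b) h2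
    have := mul_le_mul_of_nonneg_left (le_max_right a b) hs.1
    constructor <;> linarith
  have hmax : ((max a b : ℝ) : EReal) < γs := by
    rcases max_choice a b with h1 | h1 <;> rw [h1] <;> assumption
  have hgt : ∀ s ∈ Icc (0 : ℝ) 1, betaStar f γs < a + s * (b - a) := fun s hs =>
    (lt_min ha hb).trans_le (hm s hs).1
  have hlt : ∀ s ∈ Icc (0 : ℝ) 1, ((a + s * (b - a) : ℝ) : EReal) < γs := fun s hs =>
    (EReal.coe_le_coe_iff.2 (hm s hs).2).trans_lt hmax
  have hJ := fun s hs => h.mem_of_betaStar_le (hgt s hs).le (hlt s hs)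
  have hne : ∀ s ∈ Icc (0 : ℝ) 1, a + s * (b - a) ≠ 0 := fun s hs =>
    (h.betaStar_pos.trans (hgt s hs)).ne'
  refine ⟨fun s hs => (hS _ (hJ s hs) (hne s hs)).toTraj,
    fun s hs => (hS _ (hJ s hs) (hne s hs)).absorb, fun s hs => ?_, fun c hc R hnd ε hε => ?_⟩
  · rw [(hS _ (hJ s hs) (hne s hs)).init]
    have h1 := h.F_lt_F le_rfl (hgt s hs) (hlt s hs)
    rw [h.betaStar_props.2.2.1] at h1
    exact h.gammaM_props.2.2.2.1.trans h1
  · have hcont : Continuous fun s : ℝ => a + s * (b - a) := by fun_prop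
    exact ((hcont.tendsto c).mono_left nhdsWithin_le_nhds).eventually
      (Sol.continuous_dependence hN h.nonlin h.confining hS (hJ c hc) (hne c hc) hnd hε)

/-- A trajectory starting at a positive-slope point of `F` loses energy at once. -/
lemma Traj.energy_lt_init {u v : ℝ → ℝ} (hN : 2 ≤ N) (hf : Nonlin f J) (h : Traj N f J u v)
    (h0 : f (u 0) ≠ 0) {r : ℝ} (hr : 0 < r) : energy f u v r < F f (u 0) := by
  by_contra! hcon
  rw [← energy_init h] at hcon
  have hv := h.v_zero_of_energy_le hN hf le_rfl hr hcon
  have h1 : ∀ᶠ x in 𝓝[>] (0 : ℝ), v x / x = 0 := by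
    filter_upwards [Ioo_mem_nhdsGT hr] with x hx
    rw [hv x (Ioo_subset_Icc_self hx), zero_div]
  have h2 := tendsto_nhds_unique (h.tendsto_div hN hf)
    ((tendsto_const_nhds (x := (0 : ℝ))).congr' (h1.mono fun x hx => hx.symm))
  have hN0 : (N : ℝ) ≠ 0 := by positivity
  rw [neg_eq_zero, div_eq_zero_iff] at h2
  tauto

/-- Trajectories starting slightly to the right of `β_*` do not reach the well around zero. -/
lemma Setting.eventually_not_good (h : Setting f γm γs δ) (hN : 2 ≤ N)
    (hS : ∀ a ∈ Jset γm γs, a ≠ 0 → Sol N f (Jset γm γs) a (U a) (V a))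
    (hX : X < gammaM f γs) :
    ∀ᶠ a in 𝓝 (betaStar f γs), ∀ k, ¬ Good f X X₂ k (U a) (V a) := by
  obtain ⟨hlt, hbs, hFb, -, hfpos⟩ := h.betaStar_props
  set β := betaStar f γs with hβ
  set m := gammaM f γs with hm
  have hβJ := h.mem_of_betaStar_le le_rfl hbs
  have hβ0 : β ≠ 0 := h.betaStar_pos.ne'
  have hm0 : 0 < m := h.delta_pos.trans h.gammaM_props.2.1
  have hβS := hS β hβJ hβ0
  have hE : ∀ r, 0 < r → energy f (U β) (V β) r < F f m := by
    intro r hr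
    have := hβS.toTraj.energy_lt_init hN h.nonlin
      (by rw [hβS.init]; exact (hfpos β le_rfl hbs).ne') hr
    rwa [hβS.init, hFb] at this
  -- At time zero the energy equals `F(γ_M)`, which gives no barrier yet; the argument starts at a
  -- small positive time, after a strict loss of energy.
  have hgt : ∀ r, 0 ≤ r → m < U β r := by
    intro r hr
    rcases hr.eq_or_lt with rfl | hr0
    · rwa [hβS.init]
    · obtain ⟨x, hxm, hx⟩ : ∃ x, m < U β x ∧ x ∈ Ioo 0 r := by
        have h1 : ∀ᶠ x in 𝓝[>] (0 : ℝ), m < U β x :=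
          (hβS.contu.tendsto 0).mono_left nhdsWithin_le_nhds
            (lt_mem_nhds (by rw [hβS.init]; exact hlt))
        exact (h1.and (Ioo_mem_nhdsGT hr0)).exists
      have h2 := hβS.lt_iff_of_energy_lt hN h.nonlin hx.1.le hx.2.le (hE x hx.1)
      have h3 := hβS.ne_of_energy_lt hN h.nonlin hx.1.le hx.2.le (hE x hx.1)
      by_contra! hcon
      linarith [h2.2 (lt_of_le_of_ne hcon h3)]
  have hnd : ∀ r ∈ Ico (0 : ℝ) 1, ¬(U β r = 0 ∧ V β r = 0) := by
    rintro r hr ⟨h1, -⟩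
    linarith [hgt r hr.1]
  have t1 := (Sol.tendsto hN h.nonlin h.confining hS hβJ hβ0 zero_le_one hnd).1
  have t2 := Sol.tendsto_energy hN h.nonlin h.confining hS hβJ hβ0 zero_le_one hnd
  filter_upwards [t1.eventually (lt_mem_nhds (hgt 1 zero_le_one)),
    t2.eventually (gt_mem_nhds (hE 1 one_pos)), h.nonlin.isOpen.mem_nhds hβJ,
    isOpen_ne.mem_nhds hβ0] with a h1 h2 haJ ha0 k hG
  have hT := (hS a haJ ha0).toTraj
  obtain ⟨r, hr, hEr, hur⟩ := hG.2 (F f m) h.gammaM_props.2.2.2.1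
  have hrm : U a r < m := hur.2.trans hX
  rcases le_total 1 r with h3 | h3
  · linarith [(hT.lt_iff_of_energy_lt hN h.nonlin zero_le_one h3 h2).2 hrm]
  · linarith [(hT.lt_iff_of_energy_lt hN h.nonlin hr h3 hEr).1 hrm]

/-- If some trajectory without sign change falls into the well around zero, but does not tend to
zero, while trajectories starting close enough to `γ_*` oscillate, then there are two solutions. -/
lemma Setting.two_nodal_solutions (h : Setting f γm γs δ) (hN : 2 ≤ N)
    (hS : ∀ a ∈ Jset γm γs, a ≠ 0 → Sol N f (Jset γm γs) a (U a) (V a))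
    (hr : RightWell f (Jset γm γs) δ (beta1 f γs) X)
    (hl : RightWell (refl f) (Neg.neg ⁻¹' Jset γm γs) δ₂ β₂ X₂) (hX : X < gammaM f γs)
    (hα : betaStar f γs < α) (hαs : (α : EReal) < γs) (hG : Good f X X₂ 0 (U α) (V α))
    (hlim : ¬ Tendsto (U α) atTop (𝓝 0))
    (hb : ∃ b, α < b ∧ (b : EReal) < γs ∧ ¬ Good f X X₂ k (U b) (V b)) :
    AtLeastTwoNodalSolutions N f γm γs k := by
  have hGk : Good f X X₂ k (U α) (V α) := ⟨fun hk => hG.1 (hk.mono (by omega)), hG.2⟩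
  -- The parameter found differs from `α`, because the trajectory of `α` does not tend to zero.
  -- Applied on both sides of `α` this yields two distinct initial values.
  have key : ∀ b, betaStar f γs < b → (b : EReal) < γs → ¬ Good f X X₂ k (U b) (V b) →
      ∃ c ∈ Icc (0 : ℝ) 1, α + c * (b - α) ≠ α ∧
        IsNodalSolution N f γm γs k (U (α + c * (b - α))) ∧
        U (α + c * (b - α)) 0 = α + c * (b - α) := by
    intro b hb hbs hnG
    have hF := h.family hN hS hα hαs hb hbs
    obtain ⟨c, hc, hc1, hc2⟩ := hF.exists_nodal hN h.nonlin hr hl (k := k)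
      (by simpa using hGk) (by simpa using hnG)
    have hcb : betaStar f γs < α + c * (b - α) := by
      have h2 : 0 ≤ 1 - c := by linarith [hc.2]
      rcases hc.1.eq_or_lt with h0 | h0
      · rw [← h0]; linarith
      · nlinarith [mul_pos h0 (sub_pos.2 hb), mul_nonneg h2 (sub_pos.2 hα).le]
    have hcs : ((α + c * (b - α) : ℝ) : EReal) < γs := by
      have h2 : 0 ≤ 1 - c := by linarith [hc.2]
      have h3 : α + c * (b - α) ≤ max α b := by
        nlinarith [mul_le_mul_of_nonneg_left (le_max_left α b) h2,
          mul_le_mul_of_nonneg_left (le_max_right α b) hc.1]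
      refine (EReal.coe_le_coe_iff.2 h3).trans_lt ?_
      rcases max_choice α b with h1 | h1 <;> rw [h1] <;> assumption
    have hT := hF.traj c hc
    have hinit := (hS _ (h.mem_of_betaStar_le hcb.le hcs) (h.betaStar_pos.trans hcb).ne').init
    refine ⟨c, hc, fun h0 => hlim ?_, ⟨hT.isSolution hN h.nonlin hc2, ?_, ?_, hc1⟩, hinit⟩
    · rw [h0] at hc2; exact hc2
    · rw [hinit]; exact hcb
    · rw [hinit]; exact hcs
  obtain ⟨b₁, hb₁, hb₁s, hnG₁⟩ := hb
  obtain ⟨b₂, hnG₂, hb₂⟩ : ∃ b₂, (¬ Good f X X₂ k (U b₂) (V b₂)) ∧ b₂ ∈ Ioo (betaStar f γs) α := by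
    have h1 := (h.eventually_not_good hN hS (X₂ := X₂) hX).filter_mono
      (nhdsWithin_le_nhds (s := Ioi (betaStar f γs)))
    obtain ⟨b₂, h2, h3⟩ := (h1.and (Ioo_mem_nhdsGT hα)).exists
    exact ⟨b₂, h2 k, h3⟩
  obtain ⟨c₁, hc₁, hne₁, hs₁, hi₁⟩ := key b₁ (hα.trans hb₁) hb₁s hnG₁
  obtain ⟨c₂, hc₂, hne₂, hs₂, hi₂⟩ := key b₂ hb₂.1
    ((EReal.coe_lt_coe_iff.2 hb₂.2).trans hαs) hnG₂
  refine ⟨_, _, hs₁, hs₂, 0, le_rfl, ?_⟩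
  rw [hi₁, hi₂]
  have h1 : 0 ≤ c₁ * (b₁ - α) := mul_nonneg hc₁.1 (by linarith)
  have h2 : c₂ * (b₂ - α) ≤ 0 := mul_nonpos_of_nonneg_of_nonpos hc₂.1 (by linarith [hb₂.2])
  intro h3
  apply hne₁
  linarith

end

end BoundState

namespace BoundState

/-! ### Shooting from near the right end -/

/-- The Pohozaev functional `2 r^N E + (N - 2) r^(N-1) u u'`. -/
noncomputable def pohozaev (N : ℕ) (f u v : ℝ → ℝ) (r : ℝ) : ℝ :=
  2 * r ^ N * energy f u v r + ((N : ℝ) - 2) * (r ^ (N - 1) * v r) * u r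

section
variable {N : ℕ} {f : ℝ → ℝ} {J : Set ℝ} {u v : ℝ → ℝ} {a b : ℝ}

lemma Traj.hasDerivAt_pohozaev (hN : 2 ≤ N) (hf : Nonlin f J) (h : Traj N f J u v) {r : ℝ}
    (hr : 0 < r) : HasDerivAt (pohozaev N f u v) (r ^ (N - 1) * Q N f (u r)) r := by
  have h1 := (((hasDerivAt_pow N r).const_mul 2).mul (h.hasDerivAt_energy hf hr)).add
    (((h.hasDerivAt_pow_mul hN hr).const_mul ((N : ℝ) - 2)).mul (h.hu r hr))
  refine h1.congr_deriv ?_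
  have h2 : r ^ N = r ^ (N - 1) * r := by rw [← pow_succ]; congr 1; omega
  simp only [energy, Q]
  rw [h2]
  field_simp
  ring

lemma Traj.continuousOn_pohozaev (hf : Nonlin f J) (h : Traj N f J u v) :
    ContinuousOn (pohozaev N f u v) (Ici 0) := by
  have h1 : Continuous fun r : ℝ => 2 * r ^ N := by fun_prop
  have h2 : Continuous fun r : ℝ => ((N : ℝ) - 2) * (r ^ (N - 1) * v r) * u r := by
    have := h.contu
    have := h.contv
    fun_prop
  exact (h1.continuousOn.mul (h.continuousOn_energy hf)).add h2.continuousOn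

lemma Traj.pohozaev_ge (hN : 2 ≤ N) (hf : Nonlin f J) (h : Traj N f J u v) {q : ℝ} (ha : 0 ≤ a)
    (hab : a ≤ b) (hq : ∀ x ∈ Ioo a b, q ≤ Q N f (u x)) :
    pohozaev N f u v a + q * ((b ^ N - a ^ N) / N) ≤ pohozaev N f u v b := by
  have hN0 : (N : ℝ) ≠ 0 := by positivity
  have := ge_of_deriv_nonneg (g := fun r => pohozaev N f u v r - q / N * r ^ N)
    (g' := fun r => r ^ (N - 1) * (Q N f (u r) - q)) hab
    (((h.continuousOn_pohozaev hf).mono fun x hx => ha.trans hx.1).sub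
      (by fun_prop)) (fun x hx => ?_) (fun x hx => ?_)
  · have h1 : q * ((b ^ N - a ^ N) / N) = q / N * b ^ N - q / N * a ^ N := by ring
    linarith
  · refine ((h.hasDerivAt_pohozaev hN hf (ha.trans_lt hx.1)).sub
      ((hasDerivAt_pow N x).const_mul (q / N))).congr_deriv ?_
    field_simp
  · have := hq x hx
    have hx0 : 0 < x := ha.trans_lt hx.1
    exact mul_nonneg (by positivity) (by linarith)

lemma pohozaev_zero (hN : 2 ≤ N) : pohozaev N f u v 0 = 0 := by
  simp [pohozaev, zero_pow (by omega : N ≠ 0), zero_pow (by omega : N - 1 ≠ 0)]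

/-- Upper bound for the time needed to descend from the initial value. -/
lemma Traj.le_of_f_le (hN : 2 ≤ N) (h : Traj N f J u v) {M t : ℝ} (ht : 0 ≤ t)
    (hM : ∀ x ∈ Ioo 0 t, f (u x) ≤ M) : u 0 - M * t ^ 2 / (2 * N) ≤ u t := by
  have hN0 : (0 : ℝ) < N := by positivity
  have hv : ∀ r ∈ Ioo 0 t, -(M * r / N) ≤ v r := by
    intro r hr
    have := ge_of_deriv_nonneg (g := fun x => x ^ (N - 1) * v x + M / N * x ^ N)
      (g' := fun x => x ^ (N - 1) * (M - f (u x))) hr.1.le ?_ (fun x hx => ?_) (fun x hx => ?_)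
    · simp only [zero_pow (by omega : N - 1 ≠ 0), zero_pow (by omega : N ≠ 0), zero_mul,
        mul_zero, add_zero] at this
      have hp : 0 < r ^ (N - 1) := pow_pos hr.1 _
      have h2 : r ^ N = r ^ (N - 1) * r := by rw [← pow_succ]; congr 1; omega
      have h3 : 0 ≤ r ^ (N - 1) * (v r + M * r / N) := by
        rw [h2] at this; calc
          0 ≤ _ := this
          _ = _ := by ring
      linarith [nonneg_of_mul_nonneg_right h3 hp]
    · have := h.contv
      fun_prop
    · refine ((h.hasDerivAt_pow_mul hN hx.1).add
        ((hasDerivAt_pow N x).const_mul (M / N))).congr_deriv ?_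
      field_simp
      ring
    · have := hM x ⟨hx.1, hx.2.trans hr.2⟩
      exact mul_nonneg (pow_nonneg hx.1.le _) (by linarith)
  have := ge_of_deriv_nonneg (g := fun x => u x + M / (2 * N) * x ^ 2)
    (g' := fun x => v x + M * x / N) ht ?_ (fun x hx => ?_) (fun x hx => ?_)
  · have h1 : M * t ^ 2 / (2 * N) = M / (2 * N) * t ^ 2 := by ring
    rw [h1]
    simp at this
    linarith
  · have := h.contu
    fun_prop
  · refine ((h.hu x hx.1).add ((hasDerivAt_pow 2 x).const_mul (M / (2 * N)))).congr_deriv ?_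
    field_simp
    ring
  · linarith [hv x hx]

/-- A trajectory is nonincreasing as long as `f(u) ≥ 0`. -/
lemma Traj.v_nonpos (hN : 2 ≤ N) (h : Traj N f J u v) {t : ℝ}
    (hf0 : ∀ x ∈ Ioo 0 t, 0 ≤ f (u x)) : ∀ r ∈ Icc 0 t, v r ≤ 0 := by
  intro r hr
  rcases hr.1.eq_or_lt with rfl | hr0
  · exact h.v_zero.le
  have := le_of_deriv_nonpos (g := fun x => x ^ (N - 1) * v x)
    (g' := fun x => -(x ^ (N - 1) * f (u x))) hr.1 ?_ (fun x hx => h.hasDerivAt_pow_mul hN hx.1)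
    (fun x hx => ?_)
  · rw [zero_pow (by omega : N - 1 ≠ 0), zero_mul] at this
    by_contra! hcon
    linarith [mul_pos (pow_pos hr0 (N - 1)) hcon]
  · have := h.contv
    fun_prop
  · have := mul_nonneg (pow_nonneg hx.1.le (N - 1)) (hf0 x ⟨hx.1, hx.2.trans_le hr.2⟩)
    linarith

lemma Traj.antitoneOn {t : ℝ} (h : Traj N f J u v) {s : ℝ} (hs : 0 ≤ s)
    (hv : ∀ r ∈ Icc s t, v r ≤ 0) : AntitoneOn u (Icc s t) :=
  antitoneOn_Icc_of_deriv h.contu.continuousOn (fun x hx => h.hu x (hs.trans_lt hx.1))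
    fun x hx => hv x (Ioo_subset_Icc_self hx)

end

section
variable {N : ℕ} {f : ℝ → ℝ} {J : Set ℝ} {γm γs : EReal} {δ X δ₂ β₂ X₂ α : ℝ}
  {U V : ℝ → ℝ → ℝ} {k : ℕ}

/-- If the energy is still `F(γ_M)` at a sufficiently late time, losing it in the central zone would
take more than `k` sign changes. -/
lemma Setting.exists_not_good (h : Setting f γm γs δ) (hN : 2 ≤ N)
    (hS : ∀ a ∈ Jset γm γs, a ≠ 0 → Sol N f (Jset γm γs) a (U a) (V a))
    (hr : RightWell f (Jset γm γs) δ (beta1 f γs) X)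
    (hl : RightWell (refl f) (Neg.neg ⁻¹' Jset γm γs) δ₂ β₂ X₂)
    (hα : betaStar f γs < α)
    (hesc : ∀ R > 0, ∃ b, α < b ∧ (b : EReal) < γs ∧
      F f (gammaM f γs) ≤ energy f (U b) (V b) R) :
    ∃ b, α < b ∧ (b : EReal) < γs ∧ ¬ Good f X X₂ k (U b) (V b) := by
  have hX := hr.F_pos h.nonlin hr.lt le_rfl
  have hX₂ := hl.F_pos h.nonlin.refl hl.lt le_rfl
  rw [F_refl] at hX₂
  set e₂ := min (F f (gammaM f γs)) (min (F f X) (F f (-X₂)) / 2) with he₂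
  have hm := lt_min hX hX₂
  have he0 : 0 < e₂ := lt_min h.gammaM_props.2.2.2.1 (half_pos hm)
  have heX : e₂ < min (F f X) (F f (-X₂)) := (min_le_right _ _).trans_lt (half_lt_self hm)
  obtain ⟨R, hR, key⟩ := exists_many_sign_changes hN h.nonlin hr hl (half_pos he0)
    (half_lt_self he0) (heX.trans_le (min_le_left _ _)) (heX.trans_le (min_le_right _ _)) (k + 1)
  obtain ⟨b, hb, hbs, hE⟩ := hesc R hR
  refine ⟨b, hb, hbs, fun hG => hG.1 ?_⟩
  obtain ⟨σ, hσ, hEσ, huσ⟩ := hG.2 _ (half_pos he0)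
  have hbJ := h.mem_of_betaStar_le (hα.trans hb).le hbs
  exact key _ _ (hS b hbJ (h.betaStar_pos.trans (hα.trans hb)).ne').toTraj R le_rfl
    ((min_le_left _ _).trans hE) σ hσ hEσ.le huσ

/-- Under (A1), trajectories starting close to `γ_*` stay close to `γ_*` for a long time. -/
lemma AssumptionA1.eventually_stays {γs : ℝ} (h : AssumptionA1 f γm γs δ) (hN : 2 ≤ N)
    (hS : ∀ a ∈ Jset γm γs, a ≠ 0 → Sol N f (Jset γm γs) a (U a) (V a)) {c : ℝ}
    (hc : betaStar f γs ≤ c) (hcs : c < γs) (R : ℝ) :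
    ∀ᶠ a in 𝓝[<] γs, ∀ r ∈ Icc 0 R, c < U a r := by
  have hs := h.setting
  obtain ⟨K, t, ht, hK⟩ := h.lip (x := γs) ⟨⟨h.left_neg.trans (EReal.coe_lt_coe_iff.2 h.right_pos),
    le_rfl⟩, h.right_pos.ne'⟩
  have ht' : t ∈ 𝓝[≤] γs := by
    refine (nhdsWithin_le_iff.2 ?_) ht
    filter_upwards [Ioc_mem_nhdsLE h.right_pos] with x hx
    exact ⟨⟨h.left_neg.trans (EReal.coe_lt_coe_iff.2 hx.1), EReal.coe_le_coe_iff.2 hx.2⟩, hx.1.ne'⟩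
  obtain ⟨c₀, hc₀, hsub⟩ := (mem_nhdsLE_iff_exists_Ioc_subset' h.right_pos).1 ht'
  have hc₀' : c₀ < γs := hc₀
  set d := max c ((c₀ + γs) / 2) with hd
  have hds : d < γs := max_lt hcs (by linarith)
  have hcd : c ≤ d := le_max_left _ _
  have hd₀ : c₀ < d := lt_of_lt_of_le (by linarith) (le_max_right c ((c₀ + γs) / 2))
  have hd0 : 0 < d := hs.betaStar_pos.trans_le (hc.trans hcd)
  have hfK : ∀ s ∈ Icc d γs, f s ≤ K * (γs - s) := by
    intro s hs'
    have := hK.dist_le_mul s (hsub ⟨hd₀.trans_le hs'.1, hs'.2⟩) γs (hsub ⟨hc₀', le_rfl⟩)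
    rw [Real.dist_eq, Real.dist_eq, h.zero_right, sub_zero, abs_sub_comm,
      abs_of_nonneg (by linarith [hs'.2] : 0 ≤ γs - s)] at this
    exact (le_abs_self _).trans this
  have hFK : ∀ s ∈ Icc d γs, F f γs ≤ F f s + K / 2 * (γs - s) ^ 2 := by
    intro s hs'
    have := le_of_deriv_nonpos (g := fun x => F f x + K / 2 * (γs - x) ^ 2)
      (g' := fun x => f x - K * (γs - x)) hs'.2 ?_ (fun x hx => ?_) (fun x hx => ?_)
    · simp at this
      exact this
    · exact (h.continuousOn_F.mono fun x hx => ⟨by linarith [hs'.1, hx.1], hx.2⟩).add (by fun_prop)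
    · have hx' := hs.nonlin.hasDerivAt_F (hs.J_of_le (by linarith [hs'.1, hx.1]) le_rfl
        (EReal.coe_lt_coe_iff.2 hx.2))
      refine (hx'.add ((((hasDerivAt_id x).const_sub γs).pow 2).const_mul (K / 2 : ℝ))).congr_deriv
        ?_
      simp
      ring
    · linarith [hfK x ⟨hs'.1.trans hx.1.le, hx.2.le⟩]
  set L := √(K : ℝ) with hL
  have hLK : L ^ 2 = K := Real.sq_sqrt K.2
  have hlim : Tendsto (fun a => (γs - a) * Real.exp (L * R)) (𝓝[<] γs) (𝓝 0) := by
    have : Continuous fun a => (γs - a) * Real.exp (L * R) := by fun_prop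
    have := this.tendsto γs
    simp only [sub_self, zero_mul] at this
    exact this.mono_left nhdsWithin_le_nhds
  filter_upwards [hlim.eventually (gt_mem_nhds (sub_pos.2 hds)), Ioo_mem_nhdsLT hds] with a ha had
  have haS : (a : EReal) < γs := EReal.coe_lt_coe_iff.2 had.2
  have haJ := hs.mem_of_betaStar_le (hc.trans (hcd.trans had.1.le)) haS
  have hSa := hS a haJ (hd0.trans had.1).ne'
  by_contra! hcon
  obtain ⟨r, hr, hur⟩ := hcon
  obtain ⟨t, ht0, htr, hut, hbefore⟩ := exists_first_hit hSa.contu hr.1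
    (by rw [hSa.init]; exact had.1) (hur.trans hcd)
  have hub : ∀ x ∈ Icc 0 t, d ≤ U a x ∧ U a x < γs := by
    intro x hx
    refine ⟨?_, EReal.coe_lt_coe_iff.1 (hSa.mem x hx.1).2⟩
    rcases hx.2.lt_or_eq with h1 | h1
    · exact (hbefore x hx.1 h1).le
    · rw [h1, hut]
  -- The Lipschitz condition at the zero `γ_*` of `f` makes `F(γ_*) - F` at most quadratic, so the
  -- speed is at most `L (γ_* - u)`. The distance to `γ_*` then grows at most exponentially and
  -- stays small up to time `R`.
  have hv : ∀ x ∈ Ioo 0 t, -V a x ≤ L * (γs - U a x) := by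
    intro x hx
    have hux := hub x (Ioo_subset_Icc_self hx)
    have h1 := hSa.toTraj.energy_le hN hs.nonlin le_rfl hx.1.le
    rw [energy_init hSa.toTraj, hSa.init] at h1
    have h2 := h.F_lt a haJ.1 had.2
    have h3 := hFK (U a x) ⟨hux.1, hux.2.le⟩
    have h4 : V a x ^ 2 ≤ (L * (γs - U a x)) ^ 2 := by
      rw [mul_pow, hLK]
      unfold energy at h1
      linarith
    have h5 := abs_le_of_sq_le_sq h4 (mul_nonneg (Real.sqrt_nonneg _) (by linarith))
    linarith [neg_le_abs (V a x)]
  have hG := le_of_deriv_nonpos (g := fun x => (γs - U a x) * Real.exp (-(L * x)))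
    (g' := fun x => (-V a x - L * (γs - U a x)) * Real.exp (-(L * x))) ht0.le ?_
    (fun x hx => ?_) (fun x hx => ?_)
  · simp only [mul_zero, neg_zero, Real.exp_zero, mul_one] at hG
    rw [hut, hSa.init] at hG
    have h1 : (γs - d) * Real.exp (-(L * t)) * Real.exp (L * t) ≤ (γs - a) * Real.exp (L * t) :=
      mul_le_mul_of_nonneg_right hG (Real.exp_pos _).le
    rw [mul_assoc, ← Real.exp_add, neg_add_cancel, Real.exp_zero, mul_one] at h1
    have h2 : (γs - a) * Real.exp (L * t) ≤ (γs - a) * Real.exp (L * R) := by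
      refine mul_le_mul_of_nonneg_left (Real.exp_le_exp.2 ?_) (by linarith [had.2])
      exact mul_le_mul_of_nonneg_left (htr.trans hr.2) (Real.sqrt_nonneg _)
    linarith
  · have := hSa.contu
    fun_prop
  · have h1 := (((hasDerivAt_id x).const_mul L).neg).exp
    refine (((hSa.hu x hx.1).const_sub γs).mul h1).congr_deriv ?_
    simp
    ring
  · exact mul_nonpos_of_nonpos_of_nonneg (by linarith [hv x hx]) (Real.exp_pos _).le

lemma Nonlin.continuousOn_Q (hf : Nonlin f J) : ContinuousOn (Q N f) J :=
  (continuousOn_const.mul hf.continuousOn_F).sub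
    ((continuousOn_const.mul continuousOn_id).mul hf.cont)

lemma AssumptionA2.eventually_Q_pos {s₀ : ℝ} (h : AssumptionA2 N f γm δ s₀) :
    ∀ᶠ s in atTop, 0 < Q N f s := by
  obtain ⟨θ, hθ, hg⟩ := h.growth
  filter_upwards [hg 1, eventually_ge_atTop (betaStar f ⊤), eventually_gt_atTop 0] with s h1 h2 h3
  have hs : s ∈ Icc (θ * s) s := ⟨by nlinarith [hθ.2], le_rfl⟩
  have h4 := h1 s hs s hs
  have hfs := h.setting.betaStar_props.2.2.2.2 s h2 (EReal.coe_lt_top s)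
  have h5 : 0 < (s / f s) ^ ((N : ℝ) / 2) := Real.rpow_pos_of_pos (div_pos h3 hfs) _
  by_contra! hcon
  linarith [mul_nonpos_of_nonpos_of_nonneg hcon h5.le]

/-- `Q` is positive near both ends of the interval and continuous on the compact part in between. -/
lemma AssumptionA2.exists_Q_ge {s₀ : ℝ} (h : AssumptionA2 N f γm δ s₀) :
    ∃ B ≥ 0, ∀ s ∈ Jset γm ⊤, -B ≤ Q N f s := by
  have hs := h.setting
  obtain ⟨s₁, hs₁⟩ := eventually_atTop.1 h.eventually_Q_pos
  have hs₀ : s₀ ∈ Jset γm ⊤ := ⟨h.s₀_mem.1, EReal.coe_lt_top s₀⟩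
  have hm : max s₀ s₁ ∈ Jset γm ⊤ :=
    ⟨h.s₀_mem.1.trans_le (EReal.coe_le_coe_iff.2 (le_max_left _ _)), EReal.coe_lt_top _⟩
  obtain ⟨B, hB⟩ := isCompact_Icc.exists_bound_of_continuousOn
    (hs.nonlin.continuousOn_Q (N := N) |>.mono (hs.nonlin.conn.out hs₀ hm))
  refine ⟨|B|, abs_nonneg B, fun s hsJ => ?_⟩
  rcases lt_or_ge s s₀ with h1 | h1
  · linarith [h.Q_pos s hsJ.1 h1, abs_nonneg B]
  rcases lt_or_ge s s₁ with h2 | h2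
  · have := hB s ⟨h1, h2.le.trans (le_max_right _ _)⟩
    rw [Real.norm_eq_abs] at this
    linarith [(abs_le.1 this).1, le_abs_self B]
  · linarith [hs₁ s h2, abs_nonneg B]

/-- Under (A2), the Pohozaev functional of trajectories starting far to the right is large from
the first time on at which the trajectory has decayed by the factor `θ`. -/
lemma AssumptionA2.eventually_pohozaev_ge {s₀ : ℝ} (h : AssumptionA2 N f γm δ s₀) (hN : 2 ≤ N)
    (hS : ∀ a ∈ Jset γm ⊤, a ≠ 0 → Sol N f (Jset γm ⊤) a (U a) (V a)) :
    ∃ θ ∈ Ioo (0 : ℝ) 1, ∀ K R : ℝ, ∀ᶠ a in atTop, ∀ r ∈ Icc 0 R,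
      (∀ x ∈ Icc 0 r, θ * a < U a x) ∨ K ≤ pohozaev N f (U a) (V a) r := by
  have hs := h.setting
  have hN0 : (0 : ℝ) < N := by positivity
  obtain ⟨θ, hθ, hg⟩ := h.growth
  obtain ⟨B, hB0, hB⟩ := h.exists_Q_ge
  refine ⟨θ, hθ, fun K R => ?_⟩
  set D := (2 * N * (1 - θ)) ^ ((N : ℝ) / 2) with hD
  have hD0 : 0 < D := Real.rpow_pos_of_pos (by nlinarith [hθ.2]) _
  -- Falling from `a` to `θ a` takes a time `t` with `t² ≥ 2N(1-θ) a / max f`, which is the origin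
  -- of `D`. By then the Pohozaev functional is at least `t^N min Q / N`; `C` makes this exceed
  -- `|K|` plus all that can be lost up to time `R`, where `Q ≥ -B`.
  set C := (|K| + B * (R ^ N / N)) * N / D with hC
  filter_upwards [hg (max C 1), eventually_gt_atTop 0,
    eventually_ge_atTop (betaStar f ⊤ / θ)] with a hga ha0 haβ r hr
  have hβa : betaStar f ⊤ ≤ θ * a := by
    rw [div_le_iff₀ hθ.1] at haβ; linarith
  have hθa : θ * a < a := by nlinarith [hθ.2]
  have haJ := hs.mem_of_betaStar_le (hβa.trans hθa.le) (EReal.coe_lt_top a)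
  have hSa := hS a haJ ha0.ne'
  by_contra! hcon
  obtain ⟨⟨x, hx, hux⟩, hP⟩ := hcon
  obtain ⟨t, ht0, htx, hut, hbefore⟩ := exists_first_hit hSa.contu hx.1
    (by rw [hSa.init]; exact hθa) hux
  have htr : t ≤ r := htx.trans hx.2
  have hge : ∀ y ∈ Icc 0 t, θ * a ≤ U a y := by
    intro y hy
    rcases hy.2.lt_or_eq with h1 | h1
    · exact (hbefore y hy.1 h1).le
    · rw [h1, hut]
  have hfpos : ∀ s, θ * a ≤ s → 0 < f s := fun s h1 =>
    hs.betaStar_props.2.2.2.2 s (hβa.trans h1) (EReal.coe_lt_top s)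
  have hv := hSa.toTraj.v_nonpos hN (t := t) fun y hy =>
    (hfpos _ (hge y (Ioo_subset_Icc_self hy))).le
  have hmem : ∀ y ∈ Icc 0 t, U a y ∈ Icc (θ * a) a := by
    intro y hy
    refine ⟨hge y hy, ?_⟩
    have := hSa.toTraj.antitoneOn le_rfl hv (left_mem_Icc.2 ht0.le) hy hy.1
    rwa [hSa.init] at this
  have hIcc : Icc (θ * a) a ⊆ Jset γm ⊤ := fun s h1 =>
    hs.mem_of_betaStar_le (hβa.trans h1.1) (EReal.coe_lt_top s)
  have hne : (Icc (θ * a) a).Nonempty := nonempty_Icc.2 hθa.le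
  obtain ⟨s₁, hs₁, hmax⟩ := isCompact_Icc.exists_isMaxOn hne (hs.nonlin.cont.mono hIcc)
  obtain ⟨s₂, hs₂, hmin⟩ := isCompact_Icc.exists_isMinOn hne
    ((hs.nonlin.continuousOn_Q (N := N)).mono hIcc)
  have hf1 : 0 < f s₁ := hfpos s₁ hs₁.1
  have h1 := hSa.toTraj.le_of_f_le hN (M := f s₁) ht0.le fun y hy =>
    isMaxOn_iff.1 hmax _ (hmem y (Ioo_subset_Icc_self hy))
  rw [hut, hSa.init] at h1
  have h2 : 2 * N * (1 - θ) * (a / f s₁) ≤ t ^ 2 := by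
    have h3 : (1 - θ) * a ≤ f s₁ * t ^ 2 / (2 * N) := by linarith
    rw [le_div_iff₀ (by positivity)] at h3
    rw [mul_div_assoc', div_le_iff₀ hf1]
    linarith
  have hdiv : 0 < a / f s₁ := div_pos ha0 hf1
  have h3 : D * (a / f s₁) ^ ((N : ℝ) / 2) ≤ t ^ N := by
    have h4 : (0 : ℝ) ≤ 2 * N * (1 - θ) := by nlinarith [hθ.2]
    rw [hD, ← Real.mul_rpow h4 hdiv.le]
    calc _ ≤ (t ^ 2) ^ ((N : ℝ) / 2) := Real.rpow_le_rpow (by positivity) h2 (by positivity)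
      _ = t ^ N := by
        rw [← Real.rpow_natCast, ← Real.rpow_mul ht0.le, ← Real.rpow_natCast t N]
        congr 1
        push_cast
        ring
  have h4 := hga s₁ hs₁ s₂ hs₂
  have hpw : 0 < (a / f s₁) ^ ((N : ℝ) / 2) := Real.rpow_pos_of_pos hdiv _
  have hQ : 0 < Q N f s₂ := by
    by_contra! hcon
    linarith [mul_nonpos_of_nonpos_of_nonneg hcon hpw.le, le_max_right C 1]
  have h5 := hSa.toTraj.pohozaev_ge hN hs.nonlin (q := Q N f s₂) le_rfl ht0.le fun y hy =>
    isMinOn_iff.1 hmin _ (hmem y (Ioo_subset_Icc_self hy))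
  rw [pohozaev_zero hN, zero_pow (by omega), sub_zero, zero_add] at h5
  have h6 := hSa.toTraj.pohozaev_ge hN hs.nonlin (q := -B) ht0.le htr fun y hy =>
    hB _ (hSa.mem y (ht0.le.trans hy.1.le))
  have h7 : C * D ≤ Q N f s₂ * t ^ N := by
    calc C * D ≤ (Q N f s₂ * (a / f s₁) ^ ((N : ℝ) / 2)) * D :=
          mul_le_mul_of_nonneg_right ((le_max_left C 1).trans h4) hD0.le
      _ = Q N f s₂ * (D * (a / f s₁) ^ ((N : ℝ) / 2)) := by ring
      _ ≤ _ := mul_le_mul_of_nonneg_left h3 hQ.le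
  have h8 : C * D = (|K| + B * (R ^ N / N)) * N := by rw [hC]; field_simp
  have h9 : |K| + B * (R ^ N / N) ≤ Q N f s₂ * (t ^ N / N) := by
    rw [← mul_div_assoc (Q N f s₂), le_div_iff₀ hN0, ← h8]; exact h7
  have h10 : B * ((r ^ N - t ^ N) / N) ≤ B * (R ^ N / N) := by
    refine mul_le_mul_of_nonneg_left ((div_le_div_iff_of_pos_right hN0).2 ?_) hB0
    have h11 : r ^ N ≤ R ^ N := pow_le_pow_left₀ hr.1 hr.2 N
    have h12 : 0 ≤ t ^ N := by positivity
    linarith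
  linarith [le_abs_self K]

lemma AssumptionA2.exists_left_ge {s₀ : ℝ} (h : AssumptionA2 N f γm δ s₀) :
    ∃ p ∈ Jset γm ⊤, ∀ s ∈ Jset γm ⊤, s < p → F f (gammaM f ⊤) < F f s := by
  have hs := h.setting
  obtain ⟨L, -, hL2, hL⟩ := h.F_lim
  have hmJ := hs.J_of_le (hs.delta_pos.trans hs.gammaM_props.2.1).le
    (hs.betaStar_props.1.le) hs.betaStar_props.2.1
  obtain ⟨t, ht, htP⟩ := mem_comap.1 (hL2.eventually (lt_mem_nhds (hL _ (Jset_subset_dom hmJ))))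
  obtain ⟨y, hy, hyt⟩ := (mem_nhdsGT_iff_exists_Ioo_subset' h.left_neg).1 ht
  obtain ⟨p, hp1, hp2⟩ := EReal.lt_iff_exists_real_btwn.1 hy
  refine ⟨p, ⟨hp1, EReal.coe_lt_top p⟩, fun s hsJ hsp => EReal.coe_lt_coe_iff.1 ?_⟩
  exact htP (hyt ⟨hsJ.1, (EReal.coe_lt_coe_iff.2 hsp).trans hp2⟩)

/-- Under (A2), trajectories starting far to the right keep a large energy for a long time. -/
lemma AssumptionA2.eventually_energy_ge {s₀ : ℝ} (h : AssumptionA2 N f γm δ s₀) (hN : 2 ≤ N)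
    (hS : ∀ a ∈ Jset γm ⊤, a ≠ 0 → Sol N f (Jset γm ⊤) a (U a) (V a)) {R : ℝ} (hR : 0 < R) :
    ∀ᶠ a in atTop, F f (gammaM f ⊤) ≤ energy f (U a) (V a) R := by
  have hs := h.setting
  have hN' : (2 : ℝ) ≤ N := by exact_mod_cast hN
  obtain ⟨hmβ, hβs, hFβ, -, -⟩ := hs.betaStar_props
  set m := gammaM f ⊤ with hm
  set β := betaStar f ⊤ with hβ
  obtain ⟨θ, hθ, hP⟩ := h.eventually_pohozaev_ge hN hS
  obtain ⟨p, hpJ, hp⟩ := h.exists_left_ge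
  have hβJ := hs.mem_of_betaStar_le le_rfl hβs
  have hsub : Icc p β ⊆ Jset γm ⊤ := hs.nonlin.conn.out hpJ hβJ
  obtain ⟨B, hB⟩ := isCompact_Icc.exists_bound_of_continuousOn (hs.nonlin.continuousOn_F.mono hsub)
  obtain ⟨D, hD⟩ := isCompact_Icc.exists_bound_of_continuousOn (continuousOn_id (s := Icc p β))
  have hFge : ∀ s, β ≤ s → F f m ≤ F f s := by
    intro s h1
    rcases h1.eq_or_lt with rfl | h2
    · exact hFβ.ge
    · rw [← hFβ]; exact (hs.F_lt_F le_rfl h2 (EReal.coe_lt_top s)).le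
  -- Energy below `F(γ_M)` at time `R` confines `u` to the compact set `[p, β_*]` and bounds `v`,
  -- hence bounds the Pohozaev functional by `M`. Far to the right this functional exceeds `M`.
  set M := 2 * R ^ N * F f m + ((N : ℝ) - 2) * R ^ (N - 1) * (D ^ 2 + 2 * (F f m + B)) with hM
  filter_upwards [hP (M + 1) R, eventually_gt_atTop 0, eventually_ge_atTop (β / θ)]
    with a hPa ha0 haβ
  have hβa : β ≤ θ * a := by
    rw [div_le_iff₀ hθ.1] at haβ; linarith
  have hθa : θ * a < a := by nlinarith [hθ.2]
  have haJ := hs.mem_of_betaStar_le (hβa.trans hθa.le) (EReal.coe_lt_top a)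
  have hSa := hS a haJ ha0.ne'
  by_contra! hcon
  have hFu := (F_le_energy (f := f) (u := U a) (v := V a) R).trans_lt hcon
  have hu : U a R ∈ Icc p β := by
    constructor
    · by_contra! h1
      linarith [hp _ (hSa.mem R hR.le) h1]
    · by_contra! h1
      linarith [hFge _ h1.le]
  rcases hPa R ⟨hR.le, le_rfl⟩ with h1 | h1
  · linarith [h1 R ⟨hR.le, le_rfl⟩, hu.2]
  · have h2 := hB _ hu
    have h3 := hD _ hu
    rw [Real.norm_eq_abs] at h2 h3
    rw [id] at h3
    have hv2 : V a R ^ 2 ≤ 2 * (F f m + B) := by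
      unfold energy at hcon
      linarith [(abs_le.1 h2).1]
    have hu2 : U a R ^ 2 ≤ D ^ 2 := sq_le_sq' (by linarith [(abs_le.1 h3).1]) (abs_le.1 h3).2
    have huv : V a R * U a R ≤ D ^ 2 + 2 * (F f m + B) := by
      nlinarith [sq_nonneg (V a R - U a R), sq_nonneg (V a R), sq_nonneg (U a R)]
    have hRN : 0 < R ^ N := pow_pos hR N
    have h4 : 2 * R ^ N * energy f (U a) (V a) R ≤ 2 * R ^ N * F f m :=
      mul_le_mul_of_nonneg_left hcon.le (by positivity)
    have h5 : ((N : ℝ) - 2) * R ^ (N - 1) * (V a R * U a R) ≤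
        ((N : ℝ) - 2) * R ^ (N - 1) * (D ^ 2 + 2 * (F f m + B)) :=
      mul_le_mul_of_nonneg_left huv (mul_nonneg (by linarith) (pow_nonneg hR.le _))
    have h6 : pohozaev N f (U a) (V a) R = 2 * R ^ N * energy f (U a) (V a) R +
        ((N : ℝ) - 2) * R ^ (N - 1) * (V a R * U a R) := by
      unfold pohozaev; ring
    linarith

end

end BoundState

namespace BoundState

/-! ### Trajectories that stay positive -/

section
variable {N : ℕ} {f : ℝ → ℝ} {J : Set ℝ} {u v : ℝ → ℝ} {δ β X δ₂ β₂ X₂ b C t : ℝ}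

/-- A trajectory that descends at first and is higher later on has turned in between. -/
lemma Traj.exists_turning (h : Traj N f J u v) {a y : ℝ} (ha : 0 < a) (hay : a ≤ y) (hva : v a ≤ 0)
    (hu : u a < u y) :
    ∃ z ∈ Ico a y, v z = 0 ∧ u z ≤ u a ∧ ∀ x ∈ Icc a y, u z ≤ u x := by
  obtain ⟨z, hz, hmin⟩ := isCompact_Icc.exists_isMinOn (nonempty_Icc.2 hay) h.contu.continuousOn
  have hmin' := isMinOn_iff.1 hmin
  have hza := hmin' a (left_mem_Icc.2 hay)
  have hzy : z < y := lt_of_le_of_ne hz.2 fun h1 => by rw [h1] at hza; linarith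
  refine ⟨z, ⟨hz.1, hzy⟩, ?_, hza, hmin'⟩
  rcases hz.1.eq_or_lt with h1 | h1
  · rw [← h1] at hmin' ⊢
    refine le_antisymm hva ?_
    have h2 := (hasDerivAt_iff_tendsto_slope.1 (h.hu a ha)).mono_left (nhdsGT_le_nhdsNE a)
    refine ge_of_tendsto h2 ?_
    filter_upwards [Ioo_mem_nhdsGT (h1.trans_lt hzy)] with x hx
    rw [slope_def_field]
    exact div_nonneg (by linarith [hmin' x (Ioo_subset_Icc_self hx)]) (by linarith [hx.1])
  · have h2 : IsLocalMin u z := by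
      filter_upwards [Ioo_mem_nhds h1 hzy] with x hx using hmin' x (Ioo_subset_Icc_self hx)
    exact h2.hasDerivAt_eq_zero (h.hu z (ha.trans h1))

lemma Traj.v_neg (hN : 2 ≤ N) (h : Traj N f J u v) (hf0 : ∀ x ∈ Ioo 0 t, 0 < f (u x)) :
    ∀ r ∈ Ioc 0 t, v r < 0 := by
  intro r hr
  have hanti : StrictAntiOn (fun x => x ^ (N - 1) * v x) (Icc 0 r) := by
    refine strictAntiOn_of_deriv_neg (convex_Icc 0 r)
      ((continuous_pow _).mul h.contv).continuousOn fun x hx => ?_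
    rw [interior_Icc] at hx
    rw [(h.hasDerivAt_pow_mul hN hx.1).deriv]
    exact neg_neg_of_pos (mul_pos (pow_pos hx.1 _) (hf0 x ⟨hx.1, hx.2.trans_le hr.2⟩))
  have h1 := hanti (left_mem_Icc.2 hr.1.le) (right_mem_Icc.2 hr.1.le) hr.1
  simp only [h.v_zero, mul_zero] at h1
  exact neg_of_mul_neg_right h1 (pow_nonneg hr.1.le _)

/-- Convergence to zero would require the limit `F(0) = 0` not to exceed any later energy. So the
energy could no longer decrease, and the trajectory would be at rest at a positive point. -/
lemma Traj.not_tendsto_of_energy_nonpos (hN : 2 ≤ N) (hf : Nonlin f J) (h : Traj N f J u v)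
    (ht : 0 ≤ t) (hE : energy f u v t ≤ 0) (hu : 0 < u t) : ¬ Tendsto u atTop (𝓝 0) := by
  intro hlim
  by_cases hs : ∃ s, t < s ∧ energy f u v s < energy f u v t
  · obtain ⟨s, hts, hs⟩ := hs
    have h1 : Tendsto (fun r => F f (u r)) atTop (𝓝 (F f 0)) :=
      (hf.continuousAt_F hf.zero_mem).tendsto.comp hlim
    have h2 : F f 0 ≤ energy f u v s := by
      refine le_of_tendsto h1 ?_
      filter_upwards [eventually_ge_atTop s] with r hr
      exact (F_le_energy r).trans (h.energy_le hN hf (ht.trans hts.le) hr)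
    rw [F_zero] at h2
    linarith
  · push Not at hs
    have h1 : ∀ᶠ r in atTop, u r = u t := by
      filter_upwards [eventually_gt_atTop t] with r hr
      exact h.eq_of_v_zero ht hr.le (h.v_zero_of_energy_le hN hf ht hr (hs r hr))
    have h2 := tendsto_nhds_unique (hlim.congr' h1) tendsto_const_nhds
    linarith

/-- The operator `F` is applied twice: `F (F f)` is the primitive of the potential and plays the
role of `Φ` in the barrier below. -/
lemma Nonlin.hasDerivAt_FF (hf : Nonlin f J) {s : ℝ} (hs : s ∈ J) :
    HasDerivAt (F (F f)) (F f s) s := by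
  refine intervalIntegral.integral_hasDerivAt_right
    (hf.continuousOn_F.mono (hf.conn.uIcc_subset hf.zero_mem hs)).intervalIntegrable ?_
    (hf.continuousAt_F hs)
  exact hf.continuousOn_F.stronglyMeasurableAtFilter hf.isOpen s hs

lemma RightWell.integral_abs (hr : RightWell f J δ β X) :
    ∫ s in (0 : ℝ)..β, |F f s| = -F (F f) β := by
  rw [F, ← intervalIntegral.integral_neg]
  refine intervalIntegral.integral_congr fun s hs => ?_
  rw [uIcc_of_le hr.β_pos.le] at hs
  exact abs_of_nonpos (hr.nonpos s hs)

/-- Inside the well `r^(2N-2) E + c Φ(u)` is nonincreasing, where `Φ' = F`, provided that `c` is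
small compared with the speed. -/
lemma Traj.barrier (hN : 2 ≤ N) (hf : Nonlin f J) (hr : RightWell f J δ β X)
    (h : Traj N f J u v) {r W : ℝ} (hr0 : 0 < r) (hrt : r ≤ t) (hW : 0 < W)
    (hu : ∀ x ∈ Icc r t, u x ∈ Icc 0 β) (hv : ∀ x ∈ Icc r t, v x ^ 2 ≤ W ^ 2) :
    t ^ (2 * N - 2) * energy f u v t + 2 * ((N : ℝ) - 1) * r ^ (2 * N - 3) / W * F (F f) (u t) ≤
      r ^ (2 * N - 2) * energy f u v r +
        2 * ((N : ℝ) - 1) * r ^ (2 * N - 3) / W * F (F f) (u r) := by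
  obtain ⟨n, rfl⟩ : ∃ n, N = n + 2 := ⟨N - 2, by omega⟩
  have e1 : 2 * (n + 2) - 2 = 2 * n + 2 := by omega
  have e2 : 2 * (n + 2) - 3 = 2 * n + 1 := by omega
  rw [e1, e2]
  set c := 2 * (((n + 2 : ℕ) : ℝ) - 1) * r ^ (2 * n + 1) with hc
  have hn : (0 : ℝ) < ((n + 2 : ℕ) : ℝ) - 1 := by
    push_cast
    linarith [(Nat.cast_nonneg n : (0 : ℝ) ≤ n)]
  refine le_of_deriv_nonpos
    (g := fun x => x ^ (2 * n + 2) * energy f u v x + c / W * F (F f) (u x))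
    (g' := fun x => 2 * (((n + 2 : ℕ) : ℝ) - 1) * x ^ (2 * n + 1) * F f (u x) +
      c / W * (F f (u x) * v x)) hrt ?_ (fun x hx => ?_) (fun x hx => ?_)
  · refine ((continuous_pow _).continuousOn.mul ((h.continuousOn_energy hf).mono fun x hx =>
      hr0.le.trans hx.1)).add (continuousOn_const.mul fun x hx => ?_)
    exact (ContinuousAt.comp (hf.hasDerivAt_FF (h.mem x (hr0.le.trans hx.1))).continuousAt
      h.contu.continuousAt).continuousWithinAt
  · have hx0 : 0 < x := hr0.trans hx.1
    refine (((hasDerivAt_pow (2 * n + 2) x).mul (h.hasDerivAt_energy hf hx0)).add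
      (((hf.hasDerivAt_FF (h.mem x hx0.le)).comp x (h.hu x hx0)).const_mul (c / W))).congr_deriv ?_
    simp only [energy, show 2 * n + 2 - 1 = 2 * n + 1 from rfl]
    push_cast
    field_simp
    ring
  · have hx' := Ioo_subset_Icc_self hx
    have hF := hr.nonpos _ (hu x hx')
    -- The derivative of `x^(2N-2) E` is `2(N-1) x^(2N-3) F(u)`, which is at most `c F(u)`. Since
    -- `F(u) ≤ 0` and `v ≥ -W`, the second term adds at most `-c F(u)`, so the sum is nonpositive.
    have h1 : c ≤ 2 * (((n + 2 : ℕ) : ℝ) - 1) * x ^ (2 * n + 1) :=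
      mul_le_mul_of_nonneg_left (pow_le_pow_left₀ hr0.le hx.1.le _) (by linarith)
    have h2 : -W ≤ v x := (abs_le.1 (abs_le_of_sq_le_sq (hv x hx') hW.le)).1
    have hc0 : 0 < c := by positivity
    have h3 : F f (u x) * v x ≤ F f (u x) * -W := mul_le_mul_of_nonpos_left h2 hF
    have h4 : c / W * (F f (u x) * v x) ≤ c / W * (F f (u x) * -W) :=
      mul_le_mul_of_nonneg_left h3 (by positivity)
    have h5 : c / W * (F f (u x) * -W) = -(c * F f (u x)) := by field_simp
    have h6 := mul_le_mul_of_nonpos_right h1 hF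
    linarith

/-- If the trajectory enters the well early and with little energy, then it remains positive and
does not tend to zero. -/
lemma Traj.stays_positive (hN : 2 ≤ N) (hf : Nonlin f J) (hr : RightWell f J δ β X) (hX₂ : 0 < X₂)
    (h : Traj N f J u v) {r T I : ℝ} (hr0 : 0 < r) (hur : u r = β)
    (hbefore : ∀ s, 0 ≤ s → s < r → β < u s) (hrT : r ≤ T) (hE : energy f u v r ≤ I)
    (hkey : T * I < √2 * ((N : ℝ) - 1) / √(I + -sInf (F f '' Icc 0 β)) *
      ∫ s in (0 : ℝ)..β, |F f s|) :
    Good f X X₂ 0 u v ∧ ¬ Tendsto u atTop (𝓝 0) := by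
  have hN' : (2 : ℝ) ≤ N := by exact_mod_cast hN
  have hβ := hr.β_pos
  set m := sInf (F f '' Icc 0 β) with hm
  have hbdd : BddBelow (F f '' Icc 0 β) := (isCompact_Icc.image_of_continuousOn
    (hf.continuousOn_F.mono fun s hs => hr.sub hf ⟨hs.1, hs.2.trans hr.lt.le⟩)).bddBelow
  have hmF : ∀ s ∈ Icc 0 β, m ≤ F f s := fun s hs => csInf_le hbdd (mem_image_of_mem _ hs)
  have hm0 : m < 0 := by
    obtain ⟨s, hs, hFs⟩ := hr.dip 0 le_rfl hβ
    linarith [hmF s (Ioo_subset_Icc_self hs)]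
  have hI0 : 0 ≤ I := by
    have := F_le_energy (f := f) (u := u) (v := v) r
    rw [hur, hr.F_eq] at this
    linarith
  rw [hr.integral_abs, ← sub_eq_add_neg] at hkey
  -- `W` bounds the speed in the well, as the energy is at most `I` and the potential at least `m`.
  set W := √2 * √(I - m) with hW
  have hIm : 0 < I - m := by linarith
  have hsq : 0 < √(I - m) := Real.sqrt_pos.2 hIm
  have hs2 : 0 < √(2 : ℝ) := Real.sqrt_pos.2 two_pos
  have hW0 : 0 < W := mul_pos hs2 hsq
  have hW2 : W ^ 2 = 2 * (I - m) := by
    rw [hW, mul_pow, Real.sq_sqrt zero_le_two, Real.sq_sqrt hIm.le]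
  have hkey' : r * I + 2 * ((N : ℝ) - 1) / W * F (F f) β < 0 := by
    have h1 : √2 * ((N : ℝ) - 1) / √(I - m) = 2 * ((N : ℝ) - 1) / W := by
      rw [hW, div_eq_div_iff hsq.ne' (mul_pos hs2 hsq).ne']
      linear_combination ((N : ℝ) - 1) * √(I - m) * Real.mul_self_sqrt (zero_le_two : (0 : ℝ) ≤ 2)
    rw [h1] at hkey
    nlinarith [mul_le_mul_of_nonneg_right hrT hI0]
  have hvr : v r ≤ 0 := nonpos_of_le_left hr0 (h.hu r hr0) fun x hx => by
    rw [hur]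
    exact (hbefore x hx.1.le hx.2).le
  -- the trajectory decreases inside the well unless its energy is nonpositive
  have hlow : ∀ t, r ≤ t → (∀ x ∈ Icc r t, 0 < u x) → β < u t →
      ∃ z, r ≤ z ∧ z ≤ t ∧ u z ∈ Ioc 0 β ∧ energy f u v z ≤ 0 := by
    intro t hrt hpos hβt
    obtain ⟨z, hz, hvz, huz, -⟩ := h.exists_turning hr0 hrt hvr (by rwa [hur])
    rw [hur] at huz
    have hz0 := hpos z ⟨hz.1, hz.2.le⟩
    refine ⟨z, hz.1, hz.2.le, ⟨hz0, huz⟩, ?_⟩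
    simpa [energy, hvz] using hr.nonpos _ ⟨hz0.le, huz⟩
  have hbar : ∀ t, r ≤ t → (∀ x ∈ Icc r t, u x ∈ Icc 0 β) →
      t ^ (2 * N - 2) * energy f u v t +
        2 * ((N : ℝ) - 1) * r ^ (2 * N - 3) / W * F (F f) (u t) ≤
      r ^ (2 * N - 3) * (r * I + 2 * ((N : ℝ) - 1) / W * F (F f) β) := by
    intro t hrt hu
    refine (h.barrier hN hf hr hr0 hrt hW0 hu fun x hx => ?_).trans ?_
    · have h1 := (h.energy_le hN hf hr0.le hx.1).trans hE
      have h2 := hmF _ (hu x hx)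
      unfold energy at h1
      rw [hW2]
      linarith
    · rw [hur]
      have h1 : r ^ (2 * N - 2) = r ^ (2 * N - 3) * r := by rw [← pow_succ]; congr 1; omega
      have h2 := mul_le_mul_of_nonneg_left hE (pow_nonneg hr0.le (2 * N - 2))
      rw [h1] at h2 ⊢
      calc _ ≤ r ^ (2 * N - 3) * r * I + 2 * ((N : ℝ) - 1) * r ^ (2 * N - 3) / W * F (F f) β := by
            linarith
        _ = _ := by ring
  have hneg : r ^ (2 * N - 3) * (r * I + 2 * ((N : ℝ) - 1) / W * F (F f) β) < 0 :=
    mul_neg_of_pos_of_neg (pow_pos hr0 _) hkey'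
  have hpos : ∀ t, r ≤ t → 0 < u t := by
    intro t hrt
    by_contra! hcon
    obtain ⟨t₀, ht₀, -, hut, hbef⟩ := exists_first_hit h.contu hrt (by rw [hur]; exact hβ) hcon
    -- Before reaching zero the trajectory may rise above `β` only after turning with nonpositive
    -- energy, which excludes a zero. Otherwise the barrier applies down to zero, where `Φ = 0`
    -- would leave negative energy.
    by_cases hex : ∃ x, r ≤ x ∧ x ≤ t₀ ∧ β < u x
    · obtain ⟨x, hrx, hxt, hx⟩ := hex
      have hxt' : x < t₀ := lt_of_le_of_ne hxt fun h1 => by rw [h1, hut] at hx; linarith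
      obtain ⟨z, hz, hzx, huz, hEz⟩ := hlow x hrx (fun y hy => hbef y hy.1 (hy.2.trans_lt hxt')) hx
      linarith [h.pos_of_energy_nonpos hN hf (hr0.le.trans hz) hEz huz.1 t₀ (hzx.trans hxt)]
    · push Not at hex
      have hu : ∀ x ∈ Icc r t₀, u x ∈ Icc 0 β := by
        intro x hx
        refine ⟨?_, hex x hx.1 hx.2⟩
        rcases hx.2.lt_or_eq with h1 | h1
        · exact (hbef x hx.1 h1).le
        · rw [h1, hut]
      have h1 := hbar t₀ ht₀.le hu
      rw [hut, F_zero, mul_zero, add_zero] at h1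
      have h2 : 0 ≤ energy f u v t₀ := by
        unfold energy
        rw [hut, F_zero]
        positivity
      linarith [mul_nonneg (pow_nonneg (hr0.trans ht₀).le (2 * N - 2)) h2]
  have hall : ∀ t, 0 ≤ t → 0 < u t := by
    intro t ht
    rcases lt_or_ge t r with h1 | h1
    · exact hβ.trans (hbefore t ht h1)
    · exact hpos t h1
  have hnosign : ¬ SignChangesAtLeast u (0 + 1) := by
    rintro ⟨x, -, hx0, hsign⟩
    linarith [hsign 0, mul_pos (hall _ (hx0 (Fin.castSucc 0)).le) (hall _ (hx0 (Fin.succ 0)).le)]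
  by_cases hex : ∃ z, r ≤ z ∧ u z ∈ Ioc 0 β ∧ energy f u v z ≤ 0
  · obtain ⟨z, hz, huz, hEz⟩ := hex
    exact ⟨⟨hnosign, fun e he => ⟨z, hr0.le.trans hz, hEz.trans_lt he,
      ⟨by linarith [huz.1], huz.2.trans_lt hr.lt⟩⟩⟩,
      h.not_tendsto_of_energy_nonpos hN hf (hr0.le.trans hz) hEz huz.1⟩
  · have hu : ∀ x, r ≤ x → u x ∈ Icc 0 β := fun x hx =>
      ⟨(hpos x hx).le, not_lt.1 fun h1 => by
        obtain ⟨z, hz, -, hz'⟩ := hlow x hx (fun y hy => hpos y hy.1) h1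
        exact hex ⟨z, hz, hz'⟩⟩
    refine ⟨⟨hnosign, fun e he => ?_⟩, fun hlim => hex ?_⟩
    · obtain ⟨z, hz, hEz⟩ := h.exists_energy_lt_of_nonpos hN hf hr0.le
        (fun x hx => hr.nonpos _ (hu x hx)) he
      exact ⟨z, hr0.le.trans hz, hEz, ⟨by linarith [hpos z hz], (hu z hz).2.trans_lt hr.lt⟩⟩
    -- Convergence to zero makes the `Φ` term vanish in the limit, so the barrier leaves negative
    -- energy at a late time.
    · have h1 : Tendsto (fun x => F (F f) (u x)) atTop (𝓝 (F (F f) 0)) :=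
        (hf.hasDerivAt_FF hf.zero_mem).continuousAt.tendsto.comp hlim
      rw [F_zero] at h1
      have h2 := h1.const_mul (2 * ((N : ℝ) - 1) * r ^ (2 * N - 3) / W)
      rw [mul_zero] at h2
      obtain ⟨z, hz, hrz⟩ := ((h2.eventually (lt_mem_nhds hneg)).and
        (eventually_ge_atTop r)).exists
      refine ⟨z, hrz, ⟨hpos z hrz, (hu z hrz).2⟩, ?_⟩
      have h3 := hbar z hrz fun x hx => hu x hx.1
      have h4 : z ^ (2 * N - 2) * energy f u v z < 0 := by linarith
      exact (neg_of_mul_neg_right h4 (pow_nonneg (hr0.le.trans hrz) _)).le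

end

end BoundState

namespace BoundState

/-! ### The critical initial value -/

section
variable {N : ℕ} {f : ℝ → ℝ} {J : Set ℝ} {b C T : ℝ} {u v : ℝ → ℝ}

/-- While a trajectory descends from `b` to `β`, its energy remains close to `F(b)`. -/
lemma Traj.energy_ge_of_descending (hN : 2 ≤ N) (hf : Nonlin f J) (h : Traj N f J u v)
    {β W t : ℝ} (hC : 0 < C) (hCt : C ≤ t) (hW : 0 ≤ W) (huC : u C = b)
    (hv : ∀ x ∈ Icc C t, v x ≤ 0) (hut : β ≤ u t)
    (hF : ∀ s ∈ Icc β b, 2 * (F f b - F f s) ≤ W ^ 2) :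
    F f b - ((N : ℝ) - 1) * W / C * (b - β) ≤ energy f u v t := by
  have hN' : (2 : ℝ) ≤ N := by exact_mod_cast hN
  have hanti := h.antitoneOn hC.le hv
  have hcoef : 0 ≤ ((N : ℝ) - 1) * W / C := div_nonneg (mul_nonneg (by linarith) hW) hC.le
  have hmem : ∀ x ∈ Icc C t, u x ∈ Icc β b := fun x hx =>
    ⟨hut.trans (hanti hx (right_mem_Icc.2 hCt) hx.2), by
      rw [← huC]; exact hanti (left_mem_Icc.2 hCt) hx hx.1⟩
  have hβb : 0 ≤ b - β := by
    have := hmem C (left_mem_Icc.2 hCt)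
    linarith [this.1, this.2]
  rcases le_total (F f b) (energy f u v t) with h1 | h1
  · linarith [mul_nonneg hcoef hβb]
  have hE := (h.continuousOn_energy hf).mono fun x (hx : x ∈ Icc C t) => hC.le.trans hx.1
  have hEC : F f b ≤ energy f u v C := by rw [← huC]; exact F_le_energy C
  -- The bound `W` on the speed is available only while the energy is at most `F(b)`, so the loss is
  -- counted from a time at which the energy equals `F(b)`.
  obtain ⟨τ, hτ, hEτ⟩ := intermediate_value_Icc' hCt hE ⟨h1, hEC⟩
  have hτ0 : 0 < τ := hC.trans_le hτ.1
  have hg := ge_of_deriv_nonneg (g := fun x => energy f u v x - ((N : ℝ) - 1) * W / C * u x)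
    (g' := fun x => -(((N : ℝ) - 1) / x * v x ^ 2) - ((N : ℝ) - 1) * W / C * v x) hτ.2
    ((hE.mono (Icc_subset_Icc_left hτ.1)).sub (continuousOn_const.mul h.contu.continuousOn))
    (fun x hx => (h.hasDerivAt_energy hf (hτ0.trans hx.1)).sub
      ((h.hu x (hτ0.trans hx.1)).const_mul _)) (fun x hx => ?_)
  · have h2 := (hmem τ hτ).2
    have h3 : ((N : ℝ) - 1) * W / C * (u τ - u t) ≤ ((N : ℝ) - 1) * W / C * (b - β) :=
      mul_le_mul_of_nonneg_left (by linarith) hcoef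
    linarith
  · have hx' : x ∈ Icc C t := ⟨hτ.1.trans hx.1.le, hx.2.le⟩
    have hx0 : 0 < x := hτ0.trans hx.1
    have h2 := (h.energy_le hN hf hτ0.le hx.1.le).trans_eq hEτ
    have h3 := hF _ (hmem x hx')
    have h4 : v x ^ 2 ≤ W ^ 2 := by unfold energy at h2; linarith
    have h5 : -W ≤ v x := (abs_le.1 (abs_le_of_sq_le_sq h4 hW)).1
    have h6 : -v x / x ≤ W / C := div_le_div₀ hW (by linarith) hC hx'.1
    have h7 : 0 ≤ ((N : ℝ) - 1) * -v x * (W / C - -v x / x) :=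
      mul_nonneg (mul_nonneg (by linarith) (by linarith [hv x hx'])) (by linarith)
    calc 0 ≤ _ := h7
      _ = _ := by ring

/-- Lower bound for the speed of descent where `f ≥ κ`. -/
lemma Traj.v_le_of_le_f (hN : 2 ≤ N) (h : Traj N f J u v) {κ t : ℝ} (hC : 0 < C) (hCt : C ≤ t)
    (hκ : 0 ≤ κ) (hvC : v C ≤ 0) (hf0 : ∀ x ∈ Ioo C t, κ ≤ f (u x)) :
    v t ≤ -(κ / N * (t - C)) := by
  have hN0 : (0 : ℝ) < N := by positivity
  have hg := le_of_deriv_nonpos (g := fun x => x ^ (N - 1) * v x + κ / N * x ^ N)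
    (g' := fun x => x ^ (N - 1) * (κ - f (u x))) hCt ?_ (fun x hx => ?_) (fun x hx => ?_)
  · have ht : 0 < t := hC.trans_le hCt
    have hp : 0 < t ^ (N - 1) := pow_pos ht _
    have h1 : ∀ y : ℝ, y ^ N = y ^ (N - 1) * y := fun y => by
      rw [← pow_succ]; congr 1; omega
    have h2 : C ^ (N - 1) * v C ≤ 0 :=
      mul_nonpos_of_nonneg_of_nonpos (pow_nonneg hC.le _) hvC
    have h3 : C ^ N ≤ t ^ (N - 1) * C := by
      rw [h1 C]
      exact mul_le_mul_of_nonneg_right (pow_le_pow_left₀ hC.le hCt _) hC.le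
    have h4 : κ / N * C ^ N ≤ κ / N * (t ^ (N - 1) * C) :=
      mul_le_mul_of_nonneg_left h3 (div_nonneg hκ hN0.le)
    rw [h1 t] at hg
    have h5 : t ^ (N - 1) * (v t + κ / N * (t - C)) ≤ 0 := by
      calc _ = t ^ (N - 1) * v t + κ / N * (t ^ (N - 1) * t) - κ / N * (t ^ (N - 1) * C) := by ring
        _ ≤ 0 := by linarith
    linarith [nonpos_of_mul_nonpos_right h5 hp]
  · have := h.contv
    fun_prop
  · refine ((h.hasDerivAt_pow_mul hN (hC.trans hx.1)).add
      ((hasDerivAt_pow N x).const_mul (κ / N))).congr_deriv ?_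
    field_simp
    ring
  · exact mul_nonpos_of_nonneg_of_nonpos (pow_nonneg (hC.trans hx.1).le _)
      (by linarith [hf0 x hx])

/-- Time needed to descend from `b` to `β` at an energy level that is not too small. -/
lemma Traj.exists_le_of_descending (hN : 2 ≤ N) (hf : Nonlin f J) (h : Traj N f J u v)
    {β βs e κ W : ℝ} (hC : 0 < C) (huC : u C = b) (hvC : v C < 0) (hβ : β < βs) (hβb : βs < b)
    (hκ : 0 < κ) (hf0 : ∀ s ∈ Icc βs b, κ ≤ f s) (he : e < F f b)
    (hFe : ∀ s ∈ Icc β βs, F f s ≤ e) (hW : 0 ≤ W)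
    (hFW : ∀ s ∈ Icc β b, 2 * (F f b - F f s) ≤ W ^ 2)
    (hCW : ((N : ℝ) - 1) * W / C * (b - β) = (F f b - e) / 2) :
    ∃ t ∈ Icc C (C + ((βs - β) / √(F f b - e) + √(2 * N * (b - βs) / κ))), u t ≤ β := by
  have hN0 : (0 : ℝ) < N := by positivity
  set D := √(F f b - e) with hD
  have hD0 : 0 < D := Real.sqrt_pos.2 (by linarith)
  have hD2 : D ^ 2 = F f b - e := Real.sq_sqrt (by linarith)
  set t₁ := √(2 * N * (b - βs) / κ) with ht₁
  have ht₁0 : 0 ≤ t₁ := Real.sqrt_nonneg _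
  have ht₁2 : t₁ ^ 2 = 2 * N * (b - βs) / κ :=
    Real.sq_sqrt (div_nonneg (mul_nonneg (by positivity) (by linarith)) hκ.le)
  have ht₂ : 0 < (βs - β) / D := div_pos (by linarith) hD0
  set T := C + ((βs - β) / D + t₁) with hT
  have hCT : C < T := by linarith
  by_contra! hgt
  -- By `hCW`, friction consumes at most half of the gap `F(b) - e` during a descent after time `C`.
  have hmid : ∀ t ∈ Icc C T, (∀ x ∈ Icc C t, v x ≤ 0) → (F f b + e) / 2 ≤ energy f u v t := by
    intro t ht hv
    have := h.energy_ge_of_descending hN hf hC ht.1 hW huC hv (hgt t ht).le hFW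
    linarith
  -- The trajectory cannot turn: below `βs` the potential is at most `e` and the energy is larger;
  -- above `βs` the force `f ≥ κ` keeps pushing it down.
  have hvneg : ∀ t ∈ Icc C T, v t < 0 := by
    intro t ht
    by_contra! hcon
    obtain ⟨y, hCy, hyt, hvy, hbef⟩ := exists_first_hit (u := fun x => -v x) h.contv.neg ht.1
      (by linarith : (0 : ℝ) < -v C) (by linarith : -v t ≤ 0)
    have hyT : y ∈ Icc C T := ⟨hCy.le, hyt.trans ht.2⟩
    have hvle : ∀ x ∈ Icc C y, v x ≤ 0 := by
      intro x hx
      rcases hx.2.lt_or_eq with h1 | h1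
      · linarith [hbef x hx.1 h1]
      · rw [h1]; linarith
    have hvy0 : v y = 0 := by linarith
    have hE := hmid y hyT hvle
    have hanti := h.antitoneOn hC.le hvle
    rcases le_total (u y) βs with h1 | h1
    · have h2 := hFe _ ⟨(hgt y hyT).le, h1⟩
      unfold energy at hE
      rw [hvy0] at hE
      linarith
    · have h2 := h.v_le_of_le_f hN hC hCy.le hκ.le hvC.le fun x hx => by
        have hx' := Ioo_subset_Icc_self hx
        refine hf0 _ ⟨h1.trans (hanti hx' (right_mem_Icc.2 hCy.le) hx'.2), ?_⟩
        rw [← huC]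
        exact hanti (left_mem_Icc.2 hCy.le) hx' hx'.1
      have h3 : 0 < κ / N * (y - C) := mul_pos (div_pos hκ hN0) (by linarith)
      linarith
  have hanti := h.antitoneOn hC.le fun x hx => (hvneg x hx).le
  have hub : ∀ x ∈ Icc C T, u x ≤ b := fun x hx => by
    rw [← huC]; exact hanti (left_mem_Icc.2 hCT.le) hx hx.1
  have hC₁ : C + t₁ ∈ Icc C T := ⟨by linarith, by linarith⟩
  -- With acceleration at least `κ/N` the fall from `b` to `βs` takes at most `t₁`. The remaining
  -- way to `β` is covered at speed at least `D`, since there `v² ≥ F(b) - e`.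
  have hu₁ : u (C + t₁) ≤ βs := by
    by_contra! hcon
    have hκv : ∀ t ∈ Ioo C (C + t₁), v t ≤ -(κ / N * (t - C)) := fun t ht =>
      h.v_le_of_le_f hN hC ht.1.le hκ.le hvC.le fun x hx => by
        have hxT : x ∈ Icc C T := ⟨hx.1.le, by linarith [hx.2, ht.2, hC₁.2]⟩
        exact hf0 _ ⟨hcon.le.trans (hanti hxT hC₁ (by linarith [hx.2, ht.2])), hub x hxT⟩
    have := le_of_deriv_nonpos (g := fun x => u x + κ / (2 * N) * (x - C) ^ 2)
      (g' := fun x => v x + κ / N * (x - C)) hC₁.1 ?_ (fun x hx => ?_) (fun x hx => ?_)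
    · simp only [sub_self, add_sub_cancel_left] at this
      rw [ht₁2, huC] at this
      have h1 : κ / (2 * N) * (2 * N * (b - βs) / κ) = b - βs := by field_simp
      rw [h1] at this
      norm_num at this
      linarith
    · have := h.contu
      fun_prop
    · refine ((h.hu x (hC.trans hx.1)).add
        ((((hasDerivAt_id x).sub_const C).pow 2).const_mul (κ / (2 * N)))).congr_deriv ?_
      simp
      field_simp
    · linarith [hκv x hx]
  have hfinal := le_of_deriv_nonpos (g := fun x => u x + D * x) (g' := fun x => v x + D)
    (hC₁.2) ?_ (fun x hx => ?_) (fun x hx => ?_)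
  · have h1 : D * T - D * (C + t₁) = βs - β := by
      rw [hT]; field_simp; ring
    linarith [hgt T ⟨hCT.le, le_rfl⟩]
  · have := h.contu
    fun_prop
  · exact ((h.hu x (hC.trans_le (hC₁.1.trans hx.1.le))).add
      ((hasDerivAt_id x).const_mul D)).congr_deriv (by simp)
  · have hxT : x ∈ Icc C T := ⟨hC₁.1.trans hx.1.le, hx.2.le⟩
    have hE := hmid x hxT fun y hy => (hvneg y ⟨hy.1, hy.2.trans hxT.2⟩).le
    have hFx := hFe (u x) ⟨(hgt x hxT).le, (hanti hC₁ hxT hx.1.le).trans hu₁⟩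
    have h1 : D ^ 2 ≤ (-v x) ^ 2 := by
      unfold energy at hE
      rw [hD2, neg_sq]
      linarith
    linarith [(abs_le.1 (abs_le_of_sq_le_sq h1 (neg_nonneg.2 (hvneg x hxT).le))).2]

/-- On a time interval of length one between the levels `b` and `β`, the speed is at most
`b - β` at some time at which the trajectory is below `b`. -/
lemma Traj.exists_slow (h : Traj N f J u v) {β t : ℝ} (ht : 0 < t) (htT : t + 1 ≤ T)
    (hut : u t = b) (hvt : v t ≤ 0) (hβ : ∀ x ∈ Icc t T, β ≤ u x) :
    ∃ y ∈ Icc t T, |v y| ≤ b - β ∧ u y ≤ b := by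
  have hβb : β ≤ b := by rw [← hut]; exact hβ t ⟨le_rfl, by linarith⟩
  by_cases hex : ∃ x ∈ Icc t T, b < u x
  · obtain ⟨x, hx, hbx⟩ := hex
    obtain ⟨z, hz, hvz, huz, -⟩ := h.exists_turning ht hx.1 hvt (by rwa [hut])
    exact ⟨z, ⟨hz.1, hz.2.le.trans hx.2⟩, by rw [hvz, abs_zero]; linarith, by rwa [hut] at huz⟩
  · push Not at hex
    obtain ⟨y, hy, hvy⟩ := exists_hasDerivAt_eq_slope u v (by linarith : t < T)
      h.contu.continuousOn fun x hx => h.hu x (ht.trans hx.1)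
    have hy' := Ioo_subset_Icc_self hy
    refine ⟨y, hy', ?_, hex y hy'⟩
    have h1 := hβ T ⟨by linarith, le_rfl⟩
    have h2 := hex T ⟨by linarith, le_rfl⟩
    rw [hvy, hut, abs_div, abs_of_pos (by linarith : 0 < T - t), div_le_iff₀ (by linarith),
      abs_of_nonpos (by linarith)]
    nlinarith

/-- After a downward crossing the trajectory is below the level. -/
lemma Traj.exists_lt_right (h : Traj N f J u v) {t : ℝ} (ht : 0 < t) (hv : v t < 0)
    (hu : 0 < u t) (htT : t < T) : ∃ s ∈ Ioo t T, u s < u t ∧ ∀ x ∈ Icc t s, 0 < u x := by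
  have h1 := ((hasDerivAt_iff_tendsto_slope.1 (h.hu t ht)).mono_left
    (nhdsGT_le_nhdsNE t)).eventually (gt_mem_nhds hv)
  obtain ⟨ε, hε, hpos⟩ := exists_Icc_of_eventually
    (h.contu.continuousAt.eventually (lt_mem_nhds hu))
  obtain ⟨s, hs, hsI⟩ := (h1.and (Ioo_mem_nhdsGT (lt_min htT (by linarith : t < t + ε)))).exists
  rw [slope_def_field] at hs
  refine ⟨s, ⟨hsI.1, hsI.2.trans_le (min_le_left _ _)⟩, ?_, fun x hx => hpos x ?_⟩
  · by_contra! hcon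
    linarith [div_nonneg (by linarith : 0 ≤ u s - u t) (by linarith [hsI.1] : 0 ≤ s - t)]
  · have := hsI.2.trans_le (min_le_right T (t + ε))
    exact ⟨by linarith [hx.1], by linarith [hx.2]⟩

end

end BoundState

/-! ### Critical and minimal initial values. -/

namespace BoundState

section
variable {N : ℕ} {f : ℝ → ℝ} {J : Set ℝ} {γm γs : EReal} {δ X δ₂ β₂ X₂ α β b c C R T : ℝ}
  {u v : ℝ → ℝ} {U V : ℝ → ℝ → ℝ} {k : ℕ}

lemma Sol.eventually_above (hN : 2 ≤ N) (hf : Nonlin f J) (hc : Confining f J)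
    (hS : ∀ a ∈ J, a ≠ 0 → Sol N f J a (U a) (V a)) (hα : α ∈ J) (h0 : α ≠ 0) (hc0 : 0 ≤ c)
    (habove : ∀ r ∈ Icc 0 R, c < U α r) : ∀ᶠ a in 𝓝 α, ∀ r ∈ Icc 0 R, c < U a r := by
  rcases lt_or_ge R 0 with hR | hR
  · exact Eventually.of_forall fun a r hr => absurd (hr.1.trans hr.2) (not_le.2 hR)
  obtain ⟨z, hz, hmin⟩ := isCompact_Icc.exists_isMinOn (nonempty_Icc.2 hR)
    (hS α hα h0).contu.continuousOn
  filter_upwards [Sol.continuous_dependence hN hf hc hS hα h0 (R := R)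
    (fun r hr h1 => by linarith [habove r ⟨hr.1, hr.2.le⟩, h1.1])
    (sub_pos.2 (habove z hz))] with a ha r hr
  have h1 := (abs_lt.1 (ha r hr).1).1
  have h2 := isMinOn_iff.1 hmin r hr
  linarith

lemma Sol.eventually_below (hN : 2 ≤ N) (hf : Nonlin f J) (hc : Confining f J)
    (hS : ∀ a ∈ J, a ≠ 0 → Sol N f J a (U a) (V a)) (hα : α ∈ J) (h0 : α ≠ 0) (hR : 0 ≤ R)
    (hpos : ∀ r ∈ Icc 0 R, 0 < U α r) (hlt : U α R < c) : ∀ᶠ a in 𝓝 α, U a R < c :=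
  (Sol.tendsto hN hf hc hS hα h0 hR fun r hr h1 => by
    linarith [hpos r ⟨hr.1, hr.2.le⟩, h1.1]).1.eventually (gt_mem_nhds hlt)

lemma Setting.exists_flow (h : Setting f γm γs δ) (hN : 2 ≤ N) : ∃ U V : ℝ → ℝ → ℝ,
    ∀ a ∈ Jset γm γs, a ≠ 0 → Sol N f (Jset γm γs) a (U a) (V a) := by
  have hex : ∀ a, ∃ u v, a ∈ Jset γm γs → a ≠ 0 → Sol N f (Jset γm γs) a u v := by
    intro a
    by_cases ha : a ∈ Jset γm γs ∧ a ≠ 0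
    · obtain ⟨u, v, hs⟩ := exists_sol hN h.nonlin h.confining ha.1 ha.2
      exact ⟨u, v, fun _ _ => hs⟩
    · exact ⟨0, 0, fun h1 h2 => absurd ⟨h1, h2⟩ ha⟩
  choose U V hS using hex
  exact ⟨U, V, hS⟩

lemma Setting.F_le_of_le (h : Setting f γm γs δ) (hb : betaStar f γs < b) (hbs : (b : EReal) < γs)
    {s : ℝ} (hs : s ∈ Icc 0 b) : F f s ≤ F f b := by
  obtain ⟨-, -, hFβ, hmax, -⟩ := h.betaStar_props
  rcases le_or_gt s (betaStar f γs) with h1 | h1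
  · exact (hmax s ⟨hs.1, h1⟩).trans (hFβ.ge.trans (h.F_lt_F le_rfl hb hbs).le)
  · rcases hs.2.eq_or_lt with h2 | h2
    · rw [h2]
    · exact (h.F_lt_F h1.le h2 hbs).le

lemma Setting.sInf_F_le (h : Setting f γm γs δ) (hr : RightWell f (Jset γm γs) δ (beta1 f γs) X)
    (hβ : beta1 f γs < betaStar f γs) (hbs : (b : EReal) < γs) {s : ℝ}
    (hs : s ∈ Icc (beta1 f γs) b) :
    sInf (F f '' Icc (beta1 f γs) (betaStar f γs)) ≤ F f s := by
  obtain ⟨-, hβs, -, -, -⟩ := h.betaStar_props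
  have hbdd : BddBelow (F f '' Icc (beta1 f γs) (betaStar f γs)) :=
    (isCompact_Icc.image_of_continuousOn (h.nonlin.continuousOn_F.mono fun x hx =>
      h.J_of_le (hr.β_pos.le.trans hx.1) hx.2 hβs)).bddBelow
  rcases le_or_gt s (betaStar f γs) with h1 | h1
  · exact csInf_le hbdd (mem_image_of_mem _ ⟨hs.1, h1⟩)
  · exact (csInf_le hbdd (mem_image_of_mem _ (right_mem_Icc.2 hβ.le))).trans
      (h.F_lt_F le_rfl h1 ((EReal.coe_le_coe_iff.2 hs.2).trans_lt hbs)).le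

lemma Setting.Cbar_pos (h : Setting f γm γs δ) (hN : 2 ≤ N)
    (hr : RightWell f (Jset γm γs) δ (beta1 f γs) X) (hβ : beta1 f γs < betaStar f γs)
    (hb : betaStar f γs < b) (hbs : (b : EReal) < γs) : 0 < Cbar N f γs b := by
  have hN' : (2 : ℝ) ≤ N := by exact_mod_cast hN
  have hFb := h.F_lt_F le_rfl hb hbs
  rw [h.betaStar_props.2.2.1] at hFb
  have hM := h.gammaM_props.2.2.2.1
  have h1 := h.sInf_F_le hr hβ hbs ⟨le_rfl, (hβ.trans hb).le⟩
  rw [hr.F_eq] at h1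
  refine mul_pos (mul_pos (by linarith) (div_pos (by linarith) (by linarith)))
    (Real.sqrt_pos.2 (by linarith))

/-- A trajectory which descends through `b` at the time `C̄` reaches `β_1` soon. -/
lemma Setting.exists_le_beta1 (h : Setting f γm γs δ) (hN : 2 ≤ N)
    (hr : RightWell f (Jset γm γs) δ (beta1 f γs) X) (hβ : beta1 f γs < betaStar f γs)
    (hb : betaStar f γs < b) (hbs : (b : EReal) < γs) (hT : Traj N f (Jset γm γs) u v)
    (hu : u (Cbar N f γs b) = b) (hv : v (Cbar N f γs b) < 0) :
    ∃ t ∈ Icc (Cbar N f γs b) (Cbar N f γs b + constA1 N f γs b), u t ≤ beta1 f γs := by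
  have hN' : (2 : ℝ) ≤ N := by exact_mod_cast hN
  have hC := h.Cbar_pos hN hr hβ hb hbs
  obtain ⟨-, hβs, hFβ, hmax, hfpos⟩ := h.betaStar_props
  have hFb := h.F_lt_F le_rfl hb hbs
  rw [hFβ] at hFb
  have hcf : ContinuousOn f (Icc (betaStar f γs) b) := h.nonlin.cont.mono fun s hs =>
    h.mem_of_betaStar_le hs.1 ((EReal.coe_le_coe_iff.2 hs.2).trans_lt hbs)
  have hcomp := isCompact_Icc.image_of_continuousOn hcf
  have hκ : 0 < sInf (f '' Icc (betaStar f γs) b) := by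
    obtain ⟨s, hs, hs'⟩ := hcomp.sInf_mem ((nonempty_Icc.2 hb.le).image f)
    rw [← hs']
    exact hfpos s hs.1 ((EReal.coe_le_coe_iff.2 hs.2).trans_lt hbs)
  set m := sInf (F f '' Icc (beta1 f γs) (betaStar f γs)) with hm
  have hmF := fun s => h.sInf_F_le (s := s) hr hβ hbs
  have hmb : m ≤ F f b := hmF b ⟨(hβ.trans hb).le, le_rfl⟩
  refine hT.exists_le_of_descending hN h.nonlin (W := √(2 * (F f b - m))) hC hu hv hβ hb hκ
    (fun s hs => csInf_le hcomp.bddBelow (mem_image_of_mem _ hs)) hFb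
    (fun s hs => hmax s ⟨hr.β_pos.le.trans hs.1, hs.2⟩) (Real.sqrt_nonneg _) (fun s hs => ?_) ?_
  · rw [Real.sq_sqrt (by linarith)]
    linarith [hmF s hs]
  -- The constant `C̄` is defined exactly so that the friction loss on the way from `b` to `β₁`
  -- equals half of `F(b) - F(γ_M)`.
  · have hd : 0 < F f b - F f (gammaM f γs) := by linarith
    have hbβ : 0 < b - beta1 f γs := by linarith
    have hCdef : Cbar N f γs b = 2 * ((N : ℝ) - 1) *
      ((b - beta1 f γs) / (F f b - F f (gammaM f γs))) * √(2 * (F f b - m)) := rfl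
    have hw : √(2 * (F f b - m)) ≠ 0 := fun h0 => by
      rw [hCdef, h0, mul_zero] at hC
      exact lt_irrefl _ hC
    have hN1 : (N : ℝ) - 1 ≠ 0 := by linarith
    rw [hCdef]
    field_simp

/-- The smallest initial value above `b` from which the trajectory stays above `b` up to time `C`
reaches `b` exactly at time `C`. -/
lemma Setting.exists_critical (h : Setting f γm γs δ) (hN : 2 ≤ N)
    (hS : ∀ a ∈ Jset γm γs, a ≠ 0 → Sol N f (Jset γm γs) a (U a) (V a))
    (hb : betaStar f γs < b) (hC : 0 < C) {a₀ : ℝ} (ha₀ : b ≤ a₀) (ha₀s : (a₀ : EReal) < γs)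
    (habove : ∀ r ∈ Icc 0 C, b < U a₀ r) :
    ∃ α, b ≤ α ∧ (α : EReal) < γs ∧ U α C = b ∧ V α C < 0 ∧
      ∀ a ∈ Icc b α, ∃ t ∈ Icc 0 C, U a t ≤ b := by
  have hb0 : 0 < b := h.betaStar_pos.trans hb
  set S := {a | a ∈ Icc b a₀ ∧ ∀ r ∈ Icc 0 C, b < U a r} with hSdef
  have hne : S.Nonempty := ⟨a₀, ⟨ha₀, le_rfl⟩, habove⟩
  have hbdd : BddBelow S := ⟨b, fun a ha => ha.1.1⟩
  set α := sInf S with hα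
  have hbα : b ≤ α := le_csInf hne fun a ha => ha.1.1
  have hαa : α ≤ a₀ := csInf_le hbdd ⟨⟨ha₀, le_rfl⟩, habove⟩
  have hαs : (α : EReal) < γs := (EReal.coe_le_coe_iff.2 hαa).trans_lt ha₀s
  have hαJ := h.mem_of_betaStar_le (hb.le.trans hbα) hαs
  have hα0 : α ≠ 0 := (hb0.trans_le hbα).ne'
  have hSα := hS α hαJ hα0
  have hfreq : ∃ᶠ a in 𝓝 α, a ∈ S := mem_closure_iff_frequently.1 (csInf_mem_closure hne hbdd)
  have hhit : ∃ t ∈ Icc 0 C, U α t ≤ b := by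
    by_contra! hcon
    have hbα' : b < α := by
      have := hcon 0 ⟨le_rfl, hC.le⟩
      rwa [hSα.init] at this
    have h1 := (Sol.eventually_above hN h.nonlin h.confining hS hαJ hα0 hb0.le hcon).filter_mono
      (nhdsWithin_le_nhds (s := Iio α))
    obtain ⟨a, ha, haI⟩ := (h1.and (Ioo_mem_nhdsLT hbα')).exists
    have : α ≤ a := csInf_le hbdd ⟨⟨haI.1.le, haI.2.le.trans hαa⟩, ha⟩
    linarith [haI.2]
  -- As an infimum, `α` is a limit of values whose trajectories stay above `b`. Positivity up to `s`
  -- excludes a double zero, which continuous dependence needs.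
  have hnobelow : ∀ s ∈ Icc 0 C, (∀ r ∈ Icc 0 s, 0 < U α r) → b ≤ U α s := by
    intro s hs hpos
    by_contra! hcon
    obtain ⟨a, haS, ha⟩ := (hfreq.and_eventually (Sol.eventually_below hN h.nonlin h.confining hS
      hαJ hα0 hs.1 hpos hcon)).exists
    linarith [haS.2 s hs]
  -- `u` stays above `β_*` before it falls below `b`, hence is strictly decreasing
  have hge : ∀ s ∈ Icc 0 C, b ≤ U α s := by
    by_contra! hcon
    obtain ⟨s, hs, hus⟩ := hcon
    have hmid : (betaStar f γs + b) / 2 < b := by linarith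
    set d := max (U α s) ((betaStar f γs + b) / 2) with hd
    have hdb : d < b := max_lt hus hmid
    have hd0 : 0 < d := by
      have := le_max_right (U α s) ((betaStar f γs + b) / 2)
      linarith [h.betaStar_pos]
    obtain ⟨t, ht0, hts, hut, hbef⟩ := exists_first_hit hSα.contu hs.1
      (by rw [hSα.init]; exact hdb.trans_le hbα) (le_max_left (U α s) _ : U α s ≤ d)
    have := hnobelow t ⟨ht0.le, hts.trans hs.2⟩ fun r hr => by
      rcases hr.2.lt_or_eq with h1 | h1
      · exact hd0.trans (hbef r hr.1 h1)
      · rw [h1, hut]; exact hd0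
    linarith
  have hvneg := hSα.toTraj.v_neg hN (t := C) fun x hx =>
    h.betaStar_props.2.2.2.2 _ (hb.le.trans (hge x (Ioo_subset_Icc_self hx)))
      (hSα.mem x hx.1.le).2
  have hanti := hSα.toTraj.antitoneOn le_rfl fun r hr =>
    hSα.toTraj.v_nonpos hN (t := C) (fun x hx => (h.betaStar_props.2.2.2.2 _
      (hb.le.trans (hge x (Ioo_subset_Icc_self hx))) (hSα.mem x hx.1.le).2).le) r hr
  obtain ⟨t, ht, hut⟩ := hhit
  have hCI := right_mem_Icc.2 hC.le
  refine ⟨α, hbα, hαs, le_antisymm ((hanti ht hCI ht.2).trans hut) (hge C hCI),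
    hvneg C ⟨hC, le_rfl⟩, fun a ha => ?_⟩
  rcases ha.2.lt_or_eq with h1 | h1
  · by_contra! hcon
    have : α ≤ a := csInf_le hbdd ⟨⟨ha.1, h1.le.trans hαa⟩, hcon⟩
    linarith
  · rw [h1]
    exact ⟨t, ht, hut⟩

/-- Among the initial values from `b` on for which the trajectory falls to the level `β` up to
time `T`, the smallest one is `b`, or the level is reached exactly at time `T`, or it is
reached with vanishing speed. -/
lemma Setting.exists_minimal (h : Setting f γm γs δ) (hN : 2 ≤ N)
    (hS : ∀ a ∈ Jset γm γs, a ≠ 0 → Sol N f (Jset γm γs) a (U a) (V a))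
    (hb : betaStar f γs < b) (hβ0 : 0 < β) (hβb : β < b) {a₀ : ℝ} (ha₀ : b ≤ a₀)
    (ha₀s : (a₀ : EReal) < γs) (hhit : ∃ t ∈ Icc 0 T, U a₀ t ≤ β) :
    ∃ α ∈ Icc b a₀, ∃ r, 0 < r ∧ r ≤ T ∧ U α r = β ∧ (∀ s, 0 ≤ s → s < r → β < U α s) ∧
      (α = b ∨ r = T ∨ V α r = 0) := by
  have hb0 : 0 < b := hβ0.trans hβb
  set S := {a | a ∈ Icc b a₀ ∧ ∃ t ∈ Icc 0 T, U a t ≤ β} with hSdef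
  have hne : S.Nonempty := ⟨a₀, ⟨ha₀, le_rfl⟩, hhit⟩
  have hbdd : BddBelow S := ⟨b, fun a ha => ha.1.1⟩
  set α := sInf S with hα
  have hbα : b ≤ α := le_csInf hne fun a ha => ha.1.1
  have hαa : α ≤ a₀ := csInf_le hbdd ⟨⟨ha₀, le_rfl⟩, hhit⟩
  have hαs : (α : EReal) < γs := (EReal.coe_le_coe_iff.2 hαa).trans_lt ha₀s
  have hαJ := h.mem_of_betaStar_le (hb.le.trans hbα) hαs
  have hα0 : α ≠ 0 := (hb0.trans_le hbα).ne'
  have hSα := hS α hαJ hα0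
  have hfreq : ∃ᶠ a in 𝓝 α, a ∈ S := mem_closure_iff_frequently.1 (csInf_mem_closure hne hbdd)
  obtain ⟨t, ht, hut⟩ : ∃ t ∈ Icc 0 T, U α t ≤ β := by
    by_contra! hcon
    obtain ⟨a, ⟨-, t, ht, hut⟩, ha⟩ := (hfreq.and_eventually (Sol.eventually_above hN h.nonlin
      h.confining hS hαJ hα0 hβ0.le hcon)).exists
    linarith [ha t ht]
  obtain ⟨r, hr0, hrt, hur, hbef⟩ := exists_first_hit hSα.contu ht.1
    (by rw [hSα.init]; exact hβb.trans_le hbα) hut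
  have hrT : r ≤ T := hrt.trans ht.2
  refine ⟨α, ⟨hbα, hαa⟩, r, hr0, hrT, hur, hbef, ?_⟩
  -- If none of the alternatives held, `U α` would cross `β` strictly downwards before `T`. This
  -- persists for slightly smaller initial values and contradicts minimality.
  by_contra! hcon
  obtain ⟨h1, h2, h3⟩ := hcon
  have hrT' : r < T := lt_of_le_of_ne hrT h2
  have hbα' : b < α := lt_of_le_of_ne hbα (Ne.symm h1)
  have hvr : V α r ≤ 0 := nonpos_of_le_left hr0 (hSα.hu r hr0) fun x hx => by
    rw [hur]
    exact (hbef x hx.1.le hx.2).le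
  obtain ⟨s, hs, hus, hpos⟩ := hSα.toTraj.exists_lt_right hr0 (lt_of_le_of_ne hvr h3)
    (by rw [hur]; exact hβ0) hrT'
  have h5 := Sol.eventually_below hN h.nonlin h.confining hS hαJ hα0 (hr0.trans hs.1).le
    (fun x hx => by
      rcases lt_or_ge x r with h6 | h6
      · exact hβ0.trans (hbef x hx.1 h6)
      · exact hpos x ⟨h6, hx.2⟩) (by rwa [hur] at hus)
  obtain ⟨a, ha, haI⟩ := ((h5.filter_mono (nhdsWithin_le_nhds (s := Iio α))).and
    (Ioo_mem_nhdsLT hbα')).exists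
  have : α ≤ a := csInf_le hbdd ⟨⟨haI.1.le, haI.2.le.trans hαa⟩, s,
    ⟨(hr0.trans hs.1).le, hs.2.le⟩, ha.le⟩
  linarith [haI.2]

/-- A trajectory that falls below `b` up to time `C` and stays above `β` up to time `T ≥ C + 1`
is slow at some time. -/
lemma Setting.exists_slow (h : Setting f γm γs δ) (hN : 2 ≤ N) (hb : betaStar f γs < b)
    (hbs : (b : EReal) < γs) (hT : Traj N f (Jset γm γs) u v) (hu0 : b < u 0) (hβ0 : 0 < β)
    (hCT : C + 1 ≤ T) (hhit : ∃ t ∈ Icc 0 C, u t ≤ b) (hβ : ∀ x ∈ Icc 0 T, β ≤ u x) :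
    ∃ t y, 0 < t ∧ u t = b ∧ t ≤ y ∧ y ≤ T ∧ |v y| ≤ b - β ∧ u y ∈ Icc β b ∧
      energy f u v y ≤ F f b + (b - β) ^ 2 / 2 := by
  obtain ⟨t', ht', hut'⟩ := hhit
  obtain ⟨t, ht0, htt, hut, hbef⟩ := exists_first_hit hT.contu ht'.1 hu0 hut'
  have htC : t ≤ C := htt.trans ht'.2
  have hvt := hT.v_nonpos hN (t := t) (fun x hx => (h.betaStar_props.2.2.2.2 _
    (hb.le.trans (hbef x hx.1.le hx.2).le) (hT.mem x hx.1.le).2).le) t ⟨ht0.le, le_rfl⟩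
  obtain ⟨y, hy, hvy, huy⟩ := hT.exists_slow ht0 (by linarith : t + 1 ≤ T) hut hvt
    fun x hx => hβ x ⟨ht0.le.trans hx.1, hx.2⟩
  have huy' := hβ y ⟨ht0.le.trans hy.1, hy.2⟩
  refine ⟨t, y, ht0, hut, hy.1, hy.2, hvy, ⟨huy', huy⟩, ?_⟩
  have h1 := h.F_le_of_le hb hbs ⟨hβ0.le.trans huy', huy⟩
  have h2 : v y ^ 2 ≤ (b - β) ^ 2 := sq_le_sq' (by linarith [(abs_le.1 hvy).1]) (abs_le.1 hvy).2
  unfold energy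
  linarith

end

end BoundState

/-! ### Entry into the well under (A2) with controlled energy. -/

namespace BoundState

section
variable {N : ℕ} {f : ℝ → ℝ} {γm : EReal} {δ s₀ X b C T : ℝ} {U V : ℝ → ℝ → ℝ}

/-- Under (A2) some trajectory falls to the level `β_1` up to time `T`, while all trajectories
starting between `b` and its initial value fall to the level `b` up to time `C̄`. -/
lemma AssumptionA2.exists_hit (h : AssumptionA2 N f γm δ s₀) (hN : 2 ≤ N)
    (hS : ∀ a ∈ Jset γm ⊤, a ≠ 0 → Sol N f (Jset γm ⊤) a (U a) (V a))
    (hr : RightWell f (Jset γm ⊤) δ (beta1 f ⊤) X) (hβ : beta1 f ⊤ < betaStar f ⊤)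
    (hb : betaStar f ⊤ < b) (hT₁ : Cbar N f ⊤ b + 1 ≤ T)
    (hT₂ : Cbar N f ⊤ b + constA1 N f ⊤ b ≤ T) :
    ∃ a₀, b ≤ a₀ ∧ (∀ a ∈ Icc b a₀, ∃ t ∈ Icc 0 (Cbar N f ⊤ b), U a t ≤ b) ∧
      ∃ t ∈ Icc 0 T, U a₀ t ≤ beta1 f ⊤ := by
  have hs := h.setting
  have hN' : (2 : ℝ) ≤ N := by exact_mod_cast hN
  have hbs : (b : EReal) < ⊤ := EReal.coe_lt_top b
  have hC := hs.Cbar_pos hN hr hβ hb hbs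
  have hβ0 := hr.β_pos
  have hb0 : 0 < b := hs.betaStar_pos.trans hb
  -- Either some trajectory stays above `b` up to time `C̄`, and the critical initial value serves,
  -- or every trajectory falls to `b` by then, and an initial value far to the right is taken.
  by_cases hex : ∃ a₀, b ≤ a₀ ∧ ∀ r ∈ Icc 0 (Cbar N f ⊤ b), b < U a₀ r
  · obtain ⟨a₀, ha₀, habove⟩ := hex
    obtain ⟨α, hbα, hαs, huα, hvα, hall⟩ :=
      hs.exists_critical hN hS hb hC ha₀ (EReal.coe_lt_top a₀) habove
    have hαJ := hs.mem_of_betaStar_le (hb.le.trans hbα) hαs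
    obtain ⟨t, ht, hut⟩ := hs.exists_le_beta1 hN hr hβ hb hbs
      (hS α hαJ (hb0.trans_le hbα).ne').toTraj huα hvα
    exact ⟨α, hbα, hall, t, ⟨hC.le.trans ht.1, ht.2.trans hT₂⟩, hut⟩
  push Not at hex
  set I := F f b + (b - beta1 f ⊤) ^ 2 / 2 with hI
  obtain ⟨θ, hθ, hP⟩ := h.eventually_pohozaev_ge hN hS
  -- If the trajectory stayed above `β₁` up to `T`, it would be slow at some time between the
  -- levels, and its Pohozaev functional would be at most `M` there; for `a` far to the right it is
  -- larger.
  set M := 2 * T ^ N * I + ((N : ℝ) - 2) * (T ^ (N - 1) * (b - beta1 f ⊤)) * b with hM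
  obtain ⟨a, hPa, haθ, hab⟩ := ((hP (M + 1) T).and ((eventually_gt_atTop (b / θ)).and
    (eventually_gt_atTop b))).exists
  have hbθ : b < θ * a := by
    rw [div_lt_iff₀ hθ.1] at haθ; linarith
  refine ⟨a, hab.le, fun x hx => hex x hx.1, ?_⟩
  by_contra! hcon
  have haJ := hs.mem_of_betaStar_le (hb.le.trans hab.le) (EReal.coe_lt_top a)
  have hSa := hS a haJ (hb0.trans hab).ne'
  obtain ⟨t, y, ht, hut, hty, hyT, hvy, huy, hEy⟩ := hs.exists_slow hN hb hbs hSa.toTraj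
    (by rwa [hSa.init]) hβ0 hT₁ (hex a hab.le) fun x hx => (hcon x hx).le
  have hy0 : 0 ≤ y := ht.le.trans hty
  have hFb := hs.F_le_of_le hb hbs ⟨le_rfl, hb0.le⟩
  rw [F_zero] at hFb
  have hI0 : 0 ≤ I := by positivity
  rcases hPa y ⟨hy0, hyT⟩ with h1 | h1
  · linarith [h1 t ⟨ht.le, hty⟩]
  · have hyN : y ^ N ≤ T ^ N := pow_le_pow_left₀ hy0 hyT N
    have h2 : 2 * y ^ N * energy f (U a) (V a) y ≤ 2 * T ^ N * I :=
      (mul_le_mul_of_nonneg_left hEy (by positivity)).trans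
        (mul_le_mul_of_nonneg_right (by linarith) hI0)
    have hu0 : 0 ≤ U a y := hβ0.le.trans huy.1
    have hbβ : 0 ≤ b - beta1 f ⊤ := (abs_nonneg _).trans hvy
    have h3 : y ^ (N - 1) * V a y ≤ T ^ (N - 1) * (b - beta1 f ⊤) :=
      (mul_le_mul_of_nonneg_left ((le_abs_self _).trans hvy) (pow_nonneg hy0 _)).trans
        (mul_le_mul_of_nonneg_right (pow_le_pow_left₀ hy0 hyT _) hbβ)
    have h4 : ((N : ℝ) - 2) * (y ^ (N - 1) * V a y) * U a y ≤
        ((N : ℝ) - 2) * (T ^ (N - 1) * (b - beta1 f ⊤)) * b := by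
      refine (mul_le_mul_of_nonneg_right (mul_le_mul_of_nonneg_left h3 (by linarith)) hu0).trans
        (mul_le_mul_of_nonneg_left huy.2 (mul_nonneg (by linarith) (mul_nonneg ?_ hbβ)))
      exact pow_nonneg (hy0.trans hyT) _
    have h5 : pohozaev N f (U a) (V a) y ≤ M := add_le_add h2 h4
    linarith

/-- Under (A2) some trajectory enters the well around zero up to time `T` with little energy. -/
lemma AssumptionA2.exists_entry (h : AssumptionA2 N f γm δ s₀) (hN : 2 ≤ N)
    (hS : ∀ a ∈ Jset γm ⊤, a ≠ 0 → Sol N f (Jset γm ⊤) a (U a) (V a))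
    (hr : RightWell f (Jset γm ⊤) δ (beta1 f ⊤) X) (hβ : beta1 f ⊤ < betaStar f ⊤)
    (hb : betaStar f ⊤ < b) (hT₁ : Cbar N f ⊤ b + 1 ≤ T)
    (hT₂ : Cbar N f ⊤ b + constA1 N f ⊤ b ≤ T) :
    ∃ α, b ≤ α ∧ ∃ r, 0 < r ∧ r ≤ T ∧ U α r = beta1 f ⊤ ∧
      (∀ s, 0 ≤ s → s < r → beta1 f ⊤ < U α s) ∧
      energy f (U α) (V α) r ≤ F f b + (b - beta1 f ⊤) ^ 2 / 2 := by
  have hs := h.setting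
  have hbs : (b : EReal) < ⊤ := EReal.coe_lt_top b
  have hb0 : 0 < b := hs.betaStar_pos.trans hb
  obtain ⟨a₀, ha₀, hall, hhit⟩ := h.exists_hit hN hS hr hβ hb hT₁ hT₂
  obtain ⟨α, hα, r, hr0, hrT, hur, hbef, hcases⟩ := hs.exists_minimal hN hS hb hr.β_pos
    (hβ.trans hb) ha₀ (EReal.coe_lt_top a₀) hhit
  refine ⟨α, hα.1, r, hr0, hrT, hur, hbef, ?_⟩
  have hαJ := hs.mem_of_betaStar_le (hb.le.trans hα.1) (EReal.coe_lt_top α)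
  have hSα := hS α hαJ (hb0.trans_le hα.1).ne'
  have hFb := hs.F_le_of_le hb hbs ⟨le_rfl, hb0.le⟩
  rw [F_zero] at hFb
  rcases hα.1.eq_or_lt with hαb | hαb
  · have h1 := hSα.toTraj.energy_le hN hs.nonlin le_rfl hr0.le
    rw [energy_init hSα.toTraj, hSα.init, ← hαb] at h1
    rw [← hαb]
    linarith [sq_nonneg (b - beta1 f ⊤)]
  rcases hcases with h1 | h1 | h1
  · exact absurd h1 hαb.ne'
  -- When `β₁` is reached only at time `T`, the trajectory is slow at some earlier time below `b`,
  -- and the energy at that time bounds the entry energy.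
  · rw [h1] at hur hbef ⊢
    obtain ⟨t, y, ht, -, hty, hyT, -, -, hEy⟩ := hs.exists_slow hN hb hbs hSα.toTraj
      (by rwa [hSα.init]) hr.β_pos hT₁ (hall α hα) fun x hx => by
        rcases hx.2.lt_or_eq with h2 | h2
        · exact (hbef x hx.1 h2).le
        · rw [h2, hur]
    exact (hSα.toTraj.energy_le hN hs.nonlin (ht.le.trans hty) hyT).trans hEy
  · have h2 : energy f (U α) (V α) r = 0 := by simp [energy, h1, hur, hr.F_eq]
    rw [h2]
    positivity

/-- `Ī` contains twice the energy bound, multiplied by a factor at least one. The remaining terms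
are nonnegative, since `Q(b)` lies between the infimum and the supremum of `Q` in its definition. -/
lemma AssumptionA2.le_IbarA2 (h : AssumptionA2 N f γm δ s₀) (hN : 2 ≤ N)
    (hβ0 : 0 < beta1 f ⊤) (hβb : beta1 f ⊤ ≤ b) (hFb : 0 ≤ F f b) (hC : 0 < Cbar N f ⊤ b) :
    F f b + (b - beta1 f ⊤) ^ 2 / 2 ≤ IbarA2 N f s₀ b := by
  have hs := h.setting
  have hN0 : (0 : ℝ) < N := by positivity
  have hb0 : 0 ≤ b := hβ0.le.trans hβb
  have hsb : s₀ ≤ b := h.s₀_mem.2.le.trans hb0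
  have hsub : Icc s₀ b ⊆ Jset γm ⊤ :=
    hs.nonlin.conn.out ⟨h.s₀_mem.1, EReal.coe_lt_top s₀⟩ (hs.J_of_le hb0 le_rfl (EReal.coe_lt_top b))
  have hcomp := isCompact_Icc.image_of_continuousOn
    ((hs.nonlin.continuousOn_Q (N := N)).mono hsub)
  have hsub' : Icc (beta1 f ⊤) b ⊆ Icc s₀ b :=
    Icc_subset_Icc_left (h.s₀_mem.2.le.trans hβ0.le)
  have h1 : Q N f b ≤ sSup (Q N f '' Icc (beta1 f ⊤) b) :=
    le_csSup (hcomp.bddAbove.mono (image_mono hsub')) (mem_image_of_mem _ ⟨hβb, le_rfl⟩)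
  have h2 : sInf (Q N f '' Icc s₀ b) ≤ Q N f b :=
    csInf_le hcomp.bddBelow (mem_image_of_mem _ ⟨hsb, le_rfl⟩)
  have h3 : 0 ≤ 1 / (N : ℝ) *
      (sSup (Q N f '' Icc (beta1 f ⊤) b) - sInf (Q N f '' Icc s₀ b)) :=
    mul_nonneg (by positivity) (by linarith)
  have h4 : 1 ≤ ((Cbar N f ⊤ b + 1) / Cbar N f ⊤ b) ^ N :=
    one_le_pow₀ (by rw [le_div_iff₀ hC]; linarith)
  have h5 : 0 ≤ ((N : ℝ) - 2) ^ 2 * b ^ 2 / (2 * Cbar N f ⊤ b ^ 2) := by positivity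
  have h6 : 0 ≤ 2 * F f b + (b - beta1 f ⊤) ^ 2 + 1 / (N : ℝ) *
      (sSup (Q N f '' Icc (beta1 f ⊤) b) - sInf (Q N f '' Icc s₀ b)) := by positivity
  have h7 := le_mul_of_one_le_left h6 h4
  unfold IbarA2
  linarith [sq_nonneg (b - beta1 f ⊤)]

end

end BoundState

/-! ### Conclusion in the two cases. -/

namespace BoundState

/-- Trajectories starting near `γ_*` linger there, so a critical initial value reaching `b` exactly
at time `C̄` exists. From then on it needs at most the time `A` to reach `β₁`, and its energy never
exceeds `F(γ_*)`. -/
theorem AssumptionA1.two_nodal_solutions {N : ℕ} (hN : 2 ≤ N) {f : ℝ → ℝ} {γm : EReal}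
    {γs δ b : ℝ} (h : AssumptionA1 f γm γs δ) (hb : IsBarBetaA1 f γm γs b)
    (hkey : KeyInequality N f γs b (constA1 N f γs b) (IbarA1 f γs)) (k : ℕ) :
    AtLeastTwoNodalSolutions N f γm γs k := by
  have hs := h.setting
  obtain ⟨X, hr, hXγ, hγM⟩ := hs.exists_rightWell_beta1
  obtain ⟨β₂, X₂, hl⟩ := hs.exists_leftWell
  obtain ⟨U, V, hS⟩ := hs.exists_flow hN
  have hXM : X < gammaM f γs := hXγ.trans_le hγM
  have hβ : beta1 f γs < betaStar f γs := hr.lt.trans (hXM.trans hs.betaStar_props.1)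
  have hbs : (b : EReal) < γs := EReal.coe_lt_coe_iff.2 hb.2.1
  have hC := hs.Cbar_pos hN hr hβ hb.1 hbs
  obtain ⟨a₀, habove, ha₀⟩ := ((h.eventually_stays hN hS hb.1.le hb.2.1 (Cbar N f γs b)).and
    (Ioo_mem_nhdsLT hb.2.1)).exists
  obtain ⟨α, hbα, hαs, huα, hvα, -⟩ := hs.exists_critical hN hS hb.1 hC ha₀.1.le
    (EReal.coe_lt_coe_iff.2 ha₀.2) habove
  have hβα : betaStar f γs < α := hb.1.trans_le hbα
  have hαJ := hs.mem_of_betaStar_le hβα.le hαs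
  have hSα := hS α hαJ (hs.betaStar_pos.trans hβα).ne'
  obtain ⟨t, ht, hut⟩ := hs.exists_le_beta1 hN hr hβ hb.1 hbs hSα.toTraj huα hvα
  obtain ⟨r, hr0, hrt, hur, hbef⟩ := exists_first_hit hSα.contu (hC.le.trans ht.1)
    (by rw [hSα.init]; exact hβ.trans hβα) hut
  have hE : energy f (U α) (V α) r ≤ IbarA1 f γs := by
    refine (hSα.toTraj.energy_le hN hs.nonlin le_rfl hr0.le).trans ?_
    rw [energy_init hSα.toTraj, hSα.init]
    exact (h.F_lt α hαJ.1 (EReal.coe_lt_coe_iff.1 hαs)).le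
  obtain ⟨hG, hlim⟩ := hSα.toTraj.stays_positive hN hs.nonlin hr hl.X_pos hr0 hur hbef
    (hrt.trans ht.2) hE hkey
  refine hs.two_nodal_solutions hN hS hr hl hXM hβα hαs hG hlim
    (hs.exists_not_good hN hS hr hl hβα fun R hR => ?_)
  obtain ⟨a, haR, ha⟩ := ((h.eventually_stays hN hS le_rfl
    (EReal.coe_lt_coe_iff.1 hs.betaStar_props.2.1) R).and
    (Ioo_mem_nhdsLT (EReal.coe_lt_coe_iff.1 hαs))).exists
  have has : (a : EReal) < γs := EReal.coe_lt_coe_iff.2 ha.2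
  have hSa := hS a (hs.mem_of_betaStar_le (hβα.trans ha.1).le has)
    (hs.betaStar_pos.trans (hβα.trans ha.1)).ne'
  refine ⟨a, ha.1, has, le_trans ?_ (F_le_energy R)⟩
  rw [← hs.betaStar_props.2.2.1]
  exact (hs.F_lt_F le_rfl (haR R ⟨hR.le, le_rfl⟩) (hSa.mem R hR.le).2).le

/-- No bound on the initial energy is available here. Instead, minimality of the initial value shows
that `β₁` is reached from `b` itself, or with zero speed, or only at time `C̄ + A` after a slow
moment; each case bounds the entry energy. -/
theorem AssumptionA2.two_nodal_solutions {N : ℕ} (hN : 2 ≤ N) {f : ℝ → ℝ} {γm : EReal}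
    {δ s₀ b : ℝ} (h : AssumptionA2 N f γm δ s₀) (hb : IsBarBetaA2 N f γm b)
    (hkey : KeyInequality N f ⊤ b (constA2 N f b) (IbarA2 N f s₀ b)) (k : ℕ) :
    AtLeastTwoNodalSolutions N f γm ⊤ k := by
  have hs := h.setting
  obtain ⟨X, hr, hXγ, hγM⟩ := hs.exists_rightWell_beta1
  obtain ⟨β₂, X₂, hl⟩ := hs.exists_leftWell
  obtain ⟨U, V, hS⟩ := hs.exists_flow hN
  have hXM : X < gammaM f ⊤ := hXγ.trans_le hγM
  have hβ : beta1 f ⊤ < betaStar f ⊤ := hr.lt.trans (hXM.trans hs.betaStar_props.1)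
  have hbs : (b : EReal) < ⊤ := EReal.coe_lt_top b
  have hC := hs.Cbar_pos hN hr hβ hb.1 hbs
  obtain ⟨α, hbα, r, hr0, hrT, hur, hbef, hE⟩ := h.exists_entry hN hS hr hβ hb.1
    (T := Cbar N f ⊤ b + constA2 N f b) (add_le_add_right (le_max_left _ _) _)
    (add_le_add_right (le_max_right _ _) _)
  have hβα : betaStar f ⊤ < α := hb.1.trans_le hbα
  have hαs : (α : EReal) < ⊤ := EReal.coe_lt_top α
  have hSα := hS α (hs.mem_of_betaStar_le hβα.le hαs) (hs.betaStar_pos.trans hβα).ne'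
  have hFb : 0 ≤ F f b := by
    have := hs.F_le_of_le hb.1 hbs ⟨le_rfl, (hs.betaStar_pos.trans hb.1).le⟩
    rwa [F_zero] at this
  obtain ⟨hG, hlim⟩ := hSα.toTraj.stays_positive hN hs.nonlin hr hl.X_pos hr0 hur hbef hrT
    (hE.trans (h.le_IbarA2 hN hr.β_pos (hβ.trans hb.1).le hFb hC)) hkey
  refine hs.two_nodal_solutions hN hS hr hl hXM hβα hαs hG hlim
    (hs.exists_not_good hN hS hr hl hβα fun R hR => ?_)
  obtain ⟨a, haE, ha⟩ := ((h.eventually_energy_ge hN hS hR).and (eventually_gt_atTop α)).exists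
  exact ⟨a, ha, EReal.coe_lt_top a, haE⟩

end BoundState

theorem theorem1p3 (N : ℕ) (hN : 2 ≤ N) (f : ℝ → ℝ) (γm : EReal) (δ : ℝ) :
    (∀ γs b : ℝ, BoundState.AssumptionA1 f γm γs δ → BoundState.IsBarBetaA1 f γm γs b →
      BoundState.KeyInequality N f γs b
        (BoundState.constA1 N f γs b) (BoundState.IbarA1 f γs) →
      ∀ k : ℕ, BoundState.AtLeastTwoNodalSolutions N f γm γs k) ∧
    (∀ s₀ b : ℝ, BoundState.AssumptionA2 N f γm δ s₀ → BoundState.IsBarBetaA2 N f γm b →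
      BoundState.KeyInequality N f ⊤ b
        (BoundState.constA2 N f b) (BoundState.IbarA2 N f s₀ b) →
      ∀ k : ℕ, BoundState.AtLeastTwoNodalSolutions N f γm ⊤ k) :=
  ⟨fun _ _ h hb hkey k => h.two_nodal_solutions hN hb hkey k,
    fun _ _ h hb hkey k => h.two_nodal_solutions hN hb hkey k⟩
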